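/- **Setting.** Let $\mathcal M$ be a von Neumann algebra with a normal faithful finite trace $\tau$. For a measurable operator $x$ let $\lambda_s(x)=\tau(1_{(s,\infty)}(|x|))$, $\|x\|_{p}=\tau(|x|^p)^{1/p}$, $\|x\|_{p,\infty}=\sup_{s>0}s\,\lambda_s(x)^{1/p}$, and let $L_p(\mathcal M)$, $L_{p,\infty}(\mathcal M)$ be the corresponding noncommutative $L_p$ and weak $L_p$ spaces ($\|\cdot\|_\infty$ is the operator norm of $\mathcal M$). For $q>1$ and an index set $J$, the norm of a family $(x_j)_{j\in J}$ in $L_q(\mathcal M;\ell_\infty(J))$ is $\inf\|a\|_{2q}\sup_j\|y_j\|_\infty\|b\|_{2q}$ over all factorizations $x_j=a\,y_j\,b$ with $a,b\in L_{2q}(\mathcal M)$, $y_j\in\mathcal M$; the space $L_{q,\infty}(\mathcal M;\ell_\infty(J))$ is defined in the same way with $L_{2q,\infty}$ in place of $L_{2q}$. Let $(T_t)_{t>0}$ be a symmetric positive contraction semigroup on $\mathcal M$: $T_{s+t}=T_sT_t$, and each $T_t$ is a positive linear map with $\|T_tx\|_\infty\le\|x\|_\infty$, $\tau(T_tx)\le\tau(x)$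 for $x\ge0$, $\tau(T_t(y)^*x)=\tau(y^*T_t(x))$, and $T_tx\to x$ in the $w^*$-topology as $t\to0^+$. Let $L\ge0$ be its negative generator on $L_2(\mathcal M)$, $T_t=e^{-tL}$, with spectral resolution $(P_\lambda)$; for a function $f$ on $(0,\infty)$, $f(L)=\int f(\lambda)\,dP_\lambda$ on its natural domain in $L_2(\mathcal M)$ (under the hypothesis below $L$ is injective). Assume that $(T_t)$ is $\nu$-ultracontractive for some $\nu>0$: there is $A$ with $\|T_tx\|_\infty\le A\,t^{-\nu}\|x\|_1$ for all $t>0$ and $x\in L_1(\mathcal M)$. For $z\in\mathbb C$, $|||L^{z}|||_{p\to q}$ and $|||L^{z}|||_{p\to(q,\infty)}$ denote the norms (possibly $\infty$) of $L^z$, defined on $L_2(\mathcal M)\cap L_p(\mathcal M)$, from $L_p(\mathcal M)$ to $L_q(\mathcal M)$ and to $L_{q,\infty}(\mathcal M)$. **Theorem.** Let $1<p<q<\infty$, $1<r<\infty$ and $1-\frac1r=\frac1p-\frac1q=\frac\alpha\nu$. Let $m:(0,\infty)\to\mathbb C$ be continuous with $\int_0^\infty\eta^{\alpha}|m(\eta)|\frac{d\eta}{\eta}<\infty$,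 and let $$[\mathfrak M_\alpha m](u)=\int_0^\infty\eta^{\alpha-iu}m(\eta)\,\frac{d\eta}{\eta},\qquad u\in\mathbb R,$$ be its Mellin $\alpha$-transform. 1. If $\int_{-\infty}^\infty|[\mathfrak M_\alpha m](u)|\;|||L^{iu-\alpha}|||_{p\to q}\,du<\infty$, then the maximal operator $x\mapsto(t^\alpha m(tL)x)_{t>0}$ is of strong type $(p,q)$, i.e. bounded from $L_p(\mathcal M)$ to $L_q(\mathcal M;\ell_\infty((0,\infty)))$. 2. If $\int_{-\infty}^\infty|[\mathfrak M_\alpha m](u)|\;|||L^{iu-\alpha}|||_{1\to(r,\infty)}\,du<\infty$, then it is of weak type $(1,r)$, i.e. bounded from $L_1(\mathcal M)$ to $L_{r,\infty}(\mathcal M;\ell_\infty((0,\infty)))$. Here boundedness means: every $t^\alpha m(tL)$ is defined on all of $L_2(\mathcal M)\cap L_p(\mathcal M)$ (with $p=1$ in 2.) and extends to a linear operator $A_t$ on $L_p(\mathcal M)$, and there is a constant $C$ such that the norm of $(A_tx)_{t>0}$ is at most $C\|x\|_p$ for all $x\in L_p(\mathcal M)$. -/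

import Mathlib

open MeasureTheory Filter Set Topology
open scoped ENNReal NNReal

namespace NCUltra

noncomputable section

variable {H : Type*} [NormedAddCommGroup H] [InnerProductSpace ℂ H] [CompleteSpace H]

/-- The elements of a von Neumann algebra `M ⊆ B(H)`, as a C*-algebra (operator norm). -/
abbrev Elt (M : VonNeumannAlgebra H) : Type _ := ↥M.toStarSubalgebra

/-! ### Traces -/

/-- A normal faithful finite trace on `M`: a positive tracial functional with `τ(x*x) = 0` only for
`x = 0`, continuous for the `w*`-topology (the ultraweak topology) of `M`, i.e. of the form
`x ↦ ∑ₙ ⟨ξₙ, x ηₙ⟩` with `∑ ‖ξₙ‖² < ∞` and `∑ ‖ηₙ‖² < ∞`. -/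
structure Trace (M : VonNeumannAlgebra H) where
  /-- the underlying functional (a positive functional is automatically bounded) -/
  toFunctional : Elt M →L[ℂ] ℂ
  re_nonneg : ∀ x, 0 ≤ (toFunctional (star x * x)).re
  im_zero : ∀ x, (toFunctional (star x * x)).im = 0
  tracial : ∀ x y, toFunctional (x * y) = toFunctional (y * x)
  faithful : ∀ x, toFunctional (star x * x) = 0 → x = 0
  normal : ∃ ξ η : ℕ → H, Summable (fun n => ‖ξ n‖ ^ 2) ∧ Summable (fun n => ‖η n‖ ^ 2) ∧
    ∀ x : Elt M, HasSum (fun n => inner ℂ (ξ n) ((x : H →L[ℂ] H) (η n))) (toFunctional x)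

variable {M : VonNeumannAlgebra H}

instance : CoeFun (Trace M) (fun _ => Elt M → ℂ) := ⟨fun τ => τ.toFunctional⟩

theorem Trace.map_star_mul (τ : Trace M) (x y : Elt M) :
    (starRingEnd ℂ) (τ (star y * x)) = τ (star x * y) := by
  have h1 := τ.im_zero (x + y)
  have h2 := τ.im_zero (x + Complex.I • y)
  have hx := τ.im_zero x
  have hy := τ.im_zero y
  simp only [star_add, star_smul, add_mul, mul_add, map_add, smul_mul_assoc, mul_smul_comm,
    map_smul, smul_eq_mul, Complex.add_im, Complex.mul_im, Complex.mul_re, RCLike.star_def,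
    Complex.conj_I, Complex.neg_re, Complex.neg_im, Complex.I_re, Complex.I_im] at h1 h2
  apply Complex.ext
  · simp only [Complex.conj_re]; linarith
  · simp only [Complex.conj_im]; linarith

/-! ### The Hilbert space `L₂(M)` -/

/-- A copy of `M`, carrying the inner product `⟨x, y⟩ = τ(x* y)`. -/
def PreL2 (_τ : Trace M) : Type _ := Elt M

instance (τ : Trace M) : AddCommGroup (PreL2 τ) := inferInstanceAs (AddCommGroup (Elt M))
instance (τ : Trace M) : Module ℂ (PreL2 τ) := inferInstanceAs (Module ℂ (Elt M))

/-- The identity map `M → PreL2 τ`. -/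
def toPreL2 (τ : Trace M) : Elt M ≃ₗ[ℂ] PreL2 τ := LinearEquiv.refl ℂ (Elt M)

instance preL2Core (τ : Trace M) : InnerProductSpace.Core ℂ (PreL2 τ) where
  inner x y := τ (star ((toPreL2 τ).symm x) * (toPreL2 τ).symm y)
  conj_inner_symm x y := τ.map_star_mul _ _
  re_inner_nonneg x := τ.re_nonneg _
  add_left x y z := by simp [add_mul]
  smul_left x y r := by simp
  definite x h := by simpa using τ.faithful _ h

instance (τ : Trace M) : NormedAddCommGroup (PreL2 τ) :=
  InnerProductSpace.Core.toNormedAddCommGroup (𝕜 := ℂ)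

instance (τ : Trace M) : InnerProductSpace ℂ (PreL2 τ) :=
  InnerProductSpace.ofCore (preL2Core τ).toCore

/-- `L₂(M)`: the completion of `M` for the norm `‖x‖₂ = τ(x* x)^{1/2}`. -/
abbrev L2 (τ : Trace M) : Type _ := UniformSpace.Completion (PreL2 τ)

/-- The canonical embedding `M → L₂(M)`. -/
def toL2 (τ : Trace M) : Elt M →ₗ[ℂ] L2 τ :=
  (UniformSpace.Completion.toComplL (𝕜 := ℂ) (E := PreL2 τ)).toLinearMap ∘ₗ
    (toPreL2 τ).toLinearMap

theorem inner_toL2 (τ : Trace M) (x y : Elt M) :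
    inner ℂ (toL2 τ x) (toL2 τ y) = τ (star x * y) :=
  UniformSpace.Completion.inner_coe (𝕜 := ℂ) (toPreL2 τ x) (toPreL2 τ y)

theorem norm_toL2_le (τ : Trace M) (x : Elt M) :
    ‖toL2 τ x‖ ≤ √‖τ.toFunctional‖ * ‖x‖ := by
  have h1 : ‖toL2 τ x‖ ^ 2 ≤ ‖τ.toFunctional‖ * ‖x‖ ^ 2 := by
    rw [← inner_self_eq_norm_sq (𝕜 := ℂ), inner_toL2]
    calc _ ≤ ‖τ.toFunctional (star x * x)‖ := Complex.re_le_norm _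
      _ ≤ ‖τ.toFunctional‖ * ‖star x * x‖ := τ.toFunctional.le_opNorm _
      _ = ‖τ.toFunctional‖ * ‖x‖ ^ 2 := by rw [CStarRing.norm_star_mul_self, sq]
  have h2 : (√‖τ.toFunctional‖ * ‖x‖) ^ 2 = ‖τ.toFunctional‖ * ‖x‖ ^ 2 := by
    rw [mul_pow, Real.sq_sqrt (norm_nonneg _)]
  exact (sq_le_sq₀ (norm_nonneg _) (by positivity)).mp (h1.trans_eq h2.symm)

/-! ### Noncommutative `L_p` and weak `L_p` spaces

As `τ` is finite, `M ⊆ L_p(M) ⊆ L₁(M)` for `p ≥ 1`, and `L_{p,∞}(M) ⊆ L₁(M)` for `p > 1`; moreover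
`L₁(M)` is the predual of `M`, an element `x` of `L₁(M)` being identified with the functional
`z ↦ τ(x z)` on `M`. -/

/-- The ambient Banach space: the dual of `M`. -/
abbrev Fn (M : VonNeumannAlgebra H) : Type _ := StrongDual ℂ (Elt M)

/-- The element `x` of `M`, seen in `L₁(M)`, i.e. the functional `z ↦ τ(x z)`. -/
def ofM (τ : Trace M) (x : Elt M) : Fn M := τ.toFunctional.comp (ContinuousLinearMap.mul ℂ (Elt M) x)

/-- `L₁(M)`: the norm closure of `M` among the functionals on `M` (the norm of the functional
`z ↦ τ(x z)` being `τ(|x|)`). -/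
def L1 (τ : Trace M) : Set (Fn M) := closure (Set.range (ofM τ))

/-- The inclusion `L₂(M) ⊆ L₁(M)`: `ξ` is the functional `z ↦ τ(ξ z) = ⟨z*, ξ⟩`. -/
def ofL2 (τ : Trace M) (ξ : L2 τ) : Fn M :=
  LinearMap.mkContinuous
    { toFun := fun z => inner ℂ (toL2 τ (star z)) ξ
      map_add' := fun x y => by rw [star_add, map_add, inner_add_left]
      map_smul' := fun c x => by simp [inner_smul_left] }
    (√‖τ.toFunctional‖ * ‖ξ‖) (fun z => by
      have h1 := norm_inner_le_norm (𝕜 := ℂ) (toL2 τ (star z)) ξ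
      have h2 := norm_toL2_le τ (star z)
      rw [norm_star] at h2
      calc _ ≤ ‖toL2 τ (star z)‖ * ‖ξ‖ := h1
        _ ≤ (√‖τ.toFunctional‖ * ‖z‖) * ‖ξ‖ := by gcongr
        _ = _ := by ring)

/-- The distribution function `λ_s(x) = τ(1_{(s,∞)}(|x|))` of a measurable operator `x ∈ L₁(M)`,
computed as the infimum of `τ(1 - e)` over the projections `e ∈ M` for which `x e` is a bounded
operator `y ∈ M` with `‖y‖ ≤ s` (the infimum is attained at `e = 1_{[0,s]}(|x|)`). The relation
`x e = y` reads `τ(x e z) = τ(y z)` for all `z ∈ M`. -/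
def distribution (τ : Trace M) (x : Fn M) (s : ℝ) : ℝ≥0∞ :=
  ⨅ (e : Elt M) (_ : IsStarProjection e)
    (_ : ∃ y : Elt M, ‖y‖ ≤ s ∧ ∀ z, x (e * z) = τ (y * z)),
    ENNReal.ofReal (τ (1 - e)).re

/-- The generalized singular numbers `μ_t(x) = inf {s > 0 : λ_s(x) < t}`. -/
def singularNumber (τ : Trace M) (x : Fn M) (t : ℝ) : ℝ≥0∞ :=
  ⨅ (s : ℝ) (_ : 0 < s) (_ : distribution τ x s < ENNReal.ofReal t), ENNReal.ofReal s

/-- `‖x‖_p = τ(|x|^p)^{1/p} = (∫₀^∞ μ_t(x)^p dt)^{1/p}`. -/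
def lpNorm (τ : Trace M) (p : ℝ) (x : Fn M) : ℝ≥0∞ :=
  (∫⁻ t in Ioi (0 : ℝ), singularNumber τ x t ^ p) ^ (1 / p)

/-- `‖x‖_{p,∞} = sup_{s>0} s λ_s(x)^{1/p}`. -/
def weakNorm (τ : Trace M) (p : ℝ) (x : Fn M) : ℝ≥0∞ :=
  ⨆ (s : ℝ) (_ : 0 < s), ENNReal.ofReal s * distribution τ x s ^ (1 / p)

/-- `L_p(M)`, `1 ≤ p < ∞`. -/
def Lp (τ : Trace M) (p : ℝ) : Set (Fn M) := {x | x ∈ L1 τ ∧ lpNorm τ p x < ∞}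

/-! ### The spaces `L_q(M; ℓ_∞(J))` and `L_{q,∞}(M; ℓ_∞(J))` -/

/-- `x = a y b` for `a, b ∈ L₂(M)`, `y ∈ M` and `x ∈ L₁(M)`: the product is the continuous extension
of the product of `M`. -/
def IsTripleProduct (τ : Trace M) (a : L2 τ) (y : Elt M) (b : L2 τ) (x : Fn M) : Prop :=
  ∃ a' b' : ℕ → Elt M, Tendsto (fun n => toL2 τ (a' n)) atTop (𝓝 a) ∧
    Tendsto (fun n => toL2 τ (b' n)) atTop (𝓝 b) ∧
    ∀ z : Elt M, Tendsto (fun n => τ (a' n * y * b' n * z)) atTop (𝓝 (x z))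

/-- The norm of a family `x = (x_j)` in `E(M; ℓ_∞(J))`, i.e. the infimum of `N(a) sup_j ‖y_j‖ N(b)`
over the factorizations `x_j = a y_j b`, where `N` is the norm of the 2-convexification of `E`:
`N = ‖·‖_{2q}` for `E = L_q` and `N = ‖·‖_{2q,∞}` for `E = L_{q,∞}`. For `q > 1` the spaces
`L_{2q}(M)` and `L_{2q,∞}(M)` are contained in `L₂(M)`, so that `a, b` range over `L₂(M)`. The value
is `∞` when there is no factorization. -/
def supNorm (τ : Trace M) (N : Fn M → ℝ≥0∞) {J : Type*} (x : J → Fn M) : ℝ≥0∞ :=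
  ⨅ (a : L2 τ) (b : L2 τ) (y : J → Elt M) (K : ℝ≥0)
    (_ : ∀ j, ‖y j‖ ≤ K) (_ : ∀ j, IsTripleProduct τ a (y j) b (x j)),
    N (ofL2 τ a) * K * N (ofL2 τ b)

/-- `‖sup⁺ x_j‖_q`, the norm of `L_q(M; ℓ_∞(J))`. -/
def strongSupNorm (τ : Trace M) (q : ℝ) {J : Type*} (x : J → Fn M) : ℝ≥0∞ :=
  supNorm τ (lpNorm τ (2 * q)) x

/-- `‖sup⁺ x_j‖_{q,∞}`, the norm of `L_{q,∞}(M; ℓ_∞(J))`. -/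
def weakSupNorm (τ : Trace M) (q : ℝ) {J : Type*} (x : J → Fn M) : ℝ≥0∞ :=
  supNorm τ (weakNorm τ (2 * q)) x

/-! ### Semigroups -/

/-- A symmetric positive contraction semigroup `(T_t)_{t>0}` on `M`. -/
structure IsSymmetricContractionSemigroup (τ : Trace M) (T : ℝ → Elt M →ₗ[ℂ] Elt M) : Prop where
  semigroup : ∀ s > 0, ∀ t > 0, ∀ x, T (s + t) x = T s (T t x)
  contraction : ∀ t > 0, ∀ x, ‖T t x‖ ≤ ‖x‖
  trace_le : ∀ t > 0, ∀ x : Elt M, (x : H →L[ℂ] H).IsPositive → (τ (T t x)).re ≤ (τ x).re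
  positive : ∀ t > 0, ∀ x : Elt M, (x : H →L[ℂ] H).IsPositive →
    ((T t x : Elt M) : H →L[ℂ] H).IsPositive
  symmetric : ∀ t > 0, ∀ x y, τ (star (T t y) * x) = τ (star y * T t x)
  /-- `T_t x → x` as `t → 0⁺` in the `w*`-topology (ultraweak topology) of `M`. -/
  weakStar_continuous : ∀ (x : Elt M) (ξ η : ℕ → H), Summable (fun n => ‖ξ n‖ ^ 2) →
    Summable (fun n => ‖η n‖ ^ 2) →
    Tendsto (fun t => ∑' n, inner ℂ (ξ n) (((T t x : Elt M) : H →L[ℂ] H) (η n))) (𝓝[>] 0)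
      (𝓝 (∑' n, inner ℂ (ξ n) ((x : H →L[ℂ] H) (η n))))

/-- `ν`-ultracontractivity: `‖T_t x‖_∞ ≤ A t^{-ν} ‖x‖₁` for all `t > 0` and all `x` in the dense
subspace `M` of `L₁(M)`. -/
def IsUltracontractive (τ : Trace M) (T : ℝ → Elt M →ₗ[ℂ] Elt M) (ν : ℝ) : Prop :=
  ∃ A : ℝ≥0, ∀ t : ℝ, 0 < t → ∀ x : Elt M,
    ‖T t x‖ₑ ≤ A * ENNReal.ofReal (t ^ (-ν)) * lpNorm τ 1 (ofM τ x)

/-! ### Spectral resolutions and functional calculus -/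

/-- A resolution of the identity (projection-valued measure) on the Borel sets of the real line. -/
structure SpectralMeasure (K : Type*) [NormedAddCommGroup K] [InnerProductSpace ℂ K]
    [CompleteSpace K] where
  proj : Set ℝ → K →L[ℂ] K
  isStarProjection : ∀ B, MeasurableSet B → IsStarProjection (proj B)
  proj_univ : proj univ = 1
  hasSum_proj : ∀ B : ℕ → Set ℝ, (∀ n, MeasurableSet (B n)) → Pairwise (Function.onFun Disjoint B) →
    ∀ ξ, HasSum (fun n => proj (B n) ξ) (proj (⋃ n, B n) ξ)

namespace SpectralMeasure

variable {K : Type*} [NormedAddCommGroup K] [InnerProductSpace ℂ K] [CompleteSpace K]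

theorem proj_empty (E : SpectralMeasure K) : E.proj ∅ = 0 := by
  ext ξ
  have h := E.hasSum_proj (fun _ => ∅) (fun _ => MeasurableSet.empty)
    (fun _ _ _ => by simp [Function.onFun]) ξ
  have h2 := h.summable
  simpa using h2.tendsto_atTop_zero

theorem inner_proj (E : SpectralMeasure K) {B : Set ℝ} (hB : MeasurableSet B) (ξ : K) :
    (inner ℂ ξ (E.proj B ξ)).re = ‖E.proj B ξ‖ ^ 2 := by
  have h := E.isStarProjection B hB
  rw [← inner_self_eq_norm_sq (𝕜 := ℂ) (E.proj B ξ)]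
  have h1 : inner ℂ (E.proj B ξ) (E.proj B ξ) = inner ℂ ξ (E.proj B (E.proj B ξ)) := by
    conv_lhs => rw [← ContinuousLinearMap.adjoint_inner_right]
    rw [← ContinuousLinearMap.star_eq_adjoint, h.isSelfAdjoint.star_eq]
  have h2 : E.proj B (E.proj B ξ) = E.proj B ξ := by
    have := h.isIdempotentElem.eq
    exact congrArg (fun A : K →L[ℂ] K => A ξ) this
  rw [h1, h2]
  rfl

/-- The scalar spectral measure `B ↦ ‖E(B) ξ‖² = ⟨ξ, E(B) ξ⟩`. -/
def measure (E : SpectralMeasure K) (ξ : K) : Measure ℝ :=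
  Measure.ofMeasurable (fun B _ => ENNReal.ofReal (‖E.proj B ξ‖ ^ 2))
    (by simp [E.proj_empty])
    (by
      intro B hB hd
      have h1 := (E.hasSum_proj B hB hd ξ).mapL (innerSL ℂ ξ)
      have h2 := Complex.hasSum_re h1
      simp only [innerSL_apply_apply] at h2
      simp only [E.inner_proj (hB _), E.inner_proj (MeasurableSet.iUnion hB)] at h2
      rw [← h2.tsum_eq, ENNReal.ofReal_tsum_of_nonneg (fun _ => by positivity) h2.summable])

/-- `η = ∫ f(λ) dE(λ) ξ`. This is the limit of the sums `∑ c E({s = c}) ξ` along simple functions `s`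
that converge to `f` in `L²(‖E(·)ξ‖²)`; in particular `ξ` lies in the domain
`{ξ : ∫ |f|² d‖E(·)ξ‖² < ∞}`. -/
def HasIntegral (E : SpectralMeasure K) (f : ℝ → ℂ) (ξ η : K) : Prop :=
  ∀ ε : ℝ, 0 < ε → ∃ s : SimpleFunc ℝ ℂ,
    ∫⁻ l, ‖f l - s l‖ₑ ^ 2 ∂(E.measure ξ) < ENNReal.ofReal ε ∧
    ‖η - ∑ c ∈ s.range, c • E.proj (s ⁻¹' {c}) ξ‖ < ε

end SpectralMeasure

/-- `E` is the spectral resolution of the negative generator `L ≥ 0` of `(T_t)` on `L₂(M)`: it is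
carried by `[0, ∞)`, and `T_t = e^{-tL}`, i.e. `T_t x = ∫ e^{-tλ} dE(λ) x`, for `t > 0` and `x` in
the dense subspace `M` of `L₂(M)`. By the spectral theorem it exists and is unique. -/
def IsSpectralResolution (τ : Trace M) (T : ℝ → Elt M →ₗ[ℂ] Elt M)
    (E : SpectralMeasure (L2 τ)) : Prop :=
  E.proj (Iio 0) = 0 ∧ ∀ t : ℝ, 0 < t → ∀ x : Elt M,
    E.HasIntegral (fun l => (Real.exp (-(t * l)) : ℂ)) (toL2 τ x) (toL2 τ (T t x))

/-- `η = f(L) ξ` in `L₂(M)`, for the negative generator `L` of `(T_t)`. -/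
def IsMultiplier (τ : Trace M) (T : ℝ → Elt M →ₗ[ℂ] Elt M) (f : ℝ → ℂ) (ξ η : L2 τ) : Prop :=
  ∃ E : SpectralMeasure (L2 τ), IsSpectralResolution τ T E ∧ E.HasIntegral f ξ η

/-- `η = L^z ξ`. -/
def IsPower (τ : Trace M) (T : ℝ → Elt M →ₗ[ℂ] Elt M) (z : ℂ) (ξ η : L2 τ) : Prop :=
  IsMultiplier τ T (fun l => (l : ℂ) ^ z) ξ η

/-! ### Boundedness of operators -/

/-- The norm, from `L_p(M)` to the space with norm `N`, of the operator with graph `R` on `L₂(M)`: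
the least `C` such that `R` is defined on `L₂(M) ∩ L_p(M)` and `N(R ξ) ≤ C ‖ξ‖_p` there (`∞` if there
is none). -/
def opNorm (τ : Trace M) (p : ℝ) (N : Fn M → ℝ≥0∞) (R : L2 τ → L2 τ → Prop) : ℝ≥0∞ :=
  ⨅ (C : ℝ≥0) (_ : ∀ ξ : L2 τ, ofL2 τ ξ ∈ Lp τ p →
    ∃ η, R ξ η ∧ N (ofL2 τ η) ≤ C * lpNorm τ p (ofL2 τ ξ)), (C : ℝ≥0∞)

/-- `|||L^z|||_{p → q}`. -/
def strongPowerNorm (τ : Trace M) (T : ℝ → Elt M →ₗ[ℂ] Elt M) (z : ℂ) (p q : ℝ) : ℝ≥0∞ :=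
  opNorm τ p (lpNorm τ q) (IsPower τ T z)

/-- `|||L^z|||_{p → (q,∞)}`. -/
def weakPowerNorm (τ : Trace M) (T : ℝ → Elt M →ₗ[ℂ] Elt M) (z : ℂ) (p q : ℝ) : ℝ≥0∞ :=
  opNorm τ p (weakNorm τ q) (IsPower τ T z)

/-- The maximal operator `x ↦ (t^α m(tL) x)_{t>0}` is bounded from `L_p(M)` to the space of families
with norm `N`: each `t^α m(tL)` is defined on `L₂(M) ∩ L_p(M)` and extends to a linear operator `A_t`
on `L_p(M)`, and `N((A_t x)_{t>0}) ≤ C ‖x‖_p` for all `x ∈ L_p(M)`. -/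
def MaximalBounded (τ : Trace M) (T : ℝ → Elt M →ₗ[ℂ] Elt M) (m : ℝ → ℂ) (α p : ℝ)
    (N : (Ioi (0 : ℝ) → Fn M) → ℝ≥0∞) : Prop :=
  ∃ (A : Ioi (0 : ℝ) → Fn M → Fn M) (C : ℝ≥0),
    (∀ (t : Ioi (0 : ℝ)) (ξ : L2 τ), ofL2 τ ξ ∈ Lp τ p →
      ∃ η, IsMultiplier τ T (fun l => m (t * l)) ξ η ∧
        A t (ofL2 τ ξ) = ofL2 τ ((((t : ℝ) ^ α : ℝ) : ℂ) • η)) ∧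
    (∀ (t : Ioi (0 : ℝ)) (c : ℂ), ∀ x ∈ Lp τ p, ∀ y ∈ Lp τ p,
      A t (c • x + y) = c • A t x + A t y) ∧
    ∀ x ∈ Lp τ p, N (fun t => A t x) ≤ C * lpNorm τ p x

end

end NCUltra

/-!
The operator `t^α m(tL)` is a superposition of imaginary powers: by Mellin inversion
`m(x) = (2π)⁻¹ ∫ w(u) x^{iu-α} du` with `w(u) = [𝔐_α m](u)`, so that
`t^α m(tL) x = (2π)⁻¹ ∫ w(u) t^{iu} L^{iu-α} x du`. The parameter `t` enters only through the scalars
`t^{iu}` of modulus one. For fixed `u`, the family `(t^{iu} L^{iu-α} x)_t` is a unimodular multiple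
of a constant family, whose norm in `L_q(M; ℓ_∞)` is comparable to `‖L^{iu-α} x‖_q`, and an
integration over `u` gives the maximal inequality; the same applies to the weak type.

**Families of operators.** The integration needs a norm that is stable under sums and limits. A
family is `Dominated` if it is majorized, in the sense of `Majorizes`, by two positive functionals
`G₁`, `G₂` on `M` whose `K`-functionals for the couple `(L₁(M), M)` have bounded Lorentz norm; the
strong and the weak case differ only in the sequence norm (`ℓ^q` or `ℓ^∞`). This notion is stable
under sums, multiplication by bounded scalars and pointwise limits (`Dominated.of_tendsto`), since
positive functionals of bounded norm are weak* compact. A constant family is dominated in terms of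
its singular numbers (`exists_dominated_const`). Conversely a dominated family factors as
`a y_j b` with `a = G₁^{1/2}` and `b = G₂^{1/2}` (`Dominated.supNorm_le`): for `q > 1` the weights are
absolutely continuous with respect to the trace, and, after addition of a small multiple of the
trace, have a density whose inverse `k` is bounded (`IsAbsCont.exists_inverse_density`); `k^{-1/2}`
and its norm are controlled in `exists_inverse_root`.

**The generator.** Ultracontractivity makes `T_t` a strict contraction of `L₂(M)`
(`nonempty_L2Semigroup`). Hence the spectral resolution of `L`, which is constructed by
`exists_spectralMeasure_of_semigroup` and is unique since Laplace transforms
determine measures, is carried by some `[δ, ∞)` with `δ > 0` (`exists_resolution`). All the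
multipliers involved are then bounded operators on `L₂(M)`. The norm of `L^{iu-α}` is bounded below
in `u` (`Resolution.exists_le_opNorm_pow`), so that the hypothesis forces `∫ |w(u)| du < ∞`, and
Mellin inversion holds pointwise.

**The integral.** As `u ↦ |||L^{iu-α}|||` is not known to be measurable, the integral is approximated
by Riemann sums whose sample points are adapted to this weight (`exists_quadrature`). They converge
strongly on `L₂(M)` (`Resolution.tendsto_quadrature`), and the dominated families
pass to the limit. Finally an element of `L_p(M)` is a sum of elements of `M` with geometrically
decreasing norms (`exists_decomposition`), which extends `t^α m(tL)` and the maximal inequality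
from `L₂(M) ∩ L_p(M)` to `L_p(M)` (`Resolution.dominated_extend`).
-/

namespace NCUltra

noncomputable section

variable {H : Type*} [NormedAddCommGroup H] [InnerProductSpace ℂ H] [CompleteSpace H]
variable {M : VonNeumannAlgebra H}

/-! ### Order and trace inequalities in a von Neumann algebra -/

scoped instance isClosed_toStarSubalgebra (M : VonNeumannAlgebra H) :
    IsClosed (M.toStarSubalgebra : Set (H →L[ℂ] H)) := by
  have h : (M.toStarSubalgebra : Set (H →L[ℂ] H)) =
      Set.centralizer (Set.centralizer (M : Set (H →L[ℂ] H))) := by simp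
  rw [h]
  exact Set.isClosed_centralizer _

scoped instance : CStarAlgebra (Elt M) := StarSubalgebra.cstarAlgebra M.toStarSubalgebra

theorem isSelfAdjoint_of_coe_nonneg {a : Elt M} (ha : 0 ≤ (a : H →L[ℂ] H)) : IsSelfAdjoint a :=
  Subtype.ext (IsSelfAdjoint.of_nonneg ha)

/-- Square roots of positive elements stay in the algebra, so that the order inherited from `B(H)`
is the order of the C*-algebra. -/
scoped instance : StarOrderedRing (Elt M) := by
  refine StarOrderedRing.of_nonneg_iff' (fun {x y} h z => ?_) (fun a => ⟨fun ha => ?_, ?_⟩)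
  · change ((z + x : Elt M) : H →L[ℂ] H) ≤ ((z + y : Elt M) : H →L[ℂ] H)
    exact add_le_add_right (show (x : H →L[ℂ] H) ≤ y from h) _
  · have ha' : 0 ≤ (a : H →L[ℂ] H) := ha
    have hsa := isSelfAdjoint_of_coe_nonneg ha'
    have hsp : ∀ x ∈ spectrum ℝ a, 0 ≤ x := by
      intro x hx
      refine spectrum_nonneg_of_nonneg ha' ?_
      rw [spectrum.mem_iff] at hx ⊢
      intro hu
      apply hx
      exact (M.toStarSubalgebra.coe_isUnit (a := algebraMap ℝ (Elt M) x - a)).mp hu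
    refine ⟨cfc Real.sqrt a, ?_⟩
    have h1 : IsSelfAdjoint (cfc Real.sqrt a) := cfc_predicate _ _
    rw [h1.star_eq, ← cfc_mul Real.sqrt Real.sqrt a]
    conv_lhs => rw [← cfc_id' ℝ a]
    exact cfc_congr fun x hx => (Real.mul_self_sqrt (hsp x hx)).symm
  · rintro ⟨s, rfl⟩
    change 0 ≤ star (s : H →L[ℂ] H) * s
    exact star_mul_self_nonneg _

theorem Trace.nonneg (τ : Trace M) {x : Elt M} (hx : 0 ≤ x) : 0 ≤ (τ x).re := by
  obtain ⟨s, hs⟩ := CStarAlgebra.nonneg_iff_eq_star_mul_self.mp hx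
  rw [hs]
  exact τ.re_nonneg s

theorem Trace.mono (τ : Trace M) {x y : Elt M} (h : x ≤ y) : (τ x).re ≤ (τ y).re := by
  have := τ.nonneg (sub_nonneg.mpr h)
  rw [map_sub, Complex.sub_re] at this
  linarith

theorem Trace.map_star (τ : Trace M) (x : Elt M) : τ (star x) = (starRingEnd ℂ) (τ x) := by
  have := τ.map_star_mul x 1
  simpa using this.symm

theorem ofM_apply (τ : Trace M) (x z : Elt M) : ofM τ x z = τ (x * z) := rfl

theorem ofL2_apply (τ : Trace M) (ξ : L2 τ) (z : Elt M) :
    ofL2 τ ξ z = inner ℂ (toL2 τ (star z)) ξ := rfl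

theorem ofL2_toL2 (τ : Trace M) (x : Elt M) : ofL2 τ (toL2 τ x) = ofM τ x := by
  ext z
  rw [ofL2_apply, inner_toL2, star_star, ofM_apply, τ.tracial]

theorem norm_toL2_sq (τ : Trace M) (x : Elt M) : ‖toL2 τ x‖ ^ 2 = (τ (star x * x)).re := by
  rw [← inner_self_eq_norm_sq (𝕜 := ℂ), inner_toL2]; rfl

theorem norm_toL2_star (τ : Trace M) (x : Elt M) : ‖toL2 τ (star x)‖ = ‖toL2 τ x‖ := by
  rw [← sq_eq_sq₀ (norm_nonneg _) (norm_nonneg _), norm_toL2_sq, norm_toL2_sq, star_star,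
    τ.tracial]

theorem norm_toL2_mul_le (τ : Trace M) (x y : Elt M) :
    ‖toL2 τ (x * y)‖ ≤ ‖x‖ * ‖toL2 τ y‖ := by
  rw [← sq_le_sq₀ (norm_nonneg _) (by positivity), mul_pow, norm_toL2_sq, norm_toL2_sq]
  have h1 : star x * x ≤ algebraMap ℝ (Elt M) (‖x‖ ^ 2) := CStarAlgebra.star_mul_le_algebraMap_norm_sq
  have h2 := τ.mono (star_left_conjugate_le_conjugate h1 y)
  have h3 : star y * algebraMap ℝ (Elt M) (‖x‖ ^ 2) * y = ((‖x‖ ^ 2 : ℝ) : ℂ) • (star y * y) := by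
    rw [Algebra.algebraMap_eq_smul_one, mul_smul_comm, mul_one, smul_mul_assoc]
    exact (Complex.coe_smul _ _).symm
  rw [h3, map_smul, smul_eq_mul, Complex.re_ofReal_mul] at h2
  simpa [star_mul, mul_assoc] using h2

theorem norm_toL2_mul_le' (τ : Trace M) (x y : Elt M) :
    ‖toL2 τ (x * y)‖ ≤ ‖toL2 τ x‖ * ‖y‖ := by
  have := norm_toL2_mul_le τ (star y) (star x)
  rwa [← star_mul, norm_toL2_star, norm_toL2_star, norm_star, mul_comm] at this

theorem norm_trace_mul_le (τ : Trace M) (x y : Elt M) :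
    ‖τ (x * y)‖ ≤ ‖toL2 τ x‖ * ‖toL2 τ y‖ := by
  have := norm_inner_le_norm (𝕜 := ℂ) (toL2 τ (star x)) (toL2 τ y)
  rwa [inner_toL2, star_star, norm_toL2_star] at this

theorem norm_trace_mul_le_ofM (τ : Trace M) (x y : Elt M) : ‖τ (x * y)‖ ≤ ‖ofM τ x‖ * ‖y‖ :=
  (ofM τ x).le_opNorm y

theorem norm_trace_mul_le_ofM' (τ : Trace M) (x y : Elt M) : ‖τ (x * y)‖ ≤ ‖x‖ * ‖ofM τ y‖ := by
  rw [τ.tracial, mul_comm]; exact norm_trace_mul_le_ofM τ y x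

theorem norm_ofM_le_of (τ : Trace M) {x : Elt M} {C : ℝ} (hC : 0 ≤ C)
    (h : ∀ z, ‖τ (x * z)‖ ≤ C * ‖z‖) : ‖ofM τ x‖ ≤ C :=
  ContinuousLinearMap.opNorm_le_bound _ hC h

theorem norm_ofM_mul_le (τ : Trace M) (x y : Elt M) : ‖ofM τ (x * y)‖ ≤ ‖x‖ * ‖ofM τ y‖ := by
  refine norm_ofM_le_of τ (by positivity) fun z => ?_
  rw [mul_assoc, τ.tracial, mul_assoc]
  calc _ ≤ ‖ofM τ y‖ * ‖z * x‖ := norm_trace_mul_le_ofM τ _ _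
    _ ≤ ‖ofM τ y‖ * (‖z‖ * ‖x‖) := by gcongr; exact norm_mul_le _ _
    _ = _ := by ring

theorem norm_ofM_star (τ : Trace M) (x : Elt M) : ‖ofM τ (star x)‖ = ‖ofM τ x‖ := by
  have key : ∀ y : Elt M, ‖ofM τ (star y)‖ ≤ ‖ofM τ y‖ := fun y => by
    refine norm_ofM_le_of τ (norm_nonneg _) fun z => ?_
    have : τ (star y * z) = (starRingEnd ℂ) (τ (y * star z)) := by
      rw [← τ.map_star, star_mul, star_star, τ.tracial]
    rw [this, RCLike.norm_conj, ← norm_star z]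
    exact norm_trace_mul_le_ofM τ _ _
  exact le_antisymm (key x) (by simpa using key (star x))

theorem norm_ofM_mul_le_toL2 (τ : Trace M) (x y : Elt M) :
    ‖ofM τ (x * y)‖ ≤ ‖toL2 τ x‖ * ‖toL2 τ y‖ := by
  refine norm_ofM_le_of τ (by positivity) fun z => ?_
  rw [mul_assoc]
  calc _ ≤ ‖toL2 τ x‖ * ‖toL2 τ (y * z)‖ := norm_trace_mul_le τ _ _
    _ ≤ ‖toL2 τ x‖ * (‖toL2 τ y‖ * ‖z‖) := by gcongr; exact norm_toL2_mul_le' τ _ _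
    _ = _ := by ring

theorem norm_ofM_le_toL2 (τ : Trace M) (x : Elt M) :
    ‖ofM τ x‖ ≤ ‖toL2 τ 1‖ * ‖toL2 τ x‖ := by
  simpa using norm_ofM_mul_le_toL2 τ 1 x

theorem norm_ofM_star_mul_self_le (τ : Trace M) (x : Elt M) :
    ‖ofM τ (star x * x)‖ ≤ (τ (star x * x)).re := by
  have := norm_ofM_mul_le_toL2 τ (star x) x
  rwa [norm_toL2_star, ← sq, norm_toL2_sq] at this

theorem norm_ofM_of_nonneg_le (τ : Trace M) {x : Elt M} (hx : 0 ≤ x) :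
    ‖ofM τ x‖ ≤ (τ x).re := by
  obtain ⟨s, hs⟩ := CStarAlgebra.nonneg_iff_eq_star_mul_self.mp hx
  rw [hs]
  exact norm_ofM_star_mul_self_le τ s

theorem norm_ofL2_le (τ : Trace M) (ξ : L2 τ) : ‖ofL2 τ ξ‖ ≤ √‖τ.toFunctional‖ * ‖ξ‖ :=
  LinearMap.mkContinuous_norm_le _ (by positivity) _

/-- `ofL2` as a linear map. -/
def ofL2L (τ : Trace M) : L2 τ →L[ℂ] Fn M :=
  LinearMap.mkContinuous
    { toFun := ofL2 τ
      map_add' := fun x y => by ext z; simp [ofL2_apply, inner_add_right]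
      map_smul' := fun c x => by ext z; simp [ofL2_apply, inner_smul_right] }
    (√‖τ.toFunctional‖) (fun ξ => norm_ofL2_le τ ξ)

theorem ofL2L_apply (τ : Trace M) (ξ : L2 τ) : ofL2L τ ξ = ofL2 τ ξ := rfl

theorem denseRange_toL2 (τ : Trace M) : DenseRange (toL2 τ) := by
  have := UniformSpace.Completion.denseRange_coe (α := PreL2 τ)
  exact this

theorem exists_tendsto_toL2 (τ : Trace M) (ξ : L2 τ) :
    ∃ a : ℕ → Elt M, Tendsto (fun n => toL2 τ (a n)) atTop (𝓝 ξ) := by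
  obtain ⟨u, hu, hlim⟩ := mem_closure_iff_seq_limit.mp (denseRange_toL2 τ ξ)
  choose a ha using hu
  exact ⟨a, by simpa [ha] using hlim⟩

theorem ofM_mem_L1 (τ : Trace M) (x : Elt M) : ofM τ x ∈ L1 τ := subset_closure ⟨x, rfl⟩

theorem toL2_injective (τ : Trace M) : Function.Injective (toL2 τ) := by
  rw [← LinearMap.ker_eq_bot, LinearMap.ker_eq_bot']
  intro x hx
  refine τ.faithful x ?_
  rw [← inner_toL2, hx, inner_zero_left]

theorem ofL2_injective (τ : Trace M) : Function.Injective (ofL2 τ) := by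
  intro ξ η h
  refine ext_inner_left ℂ fun v => ?_
  refine (denseRange_toL2 τ).induction_on (p := fun v => inner ℂ v ξ = inner ℂ v η) v
    (isClosed_eq (by fun_prop) (by fun_prop)) fun z => ?_
  have := congrArg (fun f : Fn M => f (star z)) h
  simpa [ofL2_apply] using this

theorem eq_of_trace_mul_eq (τ : Trace M) {x y : Elt M} (h : ∀ z, τ (x * z) = τ (y * z)) :
    x = y := by
  refine toL2_injective τ (ofL2_injective τ ?_)
  rw [ofL2_toL2, ofL2_toL2]
  ext z
  exact h z

/-! ### Weak compactness of bounded sets of operators -/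

/-- A bounded family of operators converges along every ultrafilter in the weak operator
topology. -/
theorem exists_weak_limit {K ι : Type*} [NormedAddCommGroup K] [InnerProductSpace ℂ K]
    [CompleteSpace K] (U : Ultrafilter ι) (x : ι → K →L[ℂ] K) (C : ℝ) (hx : ∀ i, ‖x i‖ ≤ C) :
    ∃ A : K →L[ℂ] K, ‖A‖ ≤ C ∧
      ∀ ξ η, Tendsto (fun i => inner ℂ ξ (x i η)) U (𝓝 (inner ℂ ξ (A η))) := by
  have hC : 0 ≤ C := by
    obtain ⟨i⟩ : Nonempty ι := U.neBot.nonempty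
    exact (norm_nonneg _).trans (hx i)
  have hb : ∀ i ξ η, ‖inner ℂ (x i ξ) η‖ ≤ C * ‖ξ‖ * ‖η‖ := fun i ξ η =>
    (norm_inner_le_norm _ _).trans (by
      gcongr
      exact ((x i).le_opNorm ξ).trans (by gcongr; exact hx i))
  have hlim : ∀ ξ η, ∃ c : ℂ, ‖c‖ ≤ C * ‖ξ‖ * ‖η‖ ∧
      Tendsto (fun i => inner ℂ (x i ξ) η) U (𝓝 c) := by
    intro ξ η
    have hK := isCompact_closedBall (0 : ℂ) (C * ‖ξ‖ * ‖η‖)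
    obtain ⟨c, hc, hc'⟩ := hK.ultrafilter_le_nhds (U.map fun i => inner ℂ (x i ξ) η)
      (by
        rw [le_principal_iff, Ultrafilter.mem_coe, Ultrafilter.mem_map]
        exact univ_mem' fun i => by simpa using hb i ξ η)
    exact ⟨c, by simpa using hc, hc'⟩
  -- the limits of the matrix coefficients form a bounded sesquilinear form, hence an operator
  choose b hb1 hb2 using hlim
  let B : K →L⋆[ℂ] K →L[ℂ] ℂ := LinearMap.mkContinuous₂
    (LinearMap.mk₂'ₛₗ (starRingEnd ℂ) (RingHom.id ℂ) b
      (fun ξ₁ ξ₂ η => tendsto_nhds_unique (hb2 _ _) (by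
        simpa [inner_add_left] using (hb2 ξ₁ η).add (hb2 ξ₂ η)))
      (fun c ξ η => tendsto_nhds_unique (hb2 _ _) (by
        simpa [inner_smul_left, mul_comm] using (hb2 ξ η).const_mul (starRingEnd ℂ c)))
      (fun ξ η₁ η₂ => tendsto_nhds_unique (hb2 _ _) (by
        simpa [inner_add_right] using (hb2 ξ η₁).add (hb2 ξ η₂)))
      (fun c ξ η => tendsto_nhds_unique (hb2 _ _) (by
        simpa [inner_smul_right] using (hb2 ξ η).const_mul c))) C hb1
  have hB : ∀ ξ η, inner ℂ (InnerProductSpace.continuousLinearMapOfBilin B ξ) η = b ξ η :=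
    fun ξ η => by rw [InnerProductSpace.continuousLinearMapOfBilin_apply]; rfl
  refine ⟨InnerProductSpace.continuousLinearMapOfBilin B, ?_, fun ξ η => ?_⟩
  · refine ContinuousLinearMap.opNorm_le_bound _ hC fun ξ => ?_
    set v := InnerProductSpace.continuousLinearMapOfBilin B ξ
    have h1 : ‖v‖ * ‖v‖ ≤ C * ‖ξ‖ * ‖v‖ := by
      have := hb1 ξ v
      rw [← hB, inner_self_eq_norm_sq_to_K] at this
      simpa [sq] using this
    rcases eq_or_ne ‖v‖ 0 with h | h
    · rw [h]; positivity
    · exact le_of_mul_le_mul_right h1 (lt_of_le_of_ne (norm_nonneg _) h.symm)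
  · have h1 := (Complex.continuous_conj.tendsto _).comp (hb2 η ξ)
    rw [← hB, inner_conj_symm] at h1
    refine h1.congr fun i => ?_
    rw [Function.comp_apply, inner_conj_symm]

/-- The ball of a von Neumann algebra is compact for the weak operator topology and for the
topology of the duality given by the trace. -/
theorem exists_weak_limit_elt {ι : Type*} (τ : Trace M) (U : Ultrafilter ι) (x : ι → Elt M) (C : ℝ)
    (hx : ∀ i, ‖x i‖ ≤ C) : ∃ a : Elt M, ‖a‖ ≤ C ∧
      (∀ ξ η, Tendsto (fun i => inner ℂ ξ ((x i : H →L[ℂ] H) η)) U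
        (𝓝 (inner ℂ ξ ((a : H →L[ℂ] H) η)))) ∧
      ∀ z, Tendsto (fun i => τ (x i * z)) U (𝓝 (τ (a * z))) := by
  obtain ⟨A, hA, hlim⟩ := exists_weak_limit U (fun i => (x i : H →L[ℂ] H)) C hx
  -- commutation relations pass to the weak limit, so the limit lies in the bicommutant
  have hmem : A ∈ M.toStarSubalgebra := by
    rw [VonNeumannAlgebra.mem_carrier, ← M.centralizer_centralizer]
    intro g hg
    have hg' : ∀ i, g * (x i : H →L[ℂ] H) = x i * g := fun i =>
      (hg (x i) (x i).2).symm
    refine ContinuousLinearMap.ext fun η => ext_inner_left ℂ fun ξ => ?_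
    refine tendsto_nhds_unique (f := fun i => inner ℂ ξ ((x i : H →L[ℂ] H) (g η)))
      (l := (U : Filter ι)) ?_ (hlim ξ (g η))
    have := hlim (ContinuousLinearMap.adjoint g ξ) η
    simp only [ContinuousLinearMap.adjoint_inner_left] at this
    refine this.congr fun i => ?_
    have := congrArg (fun T : H →L[ℂ] H => T η) (hg' i)
    simp only [mul_apply_eq_comp] at this
    rw [this]
  refine ⟨⟨A, hmem⟩, hA, hlim, fun z => ?_⟩
  -- the trace being normal, weak convergence of a bounded family gives convergence of the traces
  -- by dominated convergence
  obtain ⟨ξ, η, hξ, hη, hτ⟩ := τ.normal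
  have hsum : Summable fun n => C * ‖z‖ * (‖ξ n‖ * ‖η n‖) := by
    refine Summable.mul_left _ (Summable.of_nonneg_of_le (fun n => by positivity) (fun n => ?_)
      (hξ.add hη))
    nlinarith [sq_nonneg (‖ξ n‖ - ‖η n‖), sq_nonneg ‖ξ n‖, sq_nonneg ‖η n‖]
  have hT := tendsto_tsum_of_dominated_convergence (𝓕 := (U : Filter ι))
    (f := fun i n => inner ℂ (ξ n) ((x i : H →L[ℂ] H) ((z : H →L[ℂ] H) (η n))))
    (g := fun n => inner ℂ (ξ n) (A ((z : H →L[ℂ] H) (η n)))) hsum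
    (fun n => hlim _ _) (Eventually.of_forall fun i n => by
      calc _ ≤ ‖ξ n‖ * ‖(x i : H →L[ℂ] H) ((z : H →L[ℂ] H) (η n))‖ := norm_inner_le_norm _ _
        _ ≤ ‖ξ n‖ * (C * (‖z‖ * ‖η n‖)) := by
          gcongr
          refine ((x i : H →L[ℂ] H).le_opNorm _).trans ?_
          have h1 : ‖(x i : H →L[ℂ] H)‖ ≤ C := hx i
          have h2 : ‖(z : H →L[ℂ] H) (η n)‖ ≤ ‖z‖ * ‖η n‖ := (z : H →L[ℂ] H).le_opNorm _
          exact mul_le_mul h1 h2 (norm_nonneg _) ((norm_nonneg _).trans h1)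
        _ = _ := by ring)
  have h1 : ∀ y : Elt M, τ (y * z) =
      ∑' n, inner ℂ (ξ n) ((y : H →L[ℂ] H) ((z : H →L[ℂ] H) (η n))) := fun y =>
    (hτ (y * z)).tsum_eq.symm
  rw [h1 ⟨A, hmem⟩]
  simpa only [h1] using hT

theorem nonneg_of_weak_limit {ι : Type*} {l : Filter ι} [l.NeBot] {x : ι → Elt M} {a : Elt M}
    (hx : ∀ i, 0 ≤ x i) (h : ∀ ξ η, Tendsto (fun i => inner ℂ ξ ((x i : H →L[ℂ] H) η)) l
      (𝓝 (inner ℂ ξ ((a : H →L[ℂ] H) η)))) : 0 ≤ a := by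
  change 0 ≤ (a : H →L[ℂ] H)
  rw [ContinuousLinearMap.nonneg_iff_isPositive, ContinuousLinearMap.isPositive_def']
  have hp : ∀ i, (x i : H →L[ℂ] H).IsPositive := fun i =>
    (ContinuousLinearMap.nonneg_iff_isPositive _).mp (hx i)
  refine ⟨?_, fun ξ => ?_⟩
  · rw [ContinuousLinearMap.isSelfAdjoint_iff_isSymmetric]
    intro ξ η
    refine tendsto_nhds_unique (l := l) (f := fun i => inner ℂ ξ ((x i : H →L[ℂ] H) η)) ?_ (h ξ η)
    have h1 := (Complex.continuous_conj.tendsto _).comp (h η ξ)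
    rw [inner_conj_symm] at h1
    refine h1.congr fun i => ?_
    rw [Function.comp_apply, inner_conj_symm]
    exact (hp i).isSymmetric ξ η
  · rw [ContinuousLinearMap.reApplyInnerSelf_apply]
    have h1 := (Complex.continuous_re.tendsto _).comp (h ξ ξ)
    rw [inner_re_symm]
    exact ge_of_tendsto' h1 fun i => (hp i).re_inner_nonneg_right ξ

/-! ### `M` is the dual of `L₁(M)` -/

/-- The unit ball of `M` is closed in `L₂(M)`. -/
theorem isClosed_toL2_closedBall (τ : Trace M) (C : ℝ) :
    IsClosed (toL2 τ '' Metric.closedBall 0 C) := by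
  rw [← isSeqClosed_iff_isClosed]
  intro u ζ hu hlim
  choose x hx hxu using hu
  obtain ⟨a, ha, -, hat⟩ := exists_weak_limit_elt τ (Filter.hyperfilter ℕ) x C
    (fun i => by simpa using hx i)
  refine ⟨a, by simpa using ha, ofL2_injective τ ?_⟩
  rw [ofL2_toL2]
  ext z
  refine tendsto_nhds_unique (hat z) ?_
  have h1 : Tendsto (fun i => toL2 τ (x i)) (Filter.hyperfilter ℕ : Filter ℕ) (𝓝 ζ) := by
    have := hlim.mono_left Nat.hyperfilter_le_atTop
    simpa only [hxu] using this
  have h2 := ((ofL2L τ).continuous.tendsto ζ).comp h1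
  have h3 := ((ContinuousLinearMap.apply ℂ ℂ z).continuous.tendsto _).comp h2
  simpa [Function.comp_def, ofL2L_apply, ofL2_toL2, ofM_apply] using h3

/-- A functional on `M` that is bounded for the norm of `L₁(M)` is given by an element of `M`. -/
theorem exists_elt_of_norm_le (τ : Trace M) (f : Elt M →ₗ[ℂ] ℂ) (C : ℝ) (hC : 0 ≤ C)
    (hf : ∀ z, ‖f z‖ ≤ C * ‖ofM τ z‖) : ∃ a : Elt M, ‖a‖ ≤ C ∧ ∀ z, τ (a * z) = f z := by
  -- `f` is bounded for the norm of `L₂(M)`, hence given by a vector `ζ`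
  obtain ⟨ζ, hζ⟩ : ∃ ζ : L2 τ, ∀ z, ofL2 τ ζ z = f z := by
    let g : PreL2 τ →L[ℂ] ℂ := LinearMap.mkContinuous (f ∘ₗ (toPreL2 τ).symm.toLinearMap)
      (C * ‖toL2 τ 1‖) (fun z => by
        refine (hf _).trans ?_
        have := norm_ofM_le_toL2 τ ((toPreL2 τ).symm z)
        have h2 : ‖toL2 τ ((toPreL2 τ).symm z)‖ = ‖z‖ := UniformSpace.Completion.norm_coe z
        rw [h2] at this
        rw [mul_assoc]
        exact mul_le_mul_of_nonneg_left this hC)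
    let G : L2 τ →L[ℂ] ℂ := g.extend (UniformSpace.Completion.toComplL (𝕜 := ℂ) (E := PreL2 τ))
    have hG : ∀ z : Elt M, G (toL2 τ z) = f z := fun z =>
      ContinuousLinearMap.extend_eq g (e := UniformSpace.Completion.toComplL (𝕜 := ℂ) (E := PreL2 τ))
        (UniformSpace.Completion.denseRange_coe) (UniformSpace.Completion.isUniformInducing_coe _) _
    obtain ⟨v, hv⟩ := (InnerProductSpace.toDual ℂ (L2 τ)).surjective G
    obtain ⟨b, hb⟩ := exists_tendsto_toL2 τ v
    -- pass from `v` to its adjoint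
    have hcau : CauchySeq fun n => toL2 τ (star (b n)) := by
      have := hb.cauchySeq
      rw [Metric.cauchySeq_iff] at this ⊢
      intro ε hε
      obtain ⟨N, hN⟩ := this ε hε
      refine ⟨N, fun m hm n hn => ?_⟩
      have := hN m hm n hn
      rwa [dist_eq_norm, ← map_sub, ← star_sub, norm_toL2_star, map_sub, ← dist_eq_norm]
    obtain ⟨ζ, hζ⟩ := cauchySeq_tendsto_of_complete hcau
    refine ⟨ζ, fun z => ?_⟩
    rw [← hG z, ← hv, InnerProductSpace.toDual_apply_apply]
    refine tendsto_nhds_unique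
      (((continuous_const (y := toL2 τ (star z))).inner continuous_id).tendsto ζ |>.comp hζ) ?_
    have h2 := ((continuous_id (X := L2 τ)).inner
      (continuous_const (y := toL2 τ z)) (𝕜 := ℂ)).tendsto v |>.comp hb
    refine h2.congr fun n => ?_
    simp only [Function.comp_apply, id, inner_toL2, star_star]
    rw [τ.tracial]
  by_cases hmem : ζ ∈ toL2 τ '' Metric.closedBall 0 C
  · obtain ⟨a, ha, rfl⟩ := hmem
    exact ⟨a, by simpa using ha, fun z => by rw [← hζ, ofL2_toL2, ofM_apply]⟩
  exfalso
  -- otherwise `ζ` is separated from the ball of radius `C` of `M` by a vector `d`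
  have hconv : Convex ℝ (toL2 τ '' Metric.closedBall 0 C) :=
    (convex_closedBall 0 C).linear_image ((toL2 τ).restrictScalars ℝ)
  obtain ⟨F, u, hF1, hF2⟩ := RCLike.geometric_hahn_banach_closed_point (𝕜 := ℂ) hconv
    (isClosed_toL2_closedBall τ C) hmem
  obtain ⟨d, hd⟩ := (InnerProductSpace.toDual ℂ (L2 τ)).surjective F
  obtain ⟨b, hb⟩ := exists_tendsto_toL2 τ d
  have hFz : ∀ y, F y = inner ℂ d y := fun y => by
    rw [← hd, InnerProductSpace.toDual_apply_apply]
  -- the separation says that the real part of `⟨d, ·⟩` is at most `u` on the ball, which bounds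
  -- the `L₁`-norm of `d` by `u / C`
  have hball : ∀ y : Elt M, ‖F (toL2 τ y)‖ * C ≤ u * ‖y‖ := by
    intro y
    rcases eq_or_ne ‖y‖ 0 with h0 | h0
    · rw [norm_eq_zero.mp h0]; simp
    obtain ⟨c, hc1, hc2⟩ : ∃ c : ℂ, ‖c‖ = 1 ∧ c * F (toL2 τ y) = ‖F (toL2 τ y)‖ := by
      rcases eq_or_ne (F (toL2 τ y)) 0 with h | h
      · exact ⟨1, by simp, by simp [h]⟩
      · refine ⟨‖F (toL2 τ y)‖ / F (toL2 τ y), by simp [h], by field_simp⟩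
    have h1 := hF1 (toL2 τ ((c * (C / ‖y‖ : ℝ)) • y)) ⟨_, by
      rw [mem_closedBall_zero_iff, norm_smul, norm_mul, hc1, one_mul, Complex.norm_real,
        Real.norm_of_nonneg (by positivity), div_mul_cancel₀ _ h0], rfl⟩
    rw [map_smul, map_smul, smul_eq_mul, mul_right_comm, hc2] at h1
    have h2 : ‖F (toL2 τ y)‖ * (C / ‖y‖) < u := by
      simpa [← Complex.ofReal_mul, -Complex.ofReal_div] using h1
    rw [mul_div_assoc', div_lt_iff₀ (lt_of_le_of_ne (norm_nonneg _) (Ne.symm h0))] at h2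
    exact h2.le
  have hu : 0 < u := by
    have := hF1 0 ⟨0, by simpa using hC, by simp⟩
    simpa using this
  have hbn : ∀ n, ‖inner ℂ (toL2 τ (b n)) ζ‖ ≤ C * ‖ofM τ (b n)‖ := fun n => by
    have := hf (star (b n))
    rw [← hζ, ofL2_apply, star_star, norm_ofM_star] at this
    exact this
  -- the hypothesis on `f`, applied to elements of `M` close to `d`, now gives `‖F ζ‖ ≤ u`,
  -- contrary to the separation
  have hle : ∀ ε > 0, ‖F ζ‖ ≤ u + ε := by
    intro ε hε
    have h1 : Tendsto (fun n => ‖inner ℂ (toL2 τ (b n)) ζ‖) atTop (𝓝 ‖F ζ‖) := by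
      rw [hFz]; exact (hb.inner tendsto_const_nhds).norm
    refine le_of_tendsto h1 ?_
    have h2 : Tendsto (fun n => C * (√‖τ.toFunctional‖ * ‖toL2 τ (b n) - d‖)) atTop (𝓝 0) := by
      have := (tendsto_iff_norm_sub_tendsto_zero.mp hb).const_mul √‖τ.toFunctional‖
      simpa using this.const_mul C
    filter_upwards [h2.eventually_lt_const hε] with n hn
    refine (hbn n).trans ?_
    have h3 : C * ‖ofM τ (b n)‖ ≤ u + C * (√‖τ.toFunctional‖ * ‖toL2 τ (b n) - d‖) := by
      rcases hC.eq_or_lt with h | hC'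
      · simp [← h, hu.le]
      have h5 : ‖ofM τ (star (b n))‖ ≤ u / C + √‖τ.toFunctional‖ * ‖toL2 τ (b n) - d‖ := by
        refine norm_ofM_le_of τ (by positivity) fun z => ?_
        rw [← inner_toL2]
        have h6 : inner ℂ (toL2 τ (b n)) (toL2 τ z) =
            F (toL2 τ z) + inner ℂ (toL2 τ (b n) - d) (toL2 τ z) := by
          rw [hFz, inner_sub_left]; ring
        rw [h6, add_mul]
        refine (norm_add_le _ _).trans (add_le_add ?_ ?_)
        · rw [div_mul_eq_mul_div, le_div_iff₀ hC']; exact hball z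
        · refine (norm_inner_le_norm _ _).trans ?_
          calc _ ≤ ‖toL2 τ (b n) - d‖ * (√‖τ.toFunctional‖ * ‖z‖) := by
                gcongr; exact norm_toL2_le τ z
            _ = _ := by ring
      rw [norm_ofM_star] at h5
      calc _ ≤ C * (u / C + √‖τ.toFunctional‖ * ‖toL2 τ (b n) - d‖) := by gcongr
        _ = _ := by field_simp
    linarith
  have h3 : (RCLike.re (F ζ) : ℝ) ≤ ‖F ζ‖ := RCLike.re_le_norm _
  have h4 := le_of_forall_pos_le_add hle
  linarith

/-! ### Spectral projections and their traces -/

theorem IsStarProjection.norm_le_one {e : Elt M} (he : IsStarProjection e) : ‖e‖ ≤ 1 := by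
  have h := CStarRing.norm_star_mul_self (x := e)
  rw [he.isSelfAdjoint.star_eq, he.isIdempotentElem.eq] at h
  by_contra! h1
  nlinarith

/-- The projection onto the kernel of an element of `M` belongs to `M`. -/
theorem exists_kernel_projection (d : Elt M) :
    ∃ e : Elt M, IsStarProjection e ∧ d * e = 0 ∧ ∀ x, d * x = 0 → e * x = x := by
  let K : Submodule ℂ H := LinearMap.ker (d : H →L[ℂ] H).toLinearMap
  have hKc : IsClosed (K : Set H) := (d : H →L[ℂ] H).isClosed_ker
  have : CompleteSpace K := hKc.completeSpace_coe
  -- a projection commutes with every operator that, together with its adjoint, preserves its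
  -- range; this applies to the commutant of `M`
  have hcomm : ∀ g : H →L[ℂ] H, (∀ v ∈ K, g v ∈ K) → (∀ v ∈ K, ContinuousLinearMap.adjoint g v ∈ K) →
      g * K.starProjection = K.starProjection * g := by
    intro g h1 h2
    refine ContinuousLinearMap.ext fun v => ?_
    simp only [mul_apply_eq_comp]
    have hsplit : g v = g (K.starProjection v) + g (v - K.starProjection v) := by
      rw [← map_add]; congr 1; abel
    rw [hsplit, map_add, Submodule.starProjection_eq_self_iff.mpr
      (h1 _ (Submodule.starProjection_apply_mem _ _))]
    have h3 : K.starProjection (g (v - K.starProjection v)) = 0 := by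
      rw [Submodule.starProjection_apply_eq_zero_iff, Submodule.mem_orthogonal]
      intro u hu
      rw [← ContinuousLinearMap.adjoint_inner_left]
      exact Submodule.inner_right_of_mem_orthogonal (h2 u hu)
        (Submodule.sub_starProjection_mem_orthogonal v)
    rw [h3, add_zero]
  have hmem : K.starProjection ∈ M.toStarSubalgebra := by
    rw [VonNeumannAlgebra.mem_carrier, ← M.centralizer_centralizer]
    intro g hg
    have hgd : ∀ v ∈ K, g v ∈ K := by
      intro v hv
      have h1 := hg d d.2
      have h2 := congrArg (fun T : H →L[ℂ] H => T v) h1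
      simp only [mul_apply_eq_comp] at h2
      have hv' : (d : H →L[ℂ] H) v = 0 := hv
      change (d : H →L[ℂ] H) (g v) = 0
      rw [h2, hv', map_zero]
    refine hcomm g hgd fun v hv => ?_
    have h1 := hg (star d) (star d).2
    have h2 := congrArg star h1
    simp only [star_mul, star_star] at h2
    have h3 := congrArg (fun T : H →L[ℂ] H => T v) h2
    simp only [mul_apply_eq_comp, ContinuousLinearMap.star_eq_adjoint] at h3
    have hv' : (d : H →L[ℂ] H) v = 0 := hv
    change (d : H →L[ℂ] H) (ContinuousLinearMap.adjoint g v) = 0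
    rw [← h3, hv', map_zero]
  refine ⟨⟨K.starProjection, hmem⟩, ?_, ?_, fun x hx => ?_⟩
  · have := isStarProjection_starProjection (U := K)
    exact ⟨Subtype.ext this.isIdempotentElem, Subtype.ext this.isSelfAdjoint⟩
  · refine Subtype.ext (ContinuousLinearMap.ext fun v => ?_)
    exact Submodule.starProjection_apply_mem K v
  · refine Subtype.ext (ContinuousLinearMap.ext fun v => ?_)
    refine Submodule.starProjection_eq_self_iff.mpr ?_
    exact congrArg (fun T : Elt M => (T : H →L[ℂ] H) v) hx

/-- The spectral projection `e = 1_{[σ, ∞)}(a)`, characterised through the positive parts of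
`σ - a` and of `a - σ`. -/
theorem exists_spectral_projection {a : Elt M} (ha : IsSelfAdjoint a) (σ : ℝ) :
    ∃ e : Elt M, IsStarProjection e ∧ (∀ b, IsSelfAdjoint b → Commute a b → Commute e b) ∧
      cfc (fun x : ℝ => max (σ - x) 0) a * e = 0 ∧
      cfc (fun x : ℝ => max (x - σ) 0) a * (1 - e) = 0 := by
  set n := cfc (fun x : ℝ => max (σ - x) 0) a
  set d := cfc (fun x : ℝ => max (x - σ) 0) a
  have hn : IsSelfAdjoint n := cfc_predicate _ _
  have hd : IsSelfAdjoint d := cfc_predicate _ _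
  obtain ⟨e, he, hne, hmax⟩ := exists_kernel_projection n
  refine ⟨e, he, fun b hb hab => ?_, hne, ?_⟩
  · have hnb : Commute n b := Commute.cfc hab (by rwa [ha.star_eq]) _
    have h1 : e * (b * e) = b * e := hmax _ (by rw [← mul_assoc, hnb.eq, mul_assoc, hne, mul_zero])
    have h2 := congrArg star h1
    simp only [star_mul, he.isSelfAdjoint.star_eq, hb.star_eq] at h2
    rw [Commute, SemiconjBy, ← h1, ← mul_assoc, h2]
  · have hnd : n * d = 0 := by
      rw [← cfc_mul _ _ a]
      rw [← cfc_const_zero ℝ a]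
      refine cfc_congr fun x _ => ?_
      rcases le_total σ x with h | h
      · simp [max_eq_right (sub_nonpos.mpr h)]
      · simp [max_eq_right (sub_nonpos.mpr h)]
    have h1 := hmax d hnd
    have h2 := congrArg star h1
    simp only [star_mul, he.isSelfAdjoint.star_eq, hd.star_eq] at h2
    rw [mul_sub, mul_one, h2, sub_self]

/-- The decomposition of `a - σ` into its positive and negative parts. -/
theorem cfc_sub_parts {a : Elt M} (ha : IsSelfAdjoint a) (σ : ℝ) :
    a - algebraMap ℝ (Elt M) σ =
      cfc (fun x : ℝ => max (x - σ) 0) a - cfc (fun x : ℝ => max (σ - x) 0) a := by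
  rw [← cfc_sub _ _ a]
  conv_lhs => rw [← cfc_id' ℝ a, ← cfc_const σ a, ← cfc_sub _ _ a]
  refine cfc_congr fun x _ => ?_
  rcases le_total σ x with h | h
  · simp [max_eq_right (sub_nonpos.mpr h), max_eq_left (sub_nonneg.mpr h)]
  · simp [max_eq_right (sub_nonpos.mpr h), max_eq_left (sub_nonneg.mpr h)]

theorem algebraMap_mul_eq_smul (c : ℝ) (x : Elt M) :
    algebraMap ℝ (Elt M) c * x = (c : ℂ) • x := by
  rw [Algebra.algebraMap_eq_smul_one, smul_mul_assoc, one_mul, Complex.coe_smul]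

/-- `a ≥ σ` on the range of `e = 1_{[σ, ∞)}(a)` and `a ≤ σ` on its complement. -/
theorem exists_projection_bounds {a : Elt M} (ha : IsSelfAdjoint a) (σ : ℝ) :
    ∃ e : Elt M, IsStarProjection e ∧ (∀ b, IsSelfAdjoint b → Commute a b → Commute e b) ∧
      cfc (fun x : ℝ => max (σ - x) 0) a * e = 0 ∧
      (σ : ℂ) • e ≤ e * a * e ∧ (1 - e) * a * (1 - e) ≤ (σ : ℂ) • (1 - e) := by
  obtain ⟨e, he, hc, hn, hd⟩ := exists_spectral_projection ha σ
  have hparts := cfc_sub_parts ha σ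
  have hn0 : 0 ≤ cfc (fun x : ℝ => max (σ - x) 0) a := cfc_nonneg fun x _ => le_max_right _ _
  have hd0 : 0 ≤ cfc (fun x : ℝ => max (x - σ) 0) a := cfc_nonneg fun x _ => le_max_right _ _
  set n := cfc (fun x : ℝ => max (σ - x) 0) a
  set d := cfc (fun x : ℝ => max (x - σ) 0) a
  have hee : e * e = e := he.isIdempotentElem.eq
  have hf := he.one_sub
  refine ⟨e, he, hc, hn, ?_, ?_⟩
  · have h1 : e * a * e - (σ : ℂ) • e = e * d * e := by
      have : e * (a - algebraMap ℝ (Elt M) σ) * e = e * d * e := by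
        rw [hparts, mul_sub, sub_mul, mul_assoc e n, hn, mul_zero, sub_zero]
      rw [← this, mul_sub, sub_mul, mul_assoc e (algebraMap ℝ (Elt M) σ),
        algebraMap_mul_eq_smul, mul_smul_comm, hee]
    rw [← sub_nonneg, h1]
    have := star_left_conjugate_nonneg hd0 e
    rwa [he.isSelfAdjoint.star_eq] at this
  · generalize 1 - e = f at hf hd ⊢
    have h1 : (σ : ℂ) • f - f * a * f = f * n * f := by
      have : f * (a - algebraMap ℝ (Elt M) σ) * f = - (f * n * f) := by
        rw [hparts, mul_sub, sub_mul, mul_assoc f d, hd, mul_zero, zero_sub]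
      rw [← neg_neg (f * n * f), ← this, mul_sub, sub_mul,
        mul_assoc f (algebraMap ℝ (Elt M) σ), algebraMap_mul_eq_smul, mul_smul_comm,
        hf.isIdempotentElem.eq, neg_sub]
    rw [← sub_nonneg, h1]
    have := star_left_conjugate_nonneg hn0 f
    rwa [hf.isSelfAdjoint.star_eq] at this

theorem norm_le_of_star_mul_self_le {x : Elt M} {C : ℝ} (hC : 0 ≤ C)
    (h : star x * x ≤ algebraMap ℝ (Elt M) (C ^ 2)) : ‖x‖ ≤ C := by
  have h1 := CStarAlgebra.norm_le_norm_of_nonneg_of_le (star_mul_self_nonneg x) h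
  rw [CStarRing.norm_star_mul_self] at h1
  have h2 : ‖algebraMap ℝ (Elt M) (C ^ 2)‖ ≤ C ^ 2 := by
    rcases subsingleton_or_nontrivial (Elt M) with h | h
    · rw [Subsingleton.elim (algebraMap ℝ (Elt M) (C ^ 2)) 0, norm_zero]; positivity
    · rw [norm_algebraMap', Real.norm_of_nonneg (by positivity)]
  exact abs_le_of_sq_le_sq' (by nlinarith) hC |>.2

/-- Left and right supports have the same trace: if the left support of `w` is dominated by the
projection `f`, then so is, in trace, the complement of the projection onto the kernel of `w`. -/
theorem exists_kernel_projection_trace_le (τ : Trace M) {w f : Elt M} (hf : IsStarProjection f)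
    (hw : f * w = w) :
    ∃ e : Elt M, IsStarProjection e ∧ w * e = 0 ∧ (τ (1 - e)).re ≤ (τ f).re := by
  obtain ⟨e, he, hwe, hmax⟩ := exists_kernel_projection w
  refine ⟨e, he, hwe, ?_⟩
  -- For the polar decomposition `w = v |w|` one has `v* v = 1 - e` and `v v* ≤ f`. The elements
  -- `v n = w (|w|² + ε n)^{-1/2}` of `M` approximate `v`, and the weak limit `B` of
  -- `b n = (v n)* v n` plays the part of `v* v`.
  set a := star w * w with ha_def
  have ha0 : 0 ≤ a := star_mul_self_nonneg w
  have ha : IsSelfAdjoint a := IsSelfAdjoint.of_nonneg ha0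
  let ε : ℕ → ℝ := fun n => 1 / ((n : ℝ) + 1)
  have hε : ∀ n, 0 < ε n := fun n => Nat.one_div_pos_of_nat
  have hc1 : ∀ n, Continuous fun x : ℝ => (√(|x| + ε n))⁻¹ := fun n =>
    Continuous.inv₀ (by fun_prop) fun x => by have := hε n; positivity
  have hsp : ∀ x ∈ spectrum ℝ a, 0 ≤ x := fun x hx => spectrum_nonneg_of_nonneg ha0 hx
  let r : ℕ → Elt M := fun n => cfc (fun x : ℝ => (√(|x| + ε n))⁻¹) a
  have hr : ∀ n, IsSelfAdjoint (r n) := fun n => cfc_predicate _ _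
  let v : ℕ → Elt M := fun n => w * r n
  let b : ℕ → Elt M := fun n => star (v n) * v n
  have hb : ∀ n, b n = cfc (fun x : ℝ => x / (|x| + ε n)) a := by
    intro n
    have : b n = r n * a * r n := by
      simp only [b, v, star_mul, (hr n).star_eq, ha_def, mul_assoc]
    rw [this]
    have h2 : r n * a = cfc (fun x : ℝ => (√(|x| + ε n))⁻¹ * x) a := by
      rw [cfc_mul _ _ a (hc1 n).continuousOn (by fun_prop), cfc_id' ℝ a]
    have h3 : Continuous fun x : ℝ => (√(|x| + ε n))⁻¹ * x := (hc1 n).mul continuous_id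
    rw [h2, ← cfc_mul _ _ a h3.continuousOn (hc1 n).continuousOn]
    refine cfc_congr fun x hx => ?_
    have h0 := hsp x hx
    have h1 : 0 < |x| + ε n := by have := hε n; positivity
    have h2 := Real.mul_self_sqrt h1.le
    have h3 : 0 < √(|x| + ε n) := Real.sqrt_pos.mpr h1
    field_simp
    rw [sq, h2, mul_comm]
  have hbn : ∀ n, ‖b n‖ ≤ 1 := by
    intro n
    rw [hb]
    refine norm_cfc_le zero_le_one fun x hx => ?_
    have h1 : 0 < |x| + ε n := by have := hε n; positivity
    rw [norm_div, Real.norm_of_nonneg h1.le, div_le_one h1, Real.norm_eq_abs]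
    linarith [hε n]
  -- `τ(v* v) = τ(f v v*) ≤ τ(f)`
  have htr : ∀ n, (τ (b n)).re ≤ (τ f).re := by
    intro n
    have h1 : ‖v n * star (v n)‖ ≤ 1 := by
      rw [CStarRing.norm_self_mul_star, ← CStarRing.norm_star_mul_self]; exact hbn n
    have h2 : τ (b n) = τ (f * (v n * star (v n))) := by
      rw [τ.tracial (star (v n)), ← mul_assoc]
      congr 2
      rw [← mul_assoc f, hw]
    rw [h2]
    calc _ ≤ ‖τ (f * (v n * star (v n)))‖ := Complex.re_le_norm _
      _ ≤ ‖ofM τ f‖ * ‖v n * star (v n)‖ := norm_trace_mul_le_ofM τ _ _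
      _ ≤ (τ f).re * 1 := mul_le_mul (norm_ofM_of_nonneg_le τ hf.nonneg) h1 (norm_nonneg _)
          (τ.nonneg hf.nonneg)
      _ = _ := mul_one _
  obtain ⟨B, -, -, hB⟩ := exists_weak_limit_elt τ (Filter.hyperfilter ℕ) b 1 hbn
  have hle : (Filter.hyperfilter ℕ : Filter ℕ) ≤ atTop := Nat.hyperfilter_le_atTop
  -- `w* w (1 - b n) = ε n b n` tends to `0`
  have hwB : w * (1 - B) = 0 := by
    have h1 : a * (1 - B) = 0 := by
      refine eq_of_trace_mul_eq τ fun z => ?_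
      rw [zero_mul, map_zero]
      have h2 : Tendsto (fun n => τ (a * (1 - b n) * z)) (Filter.hyperfilter ℕ : Filter ℕ)
          (𝓝 (τ (a * (1 - B) * z))) := by
        have h3 : ∀ y : Elt M, τ (a * (1 - y) * z) = τ (a * z) - τ (y * (z * a)) := fun y => by
          rw [mul_sub, mul_one, sub_mul, map_sub, mul_assoc a, τ.tracial a (y * z), mul_assoc y]
        simp only [h3]
        exact (hB _).const_sub _
      refine tendsto_nhds_unique h2 (Tendsto.mono_left ?_ hle)
      have h4 : Tendsto (fun n => ε n * ‖ofM τ z‖) atTop (𝓝 0) := by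
        have := (tendsto_one_div_add_atTop_nhds_zero_nat (𝕜 := ℝ)).mul_const ‖ofM τ z‖
        rwa [zero_mul] at this
      refine squeeze_zero_norm (fun n => ?_) h4
      refine (norm_trace_mul_le_ofM' τ _ _).trans ?_
      gcongr
      have h5 : a * (1 - b n) = cfc (fun x : ℝ => x * (1 - x / (|x| + ε n))) a := by
        have hcont : Continuous fun x : ℝ => x / (|x| + ε n) :=
          Continuous.div (by fun_prop) (by fun_prop) fun x => by have := hε n; positivity
        rw [cfc_mul (fun x : ℝ => x) (fun x => 1 - x / (|x| + ε n)) a (by fun_prop)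
          (continuous_const.sub hcont).continuousOn, cfc_id' ℝ a,
          cfc_sub _ _ a continuousOn_const hcont.continuousOn, cfc_const_one ℝ a, hb]
      rw [h5]
      refine norm_cfc_le (hε n).le fun x hx => ?_
      have h0 := hsp x hx
      have h1 : 0 < x + ε n := by have := hε n; positivity
      rw [abs_of_nonneg h0, one_sub_div h1.ne', Real.norm_of_nonneg (by
        have := hε n; rw [add_sub_cancel_left]; positivity), add_sub_cancel_left, mul_div_assoc',
        div_le_iff₀ h1]
      nlinarith [hε n]
    rw [← CStarRing.star_mul_self_eq_zero_iff, star_mul]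
    calc _ = star (1 - B) * (star w * w * (1 - B)) := by simp only [mul_assoc]
      _ = 0 := by rw [h1, mul_zero]
  have hBe : B * e = 0 := by
    refine eq_of_trace_mul_eq τ fun z => ?_
    rw [zero_mul, map_zero, mul_assoc]
    refine tendsto_nhds_unique (hB (e * z)) ?_
    have : ∀ n, b n * (e * z) = 0 := fun n => by
      have h1 : b n * e = 0 := by
        have h3 : Commute a (r n) := (Commute.cfc (Commute.refl a) (by rw [ha.star_eq]) _).symm
        have h4 : b n = r n * r n * a := by
          have : b n = r n * (a * r n) := by
            simp only [b, v, star_mul, (hr n).star_eq, ha_def, mul_assoc]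
          rw [this, h3.eq, mul_assoc]
        rw [h4, mul_assoc, ha_def, mul_assoc (star w), hwe, mul_zero, mul_zero]
      rw [← mul_assoc, h1, zero_mul]
    simp [this]
  -- together, `w (1 - B) = 0` and `B e = 0` give `τ(1 - e) = τ(B)`
  have h1 : (1 - e) * (1 - B) = 0 := by
    rw [sub_mul, one_mul, hmax _ hwB, sub_self]
  have h2 : τ (1 - e) = τ B := by
    have h3 : 1 - e = (1 - e) * B := by
      have := h1
      rw [mul_sub, mul_one, sub_eq_zero] at this
      exact this
    rw [h3, τ.tracial, mul_sub, mul_one, hBe, sub_zero]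
  rw [h2]
  have h3 := (Complex.continuous_re.tendsto _).comp (hB 1)
  simp only [mul_one, Function.comp_def] at h3
  exact le_of_tendsto' h3 htr

/-! ### Distribution functions and singular numbers -/

/-- The functional `z ↦ x (c z)`, i.e. the product `x c`. -/
def rightMul (x : Fn M) (c : Elt M) : Fn M := x.comp (ContinuousLinearMap.mul ℂ (Elt M) c)

theorem rightMul_apply (x : Fn M) (c z : Elt M) : rightMul x c z = x (c * z) := rfl

theorem distribution_le_of (τ : Trace M) {x : Fn M} {s : ℝ} {e y : Elt M}
    (he : IsStarProjection e) (hy : ‖y‖ ≤ s) (h : ∀ z, x (e * z) = τ (y * z)) :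
    distribution τ x s ≤ ENNReal.ofReal (τ (1 - e)).re :=
  iInf_le_of_le e (iInf_le_of_le he (iInf_le_of_le ⟨y, hy, h⟩ le_rfl))

theorem exists_of_distribution_lt (τ : Trace M) {x : Fn M} {s : ℝ} {δ : ℝ≥0∞}
    (h : distribution τ x s < δ) : ∃ e y : Elt M, IsStarProjection e ∧ ‖y‖ ≤ s ∧
      (∀ z, x (e * z) = τ (y * z)) ∧ ENNReal.ofReal (τ (1 - e)).re < δ := by
  simp only [distribution, iInf_lt_iff] at h
  obtain ⟨e, he, ⟨y, hy, hxy⟩, hlt⟩ := h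
  exact ⟨e, y, he, hy, hxy, hlt⟩

theorem distribution_anti (τ : Trace M) (x : Fn M) {s s' : ℝ} (h : s ≤ s') :
    distribution τ x s' ≤ distribution τ x s := by
  refine le_iInf fun e => le_iInf fun he => le_iInf fun ⟨y, hy, hxy⟩ => ?_
  exact distribution_le_of τ he (hy.trans h) hxy

theorem singularNumber_le_of (τ : Trace M) {x : Fn M} {s t : ℝ} (hs : 0 < s)
    (h : distribution τ x s < ENNReal.ofReal t) : singularNumber τ x t ≤ ENNReal.ofReal s :=
  iInf_le_of_le s (iInf_le_of_le hs (iInf_le_of_le h le_rfl))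

theorem distribution_lt_of_singularNumber_lt (τ : Trace M) {x : Fn M} {s t : ℝ}
    (h : singularNumber τ x t < ENNReal.ofReal s) : distribution τ x s < ENNReal.ofReal t := by
  simp only [singularNumber, iInf_lt_iff] at h
  obtain ⟨s', hs', hd, hlt⟩ := h
  exact (distribution_anti τ x ((ENNReal.ofReal_lt_ofReal_iff_of_nonneg hs'.le).mp hlt).le).trans_lt hd

theorem singularNumber_anti (τ : Trace M) (x : Fn M) : Antitone (singularNumber τ x) := by
  intro t t' h
  refine le_iInf fun s => le_iInf fun hs => le_iInf fun hd => ?_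
  exact singularNumber_le_of τ hs (hd.trans_le (ENNReal.ofReal_le_ofReal h))

theorem singularNumber_le_singularNumber (τ : Trace M) {x x' : Fn M}
    (h : ∀ s, 0 < s → distribution τ x s ≤ distribution τ x' s) (t : ℝ) :
    singularNumber τ x t ≤ singularNumber τ x' t := by
  refine le_iInf fun s => le_iInf fun hs => le_iInf fun hd => ?_
  exact singularNumber_le_of τ hs ((h s hs).trans_lt hd)

theorem distribution_rightMul_le (τ : Trace M) (x : Fn M) {c : Elt M} (hc : ‖c‖ ≤ 1) (s : ℝ) :
    distribution τ (rightMul x c) s ≤ distribution τ x s := by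
  refine le_iInf fun e => le_iInf fun he => le_iInf fun ⟨y, hy, hxy⟩ => ?_
  have hf := he.one_sub
  obtain ⟨g, hg, hwg, htr⟩ := exists_kernel_projection_trace_le τ (w := (1 - e) * c) hf
    (by rw [← mul_assoc, hf.isIdempotentElem.eq])
  refine (distribution_le_of τ (y := y * c * g) hg ?_ fun z => ?_).trans
    (ENNReal.ofReal_le_ofReal htr)
  · have hs : 0 ≤ s := (norm_nonneg _).trans hy
    calc _ ≤ ‖y‖ * ‖c‖ * ‖g‖ := (norm_mul_le _ _).trans (by gcongr; exact norm_mul_le _ _)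
      _ ≤ s * 1 * 1 := by gcongr; exact IsStarProjection.norm_le_one hg
      _ = s := by ring
  · have h1 : c * g = e * (c * g) := by
      have := hwg
      rwa [mul_assoc, sub_mul, one_mul, sub_eq_zero] at this
    rw [rightMul_apply, ← mul_assoc, h1, mul_assoc, hxy]
    simp only [mul_assoc]

theorem singularNumber_rightMul_le (τ : Trace M) (x : Fn M) {c : Elt M} (hc : ‖c‖ ≤ 1) (t : ℝ) :
    singularNumber τ (rightMul x c) t ≤ singularNumber τ x t :=
  singularNumber_le_singularNumber τ (fun s _ => distribution_rightMul_le τ x hc s) t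

theorem lpNorm_mono (τ : Trace M) {p : ℝ} (hp : 0 < p) {x x' : Fn M}
    (h : ∀ t, 0 < t → singularNumber τ x t ≤ singularNumber τ x' t) :
    lpNorm τ p x ≤ lpNorm τ p x' := by
  refine ENNReal.rpow_le_rpow (setLIntegral_mono' measurableSet_Ioi fun t ht => ?_) (by positivity)
  exact ENNReal.rpow_le_rpow (h t ht) hp.le

theorem lpNorm_rightMul_le (τ : Trace M) {p : ℝ} (hp : 0 < p) (x : Fn M) {c : Elt M}
    (hc : ‖c‖ ≤ 1) : lpNorm τ p (rightMul x c) ≤ lpNorm τ p x :=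
  lpNorm_mono τ hp fun t _ => singularNumber_rightMul_le τ x hc t

theorem singularNumber_eq_zero (τ : Trace M) {x : Fn M} {e : Elt M} (he : IsStarProjection e)
    (h : ∀ z, x (e * z) = 0) {t : ℝ} (ht : (τ (1 - e)).re < t) : singularNumber τ x t = 0 := by
  have h0 : 0 ≤ (τ (1 - e)).re := τ.nonneg he.one_sub.nonneg
  refine le_antisymm (le_of_forall_gt fun c hc => ?_) zero_le
  obtain ⟨s, hs0, hs⟩ := ENNReal.lt_iff_exists_nnreal_btwn.mp hc
  have hs0' : (0 : ℝ) < s := by exact_mod_cast hs0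
  refine (singularNumber_le_of τ hs0' (lt_of_le_of_lt
    (distribution_le_of τ (y := 0) he (by simp) fun z => by simp [h]) ?_)).trans_lt (by simpa using hs)
  exact (ENNReal.ofReal_lt_ofReal_iff (h0.trans_lt ht)).mpr ht

theorem singularNumber_eq_zero_of_trace_lt (τ : Trace M) (x : Fn M) {t : ℝ} (ht : (τ 1).re < t) :
    singularNumber τ x t = 0 :=
  singularNumber_eq_zero τ (e := 0) (IsStarProjection.zero _) (by simp) (by simpa using ht)

theorem singularNumber_ofM_le (τ : Trace M) (x : Elt M) {t : ℝ} (ht : 0 < t) :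
    singularNumber τ (ofM τ x) t ≤ ENNReal.ofReal ‖x‖ := by
  refine ENNReal.le_of_forall_pos_le_add fun ε hε _ => ?_
  have h1 : distribution τ (ofM τ x) (‖x‖ + ε) < ENNReal.ofReal t := by
    refine lt_of_le_of_lt (distribution_le_of τ (y := x) (IsStarProjection.one _) (by simp)
      fun z => by simp [ofM_apply]) (by simpa using ht)
  refine (singularNumber_le_of τ (by positivity) h1).trans ?_
  rw [ENNReal.ofReal_add (norm_nonneg _) ε.coe_nonneg, ENNReal.ofReal_coe_nnreal]

theorem lpNorm_ofM_lt_top (τ : Trace M) {p : ℝ} (hp : 0 < p) (x : Elt M) :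
    lpNorm τ p (ofM τ x) < ∞ := by
  refine ENNReal.rpow_lt_top_of_nonneg (by positivity) (ne_of_lt ?_)
  calc ∫⁻ t in Ioi (0 : ℝ), singularNumber τ (ofM τ x) t ^ p
      ≤ ∫⁻ t in Ioi (0 : ℝ), (Iic (τ 1).re).indicator (fun _ => ENNReal.ofReal ‖x‖ ^ p) t := by
        refine setLIntegral_mono' measurableSet_Ioi fun t ht => ?_
        by_cases h : t ∈ Iic (τ 1).re
        · rw [indicator_of_mem h]
          exact ENNReal.rpow_le_rpow (singularNumber_ofM_le τ x ht) hp.le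
        · rw [indicator_of_notMem h, singularNumber_eq_zero_of_trace_lt τ _ (not_le.mp h),
            ENNReal.zero_rpow_of_pos hp]
    _ < ∞ := by
        rw [lintegral_indicator measurableSet_Iic, setLIntegral_const, Measure.restrict_apply measurableSet_Iic, Iic_inter_Ioi, Real.volume_Ioc]
        exact ENNReal.mul_lt_top (ENNReal.rpow_lt_top_of_nonneg hp.le ENNReal.ofReal_ne_top)
          ENNReal.ofReal_lt_top

theorem ofM_mem_Lp (τ : Trace M) {p : ℝ} (hp : 0 < p) (x : Elt M) : ofM τ x ∈ Lp τ p :=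
  ⟨ofM_mem_L1 τ x, lpNorm_ofM_lt_top τ hp x⟩

/-- Chebyshev's inequality. -/
theorem distribution_ofM_le (τ : Trace M) (x : Elt M) {s : ℝ} (hs : 0 < s) :
    distribution τ (ofM τ x) s ≤ ENNReal.ofReal (‖toL2 τ x‖ ^ 2 / s ^ 2) := by
  have ha : IsSelfAdjoint (star x * x) := IsSelfAdjoint.star_mul_self x
  obtain ⟨e, he, -, -, h1, h2⟩ := exists_projection_bounds ha (s ^ 2)
  have hf := he.one_sub
  refine (distribution_le_of τ (y := x * (1 - e)) hf ?_ fun z => ?_).trans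
    (ENNReal.ofReal_le_ofReal ?_)
  · refine norm_le_of_star_mul_self_le hs.le ?_
    rw [star_mul, hf.isSelfAdjoint.star_eq]
    calc _ = (1 - e) * (star x * x) * (1 - e) := by simp only [mul_assoc]
      _ ≤ ((s ^ 2 : ℝ) : ℂ) • (1 - e) := h2
      _ ≤ ((s ^ 2 : ℝ) : ℂ) • 1 := by
        rw [← sub_nonneg, ← smul_sub, sub_sub_cancel, ← algebraMap_mul_eq_smul,
          Algebra.algebraMap_eq_smul_one, smul_mul_assoc, one_mul]
        exact smul_nonneg (by positivity) he.nonneg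
      _ = _ := by rw [← algebraMap_mul_eq_smul, mul_one]
  · rw [ofM_apply, mul_assoc]
  · rw [sub_sub_cancel, le_div_iff₀ (by positivity), norm_toL2_sq, mul_comm]
    have h3 := τ.mono h1
    rw [map_smul, smul_eq_mul, Complex.re_ofReal_mul] at h3
    refine h3.trans ?_
    have h4 : τ (e * (star x * x) * e) = τ (star (x * e) * (x * e)) := by
      rw [star_mul, he.isSelfAdjoint.star_eq]; simp only [mul_assoc]
    rw [h4, ← norm_toL2_sq, ← norm_toL2_sq]
    gcongr
    have := norm_toL2_mul_le' τ x e
    exact this.trans (mul_le_of_le_one_right (norm_nonneg _) (IsStarProjection.norm_le_one he))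

theorem singularNumber_ofM_le_div (τ : Trace M) (x : Elt M) {t : ℝ} (ht : 0 < t) :
    singularNumber τ (ofM τ x) t ≤ ENNReal.ofReal (‖toL2 τ x‖ * t ^ (-(1 / 2) : ℝ)) := by
  refine ENNReal.le_of_forall_pos_le_add fun ε hε _ => ?_
  set A := ‖toL2 τ x‖ * t ^ (-(1 / 2) : ℝ)
  have hA : 0 ≤ A := by positivity
  have hAt : ‖toL2 τ x‖ ^ 2 = A ^ 2 * t := by
    simp only [A]
    rw [mul_pow, ← Real.rpow_natCast (t ^ (-(1 / 2) : ℝ)), ← Real.rpow_mul ht.le]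
    norm_num
    rw [Real.rpow_neg_one, mul_assoc, inv_mul_cancel₀ ht.ne', mul_one]
  have hε' : (0 : ℝ) < ε := hε
  have h1 : distribution τ (ofM τ x) (A + ε) < ENNReal.ofReal t := by
    refine (distribution_ofM_le τ x (by positivity)).trans_lt ?_
    rw [ENNReal.ofReal_lt_ofReal_iff ht, div_lt_iff₀ (by positivity), hAt, mul_comm]
    gcongr
    linarith
  refine (singularNumber_le_of τ (by positivity) h1).trans ?_
  rw [ENNReal.ofReal_add hA ε.coe_nonneg, ENNReal.ofReal_coe_nnreal]

/-- The norm of `L₁(M)` defined through singular numbers is continuous for `‖·‖₂`, since `μ_t(x) ≤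
t^{-1/2} ‖x‖₂` and `μ_t(x) = 0` for `t > τ(1)`. -/
theorem lpNorm_one_ofM_le (τ : Trace M) : ∃ C : ℝ≥0, ∀ x : Elt M,
    lpNorm τ 1 (ofM τ x) ≤ C * ENNReal.ofReal ‖toL2 τ x‖ := by
  set T := (τ 1).re
  have hT : 0 ≤ T := τ.nonneg zero_le_one
  have hint : ∫⁻ t in Ioc 0 T, ENNReal.ofReal (t ^ (-(1 / 2) : ℝ)) < ∞ := by
    have h1 : IntervalIntegrable (fun t : ℝ => t ^ (-(1 / 2) : ℝ)) volume 0 T :=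
      intervalIntegral.intervalIntegrable_rpow' (by norm_num)
    rw [intervalIntegrable_iff_integrableOn_Ioc_of_le hT] at h1
    exact h1.lintegral_lt_top
  refine ⟨(∫⁻ t in Ioc 0 T, ENNReal.ofReal (t ^ (-(1 / 2) : ℝ))).toNNReal, fun x => ?_⟩
  rw [ENNReal.coe_toNNReal hint.ne, lpNorm, one_div_one, ENNReal.rpow_one]
  simp only [ENNReal.rpow_one]
  rw [mul_comm, ← lintegral_const_mul' _ _ ENNReal.ofReal_ne_top]
  rw [← lintegral_indicator measurableSet_Ioi, ← lintegral_indicator measurableSet_Ioc]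
  refine lintegral_mono fun t => ?_
  by_cases h0 : t ∈ Ioi (0 : ℝ)
  · rw [indicator_of_mem h0]
    by_cases h : t ≤ T
    · rw [indicator_of_mem (show t ∈ Ioc 0 T from ⟨h0, h⟩), ← ENNReal.ofReal_mul (norm_nonneg _)]
      exact singularNumber_ofM_le_div τ x h0
    · rw [singularNumber_eq_zero_of_trace_lt τ _ (not_le.mp h)]
      exact zero_le
  · rw [indicator_of_notMem h0]; exact zero_le

theorem singularNumber_lt_top (τ : Trace M) {p : ℝ} (hp : 0 < p) {x : Fn M}
    (hx : lpNorm τ p x < ∞) {t : ℝ} (ht : 0 < t) : singularNumber τ x t < ∞ := by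
  by_contra h
  rw [not_lt, top_le_iff] at h
  have h1 : ∫⁻ t in Ioi (0 : ℝ), singularNumber τ x t ^ p = ∞ := by
    rw [eq_top_iff]
    calc (∞ : ℝ≥0∞) = ∫⁻ s in Ioc 0 t, ∞ := by
          rw [setLIntegral_const, Real.volume_Ioc, ENNReal.top_mul (by simpa using ht)]
      _ ≤ ∫⁻ s in Ioc 0 t, singularNumber τ x s ^ p := by
          refine setLIntegral_mono' measurableSet_Ioc fun s hs => ?_
          have : singularNumber τ x s = ∞ := top_le_iff.mp (h ▸ singularNumber_anti τ x hs.2)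
          rw [this, ENNReal.top_rpow_of_pos hp]
      _ ≤ _ := lintegral_mono_set fun s hs => hs.1
  rw [lpNorm, h1, ENNReal.top_rpow_of_pos (by positivity)] at hx
  exact lt_irrefl _ hx

/-- Cutting off the large values of an element of `L_p(M)` leaves a remainder of small norm, and
of small support. -/
theorem exists_cutoff (τ : Trace M) {p : ℝ} (hp : 0 < p) {x : Fn M} (hx : lpNorm τ p x < ∞)
    {δ : ℝ} (hδ : 0 < δ) : ∃ e y : Elt M, IsStarProjection e ∧ rightMul x e = ofM τ y ∧
      (τ (1 - e)).re ≤ δ ∧ lpNorm τ p (rightMul x (1 - e)) ≤ 2⁻¹ * lpNorm τ p x := by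
  -- any bound `s > μ_{δ'}(x)` provides a projection `e` with `τ(1 - e) < δ'` on which `x` is
  -- bounded
  have key : ∀ δ' > 0, ∃ e y : Elt M, IsStarProjection e ∧ rightMul x e = ofM τ y ∧
      (τ (1 - e)).re < δ' := by
    intro δ' hδ'
    have h1 := singularNumber_lt_top τ hp hx hδ'
    obtain ⟨s, hs1, -⟩ := ENNReal.lt_iff_exists_nnreal_btwn.mp h1
    have h2 := distribution_lt_of_singularNumber_lt τ (s := s) (by simpa using hs1)
    obtain ⟨e, y, he, -, hxy, hlt⟩ := exists_of_distribution_lt τ h2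
    exact ⟨e, y, he, by ext z; exact hxy z, (ENNReal.ofReal_lt_ofReal_iff hδ').mp hlt⟩
  rcases eq_or_ne (lpNorm τ p x) 0 with h0 | h0
  · obtain ⟨e, y, he, hxy, hlt⟩ := key δ hδ
    refine ⟨e, y, he, hxy, hlt.le, ?_⟩
    refine (lpNorm_rightMul_le τ hp x (IsStarProjection.norm_le_one he.one_sub)).trans ?_
    rw [h0]; exact zero_le
  set I := ∫⁻ t in Ioi (0 : ℝ), singularNumber τ x t ^ p with hI
  have hIx : lpNorm τ p x = I ^ (1 / p) := rfl
  have hI0 : I ≠ 0 := fun h => h0 (by rw [hIx, h, ENNReal.zero_rpow_of_pos (by positivity)])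
  have hIt : I ≠ ∞ := fun h => by
    rw [hIx, h, ENNReal.top_rpow_of_pos (by positivity)] at hx; exact lt_irrefl _ hx
  -- the remainder `x (1 - e)` has singular numbers at most `μ_t(x)`, vanishing for `t > τ(1 - e)`,
  -- so that absolute continuity of the integral of `μ_t(x)^p` gives the bound
  obtain ⟨η, hη0, hη⟩ := exists_pos_setLIntegral_lt_of_measure_lt
    (μ := volume.restrict (Ioi (0 : ℝ))) hIt (ε := (2⁻¹ : ℝ≥0∞) ^ p * I)
    (mul_ne_zero (by simp) hI0)
  obtain ⟨η', hη'0, hη'⟩ := ENNReal.lt_iff_exists_nnreal_btwn.mp hη0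
  have hη'0' : (0 : ℝ) < η' := by exact_mod_cast hη'0
  obtain ⟨e, y, he, hxy, hlt⟩ := key (min δ η') (by positivity)
  refine ⟨e, y, he, hxy, hlt.le.trans (min_le_left _ _), ?_⟩
  have hf := he.one_sub
  have h1 : ∫⁻ t in Ioi (0 : ℝ), singularNumber τ (rightMul x (1 - e)) t ^ p ≤
      (2⁻¹ : ℝ≥0∞) ^ p * I := by
    refine le_trans ?_ (hη (Iic (τ (1 - e)).re) ?_).le
    · rw [← lintegral_indicator measurableSet_Iic]
      refine setLIntegral_mono' measurableSet_Ioi fun t ht => ?_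
      by_cases h : t ≤ (τ (1 - e)).re
      · rw [indicator_of_mem (show t ∈ Iic (τ (1 - e)).re from h)]
        exact ENNReal.rpow_le_rpow (singularNumber_rightMul_le τ x
          (IsStarProjection.norm_le_one hf) t) hp.le
      · rw [singularNumber_eq_zero τ he (fun z => ?_) (not_le.mp h), ENNReal.zero_rpow_of_pos hp]
        · exact zero_le
        · rw [rightMul_apply, ← mul_assoc, sub_mul, one_mul, he.isIdempotentElem.eq, sub_self,
            zero_mul, map_zero]
    · rw [Measure.restrict_apply measurableSet_Iic, Iic_inter_Ioi, Real.volume_Ioc, sub_zero]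
      refine lt_trans ?_ hη'
      rw [← ENNReal.ofReal_coe_nnreal, ENNReal.ofReal_lt_ofReal_iff hη'0']
      exact hlt.trans_le (min_le_right _ _)
  calc _ ≤ ((2⁻¹ : ℝ≥0∞) ^ p * I) ^ (1 / p) := ENNReal.rpow_le_rpow h1 (by positivity)
    _ = _ := by
      rw [ENNReal.mul_rpow_of_nonneg _ _ (by positivity), ← ENNReal.rpow_mul,
        mul_one_div_cancel hp.ne', ENNReal.rpow_one, hIx]

/-! ### Norms on sequences -/

/-- A translation invariant norm with the Fatou property on the sequences `ℤ → [0, ∞]`. It stands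
for the norm of `ℓ^q(ℤ)` or of `ℓ^∞(ℤ)`, that is, for the second index of the Lorentz spaces
`L_q = L_{q,q}` and `L_{q,∞}`. -/
structure SeqNorm where
  /-- the norm of a sequence -/
  toFun : (ℤ → ℝ≥0∞) → ℝ≥0∞
  mono : ∀ {u v}, (∀ k, u k ≤ v k) → toFun u ≤ toFun v
  add_le : ∀ u v, toFun (fun k => u k + v k) ≤ toFun u + toFun v
  smul_le : ∀ (c : ℝ≥0∞) u, toFun (fun k => c * u k) ≤ c * toFun u
  shift_le : ∀ (d : ℤ) u, toFun (fun k => u (k - d)) ≤ toFun u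
  coord_le : ∀ u k, u k ≤ toFun u
  single_lt_top : toFun (Pi.single 0 1) < ∞
  fatou : ∀ {ι : Type} {l : Filter ι} [l.NeBot] (u : ι → ℤ → ℝ≥0∞) (v : ℤ → ℝ≥0∞) (B : ℝ≥0∞),
    (∀ k, Tendsto (fun i => u i k) l (𝓝 (v k))) → (∀ i, toFun (u i) ≤ B) → toFun v ≤ B

instance : CoeFun SeqNorm (fun _ => (ℤ → ℝ≥0∞) → ℝ≥0∞) := ⟨SeqNorm.toFun⟩

/-- The norm of `ℓ^q(ℤ)`. -/
def SeqNorm.lq (q : ℝ) (hq : 1 ≤ q) : SeqNorm where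
  toFun u := (∑' k, u k ^ q) ^ (1 / q)
  mono h := by
    have hq0 : 0 < q := zero_lt_one.trans_le hq
    gcongr
    exact h _
  add_le u v := by
    have := ENNReal.lintegral_Lp_add_le (μ := Measure.count) (f := u) (g := v)
      (measurable_of_countable _).aemeasurable (measurable_of_countable _).aemeasurable hq
    simpa [lintegral_count] using this
  smul_le c u := by
    have hq0 : 0 < q := zero_lt_one.trans_le hq
    simp only [ENNReal.mul_rpow_of_nonneg _ _ hq0.le]
    rw [ENNReal.tsum_mul_left, ENNReal.mul_rpow_of_nonneg _ _ (by positivity), ← ENNReal.rpow_mul,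
      mul_one_div_cancel hq0.ne', ENNReal.rpow_one]
  shift_le d u := by
    exact (congrArg (· ^ (1 / q)) ((Equiv.subRight d).tsum_eq (fun k => u k ^ q))).le
  coord_le u k := by
    have hq0 : 0 < q := zero_lt_one.trans_le hq
    calc u k = (u k ^ q) ^ (1 / q) := by
          rw [← ENNReal.rpow_mul, mul_one_div_cancel hq0.ne', ENNReal.rpow_one]
      _ ≤ _ := ENNReal.rpow_le_rpow (ENNReal.le_tsum k) (by positivity)
  single_lt_top := by
    have hq0 : 0 < q := zero_lt_one.trans_le hq
    rw [tsum_eq_single 0 fun k hk => by simp [hk, hq0]]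
    simp
  fatou {ι l _} u v B hlim hB := by
    have hq0 : 0 < q := zero_lt_one.trans_le hq
    rw [one_div, ENNReal.rpow_inv_le_iff hq0]
    rw [ENNReal.tsum_eq_iSup_sum]
    refine iSup_le fun F => ?_
    refine le_of_tendsto (f := fun i => ∑ k ∈ F, u i k ^ q) (x := l) (tendsto_finsetSum _ fun k _ =>
      ((ENNReal.continuous_rpow_const).tendsto _).comp (hlim k)) (Eventually.of_forall fun i => ?_)
    refine (ENNReal.sum_le_tsum F).trans ?_
    rw [← ENNReal.rpow_inv_le_iff hq0, ← one_div]
    exact hB i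

/-- The norm of `ℓ^∞(ℤ)`. -/
def SeqNorm.sup : SeqNorm where
  toFun u := ⨆ k, u k
  mono h := iSup_mono h
  add_le u v := iSup_le fun k => add_le_add (le_iSup u k) (le_iSup v k)
  smul_le c u := by rw [ENNReal.mul_iSup]
  shift_le d u := iSup_le fun k => le_iSup u (k - d)
  coord_le u k := le_iSup u k
  single_lt_top := by
    refine (iSup_le fun k => ?_ : _ ≤ (1 : ℝ≥0∞)).trans_lt ENNReal.one_lt_top
    rcases eq_or_ne k 0 with rfl | h <;> simp [*]
  fatou u v B hlim hB := iSup_le fun k =>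
    le_of_tendsto' (hlim k) fun i => (le_iSup (u i) k).trans (hB i)

namespace SeqNorm

variable (N : SeqNorm)

theorem zero_eq : N (fun _ => 0) = 0 := by
  have := N.smul_le 0 (fun _ => 0)
  simpa using this

theorem sum_le {ι : Type*} (F : Finset ι) (u : ι → ℤ → ℝ≥0∞) :
    N (fun k => ∑ i ∈ F, u i k) ≤ ∑ i ∈ F, N (u i) := by
  classical
  induction F using Finset.induction_on with
  | empty => simp [N.zero_eq]
  | insert i F hi ih =>
    simp only [Finset.sum_insert hi]
    exact (N.add_le _ _).trans (by gcongr)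

theorem tsum_le {ι : Type} (u : ι → ℤ → ℝ≥0∞) :
    N (fun k => ∑' i, u i k) ≤ ∑' i, N (u i) :=
  N.fatou (l := (atTop : Filter (Finset ι))) (fun F k => ∑ i ∈ F, u i k) _ _
    (fun _ => ENNReal.summable.hasSum) fun F => (N.sum_le F u).trans (ENNReal.sum_le_tsum F)

/-- Young's inequality for the convolution with a summable sequence. -/
theorem convolution_le (c u : ℤ → ℝ≥0∞) :
    N (fun k => ∑' d, c d * u (k - d)) ≤ (∑' d, c d) * N u := by
  refine (N.tsum_le _).trans ?_
  rw [← ENNReal.tsum_mul_right]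
  refine ENNReal.tsum_le_tsum fun d => ?_
  exact (N.smul_le _ _).trans (mul_le_mul_right (N.shift_le d u) _)

theorem lt_top_of_tsum_lt_top {c : ℤ → ℝ≥0∞} (hc : ∑' d, c d < ∞) : N c < ∞ := by
  have h := N.convolution_le c (Pi.single 0 1)
  have h2 : (fun k : ℤ => ∑' d, c d * (Pi.single 0 1 : ℤ → ℝ≥0∞) (k - d)) = c := by
    ext k
    rw [tsum_eq_single k fun d hd => by
      rw [Pi.single_eq_of_ne (sub_ne_zero.mpr hd.symm), mul_zero]]
    simp
  rw [h2] at h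
  exact h.trans_lt (ENNReal.mul_lt_top hc N.single_lt_top)

end SeqNorm

/-! ### The `K`-functional -/

/-- The `K`-functional of the couple `(L₁(M), M)`, in its dual form: the supremum of `|x(z)|` over
the elements `z` of `M` with `‖z‖_∞ ≤ 1` and `‖z‖₁ ≤ t`. -/
def kFun (τ : Trace M) (t : ℝ) (x : Fn M) : ℝ≥0∞ :=
  ⨆ (z : Elt M) (_ : ‖z‖ ≤ 1) (_ : ‖ofM τ z‖ ≤ t), ‖x z‖ₑ

theorem le_kFun (τ : Trace M) {t : ℝ} (x : Fn M) {z : Elt M} (h1 : ‖z‖ ≤ 1) (h2 : ‖ofM τ z‖ ≤ t) :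
    ‖x z‖ₑ ≤ kFun τ t x :=
  le_iSup_of_le z (le_iSup_of_le h1 (le_iSup_of_le h2 le_rfl))

theorem kFun_le (τ : Trace M) {t : ℝ} {x : Fn M} {C : ℝ≥0∞}
    (h : ∀ z : Elt M, ‖z‖ ≤ 1 → ‖ofM τ z‖ ≤ t → ‖x z‖ₑ ≤ C) : kFun τ t x ≤ C :=
  iSup_le fun z => iSup_le fun h1 => iSup_le fun h2 => h z h1 h2

theorem kFun_add_le (τ : Trace M) (t : ℝ) (x y : Fn M) :
    kFun τ t (x + y) ≤ kFun τ t x + kFun τ t y :=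
  kFun_le τ fun z h1 h2 => (enorm_add_le (x z) (y z)).trans
    (add_le_add (le_kFun τ x h1 h2) (le_kFun τ y h1 h2))

theorem kFun_smul_le (τ : Trace M) (t : ℝ) (c : ℂ) (x : Fn M) :
    kFun τ t (c • x) ≤ ‖c‖ₑ * kFun τ t x :=
  kFun_le τ fun z h1 h2 => by
    change ‖c • x z‖ₑ ≤ _
    rw [enorm_smul]
    gcongr
    exact le_kFun τ x h1 h2

theorem enorm_apply_le_kFun (τ : Trace M) {t c : ℝ} (hc : 0 < c) (x : Fn M) {z : Elt M}
    (h1 : ‖z‖ ≤ c) (h2 : ‖ofM τ z‖ ≤ c * t) : ‖x z‖ₑ ≤ ENNReal.ofReal c * kFun τ t x := by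
  have hcn : ‖((c⁻¹ : ℝ) : ℂ)‖ = c⁻¹ := by
    rw [Complex.norm_real, Real.norm_of_nonneg (by positivity)]
  have h3 := le_kFun τ (t := t) x (z := ((c⁻¹ : ℝ) : ℂ) • z)
    (by rw [norm_smul, hcn, inv_mul_le_iff₀ hc, mul_one]; exact h1)
    (by
      have : ofM τ (((c⁻¹ : ℝ) : ℂ) • z) = ((c⁻¹ : ℝ) : ℂ) • ofM τ z := by
        ext; simp [ofM_apply]
      rw [this, norm_smul, hcn, inv_mul_le_iff₀ hc]; exact h2)
  have h4 : z = (c : ℂ) • ((c⁻¹ : ℝ) : ℂ) • z := by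
    rw [smul_smul, ← Complex.ofReal_mul, mul_inv_cancel₀ hc.ne', Complex.ofReal_one, one_smul]
  rw [h4, map_smul, enorm_smul]
  have h5 : ‖(c : ℂ)‖ₑ = ENNReal.ofReal c := by
    rw [← ofReal_norm, Complex.norm_real, Real.norm_of_nonneg hc.le]
  rw [h5]
  gcongr

/-- The function `t ↦ K(t, x) / t` is nonincreasing. -/
theorem kFun_le_div_mul (τ : Trace M) (x : Fn M) {t t' : ℝ} (ht : 0 < t) (h : t ≤ t') :
    kFun τ t' x ≤ ENNReal.ofReal (t' / t) * kFun τ t x :=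
  kFun_le τ fun z h1 h2 => enorm_apply_le_kFun τ (div_pos (ht.trans_le h) ht) x
    (h1.trans ((one_le_div ht).mpr h)) (by rwa [div_mul_cancel₀ _ ht.ne'])

theorem kFun_star_mul_self_le (τ : Trace M) {t : ℝ} (b : Elt M) {s D : ℝ}
    (hs : ‖b‖ ^ 2 ≤ s) (hD : ‖toL2 τ b‖ ^ 2 ≤ D) :
    kFun τ t (ofM τ (star b * b)) ≤ ENNReal.ofReal (min (s * t) D) := by
  refine kFun_le τ fun z h1 h2 => ?_
  rw [← ofReal_norm]
  refine ENNReal.ofReal_le_ofReal (le_min ?_ ?_)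
  · refine (norm_trace_mul_le_ofM' τ _ _).trans ?_
    rw [CStarRing.norm_star_mul_self, ← sq]
    exact mul_le_mul hs h2 (norm_nonneg _) ((sq_nonneg _).trans hs)
  · refine (norm_trace_mul_le_ofM τ _ _).trans ?_
    have := norm_ofM_star_mul_self_le τ b
    rw [← norm_toL2_sq] at this
    calc _ ≤ ‖toL2 τ b‖ ^ 2 * 1 := mul_le_mul this h1 (norm_nonneg _) (by positivity)
      _ ≤ D := by rwa [mul_one]

/-! ### Domination of a family of functionals -/

/-- Positivity of a functional on `M`. -/
def IsPositiveFn (G : Fn M) : Prop := ∀ z, 0 ≤ (G (z * star z)).re ∧ (G (z * star z)).im = 0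

/-- `|φ_j(z₁ z₂*)|² ≤ G₂(z₁ z₁*) G₁(z₂ z₂*)` for all `j`: formally, `φ_j = G₁^{1/2} y_j G₂^{1/2}`
with `‖y_j‖ ≤ 1`. -/
def Majorizes {J : Type*} (G₁ G₂ : Fn M) (φ : J → Fn M) : Prop :=
  ∀ j z₁ z₂, ‖φ j (z₁ * star z₂)‖ ^ 2 ≤ (G₂ (z₁ * star z₁)).re * (G₁ (z₂ * star z₂)).re

/-- The family `φ` is majorized by two positive functionals whose `K`-functionals at the dyadic
points are bounded by the sequence `κ`. -/
def DominatedBy (τ : Trace M) (κ : ℤ → ℝ≥0∞) {J : Type*} (φ : J → Fn M) : Prop :=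
  ∃ G₁ G₂ : Fn M, IsPositiveFn G₁ ∧ IsPositiveFn G₂ ∧
    (∀ k : ℤ, kFun τ (2 ^ k) G₁ ≤ κ k) ∧ (∀ k : ℤ, kFun τ (2 ^ k) G₂ ≤ κ k) ∧ Majorizes G₁ G₂ φ

/-- The discretized Lorentz norm: the sequence `2^{k(1/q-1)} κ_k`, for `κ_k = K(2^k, x)`, measured
in the sequence norm `N`. -/
def lorentz (N : SeqNorm) (q : ℝ) (κ : ℤ → ℝ≥0∞) : ℝ≥0∞ :=
  N fun k => (2 : ℝ≥0∞) ^ ((k : ℝ) * (1 / q - 1)) * κ k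

/-- `DominatedBy` for a sequence `κ` of Lorentz norm at most `B`. -/
def Dominated (τ : Trace M) (N : SeqNorm) (q : ℝ) (B : ℝ≥0∞) {J : Type*} (φ : J → Fn M) : Prop :=
  ∃ κ, lorentz N q κ ≤ B ∧ DominatedBy τ κ φ

variable {J : Type*}

theorem IsPositiveFn.add {G G' : Fn M} (h : IsPositiveFn G) (h' : IsPositiveFn G') :
    IsPositiveFn (G + G') := fun z => by
  have h1 := h z
  have h2 := h' z
  simp only [add_apply, Complex.add_re, Complex.add_im]
  exact ⟨add_nonneg h1.1 h2.1, by rw [h1.2, h2.2, add_zero]⟩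

theorem IsPositiveFn.smul {G : Fn M} (h : IsPositiveFn G) {c : ℝ} (hc : 0 ≤ c) :
    IsPositiveFn ((c : ℂ) • G) := fun z => by
  have h1 := h z
  simp only [smul_apply, smul_eq_mul, Complex.re_ofReal_mul, Complex.im_ofReal_mul]
  exact ⟨mul_nonneg hc h1.1, by rw [h1.2, mul_zero]⟩

theorem IsPositiveFn.ofM_star_mul_self (τ : Trace M) (b : Elt M) :
    IsPositiveFn (ofM τ (star b * b)) := fun z => by
  have h : ofM τ (star b * b) (z * star z) = τ (star (b * z) * (b * z)) := by
    rw [ofM_apply, star_mul, ← mul_assoc, τ.tracial]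
    simp only [mul_assoc]
  rw [h]
  exact ⟨τ.re_nonneg _, τ.im_zero _⟩

/-- By the Cauchy–Schwarz inequality for the weights, `√(ab) + √(cd) ≤ √((a + c)(b + d))`. -/
theorem Majorizes.add {G₁ G₂ G₁' G₂' : Fn M} {φ ψ : J → Fn M}
    (h1 : IsPositiveFn G₁) (h2 : IsPositiveFn G₂) (h1' : IsPositiveFn G₁')
    (h2' : IsPositiveFn G₂') (h : Majorizes G₁ G₂ φ) (h' : Majorizes G₁' G₂' ψ) :
    Majorizes (G₁ + G₁') (G₂ + G₂') (fun j => φ j + ψ j) := by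
  intro j z₁ z₂
  simp only [add_apply, Complex.add_re]
  have a1 := (h1 z₂).1
  have a2 := (h2 z₁).1
  have a3 := (h1' z₂).1
  have a4 := (h2' z₁).1
  have m1 := h j z₁ z₂
  have m2 := h' j z₁ z₂
  set x := ‖φ j (z₁ * star z₂)‖
  set y := ‖ψ j (z₁ * star z₂)‖
  generalize (G₁ (z₂ * star z₂)).re = a at *
  generalize (G₂ (z₁ * star z₁)).re = b at *
  generalize (G₁' (z₂ * star z₂)).re = c at *
  generalize (G₂' (z₁ * star z₁)).re = d at *
  have hx : 0 ≤ x := norm_nonneg _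
  have hy : 0 ≤ y := norm_nonneg _
  have h3 : ‖φ j (z₁ * star z₂) + ψ j (z₁ * star z₂)‖ ^ 2 ≤ (x + y) ^ 2 := by
    gcongr; exact norm_add_le _ _
  have h4 : x * y ≤ (a * d + b * c) / 2 := by
    refine abs_le_of_sq_le_sq' ?_ (by positivity) |>.2
    have : (x * y) ^ 2 ≤ (b * a) * (d * c) := by
      rw [mul_pow]; exact mul_le_mul m1 m2 (by positivity) (by positivity)
    nlinarith [sq_nonneg (a * d - b * c)]
  nlinarith

theorem DominatedBy.add {τ : Trace M} {κ κ' : ℤ → ℝ≥0∞} {φ ψ : J → Fn M}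
    (h : DominatedBy τ κ φ) (h' : DominatedBy τ κ' ψ) :
    DominatedBy τ (fun k => κ k + κ' k) (fun j => φ j + ψ j) := by
  obtain ⟨G₁, G₂, p1, p2, k1, k2, m⟩ := h
  obtain ⟨G₁', G₂', p1', p2', k1', k2', m'⟩ := h'
  exact ⟨G₁ + G₁', G₂ + G₂', p1.add p1', p2.add p2',
    fun k => (kFun_add_le τ _ _ _).trans (add_le_add (k1 k) (k1' k)),
    fun k => (kFun_add_le τ _ _ _).trans (add_le_add (k2 k) (k2' k)), m.add p1 p2 p1' p2' m'⟩

theorem DominatedBy.zero {τ : Trace M} : DominatedBy τ (fun _ => 0) (fun _ : J => (0 : Fn M)) :=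
  ⟨0, 0, fun z => by simp, fun z => by simp, fun k => kFun_le τ fun z _ _ => by simp,
    fun k => kFun_le τ fun z _ _ => by simp, fun j z₁ z₂ => by simp⟩

theorem DominatedBy.sum {ι : Type*} {τ : Trace M} {κ : ι → ℤ → ℝ≥0∞} {φ : ι → J → Fn M}
    (F : Finset ι) (h : ∀ i ∈ F, DominatedBy τ (κ i) (φ i)) :
    DominatedBy τ (fun k => ∑ i ∈ F, κ i k) (fun j => ∑ i ∈ F, φ i j) := by
  classical
  induction F using Finset.induction_on with
  | empty => simpa using DominatedBy.zero
  | insert i F hi ih =>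
    simp only [Finset.sum_insert hi]
    exact (h i (Finset.mem_insert_self _ _)).add (ih fun i hi => h i (Finset.mem_insert_of_mem hi))

theorem DominatedBy.smul {τ : Trace M} {κ : ℤ → ℝ≥0∞} {φ : J → Fn M} (h : DominatedBy τ κ φ)
    {C : ℝ} (hC : 0 ≤ C) (c : J → ℂ) (hc : ∀ j, ‖c j‖ ≤ C) :
    DominatedBy τ (fun k => ENNReal.ofReal C * κ k) (fun j => c j • φ j) := by
  obtain ⟨G₁, G₂, p1, p2, k1, k2, m⟩ := h
  have hn : ‖(C : ℂ)‖ₑ = ENNReal.ofReal C := by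
    rw [← ofReal_norm, Complex.norm_real, Real.norm_of_nonneg hC]
  refine ⟨(C : ℂ) • G₁, (C : ℂ) • G₂, p1.smul hC, p2.smul hC, fun k => ?_, fun k => ?_,
    fun j z₁ z₂ => ?_⟩
  · refine (kFun_smul_le τ _ _ _).trans ?_
    rw [hn]; exact mul_le_mul_right (k1 k) _
  · refine (kFun_smul_le τ _ _ _).trans ?_
    rw [hn]; exact mul_le_mul_right (k2 k) _
  · simp only [smul_apply, smul_eq_mul, Complex.re_ofReal_mul, norm_mul]
    have h1 := m j z₁ z₂
    calc _ = ‖c j‖ ^ 2 * ‖φ j (z₁ * star z₂)‖ ^ 2 := by ring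
      _ ≤ C ^ 2 * ((G₂ (z₁ * star z₁)).re * (G₁ (z₂ * star z₂)).re) := by
        gcongr; exact hc j
      _ = _ := by ring

theorem lorentz_add_le (N : SeqNorm) (q : ℝ) (κ κ' : ℤ → ℝ≥0∞) :
    lorentz N q (fun k => κ k + κ' k) ≤ lorentz N q κ + lorentz N q κ' := by
  refine le_trans (le_of_eq ?_) (N.add_le _ _)
  simp only [lorentz, mul_add]

theorem lorentz_smul_le (N : SeqNorm) (q : ℝ) (c : ℝ≥0∞) (κ : ℤ → ℝ≥0∞) :
    lorentz N q (fun k => c * κ k) ≤ c * lorentz N q κ := by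
  refine le_trans (le_of_eq ?_) (N.smul_le _ _)
  simp only [lorentz, mul_left_comm]

theorem Dominated.mono {τ : Trace M} {N : SeqNorm} {q : ℝ} {B B' : ℝ≥0∞} {φ : J → Fn M}
    (h : Dominated τ N q B φ) (hB : B ≤ B') : Dominated τ N q B' φ := by
  obtain ⟨κ, h1, h2⟩ := h
  exact ⟨κ, h1.trans hB, h2⟩

theorem Dominated.add {τ : Trace M} {N : SeqNorm} {q : ℝ} {B B' : ℝ≥0∞} {φ ψ : J → Fn M}
    (h : Dominated τ N q B φ) (h' : Dominated τ N q B' ψ) :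
    Dominated τ N q (B + B') (fun j => φ j + ψ j) := by
  obtain ⟨κ, h1, h2⟩ := h
  obtain ⟨κ', h1', h2'⟩ := h'
  exact ⟨_, (lorentz_add_le N q κ κ').trans (add_le_add h1 h1'), h2.add h2'⟩

theorem Dominated.zero {τ : Trace M} {N : SeqNorm} {q : ℝ} :
    Dominated τ N q 0 (fun _ : J => (0 : Fn M)) :=
  ⟨fun _ => 0, by simp [lorentz, N.zero_eq], DominatedBy.zero⟩

theorem Dominated.sum {ι : Type*} {τ : Trace M} {N : SeqNorm} {q : ℝ} {B : ι → ℝ≥0∞}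
    {φ : ι → J → Fn M} (F : Finset ι) (h : ∀ i ∈ F, Dominated τ N q (B i) (φ i)) :
    Dominated τ N q (∑ i ∈ F, B i) (fun j => ∑ i ∈ F, φ i j) := by
  classical
  induction F using Finset.induction_on with
  | empty => simpa using Dominated.zero
  | insert i F hi ih =>
    simp only [Finset.sum_insert hi]
    exact (h i (Finset.mem_insert_self _ _)).add (ih fun i hi => h i (Finset.mem_insert_of_mem hi))

theorem Dominated.smul {τ : Trace M} {N : SeqNorm} {q : ℝ} {B : ℝ≥0∞} {φ : J → Fn M}
    (h : Dominated τ N q B φ) {C : ℝ} (hC : 0 ≤ C) (c : J → ℂ) (hc : ∀ j, ‖c j‖ ≤ C) :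
    Dominated τ N q (ENNReal.ofReal C * B) (fun j => c j • φ j) := by
  obtain ⟨κ, h1, h2⟩ := h
  exact ⟨_, (lorentz_smul_le N q _ κ).trans (by gcongr), h2.smul hC c hc⟩

/-- A product `a b` of elements of `M` is majorized by `a a*` and `b* b`. -/
theorem dominatedBy_ofM_mul (τ : Trace M) (a b : Elt M) {s D : ℝ} (ha : ‖a‖ ^ 2 ≤ s)
    (hb : ‖b‖ ^ 2 ≤ s) (ha2 : ‖toL2 τ a‖ ^ 2 ≤ D) (hb2 : ‖toL2 τ b‖ ^ 2 ≤ D) :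
    DominatedBy τ (fun k => ENNReal.ofReal (min (s * 2 ^ k) D))
      (fun _ : J => ofM τ (a * b)) := by
  refine ⟨ofM τ (a * star a), ofM τ (star b * b), ?_, IsPositiveFn.ofM_star_mul_self τ b,
    fun k => ?_, fun k => kFun_star_mul_self_le τ b hb hb2, fun j z₁ z₂ => ?_⟩
  · simpa using IsPositiveFn.ofM_star_mul_self τ (star a)
  · simpa using kFun_star_mul_self_le τ (t := 2 ^ k) (star a) (by rwa [norm_star])
      (by rwa [norm_toL2_star])
  · have h1 : ofM τ (a * b) (z₁ * star z₂) = τ (star z₂ * a * (b * z₁)) := by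
      rw [ofM_apply, ← mul_assoc, τ.tracial]; simp only [mul_assoc]
    have h2 : (ofM τ (star b * b) (z₁ * star z₁)).re = ‖toL2 τ (b * z₁)‖ ^ 2 := by
      rw [norm_toL2_sq, ofM_apply, star_mul, ← mul_assoc, τ.tracial]; simp only [mul_assoc]
    have h3 : (ofM τ (a * star a) (z₂ * star z₂)).re = ‖toL2 τ (star z₂ * a)‖ ^ 2 := by
      rw [← norm_toL2_star, norm_toL2_sq, ofM_apply, ← mul_assoc, τ.tracial]
      simp only [star_mul, star_star, mul_assoc]
    rw [h1, h2, h3, ← mul_pow, mul_comm ‖toL2 τ (b * z₁)‖]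
    gcongr
    exact norm_trace_mul_le τ _ _

theorem enorm_le_kFun (τ : Trace M) {t : ℝ} (ht : ‖ofM τ 1‖ ≤ t) (G : Fn M) :
    ‖G‖ₑ ≤ kFun τ t G := by
  rw [ContinuousLinearMap.opENorm_le_iff]
  intro x
  rcases eq_or_ne x 0 with rfl | hx
  · simp
  rw [mul_comm, ← ofReal_norm x]
  refine enorm_apply_le_kFun τ (norm_pos_iff.mpr hx) G le_rfl ?_
  have := norm_ofM_mul_le τ x 1
  rw [mul_one] at this
  exact this.trans (by gcongr)

theorem weight_ne_zero (q : ℝ) (k : ℤ) : (2 : ℝ≥0∞) ^ ((k : ℝ) * (1 / q - 1)) ≠ 0 := by simp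

theorem weight_ne_top (q : ℝ) (k : ℤ) : (2 : ℝ≥0∞) ^ ((k : ℝ) * (1 / q - 1)) ≠ ∞ :=
  ENNReal.rpow_ne_top_of_ne_zero (by simp) (by simp)

theorem le_lorentz (N : SeqNorm) (q : ℝ) (κ : ℤ → ℝ≥0∞) (k : ℤ) :
    κ k ≤ ((2 : ℝ≥0∞) ^ ((k : ℝ) * (1 / q - 1)))⁻¹ * lorentz N q κ := by
  have h1 : (2 : ℝ≥0∞) ^ ((k : ℝ) * (1 / q - 1)) * κ k ≤ lorentz N q κ :=
    N.coord_le (fun k => (2 : ℝ≥0∞) ^ ((k : ℝ) * (1 / q - 1)) * κ k) k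
  rw [← ENNReal.mul_le_mul_iff_right (weight_ne_zero q k) (weight_ne_top q k)]
  rwa [← mul_assoc, ENNReal.mul_inv_cancel (weight_ne_zero q k) (weight_ne_top q k), one_mul]

theorem exists_enorm_le_lorentz (τ : Trace M) (q : ℝ) : ∃ R : ℝ≥0, ∀ (N : SeqNorm)
    (κ : ℤ → ℝ≥0∞) (G : Fn M), (∀ k : ℤ, kFun τ (2 ^ k) G ≤ κ k) → ‖G‖ₑ ≤ R * lorentz N q κ := by
  obtain ⟨n, hn⟩ := pow_unbounded_of_one_lt ‖ofM τ 1‖ (one_lt_two (α := ℝ))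
  refine ⟨((2 : ℝ≥0∞) ^ (((n : ℤ) : ℝ) * (1 / q - 1)))⁻¹.toNNReal, fun N κ G hG => ?_⟩
  rw [ENNReal.coe_toNNReal (ENNReal.inv_ne_top.mpr (weight_ne_zero q n))]
  exact (enorm_le_kFun τ (by rw [zpow_natCast]; exact hn.le) G).trans
    ((hG n).trans (le_lorentz N q κ n))

theorem IsPositiveFn.re_apply_le {G : Fn M} (z : Elt M) :
    (G (z * star z)).re ≤ ‖G‖ * ‖z‖ ^ 2 := by
  refine (Complex.re_le_norm _).trans ((G.le_opNorm _).trans_eq ?_)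
  rw [CStarRing.norm_self_mul_star, sq]

theorem Majorizes.norm_le {G₁ G₂ : Fn M} {φ : J → Fn M} (h : Majorizes G₁ G₂ φ) {C : ℝ}
    (hC : 0 ≤ C) (h1 : ‖G₁‖ ≤ C) (h2 : ‖G₂‖ ≤ C) (hp : IsPositiveFn G₁) (j : J) : ‖φ j‖ ≤ C := by
  refine ContinuousLinearMap.opNorm_le_bound _ hC fun z => ?_
  have h3 := h j z 1
  simp only [star_one, mul_one] at h3
  refine abs_le_of_sq_le_sq' ?_ (by positivity) |>.2
  have hone : ‖(1 : Elt M)‖ ≤ 1 := IsStarProjection.norm_le_one (IsStarProjection.one _)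
  have h4 : (G₁ (1 * star 1)).re ≤ C * 1 := by
    refine (IsPositiveFn.re_apply_le 1).trans ?_
    have : ‖(1 : Elt M)‖ ^ 2 ≤ 1 := pow_le_one₀ (norm_nonneg _) hone
    exact mul_le_mul h1 this (by positivity) hC
  have h5 : (G₂ (z * star z)).re ≤ C * ‖z‖ ^ 2 :=
    (IsPositiveFn.re_apply_le z).trans (by gcongr)
  have h6 := (hp 1).1
  rw [star_one, mul_one] at h4 h6
  calc _ ≤ _ := h3
    _ ≤ (C * ‖z‖ ^ 2) * (C * 1) := by gcongr
    _ = _ := by ring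

theorem exists_norm_le_of_dominated (τ : Trace M) (N : SeqNorm) (q : ℝ) : ∃ R : ℝ≥0,
    ∀ (B : ℝ≥0) (J : Type) (φ : J → Fn M), Dominated τ N q B φ → ∀ j, ‖φ j‖ ≤ R * B := by
  obtain ⟨R, hR⟩ := exists_enorm_le_lorentz τ q
  refine ⟨R, fun B J φ ⟨κ, hκ, G₁, G₂, p1, p2, k1, k2, m⟩ j => ?_⟩
  have key : ∀ G : Fn M, (∀ k : ℤ, kFun τ (2 ^ k) G ≤ κ k) → ‖G‖ ≤ R * B := fun G hG => by
    have h1 : ‖G‖ₑ ≤ R * B := (hR N κ G hG).trans (by gcongr)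
    rw [← enorm_norm, ← ofReal_norm, norm_norm] at h1
    exact (ENNReal.ofReal_le_iff_le_toReal (by finiteness)).mp h1 |>.trans_eq (by simp)
  exact m.norm_le (by positivity) (key _ k1) (key _ k2) p1 j

/-- The set of families dominated by a given bound is closed for pointwise convergence: the
majorants converge weakly along an ultrafilter. -/
theorem Dominated.of_tendsto {τ : Trace M} {N : SeqNorm} {q : ℝ} {B : ℝ≥0}
    {ψ : ℕ → J → Fn M} {φ : J → Fn M} (h : ∀ n, Dominated τ N q B (ψ n))
    (hlim : ∀ j z, Tendsto (fun n => ψ n j z) atTop (𝓝 (φ j z))) : Dominated τ N q B φ := by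
  obtain ⟨R, hR⟩ := exists_enorm_le_lorentz τ q
  choose κ hκ G₁ G₂ p1 p2 k1 k2 m using h
  let U : Ultrafilter ℕ := Filter.hyperfilter ℕ
  have hU : (U : Filter ℕ) ≤ atTop := Nat.hyperfilter_le_atTop
  -- the majorants are bounded in norm by a multiple of `B`, hence converge along `U` in the weak*
  -- topology of the dual of `M`
  have key : ∀ G : ℕ → Fn M, (∀ n (k : ℤ), kFun τ (2 ^ k) (G n) ≤ κ n k) →
      ∃ G' : Fn M, ∀ z, Tendsto (fun n => G n z) U (𝓝 (G' z)) := by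
    intro G hG
    have hb : ∀ n, ‖G n‖ ≤ R * B := fun n => by
      have h1 : ‖G n‖ₑ ≤ R * B := (hR N _ _ (hG n)).trans (by gcongr; exact hκ n)
      rw [← ofReal_norm] at h1
      exact (ENNReal.ofReal_le_iff_le_toReal (by finiteness)).mp h1 |>.trans_eq (by simp)
    obtain ⟨G', -, hG'⟩ := (WeakDual.isCompact_closedBall (𝕜 := ℂ) (0 : Fn M)
      (R * B)).ultrafilter_le_nhds (U.map fun n => StrongDual.toWeakDual (G n)) (by
        rw [le_principal_iff, Ultrafilter.mem_coe, Ultrafilter.mem_map]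
        refine univ_mem' fun n => ?_
        have : G n ∈ Metric.closedBall (0 : Fn M) (R * B) := by simpa using hb n
        exact this)
    refine ⟨WeakDual.toStrongDual G', fun z => ?_⟩
    exact ((WeakDual.eval_continuous z).tendsto G').comp hG'
  obtain ⟨G₁', h1⟩ := key G₁ k1
  obtain ⟨G₂', h2⟩ := key G₂ k2
  have hpos : ∀ (G : ℕ → Fn M) (G' : Fn M), (∀ n, IsPositiveFn (G n)) →
      (∀ z, Tendsto (fun n => G n z) U (𝓝 (G' z))) → IsPositiveFn G' := by
    intro G G' hp hG z
    have hre := (Complex.continuous_re.tendsto _).comp (hG (z * star z))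
    have him := (Complex.continuous_im.tendsto _).comp (hG (z * star z))
    refine ⟨ge_of_tendsto' hre fun n => (hp n z).1, tendsto_nhds_unique him ?_⟩
    refine tendsto_const_nhds.congr fun n => ?_
    exact ((hp n z).2).symm
  -- the bounds for the `K`-functionals converge in the compact space `[0, ∞]`; the Fatou property
  -- keeps their Lorentz norm below `B`
  let κ' : ℤ → ℝ≥0∞ := fun k => (U.map fun n => κ n k).lim
  have hκ' : ∀ k, Tendsto (fun n => κ n k) U (𝓝 (κ' k)) := fun k => Ultrafilter.le_nhds_lim _
  have hk : ∀ (G : ℕ → Fn M) (G' : Fn M), (∀ n (k : ℤ), kFun τ (2 ^ k) (G n) ≤ κ n k) →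
      (∀ z, Tendsto (fun n => G n z) U (𝓝 (G' z))) → ∀ k : ℤ, kFun τ (2 ^ k) G' ≤ κ' k := by
    intro G G' hG hlim k
    refine kFun_le τ fun z hz1 hz2 => ?_
    exact le_of_tendsto_of_tendsto' ((continuous_enorm.tendsto _).comp (hlim z)) (hκ' k)
      fun n => (le_kFun τ _ hz1 hz2).trans (hG n k)
  refine ⟨κ', ?_, G₁', G₂', hpos _ _ p1 h1, hpos _ _ p2 h2, hk _ _ k1 h1, hk _ _ k2 h2,
    fun j z₁ z₂ => ?_⟩
  · exact N.fatou (l := (U : Filter ℕ)) _ _ _ (fun k => ENNReal.Tendsto.const_mul (hκ' k)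
      (Or.inr (weight_ne_top q k))) hκ
  · refine le_of_tendsto_of_tendsto' (((hlim j (z₁ * star z₂)).mono_left hU).norm.pow 2)
      (((Complex.continuous_re.tendsto _).comp (h2 (z₁ * star z₁))).mul
        ((Complex.continuous_re.tendsto _).comp (h1 (z₂ * star z₂)))) fun n => m n j z₁ z₂

/-! ### Domination of an element of `L₂(M)` by its singular numbers -/

/-- The kernel `2^{d/q} min(1, 2^{1-d})` of the Hardy operator on dyadic sequences. -/
def hardyKernel (q : ℝ) (d : ℤ) : ℝ≥0∞ :=
  (2 : ℝ≥0∞) ^ ((d : ℝ) / q) * min 1 ((2 : ℝ≥0∞) ^ (1 - (d : ℝ)))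

theorem tsum_int_lt_top {c : ℤ → ℝ≥0∞} {C a : ℝ≥0∞} (hC : C < ∞) (ha : a < 1)
    (h1 : ∀ n : ℕ, c n ≤ C * a ^ n) (h2 : ∀ n : ℕ, c (-(n + 1)) ≤ C * a ^ n) : ∑' d, c d < ∞ := by
  have hg : ∑' n : ℕ, C * a ^ n < ∞ := by
    rw [ENNReal.tsum_mul_left, ENNReal.tsum_geometric]
    exact ENNReal.mul_lt_top hC (ENNReal.inv_lt_top.mpr (tsub_pos_of_lt ha))
  rw [tsum_of_nat_of_neg_add_one ENNReal.summable ENNReal.summable]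
  exact ENNReal.add_lt_top.mpr ⟨(ENNReal.tsum_le_tsum h1).trans_lt hg,
    (ENNReal.tsum_le_tsum h2).trans_lt hg⟩

theorem two_rpow_lt_one {x : ℝ} (hx : x < 0) : (2 : ℝ≥0∞) ^ x < 1 :=
  ENNReal.rpow_lt_one_of_one_lt_of_neg (by norm_num) hx

theorem two_rpow_mul_nat (x : ℝ) (n : ℕ) : (2 : ℝ≥0∞) ^ (x * n) = ((2 : ℝ≥0∞) ^ x) ^ n := by
  rw [ENNReal.rpow_mul, ENNReal.rpow_natCast]

/-- The kernel decays geometrically in both directions: like `2^{-d (1 - 1/q)}` for `d → ∞`, where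
`q > 1` is needed, and like `2^{-|d|/q}` for `d → -∞`. -/
theorem tsum_hardyKernel_lt_top {q : ℝ} (hq : 1 < q) : ∑' d, hardyKernel q d < ∞ := by
  have hq0 : 0 < q := zero_lt_one.trans hq
  have hq1 : 1 / q < 1 := by rw [div_lt_one hq0]; exact hq
  have hq2 : 0 < 1 / q := by positivity
  refine tsum_int_lt_top (C := 2) (a := max ((2 : ℝ≥0∞) ^ (1 / q - 1)) ((2 : ℝ≥0∞) ^ (-(1 / q))))
    (by simp) (max_lt (two_rpow_lt_one (by linarith)) (two_rpow_lt_one (by linarith)))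
    (fun n => ?_) (fun n => ?_)
  · calc _ ≤ (2 : ℝ≥0∞) ^ (((n : ℤ) : ℝ) / q) * (2 : ℝ≥0∞) ^ (1 - ((n : ℤ) : ℝ)) :=
        mul_le_mul_right (min_le_right _ _) _
      _ = 2 * ((2 : ℝ≥0∞) ^ (1 / q - 1)) ^ n := by
        rw [← two_rpow_mul_nat, ← ENNReal.rpow_add _ _ (by simp) (by simp)]
        nth_rewrite 2 [← ENNReal.rpow_one 2]
        rw [← ENNReal.rpow_add _ _ (by simp) (by simp)]
        congr 1
        push_cast; ring
      _ ≤ _ := by gcongr; exact le_max_left _ _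
  · calc _ ≤ (2 : ℝ≥0∞) ^ (((-(n + 1) : ℤ) : ℝ) / q) * 1 := mul_le_mul_right (min_le_left _ _) _
      _ = 2 ^ (-(1 / q)) * ((2 : ℝ≥0∞) ^ (-(1 / q))) ^ n := by
        rw [← two_rpow_mul_nat, ← ENNReal.rpow_add _ _ (by simp) (by simp), mul_one]
        congr 1
        push_cast; ring
      _ ≤ _ := by
        gcongr
        · exact (two_rpow_lt_one (by linarith)).le.trans (by norm_num)
        · exact le_max_right _ _

theorem ofReal_two_zpow (k : ℤ) : ENNReal.ofReal ((2 : ℝ) ^ k) = (2 : ℝ≥0∞) ^ (k : ℝ) := by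
  rw [← Real.rpow_intCast, ← ENNReal.ofReal_rpow_of_pos (by norm_num)]
  simp

theorem norm_toL2_projection_sq (τ : Trace M) {f : Elt M} (hf : IsStarProjection f) :
    ‖toL2 τ f‖ ^ 2 = (τ f).re := by
  rw [norm_toL2_sq, hf.isSelfAdjoint.star_eq, hf.isIdempotentElem.eq]

/-- If the values `s_k` dominate the singular numbers `μ_{2^k}(g)` of `g ∈ L₂(M)`, then the constant
family `g` is dominated, with a bound given by the Lorentz norm of `s`. The projections `e_k` with
`‖g e_k‖ ≤ s_k` and `τ(1 - e_k) < 2^k` need not commute; the telescoping decomposition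
`g = g e_{K} + g e_{K-1} f_{K} + g e_{K-2} f_{K-1} f_K + ⋯`, with `f_k = 1 - e_k`, makes up for
that. -/
theorem dominated_const (τ : Trace M) (N : SeqNorm) {q : ℝ} (η : L2 τ)
    (s : ℤ → ℝ) (hs : ∀ k, 0 < s k)
    (hd : ∀ k : ℤ, distribution τ (ofL2 τ η) (s k) < ENNReal.ofReal (2 ^ k)) {B : ℝ≥0}
    (hB : (∑' d, hardyKernel q d) *
      N (fun k => (2 : ℝ≥0∞) ^ ((k : ℝ) / q) * ENNReal.ofReal (s k)) ≤ B) :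
    Dominated τ N q B (fun _ : J => ofL2 τ η) := by
  choose e y he hy hgy htr using fun k => exists_of_distribution_lt τ (hd k)
  have htr' : ∀ k : ℤ, (τ (1 - e k)).re ≤ 2 ^ k := fun k =>
    ((ENNReal.ofReal_lt_ofReal_iff (by positivity)).mp (htr k)).le
  obtain ⟨K, hK⟩ := pow_unbounded_of_one_lt (τ 1).re (one_lt_two (α := ℝ))
  -- the projections `F n` and the products `W n = F n ⋯ F 0`
  obtain ⟨F, hF0, hFs⟩ : ∃ F : ℕ → Elt M, F 0 = 1 ∧ ∀ n : ℕ, F (n + 1) = 1 - e ((K : ℤ) - 1 - n) :=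
    ⟨fun n => Nat.casesOn n 1 fun n => 1 - e ((K : ℤ) - 1 - n), rfl, fun _ => rfl⟩
  have hF : ∀ n, IsStarProjection (F n) := fun n => by
    cases n with
    | zero => rw [hF0]; exact IsStarProjection.one _
    | succ n => rw [hFs]; exact (he _).one_sub
  have hFtr : ∀ n : ℕ, (τ (F n)).re ≤ 2 ^ ((K : ℤ) - n) := fun n => by
    cases n with
    | zero => simpa [hF0] using hK.le
    | succ n =>
      have := htr' ((K : ℤ) - 1 - n)
      have h2 : (K : ℤ) - 1 - n = K - ((n + 1 : ℕ) : ℤ) := by push_cast; ring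
      rw [hFs, ← h2]
      exact this
  obtain ⟨W, hW0, hWs⟩ : ∃ W : ℕ → Elt M, W 0 = 1 ∧ ∀ n, W (n + 1) = F (n + 1) * W n :=
    ⟨fun n => Nat.rec 1 (fun n w => F (n + 1) * w) n, rfl, fun _ => rfl⟩
  have hFW : ∀ n, F n * W n = W n := fun n => by
    cases n with
    | zero => rw [hF0, hW0, mul_one]
    | succ n => rw [hWs, ← mul_assoc, (hF (n + 1)).isIdempotentElem.eq]
  have hFn : ∀ n, ‖F n‖ ≤ 1 := fun n => IsStarProjection.norm_le_one (hF n)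
  have hWn : ∀ n, ‖W n‖ ≤ 1 := fun n => by
    induction n with
    | zero => rw [hW0, ← hF0]; exact hFn 0
    | succ n ih =>
      rw [hWs]
      exact (norm_mul_le _ _).trans (mul_le_one₀ (hFn _) (norm_nonneg _) ih)
  have hF2 : ∀ n : ℕ, ‖toL2 τ (F n)‖ ^ 2 ≤ 2 ^ ((K : ℤ) - n) := fun n => by
    rw [norm_toL2_projection_sq τ (hF n)]; exact hFtr n
  have hW2 : ∀ n, ‖toL2 τ (W n)‖ ≤ ‖toL2 τ (F n)‖ := fun n => by
    conv_lhs => rw [← hFW n]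
    exact (norm_toL2_mul_le' τ _ _).trans (mul_le_of_le_one_right (norm_nonneg _) (hWn n))
  let k' : ℕ → ℤ := fun n => (K : ℤ) - 1 - n
  have hsplit : ∀ n z, ofL2 τ η (W n * z) =
      τ (y (k' n) * W n * z) + ofL2 τ η (W (n + 1) * z) := fun n z => by
    have h1 : W n * z = e (k' n) * (W n * z) + W (n + 1) * z := by
      rw [hWs, show F (n + 1) = 1 - e (k' n) from hFs n]
      simp only [sub_mul, one_mul, mul_assoc]
      abel
    conv_lhs => rw [h1, map_add, hgy]
    rw [mul_assoc]
  have hsum : ∀ n z, ofL2 τ η z =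
      (∑ i ∈ Finset.range n, ofM τ (y (k' i) * W i)) z + ofL2 τ η (W n * z) := fun n z => by
    induction n with
    | zero => simp [hW0]
    | succ n ih =>
      rw [ih, hsplit, Finset.sum_range_succ, add_apply, ofM_apply]
      ring
  -- each term of the decomposition is majorized with explicit `K`-functionals
  have hterm : ∀ n, DominatedBy τ
      (fun i => ENNReal.ofReal (min (s (k' n) * 2 ^ i) (s (k' n) * 2 ^ ((K : ℤ) - n))))
      (fun _ : J => ofM τ (y (k' n) * W n)) := fun n => by
    have hs0 := hs (k' n)
    have hsq : 0 < √(s (k' n)) := Real.sqrt_pos.mpr hs0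
    have hss : √(s (k' n)) ^ 2 = s (k' n) := Real.sq_sqrt hs0.le
    have hn1 : ‖((√(s (k' n)) : ℝ) : ℂ)‖ = √(s (k' n)) := by
      rw [Complex.norm_real, Real.norm_of_nonneg hsq.le]
    have hn2 : ‖(((√(s (k' n)))⁻¹ : ℝ) : ℂ)‖ = (√(s (k' n)))⁻¹ := by
      rw [Complex.norm_real, Real.norm_of_nonneg (by positivity)]
    have hprod : (((√(s (k' n)))⁻¹ : ℝ) : ℂ) • (y (k' n) * F n) *
        ((√(s (k' n)) : ℝ) : ℂ) • W n = y (k' n) * W n := by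
      rw [smul_mul_smul_comm, ← Complex.ofReal_mul, inv_mul_cancel₀ hsq.ne', Complex.ofReal_one,
        one_smul, mul_assoc, hFW]
    have hyF : ‖y (k' n) * F n‖ ≤ s (k' n) := (norm_mul_le _ _).trans
      ((mul_le_mul (hy _) (hFn n) (norm_nonneg _) hs0.le).trans_eq (mul_one _))
    have hyF2 : ‖toL2 τ (y (k' n) * F n)‖ ≤ s (k' n) * ‖toL2 τ (F n)‖ :=
      (norm_toL2_mul_le τ _ _).trans (by gcongr; exact hy _)
    have hinv : (√(s (k' n)))⁻¹ ^ 2 * s (k' n) ^ 2 = s (k' n) := by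
      rw [inv_pow, hss]; field_simp
    rw [← hprod]
    refine dominatedBy_ofM_mul τ _ _ ?_ ?_ ?_ ?_
    · rw [norm_smul, hn2, mul_pow]
      calc _ ≤ (√(s (k' n)))⁻¹ ^ 2 * s (k' n) ^ 2 := by gcongr
        _ = _ := hinv
    · rw [norm_smul, hn1, mul_pow, hss]
      exact mul_le_of_le_one_right hs0.le (pow_le_one₀ (norm_nonneg _) (hWn n))
    · rw [map_smul, norm_smul, hn2, mul_pow]
      calc _ ≤ (√(s (k' n)))⁻¹ ^ 2 * (s (k' n) * ‖toL2 τ (F n)‖) ^ 2 := by gcongr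
        _ = s (k' n) * ‖toL2 τ (F n)‖ ^ 2 := by rw [mul_pow, ← mul_assoc, hinv]
        _ ≤ _ := by gcongr; exact hF2 n
    · rw [map_smul, norm_smul, hn1, mul_pow, hss]
      gcongr
      exact (pow_le_pow_left₀ (norm_nonneg _) (hW2 n) 2).trans (hF2 n)
  refine Dominated.of_tendsto (ψ := fun n _ => ∑ i ∈ Finset.range n, ofM τ (y (k' i) * W i))
    (fun n => ⟨_, ?_, DominatedBy.sum (Finset.range n) fun i _ => hterm i⟩) fun j z => ?_
  · -- discrete Hardy inequality
    refine le_trans ?_ hB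
    refine le_trans (N.mono fun i => ?_) (N.convolution_le _ _)
    set σ : ℤ → ℝ≥0∞ := fun k => (2 : ℝ≥0∞) ^ ((k : ℝ) / q) * ENNReal.ofReal (s k)
    have h1 : ∀ n : ℕ, (2 : ℝ≥0∞) ^ ((i : ℝ) * (1 / q - 1)) *
        ENNReal.ofReal (min (s (k' n) * 2 ^ i) (s (k' n) * 2 ^ ((K : ℤ) - n))) =
        hardyKernel q (i - k' n) * σ (k' n) := fun n => by
      rw [← mul_min_of_nonneg _ _ (hs _).le, ENNReal.ofReal_mul (hs _).le, ENNReal.ofReal_min,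
        ofReal_two_zpow, ofReal_two_zpow, hardyKernel]
      have h2 : min ((2 : ℝ≥0∞) ^ (i : ℝ)) ((2 : ℝ≥0∞) ^ (((K : ℤ) - n : ℤ) : ℝ)) =
          (2 : ℝ≥0∞) ^ (i : ℝ) * min 1 ((2 : ℝ≥0∞) ^ (1 - ((i - k' n : ℤ) : ℝ))) := by
        rw [mul_min, mul_one, ← ENNReal.rpow_add _ _ (by simp) (by simp)]
        congr 2
        simp only [k']
        push_cast; ring
      rw [h2]
      have h3 : (2 : ℝ≥0∞) ^ ((i : ℝ) * (1 / q - 1)) * (2 : ℝ≥0∞) ^ (i : ℝ) =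
          (2 : ℝ≥0∞) ^ (((i - k' n : ℤ) : ℝ) / q) * (2 : ℝ≥0∞) ^ ((k' n : ℝ) / q) := by
        rw [← ENNReal.rpow_add _ _ (by simp) (by simp), ← ENNReal.rpow_add _ _ (by simp) (by simp)]
        congr 1
        push_cast; ring
      simp only [σ]
      calc _ = ((2 : ℝ≥0∞) ^ ((i : ℝ) * (1 / q - 1)) * (2 : ℝ≥0∞) ^ (i : ℝ)) *
            (ENNReal.ofReal (s (k' n)) * min 1 ((2 : ℝ≥0∞) ^ (1 - ((i - k' n : ℤ) : ℝ)))) := by ring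
        _ = _ := by rw [h3]; ring
    rw [Finset.mul_sum, Finset.sum_congr rfl fun n _ => h1 n]
    refine (ENNReal.sum_le_tsum _).trans ?_
    have hinj : Function.Injective fun n : ℕ => i - k' n := fun a b hab => by
      simp only [k'] at hab; omega
    refine le_trans (le_of_eq (tsum_congr fun n => ?_))
      (ENNReal.tsum_comp_le_tsum_of_injective hinj fun d => hardyKernel q d * σ (i - d))
    simp
  · have h1 : Tendsto (fun n => ofL2 τ η (W n * z)) atTop (𝓝 0) := by
      have h2 : ∀ n, ‖ofL2 τ η (W n * z)‖ ≤ ‖toL2 τ (F n)‖ * (‖z‖ * ‖η‖) := fun n => by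
        rw [ofL2_apply]
        refine (norm_inner_le_norm _ _).trans ?_
        rw [norm_toL2_star, ← mul_assoc]
        gcongr
        exact (norm_toL2_mul_le' τ _ _).trans (by gcongr; exact hW2 n)
      refine squeeze_zero_norm h2 ?_
      rw [← zero_mul (‖z‖ * ‖η‖)]
      refine Tendsto.mul_const _ ?_
      have h3 : Tendsto (fun n : ℕ => √((2 : ℝ) ^ K * (1 / 2) ^ n)) atTop (𝓝 0) := by
        have := (tendsto_pow_atTop_nhds_zero_of_lt_one (r := (1 / 2 : ℝ)) (by norm_num)
          (by norm_num)).const_mul ((2 : ℝ) ^ K)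
        rw [mul_zero] at this
        have h4 := (Real.continuous_sqrt.tendsto _).comp this
        rwa [Real.sqrt_zero] at h4
      refine squeeze_zero (fun n => norm_nonneg _) (fun n => ?_) h3
      refine Real.le_sqrt_of_sq_le ((hF2 n).trans_eq ?_)
      rw [zpow_sub₀ (by norm_num), zpow_natCast, zpow_natCast, one_div, inv_pow, div_eq_mul_inv]
    have h2 : Tendsto (fun n => ofL2 τ η z - ofL2 τ η (W n * z)) atTop (𝓝 (ofL2 τ η z)) := by
      simpa using h1.const_sub (ofL2 τ η z)
    refine h2.congr fun n => ?_
    rw [hsum n z, add_sub_cancel_right]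

/-- Domination of an element of `L₂(M)` in terms of its singular numbers at the dyadic points. -/
theorem exists_dominated_const (τ : Trace M) (N : SeqNorm) {q : ℝ} (hq : 1 < q) :
    ∃ C : ℝ≥0, ∀ (J : Type) (η : L2 τ) (b : ℝ≥0), 0 < b →
      N (fun k : ℤ => (2 : ℝ≥0∞) ^ ((k : ℝ) / q) * singularNumber τ (ofL2 τ η) (2 ^ k)) ≤ b →
      Dominated τ N q (C * b : ℝ≥0) (fun _ : J => ofL2 τ η) := by
  have hK := tsum_hardyKernel_lt_top hq
  -- the bounds of `dominated_const` have to exceed the singular numbers strictly, even where these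
  -- vanish: add a small positive sequence `b 2^{-k/q} g k`, with `N g < ∞`
  let g : ℤ → ℝ≥0∞ := fun k => (2 : ℝ≥0∞) ^ (-(|k| : ℝ))
  have hg : N g < ∞ := by
    refine N.lt_top_of_tsum_lt_top (tsum_int_lt_top (C := 1) (a := 2⁻¹) (by simp) (by norm_num)
      (fun n => ?_) fun n => ?_)
    · simp only [g, one_mul]
      rw [← ENNReal.rpow_neg_one, ← two_rpow_mul_nat]
      simp
    · simp only [g, one_mul]
      rw [← ENNReal.rpow_neg_one, ← two_rpow_mul_nat]
      refine ENNReal.rpow_le_rpow_of_exponent_le (by norm_num) ?_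
      have : |((-((n : ℤ) + 1) : ℤ) : ℝ)| = n + 1 := by
        push_cast
        rw [abs_neg, abs_of_nonneg (by positivity)]
      rw [this]; linarith
  refine ⟨((∑' d, hardyKernel q d) * (1 + N g)).toNNReal, fun J η b hb hN => ?_⟩
  have hfin : ∀ k : ℤ, singularNumber τ (ofL2 τ η) (2 ^ k) < ∞ := fun k => by
    have h1 := (N.coord_le _ k).trans hN
    by_contra h
    rw [not_lt, top_le_iff] at h
    simp only [h] at h1
    rw [ENNReal.mul_top (by simp)] at h1
    exact absurd h1 (by simp)
  have hw : ∀ k : ℤ, (2 : ℝ) ^ (-((k : ℝ) / q)) * 2 ^ (-(|k| : ℝ)) > 0 := fun k => by positivity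
  refine dominated_const τ N η
    (fun k => (singularNumber τ (ofL2 τ η) (2 ^ k)).toReal +
      b * (2 ^ (-((k : ℝ) / q)) * 2 ^ (-(|k| : ℝ)))) (fun k => by have := hw k; positivity)
    (fun k => ?_) ?_
  · refine distribution_lt_of_singularNumber_lt τ ?_
    rw [ENNReal.lt_ofReal_iff_toReal_lt (hfin k).ne]
    have := hw k
    have hb' : (0 : ℝ) < b := hb
    nlinarith [mul_pos hb' this]
  · have h1 : ∀ k : ℤ, (2 : ℝ≥0∞) ^ ((k : ℝ) / q) * ENNReal.ofReal
        ((singularNumber τ (ofL2 τ η) (2 ^ k)).toReal +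
          b * (2 ^ (-((k : ℝ) / q)) * 2 ^ (-(|k| : ℝ)))) =
        (2 : ℝ≥0∞) ^ ((k : ℝ) / q) * singularNumber τ (ofL2 τ η) (2 ^ k) + b * g k := fun k => by
      rw [ENNReal.ofReal_add (by positivity) (by positivity), ENNReal.ofReal_toReal (hfin k).ne,
        mul_add, ENNReal.ofReal_mul (by positivity), ENNReal.ofReal_mul (by positivity),
        ← ENNReal.ofReal_rpow_of_pos (by norm_num), ← ENNReal.ofReal_rpow_of_pos (by norm_num),
        ENNReal.ofReal_coe_nnreal]
      simp only [ENNReal.ofReal_ofNat, g]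
      congr 1
      have h2 : (2 : ℝ≥0∞) ^ ((k : ℝ) / q) * (2 : ℝ≥0∞) ^ (-((k : ℝ) / q)) = 1 := by
        rw [← ENNReal.rpow_add _ _ (by simp) (by simp)]; simp
      calc _ = b * ((2 : ℝ≥0∞) ^ ((k : ℝ) / q) * (2 : ℝ≥0∞) ^ (-((k : ℝ) / q))) *
            (2 : ℝ≥0∞) ^ (-(|k| : ℝ)) := by ring
        _ = _ := by rw [h2, mul_one]
    have h3 : N (fun k : ℤ => (2 : ℝ≥0∞) ^ ((k : ℝ) / q) * ENNReal.ofReal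
        ((singularNumber τ (ofL2 τ η) (2 ^ k)).toReal +
          b * (2 ^ (-((k : ℝ) / q)) * 2 ^ (-(|k| : ℝ))))) ≤ b + b * N g := by
      simp only [h1]
      exact (N.add_le _ _).trans (add_le_add hN (N.smul_le _ _))
    rw [ENNReal.coe_mul, ENNReal.coe_toNNReal
      (ENNReal.mul_lt_top hK (ENNReal.add_lt_top.mpr ⟨by simp, hg⟩)).ne]
    calc _ ≤ (∑' d, hardyKernel q d) * (b + b * N g) := by gcongr
      _ = _ := by ring

/-! ### Norms of `L_q(M)` and `L_{q,∞}(M)` as Lorentz norms -/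

theorem pairwise_disjoint_dyadic : Pairwise (Function.onFun Disjoint
    fun k : ℤ => Ioc ((2 : ℝ) ^ (k - 1)) (2 ^ k)) := by
  have h : ∀ i j : ℤ, i < j → Disjoint (Ioc ((2 : ℝ) ^ (i - 1)) (2 ^ i))
      (Ioc ((2 : ℝ) ^ (j - 1)) (2 ^ j)) := fun i j hij => by
    rw [Set.disjoint_left]
    intro t h1 h2
    have : (2 : ℝ) ^ i ≤ 2 ^ (j - 1) := zpow_le_zpow_right₀ (by norm_num) (by omega)
    exact absurd h2.1 (not_lt.mpr (h1.2.trans this))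
  intro i j hij
  rcases lt_or_gt_of_ne hij with h1 | h1
  · exact h i j h1
  · exact (h j i h1).symm

theorem two_mul_zpow_sub_one (k : ℤ) : (2 : ℝ) * 2 ^ (k - 1) = 2 ^ k := by
  rw [← zpow_one_add₀ (by norm_num)]; congr 1; ring

/-- The discretization of `‖x‖_q` at the dyadic points: `μ` is nonincreasing. -/
theorem lq_singularNumber_le (τ : Trace M) {q : ℝ} (hq : 1 ≤ q) (x : Fn M) :
    SeqNorm.lq q hq (fun k : ℤ => (2 : ℝ≥0∞) ^ ((k : ℝ) / q) * singularNumber τ x (2 ^ k)) ≤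
      2 * lpNorm τ q x := by
  have hq0 : 0 < q := zero_lt_one.trans_le hq
  change (∑' k : ℤ, ((2 : ℝ≥0∞) ^ ((k : ℝ) / q) * singularNumber τ x (2 ^ k)) ^ q) ^ (1 / q) ≤ _
  have h1 : ∀ k : ℤ, ((2 : ℝ≥0∞) ^ ((k : ℝ) / q) * singularNumber τ x (2 ^ k)) ^ q ≤
      2 * ∫⁻ t in Ioc ((2 : ℝ) ^ (k - 1)) (2 ^ k), singularNumber τ x t ^ q := fun k => by
    calc _ = ENNReal.ofReal (2 ^ k) * singularNumber τ x (2 ^ k) ^ q := by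
          rw [ENNReal.mul_rpow_of_nonneg _ _ hq0.le, ← ENNReal.rpow_mul, div_mul_cancel₀ _ hq0.ne',
            ofReal_two_zpow]
      _ = 2 * (singularNumber τ x (2 ^ k) ^ q *
            volume (Ioc ((2 : ℝ) ^ (k - 1)) (2 ^ k))) := by
          rw [Real.volume_Ioc]
          have : (2 : ℝ) ^ k - 2 ^ (k - 1) = 2 ^ (k - 1) := by
            rw [← two_mul_zpow_sub_one k]; ring
          rw [this, ← two_mul_zpow_sub_one k, ENNReal.ofReal_mul (by norm_num), ENNReal.ofReal_ofNat]
          ring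
      _ = 2 * ∫⁻ t in Ioc ((2 : ℝ) ^ (k - 1)) (2 ^ k), singularNumber τ x (2 ^ k) ^ q := by
          rw [setLIntegral_const]
      _ ≤ _ := by
          refine mul_le_mul_right (setLIntegral_mono' measurableSet_Ioc fun t ht => ?_) _
          exact ENNReal.rpow_le_rpow (singularNumber_anti τ x ht.2) hq0.le
  calc _ ≤ (2 * ∫⁻ t in Ioi (0 : ℝ), singularNumber τ x t ^ q) ^ (1 / q) := by
        refine ENNReal.rpow_le_rpow ((ENNReal.tsum_le_tsum h1).trans ?_) (by positivity)
        rw [ENNReal.tsum_mul_left, ← lintegral_iUnion (fun _ => measurableSet_Ioc)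
          pairwise_disjoint_dyadic]
        refine mul_le_mul_right (lintegral_mono_set ?_) _
        exact iUnion_subset fun k t ht => lt_trans (by positivity) ht.1
    _ = 2 ^ (1 / q) * lpNorm τ q x := ENNReal.mul_rpow_of_nonneg _ _ (by positivity)
    _ ≤ _ := by
        gcongr
        calc (2 : ℝ≥0∞) ^ (1 / q) ≤ 2 ^ (1 : ℝ) :=
              ENNReal.rpow_le_rpow_of_exponent_le (by norm_num) ((div_le_one hq0).mpr hq)
          _ = 2 := ENNReal.rpow_one _

/-- The discretization of `‖x‖_{r,∞}` at the dyadic points. -/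
theorem sup_singularNumber_le (τ : Trace M) {r : ℝ} (hr : 1 ≤ r) (x : Fn M) :
    SeqNorm.sup (fun k : ℤ => (2 : ℝ≥0∞) ^ ((k : ℝ) / r) * singularNumber τ x (2 ^ k)) ≤
      2 * weakNorm τ r x := by
  have hr0 : 0 < r := zero_lt_one.trans_le hr
  refine (iSup_le fun k => ?_ : _ ≤ weakNorm τ r x).trans (le_mul_of_one_le_left zero_le (by norm_num))
  set W := weakNorm τ r x
  rcases eq_or_ne W ∞ with hW | hW
  · rw [hW]; exact le_top
  set w : ℝ≥0∞ := (2 : ℝ≥0∞) ^ ((k : ℝ) / r) with hw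
  change w * singularNumber τ x (2 ^ k) ≤ W
  have hw0 : w ≠ 0 := by simp [w]
  have hwt : w ≠ ∞ := ENNReal.rpow_ne_top_of_ne_zero (by simp) (by simp)
  rw [mul_comm, ← ENNReal.le_div_iff_mul_le (Or.inl hw0) (Or.inl hwt)]
  refine le_of_forall_gt fun c hc => ?_
  obtain ⟨s, hs1, hs2⟩ := ENNReal.lt_iff_exists_nnreal_btwn.mp hc
  have hs0 : (0 : ℝ) < s := by
    have := lt_of_le_of_lt zero_le hs1
    exact_mod_cast this
  refine (singularNumber_le_of τ hs0 ?_).trans_lt (by simpa using hs2)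
  have h1 : ENNReal.ofReal s * distribution τ x s ^ (1 / r) ≤ W :=
    le_iSup_of_le (s : ℝ) (le_iSup_of_le hs0 le_rfl)
  rw [ENNReal.div_lt_iff (Or.inl hw0) (Or.inl hwt)] at hs1
  rw [ENNReal.ofReal_coe_nnreal] at h1
  have h2 := h1.trans_lt hs1
  have h3 : distribution τ x s ^ (1 / r) < w := by
    by_contra! h
    exact absurd h2 (not_lt.mpr (by gcongr))
  have h4 : w = ENNReal.ofReal (2 ^ k) ^ (1 / r) := by
    rw [ofReal_two_zpow, ← ENNReal.rpow_mul, mul_one_div]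
  rw [h4] at h3
  exact (ENNReal.rpow_lt_rpow_iff (by positivity)).mp h3

/-- The relation between the spectral distribution of `a` and the functional `G`, formally equal to
`a²`: the projection `f = 1_{(s,∞)}(a)` satisfies `s² τ(f) ≤ G(f)`. -/
def SqControlled (τ : Trace M) (a : L2 τ) (G : Fn M) : Prop :=
  ∀ s : ℝ, 0 < s → ∃ T : ℝ, distribution τ (ofL2 τ a) s ≤ ENNReal.ofReal T ∧
    ENNReal.ofReal (s ^ 2) * ENNReal.ofReal T ≤ kFun τ T G

/-- Formally `μ_t(a)² = μ_t(G) ≤ K(t, G) / t`. -/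
theorem SqControlled.singularNumber_sq_le {τ : Trace M} {a : L2 τ} {G : Fn M}
    (h : SqControlled τ a G) {t : ℝ} (ht : 0 < t) :
    singularNumber τ (ofL2 τ a) t ^ (2 : ℝ) ≤ ENNReal.ofReal t⁻¹ * kFun τ t G := by
  rw [← ENNReal.le_rpow_inv_iff (by norm_num)]
  refine le_of_forall_lt fun c hc => ?_
  obtain ⟨s', hs1', hs2'⟩ := ENNReal.lt_iff_exists_nnreal_btwn.mp hc
  obtain ⟨s, hs1, hs2⟩ := ENNReal.lt_iff_exists_nnreal_btwn.mp hs2'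
  have hs0 : (0 : ℝ) < s := by
    have := lt_of_le_of_lt zero_le hs1
    exact_mod_cast this
  obtain ⟨T, hT1, hT2⟩ := h s hs0
  have htT : t ≤ T := by
    by_contra! hlt
    have h1 : distribution τ (ofL2 τ a) s < ENNReal.ofReal t :=
      hT1.trans_lt ((ENNReal.ofReal_lt_ofReal_iff ht).mpr hlt)
    have h2 := singularNumber_le_of τ hs0 h1
    rw [ENNReal.ofReal_coe_nnreal] at h2
    exact absurd hs2 (not_lt.mpr h2)
  have hT0 : 0 < T := ht.trans_le htT
  refine (hs1'.trans hs1).trans_le ?_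
  rw [ENNReal.le_rpow_inv_iff (by norm_num)]
  have h3 := hT2.trans (kFun_le_div_mul τ G ht htT)
  have h4 : ENNReal.ofReal (T / t) = ENNReal.ofReal T * ENNReal.ofReal t⁻¹ := by
    rw [div_eq_mul_inv, ENNReal.ofReal_mul hT0.le]
  rw [h4, mul_comm, mul_assoc, ENNReal.mul_le_mul_iff_right (by simpa using hT0) (by simp)] at h3
  refine le_trans (le_of_eq ?_) h3
  rw [← ENNReal.ofReal_coe_nnreal, ENNReal.ofReal_rpow_of_pos hs0, Real.rpow_ofNat]

theorem ofReal_inv_zpow (k : ℤ) : ENNReal.ofReal ((2 : ℝ) ^ k)⁻¹ = (2 : ℝ≥0∞) ^ (-(k : ℝ)) := by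
  rw [← zpow_neg, ofReal_two_zpow]; push_cast; rfl

/-- If `G` is formally `a²`, the norm of `a` in `L_{2q}(M)` is the square root of the norm of `G` in
`L_q(M)`. -/
theorem lpNorm_le_of_sqControlled {τ : Trace M} {q : ℝ} (hq : 1 ≤ q) {a : L2 τ} {G : Fn M}
    (h : SqControlled τ a G) {κ : ℤ → ℝ≥0∞} (hκ : ∀ k : ℤ, kFun τ (2 ^ k) G ≤ κ k) :
    lpNorm τ (2 * q) (ofL2 τ a) ≤ (2 * lorentz (SeqNorm.lq q hq) q κ) ^ (1 / 2 : ℝ) := by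
  have hq0 : 0 < q := zero_lt_one.trans_le hq
  have h1 : ∀ k : ℤ, ∫⁻ t in Ioc ((2 : ℝ) ^ (k - 1)) (2 ^ k),
      singularNumber τ (ofL2 τ a) t ^ (2 * q) ≤
      ((2 : ℝ≥0∞) ^ (((k - 1 : ℤ) : ℝ) * (1 / q - 1)) * κ (k - 1)) ^ q := fun k => by
    calc _ ≤ ∫⁻ t in Ioc ((2 : ℝ) ^ (k - 1)) (2 ^ k),
          ((2 : ℝ≥0∞) ^ (-((k - 1 : ℤ) : ℝ)) * κ (k - 1)) ^ q := by
          refine setLIntegral_mono' measurableSet_Ioc fun t ht => ?_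
          rw [ENNReal.rpow_mul]
          refine ENNReal.rpow_le_rpow ?_ hq0.le
          calc _ ≤ singularNumber τ (ofL2 τ a) (2 ^ (k - 1)) ^ (2 : ℝ) :=
                ENNReal.rpow_le_rpow (singularNumber_anti τ _ ht.1.le) (by norm_num)
            _ ≤ _ := h.singularNumber_sq_le (by positivity)
            _ ≤ _ := by rw [ofReal_inv_zpow]; gcongr; exact hκ _
      _ = ((2 : ℝ≥0∞) ^ (-((k - 1 : ℤ) : ℝ)) * κ (k - 1)) ^ q *
            (2 : ℝ≥0∞) ^ ((k - 1 : ℤ) : ℝ) := by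
          rw [setLIntegral_const, Real.volume_Ioc, ← ofReal_two_zpow, ← two_mul_zpow_sub_one k]
          congr 2; ring
      _ = _ := by
          rw [ENNReal.mul_rpow_of_nonneg _ _ hq0.le, ENNReal.mul_rpow_of_nonneg _ _ hq0.le,
            ← ENNReal.rpow_mul, ← ENNReal.rpow_mul, mul_right_comm,
            ← ENNReal.rpow_add _ _ (by simp) (by simp)]
          congr 2
          field_simp
          ring
  have h2 : ∫⁻ t in Ioi (0 : ℝ), singularNumber τ (ofL2 τ a) t ^ (2 * q) ≤
      ∑' k : ℤ, ((2 : ℝ≥0∞) ^ ((k : ℝ) * (1 / q - 1)) * κ k) ^ q := by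
    have hcov : Ioi (0 : ℝ) ⊆ ⋃ k : ℤ, Ioc ((2 : ℝ) ^ (k - 1)) (2 ^ k) := fun t ht => by
      obtain ⟨n, hn⟩ := exists_mem_Ioc_zpow (mem_Ioi.mp ht) (one_lt_two (α := ℝ))
      exact mem_iUnion.mpr ⟨n + 1, by simpa using hn⟩
    refine (lintegral_mono_set hcov).trans ?_
    rw [lintegral_iUnion (fun _ => measurableSet_Ioc) pairwise_disjoint_dyadic]
    refine (ENNReal.tsum_le_tsum h1).trans (le_of_eq ?_)
    exact (Equiv.subRight (1 : ℤ)).tsum_eq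
      (fun k : ℤ => ((2 : ℝ≥0∞) ^ ((k : ℝ) * (1 / q - 1)) * κ k) ^ q)
  calc _ ≤ (∑' k : ℤ, ((2 : ℝ≥0∞) ^ ((k : ℝ) * (1 / q - 1)) * κ k) ^ q) ^ (1 / (2 * q)) :=
        ENNReal.rpow_le_rpow h2 (by positivity)
    _ = (lorentz (SeqNorm.lq q hq) q κ) ^ (1 / 2 : ℝ) := by
        change _ = ((∑' k : ℤ, ((2 : ℝ≥0∞) ^ ((k : ℝ) * (1 / q - 1)) * κ k) ^ q) ^ (1 / q)) ^
          (1 / 2 : ℝ)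
        rw [← ENNReal.rpow_mul]; congr 1; field_simp
    _ ≤ _ := ENNReal.rpow_le_rpow (le_mul_of_one_le_left zero_le (by norm_num)) (by norm_num)

/-- If `G` is formally `a²`, the norm of `a` in `L_{2r,∞}(M)` is the square root of the norm of `G`
in `L_{r,∞}(M)`. -/
theorem weakNorm_le_of_sqControlled {τ : Trace M} {r : ℝ} (hr : 1 ≤ r) {a : L2 τ} {G : Fn M}
    (h : SqControlled τ a G) {κ : ℤ → ℝ≥0∞} (hκ : ∀ k : ℤ, kFun τ (2 ^ k) G ≤ κ k) :
    weakNorm τ (2 * r) (ofL2 τ a) ≤ (2 * lorentz SeqNorm.sup r κ) ^ (1 / 2 : ℝ) := by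
  have hr0 : 0 < r := zero_lt_one.trans_le hr
  refine iSup_le fun s => iSup_le fun hs => ?_
  obtain ⟨T, hT1, hT2⟩ := h s hs
  rcases le_or_gt T 0 with hT | hT
  · have : distribution τ (ofL2 τ a) s = 0 := by
      rw [ENNReal.ofReal_of_nonpos hT] at hT1
      exact le_antisymm hT1 zero_le
    rw [this, ENNReal.zero_rpow_of_pos (by positivity), mul_zero]
    exact zero_le
  obtain ⟨k, hk1, hk2⟩ := exists_mem_Ico_zpow hT (one_lt_two (α := ℝ))
  have h3 := hT2.trans (kFun_le_div_mul τ G (by positivity : (0 : ℝ) < 2 ^ k) hk1)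
  rw [div_eq_mul_inv, ENNReal.ofReal_mul hT.le, mul_comm, mul_assoc,
    ENNReal.mul_le_mul_iff_right (by simpa using hT) (by simp), ofReal_inv_zpow] at h3
  have h4 : ENNReal.ofReal (s ^ 2) ≤ (2 : ℝ≥0∞) ^ (-(k : ℝ)) * κ k := h3.trans (by gcongr; exact hκ k)
  have h5 : distribution τ (ofL2 τ a) s ≤ (2 : ℝ≥0∞) ^ ((k : ℝ) + 1) := by
    refine hT1.trans ((ENNReal.ofReal_le_ofReal hk2.le).trans_eq ?_)
    rw [ofReal_two_zpow]; push_cast; rfl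
  have h6 : (2 : ℝ≥0∞) ^ ((k : ℝ) * (1 / r - 1)) * κ k ≤ lorentz SeqNorm.sup r κ :=
    SeqNorm.sup.coord_le (fun k => (2 : ℝ≥0∞) ^ ((k : ℝ) * (1 / r - 1)) * κ k) k
  rw [one_div (2 : ℝ), ENNReal.le_rpow_inv_iff (by norm_num), ENNReal.mul_rpow_of_nonneg _ _ (by norm_num),
    ← ENNReal.rpow_mul, ENNReal.ofReal_rpow_of_pos hs]
  calc _ ≤ ((2 : ℝ≥0∞) ^ (-(k : ℝ)) * κ k) * ((2 : ℝ≥0∞) ^ ((k : ℝ) + 1)) ^ (1 / r) := by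
        refine mul_le_mul' ?_ ?_
        · simpa using h4
        · have : 1 / (2 * r) * 2 = 1 / r := by field_simp
          rw [this]
          exact ENNReal.rpow_le_rpow h5 (by positivity)
    _ = 2 ^ (1 / r) * ((2 : ℝ≥0∞) ^ ((k : ℝ) * (1 / r - 1)) * κ k) := by
        rw [← ENNReal.rpow_mul, mul_right_comm, ← mul_assoc,
          ← ENNReal.rpow_add _ _ (by simp) (by simp), ← ENNReal.rpow_add _ _ (by simp) (by simp)]
        congr 2; ring
    _ ≤ 2 * lorentz SeqNorm.sup r κ := by
        gcongr
        calc (2 : ℝ≥0∞) ^ (1 / r) ≤ 2 ^ (1 : ℝ) :=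
              ENNReal.rpow_le_rpow_of_exponent_le (by norm_num) ((div_le_one hr0).mpr hr)
          _ = 2 := ENNReal.rpow_one _

/-! ### Balanced factorization and the functional calculus -/

theorem cfc_mul_mul_self {a : Elt M} (ha : IsSelfAdjoint a) {g : ℝ → ℝ} (hg : Continuous g) :
    cfc g a * a * cfc g a = cfc (fun x => g x * x * g x) a := by
  have h3 : Continuous fun x : ℝ => g x * x := hg.mul continuous_id
  have h2 : cfc g a * a = cfc (fun x : ℝ => g x * x) a := by
    rw [cfc_mul _ _ a hg.continuousOn (by fun_prop), cfc_id' ℝ a]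
  rw [h2, ← cfc_mul _ _ a h3.continuousOn hg.continuousOn]

/-- The trace of `|z|` is at most the norm of the functional `τ(z ·)`. -/
theorem trace_abs_le (τ : Trace M) (z : Elt M) :
    (τ (cfc Real.sqrt (star z * z))).re ≤ ‖ofM τ z‖ := by
  set a := star z * z with ha_def
  have ha0 : 0 ≤ a := star_mul_self_nonneg z
  have ha : IsSelfAdjoint a := IsSelfAdjoint.of_nonneg ha0
  have hsp : ∀ x ∈ spectrum ℝ a, 0 ≤ x := fun x hx => spectrum_nonneg_of_nonneg ha0 hx
  -- test the functional on the adjoint of `u = z (|z| + δ)⁻¹`, a contraction that replaces the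
  -- polar part of `z`
  have key : ∀ δ : ℝ, 0 < δ →
      (τ (cfc Real.sqrt a)).re ≤ ‖ofM τ z‖ + δ * (τ 1).re := fun δ hδ => by
    have hc : Continuous fun x : ℝ => (√x + δ)⁻¹ :=
      Continuous.inv₀ (by fun_prop) fun x => by positivity
    set u := z * cfc (fun x : ℝ => (√x + δ)⁻¹) a with hu_def
    have hsa : IsSelfAdjoint (cfc (fun x : ℝ => (√x + δ)⁻¹) a) := cfc_predicate _ _
    have hu : ‖u‖ ≤ 1 := by
      have h1 : ‖star u * u‖ ≤ 1 := by
        have : star u * u = cfc (fun x : ℝ => (√x + δ)⁻¹) a * a *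
            cfc (fun x : ℝ => (√x + δ)⁻¹) a := by
          rw [hu_def, star_mul, hsa.star_eq, ha_def]; simp only [mul_assoc]
        rw [this, cfc_mul_mul_self ha hc]
        refine norm_cfc_le zero_le_one fun x hx => ?_
        have h0 := hsp x hx
        have h1 : 0 < √x + δ := by positivity
        have h2 := Real.mul_self_sqrt h0
        rw [Real.norm_of_nonneg (by positivity)]
        field_simp
        nlinarith [Real.sqrt_nonneg x]
      rw [CStarRing.norm_star_mul_self] at h1
      nlinarith [norm_nonneg u]
    have h2 : τ (z * star u) = τ (cfc (fun x : ℝ => (√x + δ)⁻¹ * x) a) := by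
      rw [τ.tracial, hu_def, star_mul, hsa.star_eq, mul_assoc, ← ha_def,
        cfc_mul _ _ a hc.continuousOn (by fun_prop), cfc_id' ℝ a]
    have h3 : cfc Real.sqrt a ≤
        cfc (fun x : ℝ => (√x + δ)⁻¹ * x) a + algebraMap ℝ (Elt M) δ := by
      have hc' : Continuous fun x : ℝ => (√x + δ)⁻¹ * x := hc.mul continuous_id
      rw [← cfc_add_const _ _ a hc'.continuousOn]
      refine cfc_mono (fun x hx => ?_) (by fun_prop)
        ((hc.mul continuous_id).add continuous_const).continuousOn
      have h0 := hsp x hx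
      have h1 : 0 < √x + δ := by positivity
      have h2 := Real.mul_self_sqrt h0
      have h4 : (√x + δ)⁻¹ * x + δ = (x + δ * (√x + δ)) / (√x + δ) := by field_simp
      rw [h4, le_div_iff₀ h1]
      nlinarith
    have h4 := τ.mono h3
    have h5 : τ (algebraMap ℝ (Elt M) δ) = δ * τ 1 := by
      rw [← mul_one (algebraMap ℝ (Elt M) δ), algebraMap_mul_eq_smul, map_smul, smul_eq_mul]
    rw [map_add, Complex.add_re, h5, Complex.re_ofReal_mul, ← h2] at h4
    refine h4.trans ?_
    gcongr
    calc _ ≤ ‖τ (z * star u)‖ := Complex.re_le_norm _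
      _ ≤ ‖ofM τ z‖ * ‖star u‖ := norm_trace_mul_le_ofM τ _ _
      _ ≤ ‖ofM τ z‖ * 1 := by rw [norm_star]; gcongr
      _ = _ := mul_one _
  refine le_of_forall_pos_le_add fun ε hε => ?_
  have h1 : 0 ≤ (τ 1).re := τ.nonneg zero_le_one
  refine (key (ε / ((τ 1).re + 1)) (by positivity)).trans ?_
  gcongr
  rw [div_mul_eq_mul_div, div_le_iff₀ (by positivity)]
  nlinarith

/-- Every `z` is a product `z₁ z₂*` with `‖z₁‖₂²` and `‖z₂‖₂²` at most `‖z‖₁` up to `ε`: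
`z₁ = u |z|^{1/2}` and `z₂ = |z|^{1/2}` for the polar decomposition `z = u |z|`, regularized. -/
theorem exists_balanced_factorization (τ : Trace M) (z : Elt M) {ε : ℝ} (hε : 0 < ε) :
    ∃ z₁ z₂ : Elt M, z = z₁ * star z₂ ∧ (τ (z₁ * star z₁)).re ≤ ‖ofM τ z‖ ∧
      (τ (z₂ * star z₂)).re ≤ ‖ofM τ z‖ + ε * (τ 1).re := by
  set a := star z * z with ha_def
  have ha0 : 0 ≤ a := star_mul_self_nonneg z
  have ha : IsSelfAdjoint a := IsSelfAdjoint.of_nonneg ha0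
  have hsp : ∀ x ∈ spectrum ℝ a, 0 ≤ x := fun x hx => spectrum_nonneg_of_nonneg ha0 hx
  have hc : Continuous fun x : ℝ => (√(√x + ε))⁻¹ :=
    Continuous.inv₀ (by fun_prop) fun x => by positivity
  have hc2 : Continuous fun x : ℝ => √(√x + ε) := by fun_prop
  have hsa : IsSelfAdjoint (cfc (fun x : ℝ => (√(√x + ε))⁻¹) a) := cfc_predicate _ _
  have hsa2 : IsSelfAdjoint (cfc (fun x : ℝ => √(√x + ε)) a) := cfc_predicate _ _
  -- `z₁ = z (|z| + ε)^{-1/2}` and `z₂ = (|z| + ε)^{1/2}`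
  refine ⟨z * cfc (fun x : ℝ => (√(√x + ε))⁻¹) a, cfc (fun x : ℝ => √(√x + ε)) a, ?_, ?_, ?_⟩
  · rw [hsa2.star_eq, mul_assoc, ← cfc_mul _ _ a hc.continuousOn hc2.continuousOn]
    have : (fun x : ℝ => (√(√x + ε))⁻¹ * √(√x + ε)) = fun _ => 1 := by
      funext x
      exact inv_mul_cancel₀ (by positivity)
    rw [this, cfc_const_one ℝ a, mul_one]
  · rw [τ.tracial, star_mul, hsa.star_eq]
    have : cfc (fun x : ℝ => (√(√x + ε))⁻¹) a * star z * (z * cfc (fun x : ℝ => (√(√x + ε))⁻¹) a) =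
        cfc (fun x : ℝ => (√(√x + ε))⁻¹) a * a * cfc (fun x : ℝ => (√(√x + ε))⁻¹) a := by
      rw [ha_def]; simp only [mul_assoc]
    rw [this, cfc_mul_mul_self ha hc]
    refine le_trans (τ.mono (cfc_mono (fun x hx => ?_)
      ((hc.mul continuous_id).mul hc).continuousOn (by fun_prop))) (trace_abs_le τ z)
    have h0 := hsp x hx
    have h1 : 0 < √x + ε := by positivity
    have h2 := Real.mul_self_sqrt h0
    have h3 := Real.mul_self_sqrt h1.le
    have h4 : (√(√x + ε))⁻¹ * x * (√(√x + ε))⁻¹ = x / (√x + ε) := by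
      rw [mul_right_comm, ← mul_inv, h3, mul_comm, div_eq_mul_inv]
    rw [h4, div_le_iff₀ h1]
    nlinarith [Real.sqrt_nonneg x]
  · rw [hsa2.star_eq, ← cfc_mul _ _ a hc2.continuousOn hc2.continuousOn]
    have : (fun x : ℝ => √(√x + ε) * √(√x + ε)) = fun x => √x + ε := by
      funext x
      exact Real.mul_self_sqrt (by positivity)
    rw [this, cfc_add_const _ _ a (by fun_prop), map_add, Complex.add_re]
    have h5 : τ (algebraMap ℝ (Elt M) ε) = ε * τ 1 := by
      rw [← mul_one (algebraMap ℝ (Elt M) ε), algebraMap_mul_eq_smul, map_smul, smul_eq_mul]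
    rw [h5, Complex.re_ofReal_mul]
    gcongr
    exact trace_abs_le τ z

/-- A sesquilinear estimate on factorizations `z = z₁ z₂*` gives boundedness for `‖·‖₁`. -/
theorem norm_le_norm_ofM_of_factor (τ : Trace M) (f : Elt M → ℂ)
    (hf : ∀ z₁ z₂, ‖f (z₁ * star z₂)‖ ^ 2 ≤ (τ (z₁ * star z₁)).re * (τ (z₂ * star z₂)).re)
    (z : Elt M) : ‖f z‖ ≤ ‖ofM τ z‖ := by
  have h1 : 0 ≤ (τ 1).re := τ.nonneg zero_le_one
  have key : ∀ ε : ℝ, 0 < ε → ‖f z‖ ≤ ‖ofM τ z‖ + ε * (τ 1).re := fun ε hε => by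
    obtain ⟨z₁, z₂, h, h2, h3⟩ := exists_balanced_factorization τ z hε
    have h4 := hf z₁ z₂
    rw [← h] at h4
    have h5 : 0 ≤ (τ (z₂ * star z₂)).re := τ.nonneg (mul_star_self_nonneg _)
    have h6 : 0 ≤ (τ (z₁ * star z₁)).re := τ.nonneg (mul_star_self_nonneg _)
    have h7 : 0 ≤ ε * (τ 1).re := by positivity
    refine abs_le_of_sq_le_sq' ?_ (by positivity) |>.2
    nlinarith [norm_nonneg (ofM τ z)]
  refine le_of_forall_pos_le_add fun ε hε => ?_
  refine (key (ε / ((τ 1).re + 1)) (by positivity)).trans ?_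
  gcongr
  rw [div_mul_eq_mul_div, div_le_iff₀ (by positivity)]
  nlinarith

/-- The centralizer of a functional is stable under the functional calculus. -/
theorem apply_cfc_mul_comm {G : Fn M} {k : Elt M} (hk : IsSelfAdjoint k)
    (h : ∀ z, G (k * z) = G (z * k)) (f : ℝ → ℝ) (z : Elt M) :
    G (cfc f k * z) = G (z * cfc f k) := by
  let S : StarSubalgebra ℝ (Elt M) :=
    { carrier := {x | (∀ z, G (x * z) = G (z * x)) ∧ ∀ z, G (star x * z) = G (z * star x)}
      mul_mem' := fun {x y} hx hy => ⟨fun z => by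
          rw [mul_assoc, hx.1, mul_assoc, hy.1, mul_assoc], fun z => by
          rw [star_mul, mul_assoc, hy.2, mul_assoc, hx.2, mul_assoc]⟩
      add_mem' := fun {x y} hx hy => ⟨fun z => by
          rw [add_mul, mul_add, map_add, map_add, hx.1, hy.1], fun z => by
          rw [star_add, add_mul, mul_add, map_add, map_add, hx.2, hy.2]⟩
      algebraMap_mem' := fun r => ⟨fun z => by rw [Algebra.commutes], fun z => by
        rw [((IsSelfAdjoint.all r).algebraMap (Elt M)).star_eq, Algebra.commutes]⟩
      star_mem' := fun {x} hx => ⟨hx.2, by simpa using hx.1⟩ }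
  have hS : IsClosed (S : Set (Elt M)) := by
    have h1 : (S : Set (Elt M)) = (⋂ z, {x | G (x * z) = G (z * x)}) ∩
        ⋂ z, {x | G (star x * z) = G (z * star x)} := by
      ext x
      simp only [Set.mem_inter_iff, Set.mem_iInter, Set.mem_ofPred_eq]
      rfl
    rw [h1]
    refine IsClosed.inter (isClosed_iInter fun z => ?_) (isClosed_iInter fun z => ?_) <;>
      exact isClosed_eq (by fun_prop) (by fun_prop)
  have := cfc_mem (𝕜' := ℝ) (s := S) (hs := hS) f (a := k)
    ⟨h, by rw [hk.star_eq]; exact h⟩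
  exact this.1 z

/-! ### Absolutely continuous positive functionals -/

/-- Absolute continuity with respect to the trace: `G` is small on the elements of the unit ball
whose `L₁`-norm is small. -/
def IsAbsCont (τ : Trace M) (G : Fn M) : Prop :=
  ∀ ε : ℝ, 0 < ε → ∃ t : ℝ, 0 < t ∧ kFun τ t G ≤ ENNReal.ofReal ε

/-- An absolutely continuous functional is the sum of a functional of norm at most `ε / 2` and of
one that is continuous for `‖·‖₂` (Hahn–Banach), and the latter is a limit of elements of `M`. -/
theorem IsAbsCont.exists_norm_sub_le {τ : Trace M} {G : Fn M} (hG : IsAbsCont τ G) {ε : ℝ}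
    (hε : 0 < ε) : ∃ y : Elt M, ‖G - ofM τ y‖ ≤ ε := by
  obtain ⟨t, ht, hK⟩ := hG (ε / 2) (by positivity)
  -- embed `M` into `M × L₂(M)` by `z ↦ (z, l z)`: for this `l`, the image of `z` having norm at
  -- most `1` implies `‖z‖ ≤ 1` and `‖z‖₁ ≤ t`, so that `G` has norm at most `ε / 2` on the image
  set l : ℝ := ‖toL2 τ 1‖ / t with hl
  have hl0 : 0 ≤ l := by positivity
  let ι : Elt M →ₗ[ℂ] Elt M × L2 τ := LinearMap.prod LinearMap.id ((l : ℂ) • toL2 τ)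
  have hι : Function.Injective ι := fun x y h => congrArg Prod.fst h
  have hbound : ∀ z, ‖G z‖ ≤ ε / 2 * ‖ι z‖ := fun z => by
    rcases eq_or_ne z 0 with rfl | hz
    · simp
    have hz0 : 0 < ‖z‖ := norm_pos_iff.mpr hz
    have hιz : ‖ι z‖ = max ‖z‖ (l * ‖toL2 τ z‖) := by
      change max ‖z‖ ‖(l : ℂ) • toL2 τ z‖ = _
      rw [norm_smul, Complex.norm_real, Real.norm_of_nonneg hl0]
    have h0 : 0 < ‖ι z‖ := by rw [hιz]; exact lt_max_of_lt_left hz0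
    have h1 := enorm_apply_le_kFun τ (t := t) h0 G (z := z) (by rw [hιz]; exact le_max_left _ _) (by
      refine (norm_ofM_le_toL2 τ z).trans ?_
      have h2 : l * ‖toL2 τ z‖ ≤ ‖ι z‖ := by rw [hιz]; exact le_max_right _ _
      calc _ = l * ‖toL2 τ z‖ * t := by rw [hl]; field_simp
        _ ≤ _ := by gcongr)
    have h3 : ‖G z‖ₑ ≤ ENNReal.ofReal (ε / 2 * ‖ι z‖) := by
      refine h1.trans ?_
      rw [mul_comm (ε / 2), ENNReal.ofReal_mul h0.le]
      gcongr
    rw [← ofReal_norm] at h3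
    exact (ENNReal.ofReal_le_ofReal_iff (by positivity)).mp h3
  let e := LinearEquiv.ofInjective ι hι
  let f : StrongDual ℂ (LinearMap.range ι) :=
    LinearMap.mkContinuous (G.toLinearMap ∘ₗ e.symm.toLinearMap) (ε / 2) (fun x => by
      obtain ⟨z, rfl⟩ := e.surjective x
      simpa [e] using hbound z)
  -- the two components of a Hahn–Banach extension give the decomposition
  obtain ⟨g, hg1, hg2⟩ := exists_extension_norm_eq (LinearMap.range ι) f
  have hgn : ‖g‖ ≤ ε / 2 := by
    rw [hg2]; exact LinearMap.mkContinuous_norm_le _ (by positivity) _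
  have hgG : ∀ z, G z = g (z, 0) + g (0, (l : ℂ) • toL2 τ z) := fun z => by
    rw [← map_add, Prod.mk_add_mk, add_zero, zero_add]
    have := hg1 (e z)
    simp only [f, LinearMap.mkContinuous_apply, LinearMap.comp_apply, LinearEquiv.coe_coe,
      LinearEquiv.symm_apply_apply] at this
    exact this.symm
  let g2 : StrongDual ℂ (L2 τ) := g.comp (ContinuousLinearMap.inr ℂ (Elt M) (L2 τ))
  let ζ : L2 τ := (InnerProductSpace.toDual ℂ (L2 τ)).symm ((l : ℂ) • g2)
  have hζ : ∀ z, g (0, (l : ℂ) • toL2 τ z) = inner ℂ ζ (toL2 τ z) := fun z => by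
    rw [InnerProductSpace.toDual_symm_apply]
    change g2 ((l : ℂ) • toL2 τ z) = (l : ℂ) • g2 (toL2 τ z)
    rw [map_smul]
  set S := √‖τ.toFunctional‖
  -- the functional on `L₂(M)` is given by a vector `ζ`, which is approximated by `y ∈ M`
  obtain ⟨y, hy⟩ := (denseRange_toL2 τ).exists_dist_lt ζ
    (show 0 < ε / (2 * (S + 1)) by positivity)
  refine ⟨star y, ContinuousLinearMap.opNorm_le_bound _ hε.le fun z => ?_⟩
  have h1 : (G - ofM τ (star y)) z = g (z, 0) + inner ℂ (ζ - toL2 τ y) (toL2 τ z) := by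
    rw [sub_apply, hgG, hζ, ofM_apply, inner_sub_left, inner_toL2]
    ring
  rw [h1]
  have h2 : ‖g (z, 0)‖ ≤ ε / 2 * ‖z‖ := by
    refine (g.le_of_opNorm_le hgn _).trans_eq ?_
    simp [Prod.norm_def]
  have h3 : ‖inner ℂ (ζ - toL2 τ y) (toL2 τ z)‖ ≤ ε / 2 * ‖z‖ := by
    refine (norm_inner_le_norm _ _).trans ?_
    rw [dist_eq_norm] at hy
    calc _ ≤ ε / (2 * (S + 1)) * (S * ‖z‖) :=
          mul_le_mul hy.le (norm_toL2_le τ z) (norm_nonneg _) (by positivity)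
      _ = ε / 2 * ‖z‖ * (S / (S + 1)) := by field_simp
      _ ≤ ε / 2 * ‖z‖ * 1 := by
          gcongr
          rw [div_le_one (by positivity)]
          linarith
      _ = _ := mul_one _
  calc _ ≤ ε / 2 * ‖z‖ + ε / 2 * ‖z‖ := (norm_add_le _ _).trans (add_le_add h2 h3)
    _ = _ := by ring

theorem IsPositiveFn.apply_nonneg {G : Fn M} (hG : IsPositiveFn G) {x : Elt M} (hx : 0 ≤ x) :
    0 ≤ (G x).re ∧ (G x).im = 0 := by
  obtain ⟨y, rfl⟩ := CStarAlgebra.nonneg_iff_eq_mul_star_self.mp hx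
  exact hG y

theorem IsPositiveFn.mono {G : Fn M} (hG : IsPositiveFn G) {x y : Elt M} (h : x ≤ y) :
    (G x).re ≤ (G y).re := by
  have := (hG.apply_nonneg (sub_nonneg.mpr h)).1
  rw [map_sub, Complex.sub_re] at this
  linarith

theorem IsPositiveFn.im_eq_zero {G : Fn M} (hG : IsPositiveFn G) {x : Elt M}
    (hx : IsSelfAdjoint x) : (G x).im = 0 := by
  have h1 : 0 ≤ x + algebraMap ℝ (Elt M) ‖x‖ := by
    have := hx.neg_algebraMap_norm_le_self
    rwa [neg_le_iff_add_nonneg] at this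
  have h2 : (0 : Elt M) ≤ algebraMap ℝ (Elt M) ‖x‖ := algebraMap_nonneg (Elt M) (norm_nonneg x)
  have h3 := (hG.apply_nonneg h1).2
  rw [map_add, Complex.add_im, (hG.apply_nonneg h2).2, add_zero] at h3
  exact h3

theorem IsPositiveFn.map_star {G : Fn M} (hG : IsPositiveFn G) (z : Elt M) :
    G (star z) = (starRingEnd ℂ) (G z) := by
  have h1 : IsSelfAdjoint (z + star z) := IsSelfAdjoint.add_star_self z
  have h2 : IsSelfAdjoint (Complex.I • (z - star z)) := by
    rw [IsSelfAdjoint, star_smul, star_sub, star_star]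
    simp only [RCLike.star_def, Complex.conj_I, neg_smul]
    rw [← smul_neg, neg_sub]
  have h3 := hG.im_eq_zero h1
  have h4 := hG.im_eq_zero h2
  simp only [map_add, map_smul, map_sub, smul_eq_mul, Complex.add_im, Complex.mul_im,
    Complex.I_re, Complex.I_im, Complex.sub_re, Complex.sub_im] at h3 h4
  apply Complex.ext
  · simp only [Complex.conj_re]; linarith
  · simp only [Complex.conj_im]; linarith

/-- A positive absolutely continuous functional is a norm limit of positive elements of `M`. -/
theorem IsAbsCont.exists_nonneg_norm_sub_le {τ : Trace M} {G : Fn M} (hG : IsAbsCont τ G)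
    (hpos : IsPositiveFn G) {ε : ℝ} (hε : 0 < ε) :
    ∃ y : Elt M, 0 ≤ y ∧ ‖G - ofM τ y‖ ≤ ε := by
  obtain ⟨y₀, hy₀⟩ := hG.exists_norm_sub_le (half_pos hε)
  -- `G` is hermitian, so that the approximant may be taken self-adjoint
  set y : Elt M := (2⁻¹ : ℂ) • (y₀ + star y₀) with hy_def
  have hysa : IsSelfAdjoint y := by
    rw [IsSelfAdjoint, hy_def, star_smul, star_add, star_star, add_comm]; simp
  have hy : ‖G - ofM τ y‖ ≤ ε / 2 := by
    refine ContinuousLinearMap.opNorm_le_bound _ (by positivity) fun z => ?_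
    have h1 : (G - ofM τ y) z = 2⁻¹ * ((G - ofM τ y₀) z +
        (starRingEnd ℂ) ((G - ofM τ y₀) (star z))) := by
      simp only [sub_apply, ofM_apply, map_sub, hpos.map_star,
        Complex.conj_conj]
      rw [← τ.map_star (y₀ * star z), star_mul, star_star, τ.tracial z, hy_def, smul_mul_assoc,
        map_smul, add_mul, map_add, smul_eq_mul]
      ring
    rw [h1, norm_mul, norm_inv, Complex.norm_ofNat]
    have h2 := (G - ofM τ y₀).le_of_opNorm_le hy₀ z
    have h3 := (G - ofM τ y₀).le_of_opNorm_le hy₀ (star z)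
    rw [norm_star] at h3
    have h4 := norm_add_le ((G - ofM τ y₀) z) ((starRingEnd ℂ) ((G - ofM τ y₀) (star z)))
    rw [Complex.norm_conj] at h4
    linarith
  obtain ⟨e, he, -, h1, h2⟩ := exists_spectral_projection hysa 0
  have h3 := cfc_sub_parts hysa 0
  simp only [map_zero, sub_zero, zero_sub] at h1 h2 h3
  set yp := cfc (fun x : ℝ => max x 0) y
  set yn := cfc (fun x : ℝ => max (-x) 0) y
  have hyn : 0 ≤ yn := cfc_nonneg fun x _ => le_max_right _ _
  have h4 : y * (1 - e) = -yn := by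
    rw [h3, sub_mul, h2, mul_sub, h1, mul_one, sub_zero, zero_sub]
  have he1 : IsStarProjection (1 - e) := he.one_sub
  -- the negative part of `y` has small trace: evaluate `G - τ(y ·)` at the projection `1 - e`,
  -- where `G` is nonnegative
  have h5 : (τ yn).re ≤ ε / 2 := by
    have h6 := (G - ofM τ y).le_of_opNorm_le hy (1 - e)
    rw [sub_apply, ofM_apply, h4, map_neg, sub_neg_eq_add] at h6
    have h7 := (hpos.apply_nonneg he1.nonneg).1
    have h8 := (Complex.re_le_norm _).trans h6
    rw [Complex.add_re] at h8
    have h9 := IsStarProjection.norm_le_one he1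
    nlinarith
  refine ⟨yp, cfc_nonneg fun x _ => le_max_right _ _, ?_⟩
  have h6 : ofM τ yp = ofM τ y + ofM τ yn := by
    ext z
    rw [add_apply, ofM_apply, ofM_apply, ofM_apply, ← map_add, ← add_mul, h3,
      sub_add_cancel]
  rw [h6, ← sub_sub]
  calc _ ≤ ε / 2 + ε / 2 := (norm_sub_le _ _).trans
        (add_le_add hy ((norm_ofM_of_nonneg_le τ hyn).trans h5))
    _ = ε := by ring

/-- The inverse of the density of `G + c τ` with respect to `τ`: a bounded positive operator. -/
theorem IsAbsCont.exists_inverse_density {τ : Trace M} {G : Fn M} (hG : IsAbsCont τ G)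
    (hpos : IsPositiveFn G) {c : ℝ} (hc : 0 < c) :
    ∃ k : Elt M, 0 ≤ k ∧ ∀ z, (G + (c : ℂ) • ofM τ 1) (k * z) = τ z ∧
      (G + (c : ℂ) • ofM τ 1) (z * k) = τ z := by
  let ε : ℕ → ℝ := fun n => 1 / ((n : ℝ) + 1)
  have hε : ∀ n, 0 < ε n := fun n => Nat.one_div_pos_of_nat
  -- `k` is a weak limit of `kn n = (y n + c)⁻¹`, where `y n ≥ 0` approximates `G` in norm
  choose y hy0 hy using fun n => hG.exists_nonneg_norm_sub_le hpos (hε n)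
  set G' := G + (c : ℂ) • ofM τ 1 with hG'
  have hsa : ∀ n, IsSelfAdjoint (y n) := fun n => IsSelfAdjoint.of_nonneg (hy0 n)
  have hsp : ∀ n, ∀ x ∈ spectrum ℝ (y n), 0 ≤ x := fun n x hx => spectrum_nonneg_of_nonneg (hy0 n) hx
  have hcont : Continuous fun x : ℝ => (|x| + c)⁻¹ :=
    Continuous.inv₀ (by fun_prop) fun x => by positivity
  let y' : ℕ → Elt M := fun n => y n + algebraMap ℝ (Elt M) c
  let kn : ℕ → Elt M := fun n => cfc (fun x : ℝ => (|x| + c)⁻¹) (y n)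
  have hkn0 : ∀ n, 0 ≤ kn n := fun n => cfc_nonneg fun x _ => by positivity
  have hknn : ∀ n, ‖kn n‖ ≤ c⁻¹ := fun n => norm_cfc_le (by positivity) fun x _ => by
    rw [Real.norm_of_nonneg (by positivity)]
    exact inv_anti₀ hc (by linarith [abs_nonneg x])
  have hyk : ∀ n, kn n * y' n = 1 := fun n => by
    have h1 : y' n = cfc (fun x : ℝ => x + c) (y n) := by
      rw [cfc_add_const _ _ _ (by fun_prop), cfc_id' ℝ (y n)]
    rw [h1, ← cfc_mul _ _ _ hcont.continuousOn (by fun_prop)]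
    rw [← cfc_const_one ℝ (y n)]
    refine cfc_congr fun x hx => ?_
    have h0 := hsp n x hx
    change (|x| + c)⁻¹ * (x + c) = 1
    rw [abs_of_nonneg h0]
    exact inv_mul_cancel₀ (by positivity)
  have hky : ∀ n, y' n * kn n = 1 := fun n => by
    have h1 : Commute (y n) (kn n) := (Commute.cfc (Commute.refl _) (by rw [(hsa n).star_eq]) _).symm
    have h2 : Commute (y' n) (kn n) := h1.add_left (Algebra.commutes c (kn n))
    rw [h2.eq, hyk]
  have hG'y : ∀ n, ‖G' - ofM τ (y' n)‖ ≤ ε n := fun n => by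
    have : G' - ofM τ (y' n) = G - ofM τ (y n) := by
      ext z
      simp only [hG', sub_apply, add_apply, ofM_apply,
        smul_apply, smul_eq_mul, one_mul, y', add_mul, map_add,
        algebraMap_mul_eq_smul, map_smul]
      ring
    rw [this]; exact hy n
  obtain ⟨k, -, hk1, hk2⟩ := exists_weak_limit_elt τ (Filter.hyperfilter ℕ) kn _ hknn
  have hle : (Filter.hyperfilter ℕ : Filter ℕ) ≤ atTop := Nat.hyperfilter_le_atTop
  have hε0 : Tendsto ε (Filter.hyperfilter ℕ : Filter ℕ) (𝓝 0) :=
    (tendsto_one_div_add_atTop_nhds_zero_nat (𝕜 := ℝ)).mono_left hle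
  -- `G'`, a norm limit of functionals `τ(y' ·)`, is continuous along bounded weakly convergent
  -- families
  have happrox : ∀ (w : ℕ → Elt M) (v : Elt M) (C : ℝ), (∀ n, ‖w n‖ ≤ C) →
      (∀ u, Tendsto (fun n => τ (u * w n)) (Filter.hyperfilter ℕ : Filter ℕ) (𝓝 (τ (u * v)))) →
      Tendsto (fun n => G' (w n)) (Filter.hyperfilter ℕ : Filter ℕ) (𝓝 (G' v)) := by
    intro w v C hw hlim
    have hC : 0 ≤ C := (norm_nonneg _).trans (hw 0)
    rw [Metric.tendsto_nhds]
    intro δ hδ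
    obtain ⟨m, hm⟩ : ∃ m : ℕ, ε m * (C + ‖v‖) < δ / 2 := by
      have h1 : Tendsto (fun m => ε m * (C + ‖v‖)) atTop (𝓝 0) := by
        have := (tendsto_one_div_add_atTop_nhds_zero_nat (𝕜 := ℝ)).mul_const (C + ‖v‖)
        rwa [zero_mul] at this
      exact (h1.eventually_lt_const (by positivity)).exists
    filter_upwards [Metric.tendsto_nhds.mp (hlim (y' m)) (δ / 2) (by positivity)] with n hn
    have h1 := (G' - ofM τ (y' m)).le_of_opNorm_le (hG'y m) (w n - v)
    have h2 : ‖w n - v‖ ≤ C + ‖v‖ := (norm_sub_le _ _).trans (by gcongr; exact hw n)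
    rw [dist_eq_norm] at hn ⊢
    have h3 : G' (w n) - G' v = (G' - ofM τ (y' m)) (w n - v) + (τ (y' m * w n) - τ (y' m * v)) := by
      simp only [sub_apply, ofM_apply, map_sub]
      ring
    rw [h3]
    have h4 : ε m * ‖w n - v‖ ≤ ε m * (C + ‖v‖) := by have := (hε m).le; gcongr
    calc _ ≤ _ := norm_add_le _ _
      _ < δ := by linarith
  -- on the other hand `G'(w n)` is close to `τ(y' n (w n))`, as
  -- `G'` is close in norm to `τ(y' n ·)`
  have hG'kn : ∀ (w : ℕ → Elt M) (t : ℂ) (C : ℝ), (∀ n, ‖w n‖ ≤ C) → (∀ n, τ (y' n * w n) = t) →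
      Tendsto (fun n => G' (w n)) (Filter.hyperfilter ℕ : Filter ℕ) (𝓝 t) := by
    intro w t C hw ht
    rw [tendsto_iff_norm_sub_tendsto_zero]
    refine squeeze_zero (fun _ => norm_nonneg _) (fun n => ?_)
      (by simpa using hε0.mul_const C : Tendsto (fun n => ε n * C) _ _)
    have h1 := (G' - ofM τ (y' n)).le_of_opNorm_le (hG'y n) (w n)
    rw [sub_apply, ofM_apply, ht] at h1
    exact h1.trans (by have := (hε n).le; gcongr; exact hw n)
  refine ⟨k, nonneg_of_weak_limit hkn0 hk1, fun z => ⟨?_, ?_⟩⟩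
  · have hb : ∀ n, ‖kn n * z‖ ≤ c⁻¹ * ‖z‖ := fun n => (norm_mul_le _ _).trans (by gcongr; exact hknn n)
    refine tendsto_nhds_unique (happrox (fun n => kn n * z) _ _ hb fun u => ?_)
      (hG'kn (fun n => kn n * z) _ _ hb fun n => ?_)
    · have : ∀ x : Elt M, τ (u * (x * z)) = τ (x * (z * u)) := fun x => by
        rw [τ.tracial, mul_assoc]
      simp only [this]
      exact hk2 _
    · rw [← mul_assoc, hky, one_mul]
  · have hb : ∀ n, ‖z * kn n‖ ≤ ‖z‖ * c⁻¹ := fun n => (norm_mul_le _ _).trans (by gcongr; exact hknn n)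
    refine tendsto_nhds_unique (happrox (fun n => z * kn n) _ _ hb fun u => ?_)
      (hG'kn (fun n => z * kn n) _ _ hb fun n => ?_)
    · have : ∀ x : Elt M, τ (u * (z * x)) = τ (x * (u * z)) := fun x => by
        rw [← mul_assoc, τ.tracial]
      simp only [this]
      exact hk2 _
    · rw [← mul_assoc, τ.tracial, ← mul_assoc, hyk, one_mul]

set_option maxHeartbeats 1000000 in
/-- Let `G` be a positive functional with density `k⁻¹` with respect to `τ`, where `k` is bounded.
Then `a = k^{-1/2}` is an element of `L₂(M)` controlled by `G`, and `h = k^{1/2}` intertwines `G`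
and `τ`. The elements `a'ₙ = (k + 1/(n+1))^{-1/2}` of `M` approximate `a`, and `h a'ₙ` tends to `1`
in the seminorm given by `G`. -/
theorem exists_inverse_root {τ : Trace M} {G : Fn M} (hG : IsAbsCont τ G) (hpos : IsPositiveFn G)
    {k : Elt M} (hk0 : 0 ≤ k) (hk : ∀ z, G (k * z) = τ z ∧ G (z * k) = τ z) :
    ∃ (h : Elt M) (a : L2 τ) (a' : ℕ → Elt M), IsSelfAdjoint h ∧ (∀ z, G (h * z * h) = τ z) ∧
      Tendsto (fun n => toL2 τ (a' n)) atTop (𝓝 a) ∧ SqControlled τ a G ∧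
      (∀ n, IsSelfAdjoint (a' n)) ∧ (∀ n, IsSelfAdjoint (h * a' n)) ∧ (∀ n, ‖h * a' n‖ ≤ 1) ∧
      Tendsto (fun n => (G ((1 - h * a' n) * star (1 - h * a' n))).re) atTop (𝓝 0) := by
  let ε : ℕ → ℝ := fun n => 1 / ((n : ℝ) + 1)
  have hε : ∀ n, 0 < ε n := fun n => Nat.one_div_pos_of_nat
  have hε0 : Tendsto ε atTop (𝓝 0) := tendsto_one_div_add_atTop_nhds_zero_nat (𝕜 := ℝ)
  have hεanti : Antitone ε := fun m n hmn => Nat.one_div_le_one_div hmn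
  have hksa : IsSelfAdjoint k := IsSelfAdjoint.of_nonneg hk0
  have hsp : ∀ x ∈ spectrum ℝ k, 0 ≤ x := fun x hx => spectrum_nonneg_of_nonneg hk0 hx
  have hcomm : ∀ (f : ℝ → ℝ) z, G (cfc f k * z) = G (z * cfc f k) :=
    apply_cfc_mul_comm hksa fun z => by rw [(hk z).1, (hk z).2]
  have hφ : ∀ n, Continuous fun x : ℝ => (√(|x| + ε n))⁻¹ := fun n =>
    Continuous.inv₀ (by fun_prop) fun x => by have := hε n; positivity
  have hφ2 : ∀ n, Continuous fun x : ℝ => (|x| + ε n)⁻¹ := fun n =>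
    Continuous.inv₀ (by fun_prop) fun x => by have := hε n; positivity
  have hsq : ∀ n x, (√(|x| + ε n))⁻¹ * (√(|x| + ε n))⁻¹ = (|x| + ε n)⁻¹ := fun n x => by
    rw [← mul_inv, Real.mul_self_sqrt (by have := hε n; positivity)]
  set h := cfc Real.sqrt k with h_def
  have hhh : h * h = k := by
    rw [h_def, ← cfc_mul _ _ k (by fun_prop) (by fun_prop)]
    conv_rhs => rw [← cfc_id' ℝ k]
    exact cfc_congr fun x hx => Real.mul_self_sqrt (hsp x hx)
  let a' : ℕ → Elt M := fun n => cfc (fun x : ℝ => (√(|x| + ε n))⁻¹) k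
  have ha'sa : ∀ n, IsSelfAdjoint (a' n) := fun n => cfc_predicate _ _
  -- `‖a' n - a' m‖₂² ≤ s n - s m`, where `s n = ‖a' n‖₂²` is monotone and bounded by `G 1`;
  -- therefore `a'` converges in `L₂(M)`
  let s : ℕ → ℝ := fun n => (τ (cfc (fun x : ℝ => (|x| + ε n)⁻¹) k)).re
  have hs1 : ∀ n, s n ≤ (G 1).re := fun n => by
    have h1 : τ (cfc (fun x : ℝ => (|x| + ε n)⁻¹) k) =
        G (cfc (fun x : ℝ => (|x| + ε n)⁻¹ * x) k) := by
      rw [cfc_mul _ _ k (hφ2 n).continuousOn (by fun_prop), cfc_id' ℝ k, (hk _).2]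
    change (τ _).re ≤ _
    rw [h1, ← cfc_const_one ℝ k]
    refine hpos.mono (cfc_mono (fun x hx => ?_) ((hφ2 n).mul continuous_id).continuousOn
      continuousOn_const)
    have h0 := hsp x hx
    have := hε n
    rw [abs_of_nonneg h0, inv_mul_le_iff₀ (by positivity)]
    linarith
  have hsmono : Monotone s := fun m n hmn => by
    refine τ.mono (cfc_mono (fun x hx => ?_) (hφ2 m).continuousOn (hφ2 n).continuousOn)
    have := hε n
    have := hεanti hmn
    gcongr
  have hdiff : ∀ m n, m ≤ n → ‖toL2 τ (a' n) - toL2 τ (a' m)‖ ^ 2 ≤ s n - s m := fun m n hmn => by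
    rw [← map_sub, norm_toL2_sq, ((ha'sa n).sub (ha'sa m)).star_eq]
    have h1 : a' n - a' m = cfc (fun x : ℝ => (√(|x| + ε n))⁻¹ - (√(|x| + ε m))⁻¹) k :=
      (cfc_sub _ _ k (hφ n).continuousOn (hφ m).continuousOn).symm
    have h2 : ContinuousOn (fun x : ℝ => (√(|x| + ε n))⁻¹ - (√(|x| + ε m))⁻¹) (spectrum ℝ k) :=
      ((hφ n).sub (hφ m)).continuousOn
    change (τ _).re ≤ (τ _).re - (τ _).re
    rw [h1, ← cfc_mul _ _ k h2 h2, ← Complex.sub_re, ← map_sub,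
      ← cfc_sub _ _ k (hφ2 n).continuousOn (hφ2 m).continuousOn]
    refine τ.mono (cfc_mono (fun x hx => ?_)
      (((hφ n).sub (hφ m)).mul ((hφ n).sub (hφ m))).continuousOn
      ((hφ2 n).sub (hφ2 m)).continuousOn)
    have hn := hε n
    have hm := hεanti hmn
    rw [← hsq, ← hsq]
    have h3 : (√(|x| + ε m))⁻¹ ≤ (√(|x| + ε n))⁻¹ := by gcongr
    have h4 : 0 ≤ (√(|x| + ε m))⁻¹ := by positivity
    nlinarith
  obtain ⟨a, ha⟩ : ∃ a, Tendsto (fun n => toL2 τ (a' n)) atTop (𝓝 a) := by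
    refine cauchySeq_tendsto_of_complete (Metric.cauchySeq_iff'.mpr fun δ hδ => ?_)
    have h1 : CauchySeq s := (tendsto_atTop_ciSup hsmono
      ⟨(G 1).re, by rintro _ ⟨n, rfl⟩; exact hs1 n⟩).cauchySeq
    obtain ⟨N, hN⟩ := Metric.cauchySeq_iff'.mp h1 (δ ^ 2) (by positivity)
    refine ⟨N, fun n hn => ?_⟩
    have h2 := hN n hn
    rw [Real.dist_eq] at h2
    rw [dist_eq_norm]
    exact lt_of_pow_lt_pow_left₀ 2 hδ.le
      ((hdiff N n hn).trans_lt ((le_abs_self _).trans_lt h2))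
  -- `h a' n` is `r(k)` for a function `r` with values in `[0, 1]`
  have hha : ∀ n, h * a' n = cfc (fun x : ℝ => √x * (√(|x| + ε n))⁻¹) k := fun n =>
    (cfc_mul _ _ k (by fun_prop) (hφ n).continuousOn).symm
  have hr : ∀ n, ∀ x ∈ spectrum ℝ k, 0 ≤ √x * (√(|x| + ε n))⁻¹ ∧ √x * (√(|x| + ε n))⁻¹ ≤ 1 :=
    fun n x hx => by
      have h0 := hsp x hx
      have hn := hε n
      have h1 : 0 < √(|x| + ε n) := Real.sqrt_pos.mpr (by positivity)
      refine ⟨by positivity, ?_⟩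
      rw [← div_eq_mul_inv, div_le_one h1]
      exact Real.sqrt_le_sqrt (by rw [abs_of_nonneg h0]; linarith)
  refine ⟨h, a, a', cfc_predicate _ _, fun z => ?_, ha, fun t ht => ?_, ha'sa, fun n => ?_,
    fun n => ?_, ?_⟩
  · rw [← hcomm, ← mul_assoc, hhh, (hk z).1]
  · set σ : ℝ := (t ^ 2)⁻¹ with hσ
    have hσ0 : 0 < σ := by positivity
    -- on the range of `e = 1_{[σ, ∞)}(k)`, for `σ = t⁻²`, the operator `a = k^{-1/2}` is bounded
    -- by `t`; the relation to `G` follows from `k (1 - e) ≤ σ (1 - e)`, as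
    -- `G(k (1 - e)) = τ(1 - e)`
    obtain ⟨e, he, hecomm, he0, -, he2⟩ := exists_projection_bounds hksa σ
    have hf : IsStarProjection (1 - e) := he.one_sub
    refine ⟨(τ (1 - e)).re, ?_, ?_⟩
    · have hψ : Continuous fun x : ℝ => (√(max |x| σ))⁻¹ :=
        Continuous.inv₀ (by fun_prop) fun x => by
          have : 0 < max |x| σ := lt_max_of_lt_right hσ0
          positivity
      refine distribution_le_of τ he (y := cfc (fun x : ℝ => (√(max |x| σ))⁻¹) k * e) ?_
        fun z => ?_
      · have h1 : ‖cfc (fun x : ℝ => (√(max |x| σ))⁻¹) k‖ ≤ t := by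
          refine norm_cfc_le ht.le fun x _ => ?_
          rw [Real.norm_of_nonneg (by positivity)]
          have h2 : t⁻¹ ≤ √(max |x| σ) := by
            refine Real.le_sqrt_of_sq_le ?_
            rw [inv_pow]
            exact le_max_right _ _
          exact inv_le_of_inv_le₀ ht h2
        calc _ ≤ t * 1 := (norm_mul_le _ _).trans (mul_le_mul h1 (IsStarProjection.norm_le_one he)
              (norm_nonneg _) ht.le)
          _ = t := mul_one t
      · have hlim : Tendsto (fun n => τ (a' n * (e * z))) atTop (𝓝 (ofL2 τ a (e * z))) := by
          have h1 := ((innerSL ℂ (toL2 τ (star (e * z)))).continuous.tendsto a).comp ha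
          refine h1.congr fun n => ?_
          change ofL2 τ (toL2 τ (a' n)) (e * z) = _
          rw [ofL2_toL2, ofM_apply]
        refine tendsto_nhds_unique hlim ?_
        have hψn : ∀ n, Continuous fun x : ℝ => (√(max |x| σ + ε n))⁻¹ := fun n =>
          Continuous.inv₀ (by fun_prop) fun x => by
            have : 0 < max |x| σ := lt_max_of_lt_right hσ0
            have := hε n
            positivity
        -- on the range of `e` the function `|x|` may be replaced by `max |x| σ`: the difference is
        -- a multiple of `max (σ - x) 0`, which vanishes there
        have hae : ∀ n, a' n * e = cfc (fun x : ℝ => (√(max |x| σ + ε n))⁻¹) k * e := fun n => by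
          have hg : Continuous fun x : ℝ => (√(|x| + ε n) * √(max |x| σ + ε n) *
              (√(|x| + ε n) + √(max |x| σ + ε n)))⁻¹ :=
            Continuous.inv₀ (by fun_prop) fun x => by
              have : 0 < max |x| σ := lt_max_of_lt_right hσ0
              have := hε n
              positivity
          rw [← sub_eq_zero, ← sub_mul]
          have h1 : a' n - cfc (fun x : ℝ => (√(max |x| σ + ε n))⁻¹) k =
              cfc (fun x : ℝ => (√(|x| + ε n) * √(max |x| σ + ε n) *
              (√(|x| + ε n) + √(max |x| σ + ε n)))⁻¹) k * cfc (fun x : ℝ => max (σ - x) 0) k := by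
            rw [← cfc_mul _ _ k hg.continuousOn (by fun_prop)]
            change cfc _ k - cfc _ k = _
            rw [← cfc_sub _ _ k (hφ n).continuousOn (hψn n).continuousOn]
            refine cfc_congr fun x hx => ?_
            have h0 := hsp x hx
            have hn := hε n
            have hm : 0 < max |x| σ := lt_max_of_lt_right hσ0
            have h1 : 0 < √(|x| + ε n) := Real.sqrt_pos.mpr (by positivity)
            have h2 : 0 < √(max |x| σ + ε n) := Real.sqrt_pos.mpr (by positivity)
            have h3 := Real.sq_sqrt (show 0 ≤ |x| + ε n by positivity)
            have h4 := Real.sq_sqrt (show 0 ≤ max |x| σ + ε n by positivity)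
            have h5 : max (σ - x) 0 = √(max |x| σ + ε n) ^ 2 - √(|x| + ε n) ^ 2 := by
              rw [h3, h4, abs_of_nonneg h0]
              rcases le_total x σ with hxσ | hxσ
              · rw [max_eq_left (by linarith), max_eq_right hxσ]; ring
              · rw [max_eq_right (by linarith), max_eq_left hxσ]; ring
            change _ = _ * max (σ - x) 0
            rw [h5]
            field_simp
            ring
          rw [h1, mul_assoc, he0, mul_zero]
        rw [tendsto_iff_norm_sub_tendsto_zero]
        have h0 : Tendsto (fun n => √(ε n) / σ * ‖e * z‖ * ‖ofM τ 1‖) atTop (𝓝 0) := by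
          have h1 := (Real.continuous_sqrt.tendsto 0).comp hε0
          rw [Real.sqrt_zero] at h1
          simpa using ((h1.div_const σ).mul_const ‖e * z‖).mul_const ‖ofM τ 1‖
        refine squeeze_zero (fun _ => norm_nonneg _) (fun n => ?_) h0
        rw [← mul_assoc, hae, mul_assoc, mul_assoc, ← map_sub, ← sub_mul,
          ← cfc_sub _ _ k (hψn n).continuousOn hψ.continuousOn, ← mul_one (_ * (e * z))]
        refine (norm_trace_mul_le_ofM' τ _ _).trans ?_
        gcongr
        refine (norm_mul_le _ _).trans ?_
        gcongr
        refine norm_cfc_le (by positivity) fun x hx => ?_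
        have hn := hε n
        have hm : 0 < max |x| σ := lt_max_of_lt_right hσ0
        have h1 : √σ ≤ √(max |x| σ) := Real.sqrt_le_sqrt (le_max_right _ _)
        have h2 : √(max |x| σ) ≤ √(max |x| σ + ε n) := Real.sqrt_le_sqrt (by linarith)
        have h3 : √(max |x| σ + ε n) ≤ √(max |x| σ) + √(ε n) := by
          refine Real.sqrt_le_iff.mpr ⟨by positivity, ?_⟩
          have h4 := Real.sq_sqrt hm.le
          have h5 := Real.sq_sqrt hn.le
          nlinarith [Real.sqrt_nonneg (max |x| σ), Real.sqrt_nonneg (ε n),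
            mul_nonneg (Real.sqrt_nonneg (max |x| σ)) (Real.sqrt_nonneg (ε n))]
        have h4 : 0 < √σ := Real.sqrt_pos.mpr hσ0
        have h5 := Real.mul_self_sqrt hσ0.le
        have h6 : 0 < √(max |x| σ) := h4.trans_le h1
        have h7 : 0 < √(max |x| σ + ε n) := h6.trans_le h2
        rw [Real.norm_eq_abs, abs_sub_comm, abs_of_nonneg (sub_nonneg.mpr (by gcongr)),
          inv_sub_inv h6.ne' h7.ne']
        gcongr
        · linarith
        · exact h5.symm.le.trans (mul_le_mul h1 (h1.trans h2) h4.le h6.le)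
    · have hek : Commute e k := hecomm k hksa (Commute.refl k)
      have hkf : k * (1 - e) = (1 - e) * k * (1 - e) := by
        have h1 : Commute (1 - e) k := (Commute.one_left k).sub_left hek
        rw [h1.eq, mul_assoc, hf.isIdempotentElem.eq]
      have h1 : (τ (1 - e)).re ≤ σ * (G (1 - e)).re := by
        have h2 := hpos.mono he2
        rw [← hkf, (hk _).1, map_smul, smul_eq_mul, Complex.re_ofReal_mul] at h2
        exact h2
      have h2 : t ^ 2 * (τ (1 - e)).re ≤ (G (1 - e)).re := by
        rw [hσ, inv_mul_eq_div, le_div_iff₀ (by positivity)] at h1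
        linarith
      rw [← ENNReal.ofReal_mul (by positivity)]
      refine (ENNReal.ofReal_le_ofReal h2).trans ?_
      refine le_trans ?_ (le_kFun τ G (IsStarProjection.norm_le_one hf)
        (norm_ofM_of_nonneg_le τ hf.nonneg))
      rw [← ofReal_norm]
      exact ENNReal.ofReal_le_ofReal (Complex.re_le_norm _)
  · rw [hha]; exact cfc_predicate _ _
  · rw [hha]
    refine norm_cfc_le zero_le_one fun x hx => ?_
    rw [Real.norm_of_nonneg (hr n x hx).1]
    exact (hr n x hx).2
  -- `(1 - h a' n)² ≤ ε n (k + ε n)⁻¹`, an element of the unit ball of small `L₁`-norm, on which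
  -- the absolutely continuous functional `G` is small
  · have hw : ∀ n, (G ((1 - h * a' n) * star (1 - h * a' n))).re ≤
        (G (cfc (fun x : ℝ => ε n * (|x| + ε n)⁻¹) k)).re := fun n => by
      refine hpos.mono ?_
      have hc : Continuous fun x : ℝ => √x * (√(|x| + ε n))⁻¹ := Real.continuous_sqrt.mul (hφ n)
      have h1 : 1 - h * a' n = cfc (fun x : ℝ => 1 - √x * (√(|x| + ε n))⁻¹) k := by
        rw [cfc_sub _ _ k continuousOn_const hc.continuousOn, cfc_const_one ℝ k, hha]
      have h2 : IsSelfAdjoint (1 - h * a' n) := by rw [h1]; exact cfc_predicate _ _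
      have hc1 : Continuous fun x : ℝ => 1 - √x * (√(|x| + ε n))⁻¹ := continuous_const.sub hc
      rw [h2.star_eq, h1, ← cfc_mul _ _ k hc1.continuousOn hc1.continuousOn]
      refine cfc_mono (fun x hx => ?_) (hc1.mul hc1).continuousOn
        (continuous_const.mul (hφ2 n)).continuousOn
      obtain ⟨h3, h4⟩ := hr n x hx
      have h0 := hsp x hx
      have hn := hε n
      have h5 : (√x * (√(|x| + ε n))⁻¹) * (√x * (√(|x| + ε n))⁻¹) = x * (|x| + ε n)⁻¹ := by
        rw [mul_mul_mul_comm, hsq, Real.mul_self_sqrt h0]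
      have h6 : ε n * (|x| + ε n)⁻¹ = 1 - x * (|x| + ε n)⁻¹ := by
        rw [abs_of_nonneg h0]; field_simp; ring
      rw [h6, ← h5]
      nlinarith
    have hwτ : ∀ n, ‖ofM τ (cfc (fun x : ℝ => ε n * (|x| + ε n)⁻¹) k)‖ ≤ ε n * (G 1).re :=
      fun n => by
        have hn := hε n
        refine (norm_ofM_of_nonneg_le τ (cfc_nonneg fun x _ => by positivity)).trans ?_
        rw [cfc_const_mul _ _ k (hφ2 n).continuousOn,
          ← Complex.coe_smul, map_smul, smul_eq_mul, Complex.re_ofReal_mul]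
        exact mul_le_mul_of_nonneg_left (hs1 n) hn.le
    rw [Metric.tendsto_atTop]
    intro δ hδ
    obtain ⟨t, ht, hKt⟩ := hG (δ / 2) (by positivity)
    have h1 : Tendsto (fun n => ε n * (G 1).re) atTop (𝓝 0) := by simpa using hε0.mul_const (G 1).re
    obtain ⟨N, hN⟩ := (h1.eventually_le_const ht).exists_forall_of_atTop
    refine ⟨N, fun n hn => ?_⟩
    rw [Real.dist_0_eq_abs, abs_of_nonneg (hpos _).1]
    refine (hw n).trans_lt ?_
    have h2 : ‖G (cfc (fun x : ℝ => ε n * (|x| + ε n)⁻¹) k)‖ₑ ≤ ENNReal.ofReal (δ / 2) := by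
      refine (le_kFun τ G ?_ ((hwτ n).trans (hN n hn))).trans hKt
      refine norm_cfc_le zero_le_one fun x _ => ?_
      have hn := hε n
      rw [Real.norm_of_nonneg (by positivity), ← div_eq_mul_inv, div_le_one (by positivity)]
      linarith [abs_nonneg x]
    rw [← ofReal_norm, ENNReal.ofReal_le_ofReal_iff (by positivity)] at h2
    linarith [Complex.re_le_norm (G (cfc (fun x : ℝ => ε n * (|x| + ε n)⁻¹) k))]

/-! ### Dominated families factor through a pair of weights -/

/-- `K(2^{-n}, G)` is at most `2^{-n (1 - 1/q)}` times the Lorentz norm; this is where `q > 1` is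
needed. -/
theorem isAbsCont_of_lorentz_lt_top {τ : Trace M} {N : SeqNorm} {q : ℝ} (hq : 1 < q) {G : Fn M}
    {κ : ℤ → ℝ≥0∞} (hκ : ∀ k : ℤ, kFun τ (2 ^ k) G ≤ κ k) (hB : lorentz N q κ < ∞) :
    IsAbsCont τ G := by
  intro ε hε
  have hq1 : 1 / q - 1 < 0 := by
    rw [sub_neg, div_lt_one (by linarith)]; exact hq
  have h1 : Tendsto (fun n : ℕ => ((2 : ℝ≥0∞) ^ (1 / q - 1)) ^ n * lorentz N q κ) atTop (𝓝 0) := by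
    have := ENNReal.Tendsto.mul_const
      (ENNReal.tendsto_pow_atTop_nhds_zero_of_lt_one (two_rpow_lt_one hq1))
      (Or.inr hB.ne : (0 : ℝ≥0∞) ≠ 0 ∨ lorentz N q κ ≠ ∞)
    rwa [zero_mul] at this
  obtain ⟨n, hn⟩ := (h1.eventually_lt_const (ENNReal.ofReal_pos.mpr hε)).exists
  refine ⟨2 ^ (-n : ℤ), by positivity, (hκ _).trans ((le_lorentz N q κ _).trans (le_trans ?_ hn.le))⟩
  rw [← ENNReal.rpow_neg, ← two_rpow_mul_nat]
  refine le_of_eq ?_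
  congr 2
  push_cast
  ring

/-- The unit of `M` has finite Lorentz norm: `K(t, 1)` is at most a multiple of `min 1 t`. -/
theorem lorentz_kFun_trace_lt_top (τ : Trace M) (N : SeqNorm) {q : ℝ} (hq : 1 < q) :
    lorentz N q (fun k : ℤ => kFun τ (2 ^ k) (ofM τ 1)) < ∞ := by
  have hq0 : 0 < q := by linarith
  set D : ℝ := ‖(1 : Elt M)‖ ^ 2 + ‖toL2 τ 1‖ ^ 2 with hD
  have h1 : ∀ k : ℤ, kFun τ (2 ^ k) (ofM τ 1) ≤
      ENNReal.ofReal D * min 1 ((2 : ℝ≥0∞) ^ (k : ℝ)) := fun k => by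
    have h2 := kFun_star_mul_self_le τ (t := 2 ^ k) (1 : Elt M) (s := D) (D := D)
      (by rw [hD]; nlinarith [sq_nonneg ‖toL2 τ 1‖]) (by rw [hD]; nlinarith [sq_nonneg ‖(1 : Elt M)‖])
    rw [star_one, one_mul] at h2
    refine h2.trans ?_
    have hD0 : 0 ≤ D := by positivity
    have h3 : min (D * 2 ^ k) D = D * min 1 (2 ^ k) := by
      rw [mul_min_of_nonneg _ _ hD0, mul_one, min_comm]
    rw [h3, ENNReal.ofReal_mul hD0, ENNReal.ofReal_min, ENNReal.ofReal_one, ofReal_two_zpow]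
  refine (N.mono fun k => mul_le_mul_right (h1 k) _).trans_lt
    (SeqNorm.lt_top_of_tsum_lt_top N ?_)
  set a : ℝ≥0∞ := max ((2 : ℝ≥0∞) ^ (1 / q - 1)) ((2 : ℝ≥0∞) ^ (-(1 / q))) with ha
  have hq1 : 1 / q - 1 < 0 := by
    rw [sub_neg, div_lt_one (by linarith)]; exact hq
  have hq2 : -(1 / q) < 0 := by
    have : 0 < 1 / q := by positivity
    linarith
  refine tsum_int_lt_top (C := ENNReal.ofReal D) (a := a) ENNReal.ofReal_lt_top
    (max_lt (two_rpow_lt_one hq1) (two_rpow_lt_one hq2)) (fun n => ?_) fun n => ?_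
  · calc _ ≤ (2 : ℝ≥0∞) ^ ((1 / q - 1) * n) * (ENNReal.ofReal D * 1) := by
          refine mul_le_mul' (le_of_eq ?_) (mul_le_mul_right (min_le_left _ _) _)
          push_cast
          rw [mul_comm]
      _ ≤ _ := by
          rw [mul_one, mul_comm, two_rpow_mul_nat]
          gcongr
          exact le_max_left _ _
  · calc _ ≤ (2 : ℝ≥0∞) ^ (((-((n : ℤ) + 1) : ℤ) : ℝ) * (1 / q - 1)) *
          (ENNReal.ofReal D * (2 : ℝ≥0∞) ^ ((-((n : ℤ) + 1) : ℤ) : ℝ)) :=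
          mul_le_mul_right (mul_le_mul_right (min_le_right _ _) _) _
      _ = ENNReal.ofReal D * ((2 : ℝ≥0∞) ^ (-(1 / q))) ^ (n + 1) := by
          rw [mul_left_comm, ← ENNReal.rpow_add _ _ (by simp) (by simp), ← two_rpow_mul_nat]
          congr 2
          push_cast
          ring
      _ ≤ ENNReal.ofReal D * ((2 : ℝ≥0∞) ^ (-(1 / q))) ^ n :=
          mul_le_mul_right (pow_le_pow_right_of_le_one' (two_rpow_lt_one hq2).le (Nat.le_succ n)) _
      _ ≤ _ := by
          gcongr
          exact le_max_right _ _

theorem IsPositiveFn.le_add_smul_trace {τ : Trace M} (G : Fn M) {c : ℝ} (hc : 0 ≤ c) (z : Elt M) :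
    (G (z * star z)).re ≤ ((G + (c : ℂ) • ofM τ 1) (z * star z)).re := by
  have h1 := τ.nonneg (mul_star_self_nonneg z)
  rw [add_apply, smul_apply, ofM_apply, one_mul, Complex.add_re, smul_eq_mul,
    Complex.re_ofReal_mul]
  have := mul_nonneg hc h1
  linarith

/-- A majorized family is factored by the inverse roots of its two weights. -/
theorem Majorizes.exists_factorization {τ : Trace M} {J : Type*} {φ : J → Fn M} {G₁ G₂ : Fn M}
    (hφ : Majorizes G₁ G₂ φ) (hp1 : IsPositiveFn G₁) (hp2 : IsPositiveFn G₂) {c : ℝ} (hc : 0 < c)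
    (h1 : IsAbsCont τ G₁) (h2 : IsAbsCont τ G₂)
    (h1' : IsAbsCont τ (G₁ + (c : ℂ) • ofM τ 1)) (h2' : IsAbsCont τ (G₂ + (c : ℂ) • ofM τ 1)) :
    ∃ (a b : L2 τ) (y : J → Elt M), (∀ j, ‖y j‖ ≤ 1) ∧ (∀ j, IsTripleProduct τ a (y j) b (φ j)) ∧
      SqControlled τ a (G₁ + (c : ℂ) • ofM τ 1) ∧ SqControlled τ b (G₂ + (c : ℂ) • ofM τ 1) := by
  have hτ : IsPositiveFn (ofM τ (1 : Elt M)) := by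
    simpa using IsPositiveFn.ofM_star_mul_self τ (1 : Elt M)
  have hle1 := fun z => IsPositiveFn.le_add_smul_trace (τ := τ) G₁ hc.le z
  have hle2 := fun z => IsPositiveFn.le_add_smul_trace (τ := τ) G₂ hc.le z
  have hp1' : IsPositiveFn (G₁ + (c : ℂ) • ofM τ 1) := hp1.add (hτ.smul hc.le)
  have hp2' : IsPositiveFn (G₂ + (c : ℂ) • ofM τ 1) := hp2.add (hτ.smul hc.le)
  -- `c τ` makes the densities of the weights invertible
  obtain ⟨k₁, hk₁, hk₁'⟩ := h1.exists_inverse_density hp1 hc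
  obtain ⟨k₂, hk₂, hk₂'⟩ := h2.exists_inverse_density hp2 hc
  obtain ⟨h₁, a, a', hh₁, hG₁, ha, hSa, ha', hha, hhan, hlima⟩ :=
    exists_inverse_root h1' hp1' hk₁ hk₁'
  obtain ⟨h₂, b, b', hh₂, hG₂, hb, hSb, hb', hhb, hhbn, hlimb⟩ :=
    exists_inverse_root h2' hp2' hk₂ hk₂'
  set G₁' := G₁ + (c : ℂ) • ofM τ 1
  set G₂' := G₂ + (c : ℂ) • ofM τ 1
  -- `y j` is the density of `z ↦ φ_j(h₂ z h₁)`, formally `h₁ φ_j h₂ = G₁^{-1/2} φ_j G₂^{-1/2}`; by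
  -- majorization this functional is bounded by `1` for `‖·‖₁`
  let f : J → Elt M →ₗ[ℂ] ℂ := fun j =>
    { toFun := fun z => φ j (h₂ * z * h₁)
      map_add' := fun x y => by rw [mul_add, add_mul, map_add]
      map_smul' := fun r x => by
        rw [mul_smul_comm, smul_mul_assoc, map_smul, RingHom.id_apply] }
  have hf : ∀ j z, ‖f j z‖ ≤ 1 * ‖ofM τ z‖ := fun j z => by
    rw [one_mul]
    refine norm_le_norm_ofM_of_factor τ (f j) (fun z₁ z₂ => ?_) z
    have e1 : f j (z₁ * star z₂) = φ j ((h₂ * z₁) * star (h₁ * z₂)) := by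
      change φ j (h₂ * (z₁ * star z₂) * h₁) = _
      rw [star_mul, hh₁.star_eq]
      simp only [mul_assoc]
    rw [e1]
    refine (hφ j _ _).trans ?_
    have e2 : ∀ (G : Fn M) {h : Elt M}, IsSelfAdjoint h → (∀ z, G (h * z * h) = τ z) →
        ∀ z, G ((h * z) * star (h * z)) = τ (z * star z) := fun G h hsa hG z => by
      rw [star_mul, hsa.star_eq, ← hG]
      simp only [mul_assoc]
    refine mul_le_mul ?_ ?_ (hp1 _).1 (τ.nonneg (mul_star_self_nonneg _))
    · exact (hle2 _).trans_eq (by rw [e2 G₂' hh₂ hG₂])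
    · exact (hle1 _).trans_eq (by rw [e2 G₁' hh₁ hG₁])
  choose y hy1 hy2 using fun j => exists_elt_of_norm_le τ (f j) 1 zero_le_one (hf j)
  refine ⟨a, b, y, hy1, fun j => ⟨a', b', ha, hb, fun z => ?_⟩, hSa, hSb⟩
  have e1 : ∀ n, τ (a' n * y j * b' n * z) = φ j ((h₂ * b' n) * z * (h₁ * a' n)) := fun n => by
    have e2 : h₁ * a' n = a' n * h₁ := by
      have := (hha n).star_eq
      rwa [star_mul, hh₁.star_eq, (ha' n).star_eq, eq_comm] at this
    rw [mul_assoc, mul_assoc, τ.tracial, mul_assoc, hy2, e2]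
    change φ j (h₂ * _ * h₁) = _
    simp only [mul_assoc]
  simp only [e1]
  rw [tendsto_iff_norm_sub_tendsto_zero]
  -- compare `φ_j(p z r)` with `φ_j(z)`, where `p = h₂ b' n` and `r = h₁ a' n` tend to `1` in the
  -- seminorms of the weights
  have hbound : ∀ n, ‖φ j ((h₂ * b' n) * z * (h₁ * a' n)) - φ j z‖ ≤
      √((G₂' ((1 - h₂ * b' n) * star (1 - h₂ * b' n))).re * (‖G₁‖ * ‖z‖ ^ 2)) +
      √(‖G₂‖ * ‖z‖ ^ 2 * (G₁' ((1 - h₁ * a' n) * star (1 - h₁ * a' n))).re) := fun n => by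
    set p := h₂ * b' n
    set r := h₁ * a' n
    have e2 : φ j (p * z * r) - φ j z =
        -(φ j ((1 - p) * star (star z)) + φ j ((p * z) * star (1 - r))) := by
      rw [← map_sub, ← map_add, ← map_neg, star_star, star_sub, star_one, (hha n).star_eq]
      congr 1
      noncomm_ring
    rw [e2, norm_neg]
    refine (norm_add_le _ _).trans (add_le_add ?_ ?_)
    · refine Real.le_sqrt_of_sq_le ((hφ j _ _).trans ?_)
      refine mul_le_mul (hle2 _) ?_ (hp1 _).1 (hp2' _).1
      simpa using IsPositiveFn.re_apply_le (G := G₁) (star z)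
    · refine Real.le_sqrt_of_sq_le ((hφ j _ _).trans ?_)
      refine mul_le_mul ?_ (hle1 _) (hp1 _).1 (by positivity)
      refine (IsPositiveFn.re_apply_le (G := G₂) (p * z)).trans ?_
      have : ‖p * z‖ ≤ ‖z‖ := (norm_mul_le _ _).trans (by
        have := mul_le_mul_of_nonneg_right (hhbn n) (norm_nonneg z)
        rwa [one_mul] at this)
      gcongr
  refine squeeze_zero (fun _ => norm_nonneg _) hbound ?_
  have l1 := (Real.continuous_sqrt.tendsto _).comp (hlimb.mul_const (‖G₁‖ * ‖z‖ ^ 2))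
  have l2 := (Real.continuous_sqrt.tendsto _).comp (hlima.const_mul (‖G₂‖ * ‖z‖ ^ 2))
  simpa using l1.add l2

/-- A dominated family belongs to the space of families with norm `supNorm`. -/
theorem Dominated.supNorm_le {τ : Trace M} {N : SeqNorm} {q : ℝ} (hq : 1 < q)
    {N₂ : Fn M → ℝ≥0∞}
    (hN₂ : ∀ (a : L2 τ) (G : Fn M) (κ : ℤ → ℝ≥0∞), SqControlled τ a G →
      (∀ k : ℤ, kFun τ (2 ^ k) G ≤ κ k) → N₂ (ofL2 τ a) ≤ (2 * lorentz N q κ) ^ (1 / 2 : ℝ))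
    {B : ℝ≥0} (hB : 0 < B) {J : Type*} {φ : J → Fn M} (h : Dominated τ N q B φ) :
    supNorm τ N₂ φ ≤ 4 * B := by
  obtain ⟨κ, hκ, G₁, G₂, hp1, hp2, hκ1, hκ2, hφ⟩ := h
  set L := lorentz N q (fun k : ℤ => kFun τ (2 ^ k) (ofM τ 1)) with hL
  have hLt : L ≠ ∞ := (lorentz_kFun_trace_lt_top τ N hq).ne
  -- the correction `c τ` that makes the densities invertible at most doubles the bound `B`
  obtain ⟨c, hc, hcL⟩ : ∃ c : ℝ, 0 < c ∧ ENNReal.ofReal c * L ≤ B := by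
    have hB' : (0 : ℝ) < B := hB
    refine ⟨B / (L.toReal + 1), by positivity, ?_⟩
    rw [← ENNReal.ofReal_toReal hLt, ← ENNReal.ofReal_mul (by positivity),
      ← ENNReal.ofReal_coe_nnreal, ENNReal.toReal_ofReal ENNReal.toReal_nonneg]
    refine ENNReal.ofReal_le_ofReal ?_
    rw [div_mul_eq_mul_div, div_le_iff₀ (by positivity)]
    nlinarith [ENNReal.toReal_nonneg (a := L)]
  let κ' : ℤ → ℝ≥0∞ := fun k => κ k + ENNReal.ofReal c * kFun τ (2 ^ k) (ofM τ 1)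
  have hκ' : lorentz N q κ' ≤ 2 * B := by
    refine (lorentz_add_le N q _ _).trans ?_
    rw [two_mul]
    exact add_le_add hκ ((lorentz_smul_le N q _ _).trans hcL)
  have hle : ∀ G : Fn M, (∀ k : ℤ, kFun τ (2 ^ k) G ≤ κ k) →
      ∀ k : ℤ, kFun τ (2 ^ k) (G + (c : ℂ) • ofM τ 1) ≤ κ' k := fun G hG k => by
    refine (kFun_add_le τ _ _ _).trans (add_le_add (hG k) ((kFun_smul_le τ _ _ _).trans_eq ?_))
    rw [← ofReal_norm, Complex.norm_real, Real.norm_of_nonneg hc.le]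
  have hfin : lorentz N q κ < ∞ := hκ.trans_lt ENNReal.coe_lt_top
  have hfin' : lorentz N q κ' < ∞ := hκ'.trans_lt (ENNReal.mul_lt_top (by simp) ENNReal.coe_lt_top)
  obtain ⟨a, b, y, hy, hyφ, hSa, hSb⟩ := hφ.exists_factorization hp1 hp2 hc
    (isAbsCont_of_lorentz_lt_top hq hκ1 hfin) (isAbsCont_of_lorentz_lt_top hq hκ2 hfin)
    (isAbsCont_of_lorentz_lt_top hq (hle _ hκ1) hfin')
    (isAbsCont_of_lorentz_lt_top hq (hle _ hκ2) hfin')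
  refine (iInf₂_le_of_le a b (iInf₂_le_of_le y 1 (iInf₂_le_of_le hy hyφ le_rfl))).trans ?_
  have hbd : (2 * lorentz N q κ') ^ (1 / 2 : ℝ) ≤ ((4 : ℝ≥0∞) * B) ^ (1 / 2 : ℝ) := by
    refine ENNReal.rpow_le_rpow ((mul_le_mul_right hκ' _).trans_eq ?_) (by norm_num)
    rw [← mul_assoc]; norm_num
  calc _ ≤ ((4 : ℝ≥0∞) * B) ^ (1 / 2 : ℝ) * 1 * ((4 : ℝ≥0∞) * B) ^ (1 / 2 : ℝ) := by
        rw [ENNReal.coe_one]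
        gcongr
        · exact (hN₂ a _ κ' hSa (hle _ hκ1)).trans hbd
        · exact (hN₂ b _ κ' hSb (hle _ hκ2)).trans hbd
    _ = 4 * B := by
        rw [mul_one, ← ENNReal.rpow_add_of_nonneg _ _ (by norm_num) (by norm_num)]
        norm_num

/-! ### The spectral theorem: projections from a continuous functional calculus -/

section SpectralTheorem

variable {K : Type*} [NormedAddCommGroup K] [InnerProductSpace ℂ K] [CompleteSpace K]
variable {X : Type*} [MetricSpace X] [CompactSpace X] [MeasurableSpace X] [BorelSpace X]

/-- The scalar measures of a representation of `C(X)`, given by the Riesz–Markov–Kakutani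
theorem. -/
theorem exists_scalar_measure (Φ : C(X, ℝ) →⋆ₐ[ℝ] (K →L[ℂ] K)) (ξ : K) :
    ∃ ν : Measure X, IsFiniteMeasure ν ∧ ∀ f : C(X, ℝ), ∫ x, f x ∂ν = (inner ℂ ξ (Φ f ξ)).re := by
  let c : CompactlySupportedContinuousMap X ℝ → C(X, ℝ) := fun f => f.toContinuousMap
  let Λ : CompactlySupportedContinuousMap X ℝ →ₚ[ℝ] ℝ := PositiveLinearMap.mk₀
    { toFun := fun f => (inner ℂ ξ (Φ (c f) ξ)).re
      map_add' := fun f g => by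
        have : c (f + g) = c f + c g := rfl
        rw [this, map_add, add_apply, inner_add_right, Complex.add_re]
      map_smul' := fun r f => by
        have : c (r • f) = r • c f := rfl
        rw [this, map_smul, RingHom.id_apply, smul_apply, ← Complex.coe_smul, inner_smul_right,
          Complex.re_ofReal_mul, smul_eq_mul] }
    (fun f hf => by
      have h1 : c f = star (⟨fun x => √(f x), by fun_prop⟩ : C(X, ℝ)) *
          ⟨fun x => √(f x), by fun_prop⟩ := by
        ext x
        exact (Real.mul_self_sqrt (hf x)).symm
      have h2 : 0 ≤ Φ (c f) := by
        rw [h1, map_mul, map_star]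
        exact star_mul_self_nonneg _
      rw [ContinuousLinearMap.nonneg_iff_isPositive] at h2
      exact h2.re_inner_nonneg_right ξ)
  refine ⟨RealRMK.rieszMeasure Λ, inferInstance, fun f => ?_⟩
  exact RealRMK.integral_rieszMeasure Λ ⟨f, HasCompactSupport.of_compactSpace _⟩

/-- Continuous functions are dense in `L²(ν)`; truncation to values in `[0, 1]` brings them closer
to an indicator. -/
theorem exists_continuous_approx (ν : Measure X) [IsFiniteMeasure ν] {B : Set X}
    (hB : MeasurableSet B) {ε : ℝ} (hε : 0 < ε) :
    ∃ f : C(X, ℝ), (∀ x, 0 ≤ f x ∧ f x ≤ 1) ∧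
      ∫ x, (f x - B.indicator (fun _ => (1 : ℝ)) x) ^ 2 ∂ν ≤ ε := by
  have h1 : MemLp (B.indicator fun _ => (1 : ℝ)) (ENNReal.ofReal 2) ν :=
    (memLp_const 1).indicator hB
  obtain ⟨g, hg, hg2⟩ := h1.exists_boundedContinuous_integral_rpow_sub_le (by norm_num) hε
  refine ⟨⟨fun x => max 0 (min (g x) 1), by fun_prop⟩,
    fun x => ⟨le_max_left _ _, max_le zero_le_one (min_le_right _ _)⟩, le_trans ?_ hg⟩
  refine integral_mono_of_nonneg (Eventually.of_forall fun x => sq_nonneg _) ?_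
    (Eventually.of_forall fun x => ?_)
  · have := (h1.sub hg2).integrable_norm_rpow (by norm_num) (by norm_num)
    simpa using this
  · change _ ≤ ‖_ - _‖ ^ (2 : ℝ)
    rw [Real.rpow_ofNat, Real.norm_eq_abs]
    refine (sq_abs _).symm.trans_le ?_
    refine pow_le_pow_left₀ (abs_nonneg _) ?_ 2
    change |max 0 (min (g x) 1) - _| ≤ _
    by_cases hx : x ∈ B
    · rw [indicator_of_mem hx]
      rcases le_total (g x) 1 with h | h
      · rw [min_eq_left h, abs_sub_comm, abs_of_nonneg (by simp [h]),
          abs_of_nonneg (by linarith)]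
        linarith [le_max_right 0 (g x)]
      · rw [min_eq_right h]; simp
    · rw [indicator_of_notMem hx]
      rcases le_total 0 (g x) with h | h
      · rw [sub_zero, zero_sub, abs_neg, abs_of_nonneg (le_max_left _ _), abs_of_nonneg h]
        exact max_le h (min_le_left _ _)
      · rw [max_eq_left ((min_le_left _ _).trans h)]; simp

/-- Continuous functions that tend to the indicator of `B` in `L²(ν)`. -/
def IsApprox (ν : Measure X) (B : Set X) (f : ℕ → C(X, ℝ)) : Prop :=
  Tendsto (fun n => ∫ x, (f n x - B.indicator (fun _ => (1 : ℝ)) x) ^ 2 ∂ν) atTop (𝓝 0)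

theorem integrable_sq_sub_indicator (ν : Measure X) [IsFiniteMeasure ν] {B : Set X}
    (hB : MeasurableSet B) (f : C(X, ℝ)) :
    Integrable (fun x => (f x - B.indicator (fun _ => (1 : ℝ)) x) ^ 2) ν := by
  have hm : Measurable fun x => (f x - B.indicator (fun _ => (1 : ℝ)) x) ^ 2 :=
    (f.continuous.measurable.sub (measurable_const.indicator hB)).pow_const 2
  refine Integrable.of_bound hm.aestronglyMeasurable ((‖f‖ + 1) ^ 2)
    (Eventually.of_forall fun x => ?_)
  rw [norm_pow]
  refine pow_le_pow_left₀ (norm_nonneg _) ((norm_sub_le _ _).trans (add_le_add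
    (f.norm_coe_le_norm x) ?_)) 2
  refine (norm_indicator_le_norm_self _ _).trans ?_
  simp

theorem integrable_continuousMap (ν : Measure X) [IsFiniteMeasure ν] (f : C(X, ℝ)) :
    Integrable (fun x => f x) ν :=
  Integrable.of_bound f.continuous.measurable.aestronglyMeasurable ‖f‖
    (Eventually.of_forall f.norm_coe_le_norm)

theorem exists_isApprox (ν : Measure X) [IsFiniteMeasure ν] {B : Set X} (hB : MeasurableSet B) :
    ∃ f : ℕ → C(X, ℝ), (∀ n x, 0 ≤ f n x ∧ f n x ≤ 1) ∧ IsApprox ν B f := by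
  choose f hf1 hf2 using fun n : ℕ => exists_continuous_approx ν hB
    (ε := 1 / ((n : ℝ) + 1)) Nat.one_div_pos_of_nat
  exact ⟨f, hf1, squeeze_zero (fun n => integral_nonneg fun x => sq_nonneg _) hf2
    (tendsto_one_div_add_atTop_nhds_zero_nat (𝕜 := ℝ))⟩

theorem IsApprox.mono {ν ν' : Measure X} [IsFiniteMeasure ν'] {B : Set X} (hB : MeasurableSet B)
    {f : ℕ → C(X, ℝ)} (h : IsApprox ν' B f) (hν : ν ≤ ν') : IsApprox ν B f :=
  squeeze_zero (fun _ => integral_nonneg fun _ => sq_nonneg _)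
    (fun n => integral_mono_measure hν (Eventually.of_forall fun _ => sq_nonneg _)
      (integrable_sq_sub_indicator ν' hB (f n))) h

/-- The approximants have values in `[0, 1]`, so that `|f² - 1_B| ≤ 2 |f - 1_B| ≤ δ + (f - 1_B)² /
δ`. -/
theorem IsApprox.tendsto_integral_sq {ν : Measure X} [IsFiniteMeasure ν] {B : Set X}
    (hB : MeasurableSet B) {f : ℕ → C(X, ℝ)} (h01 : ∀ n x, 0 ≤ f n x ∧ f n x ≤ 1)
    (h : IsApprox ν B f) :
    Tendsto (fun n => ∫ x, f n x * f n x ∂ν) atTop (𝓝 (ν.real B)) := by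
  rw [Metric.tendsto_atTop]
  intro ε hε
  set V := ν.real univ
  have hV : 0 ≤ V := measureReal_nonneg
  set δ := ε / (2 * (V + 1)) with hδ
  have hδ0 : 0 < δ := by positivity
  obtain ⟨n₀, hn₀⟩ := Metric.tendsto_atTop.mp h (ε * δ / 2) (by positivity)
  refine ⟨n₀, fun n hn => ?_⟩
  have h1 := hn₀ n hn
  rw [Real.dist_0_eq_abs, abs_of_nonneg (integral_nonneg fun x => sq_nonneg _)] at h1
  have hi1 : Integrable (fun x => f n x * f n x) ν := integrable_continuousMap ν (f n * f n)
  have hi2 : Integrable (B.indicator fun _ => (1 : ℝ)) ν := (integrable_const 1).indicator hB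
  have hi3 := integrable_sq_sub_indicator ν hB (f n)
  have h2 : ν.real B = ∫ x, B.indicator (fun _ => (1 : ℝ)) x ∂ν := by
    rw [integral_indicator hB]; simp
  rw [Real.dist_eq, h2, ← integral_sub hi1 hi2]
  calc _ ≤ ∫ x, (δ + (f n x - B.indicator (fun _ => (1 : ℝ)) x) ^ 2 / δ) ∂ν := by
        refine (abs_integral_le_integral_abs).trans (integral_mono (hi1.sub hi2).abs
          ((integrable_const δ).add (hi3.div_const δ)) fun x => ?_)
        have h3 : |f n x * f n x - B.indicator (fun _ => (1 : ℝ)) x| ≤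
            2 * |f n x - B.indicator (fun _ => (1 : ℝ)) x| := by
          obtain ⟨h4, h5⟩ := h01 n x
          by_cases hx : x ∈ B
          · rw [indicator_of_mem hx, abs_sub_comm, abs_sub_comm (f n x),
              abs_of_nonneg (by nlinarith), abs_of_nonneg (by linarith)]
            nlinarith
          · rw [indicator_of_notMem hx, sub_zero, sub_zero, abs_of_nonneg (by positivity),
              abs_of_nonneg h4]
            nlinarith
        refine h3.trans ?_
        rw [← sq_abs (f n x - _)]
        set a := |f n x - B.indicator (fun _ => (1 : ℝ)) x|
        change 2 * a ≤ δ + a ^ 2 / δ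
        rw [← sub_nonneg]
        have : δ + a ^ 2 / δ - 2 * a = (δ - a) ^ 2 / δ := by field_simp; ring
        rw [this]
        positivity
    _ = V * δ + (∫ x, (f n x - B.indicator (fun _ => (1 : ℝ)) x) ^ 2 ∂ν) / δ := by
        rw [integral_add (integrable_const δ) (hi3.div_const δ), integral_const, integral_div,
          smul_eq_mul]
    _ < V * δ + ε / 2 := by
        refine add_lt_add_right ?_ _
        rw [div_lt_iff₀ hδ0]
        linarith
    _ ≤ ε := by
        have : V * δ ≤ ε / 2 := by
          rw [hδ, mul_div_assoc', div_le_iff₀ (by positivity)]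
          nlinarith
        linarith

theorem isSelfAdjoint_map_continuousMap {X : Type*} [TopologicalSpace X]
    (Φ : C(X, ℝ) →⋆ₐ[ℝ] (K →L[ℂ] K)) (f : C(X, ℝ)) : IsSelfAdjoint (Φ f) := by
  rw [IsSelfAdjoint, ← map_star]
  congr 1

theorem inner_map_continuousMap {X : Type*} [TopologicalSpace X]
    (Φ : C(X, ℝ) →⋆ₐ[ℝ] (K →L[ℂ] K)) (f : C(X, ℝ)) (ξ η : K) :
    inner ℂ (Φ f ξ) η = inner ℂ ξ (Φ f η) := by
  rw [← ContinuousLinearMap.adjoint_inner_left, ← ContinuousLinearMap.star_eq_adjoint,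
    (isSelfAdjoint_map_continuousMap Φ f).star_eq]

/-- The scalar measures `ν_ξ` of a representation of `C(X)`. -/
structure ScalarMeasures (Φ : C(X, ℝ) →⋆ₐ[ℝ] (K →L[ℂ] K)) (ν : K → Measure X) : Prop where
  isFinite : ∀ ξ, IsFiniteMeasure (ν ξ)
  integral_eq : ∀ ξ, ∀ f : C(X, ℝ), ∫ x, f x ∂(ν ξ) = (inner ℂ ξ (Φ f ξ)).re

namespace ScalarMeasures

variable {Φ : C(X, ℝ) →⋆ₐ[ℝ] (K →L[ℂ] K)} {ν : K → Measure X}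

theorem norm_sq (h : ScalarMeasures Φ ν) (f : C(X, ℝ)) (ξ : K) :
    ‖Φ f ξ‖ ^ 2 = ∫ x, f x * f x ∂(ν ξ) := by
  rw [← inner_self_eq_norm_sq (𝕜 := ℂ), inner_map_continuousMap]
  have : Φ f (Φ f ξ) = Φ (f * f) ξ := by rw [map_mul]; rfl
  rw [this]
  exact (h.integral_eq ξ (f * f)).symm

theorem measureReal_univ (h : ScalarMeasures Φ ν) (ξ : K) : (ν ξ).real univ = ‖ξ‖ ^ 2 := by
  have := h.norm_sq 1 ξ
  rw [map_one] at this
  simpa using this.symm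

theorem norm_sub_sq_le (h : ScalarMeasures Φ ν) {B : Set X} (hB : MeasurableSet B)
    (f g : C(X, ℝ)) (ξ : K) : ‖Φ f ξ - Φ g ξ‖ ^ 2 ≤
      2 * ∫ x, (f x - B.indicator (fun _ => (1 : ℝ)) x) ^ 2 ∂(ν ξ) +
      2 * ∫ x, (g x - B.indicator (fun _ => (1 : ℝ)) x) ^ 2 ∂(ν ξ) := by
  have := h.isFinite ξ
  have h1 : Φ f ξ - Φ g ξ = Φ (f - g) ξ := by rw [map_sub]; rfl
  have hf := integrable_sq_sub_indicator (ν ξ) hB f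
  have hg := integrable_sq_sub_indicator (ν ξ) hB g
  rw [h1, h.norm_sq, ← integral_const_mul, ← integral_const_mul,
    ← integral_add (hf.const_mul 2) (hg.const_mul 2)]
  refine integral_mono (integrable_continuousMap (ν ξ) ((f - g) * (f - g)))
    ((hf.const_mul 2).add (hg.const_mul 2)) fun x => ?_
  change (f x - g x) * (f x - g x) ≤ 2 * _ ^ 2 + 2 * _ ^ 2
  nlinarith [sq_nonneg ((f x - B.indicator (fun _ => (1 : ℝ)) x) +
    (g x - B.indicator (fun _ => (1 : ℝ)) x))]

/-- The vectors `f_n(S) ξ` converge, to the same limit, whenever `f_n` tends to the indicator of `B`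
in `L²(ν_ξ)`. -/
theorem exists_limit (h : ScalarMeasures Φ ν) {B : Set X} (hB : MeasurableSet B) (ξ : K) :
    ∃ η, ∀ f : ℕ → C(X, ℝ), IsApprox (ν ξ) B f → Tendsto (fun n => Φ (f n) ξ) atTop (𝓝 η) := by
  have := h.isFinite ξ
  obtain ⟨g, -, hg⟩ := exists_isApprox (ν ξ) hB
  obtain ⟨η, hη⟩ : ∃ η, Tendsto (fun n => Φ (g n) ξ) atTop (𝓝 η) := by
    refine cauchySeq_tendsto_of_complete (Metric.cauchySeq_iff.mpr fun ε hε => ?_)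
    obtain ⟨n₀, hn₀⟩ := Metric.tendsto_atTop.mp hg (ε ^ 2 / 4) (by positivity)
    refine ⟨n₀, fun m hm n hn => ?_⟩
    have h1 := hn₀ m hm
    have h2 := hn₀ n hn
    rw [Real.dist_0_eq_abs, abs_of_nonneg (integral_nonneg fun x => sq_nonneg _)] at h1 h2
    have h3 := h.norm_sub_sq_le hB (g m) (g n) ξ
    rw [dist_eq_norm]
    exact lt_of_pow_lt_pow_left₀ 2 hε.le (by linarith)
  refine ⟨η, fun f hf => ?_⟩
  have h1 : Tendsto (fun n => ‖Φ (f n) ξ - Φ (g n) ξ‖ ^ 2) atTop (𝓝 0) := by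
    refine squeeze_zero (fun _ => sq_nonneg _) (fun n => h.norm_sub_sq_le hB (f n) (g n) ξ) ?_
    simpa using (hf.const_mul 2).add (hg.const_mul 2)
  have h2 : Tendsto (fun n => ‖Φ (f n) ξ - Φ (g n) ξ‖) atTop (𝓝 0) := by
    have := (Real.continuous_sqrt.tendsto 0).comp h1
    simpa [Function.comp_def, Real.sqrt_sq] using this
  have h3 := (tendsto_zero_iff_norm_tendsto_zero.mpr h2).add hη
  simpa using h3

/-- There is a sequence that approximates `B` for three given measures at once. -/
theorem exists_common_approx (h : ScalarMeasures Φ ν) {B : Set X} (hB : MeasurableSet B)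
    (ξ η ζ : K) : ∃ f : ℕ → C(X, ℝ), (∀ n x, 0 ≤ f n x ∧ f n x ≤ 1) ∧ IsApprox (ν ξ) B f ∧
      IsApprox (ν η) B f ∧ IsApprox (ν ζ) B f := by
  have := h.isFinite ξ
  have := h.isFinite η
  have := h.isFinite ζ
  obtain ⟨f, hf1, hf⟩ := exists_isApprox (ν ξ + ν η + ν ζ) hB
  refine ⟨f, hf1, hf.mono hB ?_, hf.mono hB ?_, hf.mono hB ?_⟩
  · rw [add_assoc]; exact Measure.le_add_right le_rfl
  · rw [add_comm (ν ξ), add_assoc]; exact Measure.le_add_right le_rfl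
  · exact Measure.le_add_left le_rfl

/-- The spectral projections. -/
theorem exists_spectral_projections (h : ScalarMeasures Φ ν) :
    ∃ P : Set X → K →L[ℂ] K, (∀ B, MeasurableSet B → IsStarProjection (P B)) ∧ P univ = 1 ∧
      (∀ B, MeasurableSet B → ∀ ξ, ‖P B ξ‖ ^ 2 = (ν ξ).real B) ∧
      ∀ B C, MeasurableSet B → MeasurableSet C → Disjoint B C → P (B ∪ C) = P B + P C := by
  classical
  -- `P B ξ` is the limit of `f_n(S) ξ`, for `f_n` tending to the indicator of `B`; linearity,
  -- idempotence, symmetry and additivity are inherited from the approximants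
  choose! η hη using fun (B : Set X) (hB : MeasurableSet B) (ξ : K) => h.exists_limit hB ξ
  have hnorm : ∀ B, MeasurableSet B → ∀ ξ, ‖η B ξ‖ ^ 2 = (ν ξ).real B := fun B hB ξ => by
    have := h.isFinite ξ
    obtain ⟨f, hf1, hf⟩ := exists_isApprox (ν ξ) hB
    have h1 := ((hη B hB ξ f hf).norm).pow 2
    simp only [h.norm_sq] at h1
    exact tendsto_nhds_unique h1 (hf.tendsto_integral_sq hB hf1)
  let P : Set X → K →L[ℂ] K := fun B =>
    if hB : MeasurableSet B then LinearMap.mkContinuous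
      { toFun := η B
        map_add' := fun ξ ζ => by
          obtain ⟨f, -, h1, h2, h3⟩ := h.exists_common_approx hB ξ ζ (ξ + ζ)
          refine tendsto_nhds_unique (hη B hB _ f h3) ?_
          simpa only [map_add] using (hη B hB _ f h1).add (hη B hB _ f h2)
        map_smul' := fun c ξ => by
          obtain ⟨f, -, h1, h2, -⟩ := h.exists_common_approx hB ξ (c • ξ) 0
          refine tendsto_nhds_unique (hη B hB _ f h2) ?_
          simpa only [map_smul, RingHom.id_apply] using (hη B hB _ f h1).const_smul c } 1
      (fun ξ => by
        have := h.isFinite ξ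
        have h1 : ‖η B ξ‖ ^ 2 ≤ ‖ξ‖ ^ 2 := by
          rw [hnorm B hB, ← h.measureReal_univ]
          exact measureReal_mono (subset_univ _)
        rw [one_mul]
        exact le_of_sq_le_sq h1 (norm_nonneg _)) else 0
  have hP : ∀ B, MeasurableSet B → ∀ ξ, P B ξ = η B ξ := fun B hB ξ => by
    simp only [P, dif_pos hB, LinearMap.mkContinuous_apply]
    rfl
  refine ⟨P, fun B hB => ⟨?_, ?_⟩, ?_, fun B hB ξ => by rw [hP B hB, hnorm B hB],
    fun B C hB hC hBC => ?_⟩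
  · ext ξ
    change P B (P B ξ) = P B ξ
    simp only [hP B hB]
    -- compare `f_n(S) (f_n(S) ξ)`, which tends to `P B ξ` as `f_n²` approximates `B`, with
    -- `f_n(S) (P B ξ)`, which tends to `P B (P B ξ)`
    obtain ⟨f, hf1, h1, h2, -⟩ := h.exists_common_approx hB ξ (η B ξ) 0
    have h3 := hη B hB _ f h2
    have h4 := hη B hB _ f h1
    have h5 : Tendsto (fun n => Φ (f n) (η B ξ) - Φ (f n) (Φ (f n) ξ)) atTop (𝓝 0) := by
      have h6 : Tendsto (fun n => ‖η B ξ - Φ (f n) ξ‖) atTop (𝓝 0) := by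
        have := (h4.const_sub (η B ξ)).norm
        simpa using this
      refine squeeze_zero_norm (fun n => ?_) h6
      rw [← map_sub]
      refine le_of_sq_le_sq ?_ (norm_nonneg _)
      have := h.isFinite (η B ξ - Φ (f n) ξ)
      rw [h.norm_sq, ← h.measureReal_univ]
      have h7 : (ν (η B ξ - Φ (f n) ξ)).real univ = ∫ _, (1 : ℝ) ∂ν (η B ξ - Φ (f n) ξ) := by simp
      rw [h7]
      refine integral_mono (integrable_continuousMap _ (f n * f n)) (integrable_const 1) fun x => ?_
      obtain ⟨h8, h9⟩ := hf1 n x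
      change f n x * f n x ≤ 1
      nlinarith
    have h6 : Tendsto (fun n => Φ (f n) (Φ (f n) ξ)) atTop (𝓝 (η B ξ)) := by
      have h7 : IsApprox (ν ξ) B fun n => f n * f n := by
        have := h.isFinite ξ
        have h8 := h1.const_mul 4
        rw [mul_zero] at h8
        refine squeeze_zero (fun n => integral_nonneg fun x => sq_nonneg _) (fun n => ?_) h8
        rw [← integral_const_mul]
        refine integral_mono (integrable_sq_sub_indicator _ hB (f n * f n))
          ((integrable_sq_sub_indicator _ hB (f n)).const_mul 4) fun x => ?_
        obtain ⟨h8, h9⟩ := hf1 n x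
        change (f n x * f n x - _) ^ 2 ≤ 4 * (f n x - _) ^ 2
        by_cases hx : x ∈ B
        · rw [indicator_of_mem hx]
          have : (f n x * f n x - 1) ^ 2 = (f n x + 1) ^ 2 * (f n x - 1) ^ 2 := by ring
          rw [this]
          gcongr
          nlinarith
        · rw [indicator_of_notMem hx, sub_zero, sub_zero]
          nlinarith [mul_nonneg h8 h8, mul_le_mul h9 h9 h8 zero_le_one,
            mul_nonneg (mul_nonneg h8 h8) (mul_nonneg h8 h8)]
      have h8 := hη B hB ξ _ h7
      refine h8.congr fun n => ?_
      rw [map_mul]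
      rfl
    have h7 := h5.add h6
    simp only [sub_add_cancel, zero_add] at h7
    exact tendsto_nhds_unique h3 h7
  · rw [ContinuousLinearMap.isSelfAdjoint_iff_isSymmetric]
    intro ξ ζ
    change inner ℂ (P B ξ) ζ = inner ℂ ξ (P B ζ)
    simp only [hP B hB]
    obtain ⟨f, -, h1, h2, -⟩ := h.exists_common_approx hB ξ ζ 0
    have h3 := (hη B hB _ f h1).inner (tendsto_const_nhds (x := ζ)) (𝕜 := ℂ)
    have h4 := (tendsto_const_nhds (x := ξ)).inner (hη B hB _ f h2) (𝕜 := ℂ)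
    simp only [inner_map_continuousMap] at h3
    exact tendsto_nhds_unique h3 h4
  · ext ξ
    rw [hP _ MeasurableSet.univ]
    refine tendsto_nhds_unique (hη univ MeasurableSet.univ ξ (fun _ => 1) ?_) ?_
    · simp [IsApprox]
    · simp
  · ext ξ
    rw [add_apply, hP _ hB, hP _ hC, hP _ (hB.union hC)]
    have := h.isFinite ξ
    obtain ⟨f, -, hf⟩ := exists_isApprox (ν ξ) hB
    obtain ⟨g, -, hg⟩ := exists_isApprox (ν ξ) hC
    have h1 : IsApprox (ν ξ) (B ∪ C) fun n => f n + g n := by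
      have h8 := (hf.const_mul 2).add (hg.const_mul 2)
      rw [mul_zero, add_zero] at h8
      refine squeeze_zero (fun n => integral_nonneg fun x => sq_nonneg _) (fun n => ?_) h8
      have hif := (integrable_sq_sub_indicator (ν ξ) hB (f n)).const_mul 2
      have hig := (integrable_sq_sub_indicator (ν ξ) hC (g n)).const_mul 2
      rw [← integral_const_mul, ← integral_const_mul, ← integral_add hif hig]
      refine integral_mono (integrable_sq_sub_indicator _ (hB.union hC) (f n + g n))
        (hif.add hig) fun x => ?_
      rw [indicator_union_of_disjoint hBC]
      change (f n x + g n x - (_ + _)) ^ 2 ≤ 2 * _ ^ 2 + 2 * _ ^ 2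
      nlinarith [sq_nonneg ((f n x - B.indicator (fun _ => (1 : ℝ)) x) -
        (g n x - C.indicator (fun _ => (1 : ℝ)) x))]
    have h2 := hη _ (hB.union hC) ξ _ h1
    have h3 := (hη B hB ξ f hf).add (hη C hC ξ g hg)
    refine tendsto_nhds_unique h2 (h3.congr fun n => ?_)
    rw [map_add]
    rfl

end ScalarMeasures

end SpectralTheorem

/-! ### The bounded Borel functional calculus of a spectral measure -/

namespace SpectralMeasure

variable {K : Type*} [NormedAddCommGroup K] [InnerProductSpace ℂ K] [CompleteSpace K]
variable (E : SpectralMeasure K)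

theorem measure_apply {B : Set ℝ} (hB : MeasurableSet B) (ξ : K) :
    E.measure ξ B = ENNReal.ofReal (‖E.proj B ξ‖ ^ 2) :=
  Measure.ofMeasurable_apply B hB

instance (ξ : K) : IsFiniteMeasure (E.measure ξ) :=
  ⟨by rw [E.measure_apply MeasurableSet.univ]; exact ENNReal.ofReal_lt_top⟩

theorem measureReal_apply {B : Set ℝ} (hB : MeasurableSet B) (ξ : K) :
    (E.measure ξ).real B = ‖E.proj B ξ‖ ^ 2 := by
  rw [measureReal_def, E.measure_apply hB, ENNReal.toReal_ofReal (by positivity)]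

theorem measureReal_univ (ξ : K) : (E.measure ξ).real univ = ‖ξ‖ ^ 2 := by
  rw [E.measureReal_apply MeasurableSet.univ, E.proj_univ]; rfl

theorem proj_union {B C : Set ℝ} (hB : MeasurableSet B) (hC : MeasurableSet C)
    (hBC : Disjoint B C) : E.proj (B ∪ C) = E.proj B + E.proj C := by
  ext ξ
  let D : ℕ → Set ℝ := fun n => if n = 0 then B else if n = 1 then C else ∅
  have hD : ∀ n, MeasurableSet (D n) := fun n => by
    simp only [D]; split_ifs <;> simp [hB, hC]
  have hdisj : Pairwise (Function.onFun Disjoint D) := fun i j hij => by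
    simp only [D, Function.onFun]
    split_ifs <;> first | omega | exact hBC | exact hBC.symm | simp
  have hU : (⋃ n, D n) = B ∪ C := by
    ext x
    simp only [mem_iUnion, mem_union, D]
    constructor
    · rintro ⟨n, hn⟩
      split_ifs at hn
      · exact Or.inl hn
      · exact Or.inr hn
      · exact absurd hn (by simp)
    · rintro (h | h)
      · exact ⟨0, by simpa using h⟩
      · exact ⟨1, by simpa using h⟩
  have h1 := E.hasSum_proj D hD hdisj ξ
  rw [hU] at h1
  have h2 : HasSum (fun n => E.proj (D n) ξ) (∑ n ∈ Finset.range 2, E.proj (D n) ξ) :=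
    hasSum_sum_of_ne_finset_zero fun n hn => by
      have : 1 < n := by simpa using hn
      have h3 : D n = ∅ := by simp only [D]; rw [if_neg (by omega), if_neg (by omega)]
      rw [h3, E.proj_empty]; rfl
  rw [h1.unique h2, Finset.sum_range_succ, Finset.sum_range_one]
  simp [D]

theorem inner_proj_comm {B : Set ℝ} (hB : MeasurableSet B) (ξ η : K) :
    inner ℂ (E.proj B ξ) η = inner ℂ ξ (E.proj B η) := by
  rw [← ContinuousLinearMap.adjoint_inner_left, ← ContinuousLinearMap.star_eq_adjoint,
    (E.isStarProjection B hB).isSelfAdjoint.star_eq]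

theorem proj_mul_self {B : Set ℝ} (hB : MeasurableSet B) : E.proj B * E.proj B = E.proj B :=
  (E.isStarProjection B hB).isIdempotentElem.eq

/-- The projections of disjoint sets are orthogonal: with `η = E(C) ξ`, additivity of
`‖E(·) η‖²` gives `2 ‖E(B) E(C) ξ‖² = 0`. -/
theorem proj_mul_of_disjoint {B C : Set ℝ} (hB : MeasurableSet B) (hC : MeasurableSet C)
    (hBC : Disjoint B C) : E.proj B * E.proj C = 0 := by
  ext ξ
  change E.proj B (E.proj C ξ) = 0
  set η := E.proj C ξ
  have hη : E.proj C η = η := congrArg (fun A : K →L[ℂ] K => A ξ) (E.proj_mul_self hC)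
  have h1 := measureReal_union (μ := E.measure η) hBC hC
  rw [E.measureReal_apply hB, E.measureReal_apply hC, E.measureReal_apply (hB.union hC),
    E.proj_union hB hC hBC, add_apply, hη] at h1
  have h2 := norm_add_sq (𝕜 := ℂ) (E.proj B η) η
  have h3 : RCLike.re (inner ℂ (E.proj B η) η) = ‖E.proj B η‖ ^ 2 := by
    rw [E.inner_proj_comm hB, ← E.inner_proj hB]; rfl
  rw [h3] at h2
  have h4 : ‖E.proj B η‖ ^ 2 = 0 := by linarith
  simpa using h4

/-- The integral of a simple function. -/
def simpleOp (s : SimpleFunc ℝ ℂ) : K →L[ℂ] K := ∑ c ∈ s.range, c • E.proj (s ⁻¹' {c})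

theorem finMeasAdditive : FinMeasAdditive (0 : Measure ℝ)
    fun B => (ContinuousLinearMap.id ℝ ℂ).smulRight (E.proj B) := by
  intro B C hB hC _ _ hBC
  ext c : 1
  simp [E.proj_union hB hC hBC]

theorem simpleOp_map {G : Type*} [NormedAddCommGroup G] (p : SimpleFunc ℝ G) {g : G → ℂ}
    (hg : g 0 = 0) : E.simpleOp (p.map g) = ∑ x ∈ p.range, g x • E.proj (p ⁻¹' {x}) :=
  SimpleFunc.map_setToSimpleFunc _ E.finMeasAdditive integrable_zero_measure hg

theorem simpleOp_sub (s t : SimpleFunc ℝ ℂ) :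
    E.simpleOp (s - t) = E.simpleOp s - E.simpleOp t :=
  SimpleFunc.setToSimpleFunc_sub _ E.finMeasAdditive integrable_zero_measure integrable_zero_measure

theorem simpleOp_mul (s t : SimpleFunc ℝ ℂ) :
    E.simpleOp (s * t) = E.simpleOp s * E.simpleOp t := by
  classical
  set p := s.pair t
  have h1 : s = p.map Prod.fst := by ext x; rfl
  have h2 : t = p.map Prod.snd := by ext x; rfl
  have h3 : s * t = p.map fun z => z.1 * z.2 := by ext x; rfl
  rw [h3, E.simpleOp_map p (by simp)]
  conv_rhs => rw [h1, h2]
  rw [E.simpleOp_map p rfl, E.simpleOp_map p rfl, Finset.sum_mul_sum]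
  refine Finset.sum_congr rfl fun x hx => ?_
  rw [Finset.sum_eq_single x]
  · rw [smul_mul_smul_comm, E.proj_mul_self (p.measurableSet_fiber x)]
  · intro y _ hyx
    rw [smul_mul_smul_comm, E.proj_mul_of_disjoint (p.measurableSet_fiber x)
      (p.measurableSet_fiber y), smul_zero]
    exact Disjoint.preimage _ (by simpa using hyx.symm)
  · exact fun h => absurd hx h

theorem simpleOp_conj (s : SimpleFunc ℝ ℂ) (ξ η : K) :
    inner ℂ (E.simpleOp s ξ) η = inner ℂ ξ (E.simpleOp (s.map (starRingEnd ℂ)) η) := by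
  rw [E.simpleOp_map s (map_zero _), simpleOp, sum_apply, sum_apply, sum_inner, inner_sum]
  refine Finset.sum_congr rfl fun c _ => ?_
  rw [smul_apply, smul_apply, inner_smul_left, inner_smul_right,
    E.inner_proj_comm (s.measurableSet_fiber c)]

theorem inner_simpleOp (s : SimpleFunc ℝ ℂ) (ξ : K) :
    inner ℂ ξ (E.simpleOp s ξ) = ∫ l, s l ∂(E.measure ξ) := by
  rw [← SimpleFunc.integral_eq_integral s (SimpleFunc.integrable_of_isFiniteMeasure s),
    SimpleFunc.integral_eq, simpleOp, sum_apply, inner_sum]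
  refine Finset.sum_congr rfl fun c _ => ?_
  have hm := s.measurableSet_fiber c
  rw [smul_apply, inner_smul_right, E.measureReal_apply hm, mul_comm]
  have h1 : inner ℂ ξ (E.proj (s ⁻¹' {c}) ξ) = ((‖E.proj (s ⁻¹' {c}) ξ‖ ^ 2 : ℝ) : ℂ) := by
    conv_lhs => rw [← E.proj_mul_self hm]
    change inner ℂ ξ (E.proj _ (E.proj _ ξ)) = _
    rw [← E.inner_proj_comm hm, inner_self_eq_norm_sq_to_K]
    norm_cast
  rw [h1]
  simp

theorem norm_simpleOp_sq (s : SimpleFunc ℝ ℂ) (ξ : K) :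
    ‖E.simpleOp s ξ‖ ^ 2 = ∫ l, ‖s l‖ ^ 2 ∂(E.measure ξ) := by
  have h1 : inner ℂ (E.simpleOp s ξ) (E.simpleOp s ξ) =
      ((∫ l, ‖s l‖ ^ 2 ∂(E.measure ξ) : ℝ) : ℂ) := by
    rw [E.simpleOp_conj]
    change inner ℂ ξ ((E.simpleOp _ * E.simpleOp s) ξ) = _
    rw [← E.simpleOp_mul, inner_simpleOp, ← integral_complex_ofReal]
    refine integral_congr_ae (Eventually.of_forall fun l => ?_)
    change (starRingEnd ℂ) (s l) * s l = ((‖s l‖ ^ 2 : ℝ) : ℂ)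
    rw [Complex.conj_mul']
    norm_cast
  rw [← inner_self_eq_norm_sq (𝕜 := ℂ), h1]
  rfl

theorem norm_simpleOp_le {s : SimpleFunc ℝ ℂ} {C : ℝ} (hC : 0 ≤ C) (hs : ∀ l, ‖s l‖ ≤ C) :
    ‖E.simpleOp s‖ ≤ C := by
  refine ContinuousLinearMap.opNorm_le_bound _ hC fun ξ => ?_
  refine le_of_sq_le_sq ?_ (by positivity)
  rw [E.norm_simpleOp_sq, mul_pow, ← E.measureReal_univ]
  calc _ ≤ ∫ _, C ^ 2 ∂(E.measure ξ) := by
        refine integral_mono_of_nonneg (Eventually.of_forall fun l => by positivity)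
          (integrable_const _) (Eventually.of_forall fun l => ?_)
        exact pow_le_pow_left₀ (norm_nonneg _) (hs l) 2
    _ = _ := by simp [mul_comm]

end SpectralMeasure

/-- Bounded Borel functions. -/
structure IsBdd (f : ℝ → ℂ) : Prop where
  measurable : Measurable f
  bounded : ∃ C : ℝ, ∀ l, ‖f l‖ ≤ C

namespace IsBdd

variable {f g : ℝ → ℂ}

theorem mul (hf : IsBdd f) (hg : IsBdd g) : IsBdd fun l => f l * g l := by
  obtain ⟨C, hC⟩ := hf.bounded
  obtain ⟨D, hD⟩ := hg.bounded
  refine ⟨hf.measurable.mul hg.measurable, C * D, fun l => ?_⟩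
  rw [norm_mul]
  exact mul_le_mul (hC l) (hD l) (norm_nonneg _) ((norm_nonneg _).trans (hC l))

theorem sub (hf : IsBdd f) (hg : IsBdd g) : IsBdd fun l => f l - g l := by
  obtain ⟨C, hC⟩ := hf.bounded
  obtain ⟨D, hD⟩ := hg.bounded
  exact ⟨hf.measurable.sub hg.measurable, C + D, fun l =>
    (norm_sub_le _ _).trans (add_le_add (hC l) (hD l))⟩

theorem add (hf : IsBdd f) (hg : IsBdd g) : IsBdd fun l => f l + g l := by
  obtain ⟨C, hC⟩ := hf.bounded
  obtain ⟨D, hD⟩ := hg.bounded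
  exact ⟨hf.measurable.add hg.measurable, C + D, fun l =>
    (norm_add_le _ _).trans (add_le_add (hC l) (hD l))⟩

theorem conj (hf : IsBdd f) : IsBdd fun l => (starRingEnd ℂ) (f l) := by
  obtain ⟨C, hC⟩ := hf.bounded
  exact ⟨Complex.continuous_conj.measurable.comp hf.measurable, C, fun l => by
    rw [Complex.norm_conj]; exact hC l⟩

theorem const (c : ℂ) : IsBdd fun _ => c := ⟨measurable_const, ‖c‖, fun _ => le_rfl⟩

theorem simpleFunc (s : SimpleFunc ℝ ℂ) : IsBdd s := by
  obtain ⟨C, hC⟩ := s.exists_forall_norm_le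
  exact ⟨s.measurable, C, hC⟩

theorem integrable (hf : IsBdd f) (μ : Measure ℝ) [IsFiniteMeasure μ] : Integrable f μ := by
  obtain ⟨C, hC⟩ := hf.bounded
  exact Integrable.of_bound hf.measurable.aestronglyMeasurable C (Eventually.of_forall hC)

theorem integrable_norm_sq (hf : IsBdd f) (μ : Measure ℝ) [IsFiniteMeasure μ] :
    Integrable (fun l => ‖f l‖ ^ 2) μ := by
  obtain ⟨C, hC⟩ := hf.bounded
  refine Integrable.of_bound (hf.measurable.norm.pow_const 2).aestronglyMeasurable (C ^ 2)
    (Eventually.of_forall fun l => ?_)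
  rw [norm_pow, norm_norm]
  exact pow_le_pow_left₀ (norm_nonneg _) (hC l) 2

theorem exists_simpleFunc (hf : IsBdd f) {ε : ℝ} (hε : 0 < ε) :
    ∃ s : SimpleFunc ℝ ℂ, ∀ l, ‖f l - s l‖ ≤ ε := by
  obtain ⟨C, hC⟩ := hf.bounded
  let e := TopologicalSpace.denseSeq ℂ
  obtain ⟨N, hN⟩ := (isCompact_closedBall (0 : ℂ) C).elim_directed_cover
    (fun N : ℕ => ⋃ k ≤ N, Metric.ball (e k) ε)
    (fun N => isOpen_iUnion fun k => isOpen_iUnion fun _ => Metric.isOpen_ball)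
    (fun z _ => by
      obtain ⟨k, hk⟩ := (TopologicalSpace.denseRange_denseSeq ℂ).exists_dist_lt z hε
      exact mem_iUnion.mpr ⟨k, mem_iUnion₂.mpr ⟨k, le_rfl, hk⟩⟩)
    (directed_of_isDirected_le fun N N' h => iUnion_mono fun k =>
      iUnion_mono' fun hk => ⟨hk.trans h, le_rfl⟩)
  refine ⟨(SimpleFunc.nearestPt e N).comp f hf.measurable, fun l => ?_⟩
  obtain ⟨k, hk, hl⟩ := mem_iUnion₂.mp (hN (show f l ∈ Metric.closedBall 0 C by simpa using hC l))
  have h1 := SimpleFunc.edist_nearestPt_le e (f l) hk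
  rw [edist_dist, edist_dist, ENNReal.ofReal_le_ofReal_iff dist_nonneg] at h1
  rw [← dist_eq_norm, dist_comm]
  refine h1.trans ?_
  rw [dist_comm]
  exact (Metric.mem_ball.mp hl).le

theorem exists_seq (hf : IsBdd f) :
    ∃ s : ℕ → SimpleFunc ℝ ℂ, ∀ n l, ‖f l - s n l‖ ≤ 1 / ((n : ℝ) + 1) := by
  choose s hs using fun n : ℕ => hf.exists_simpleFunc (ε := 1 / ((n : ℝ) + 1)) Nat.one_div_pos_of_nat
  exact ⟨s, hs⟩

end IsBdd

namespace SpectralMeasure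

variable {K : Type*} [NormedAddCommGroup K] [InnerProductSpace ℂ K] [CompleteSpace K]
variable (E : SpectralMeasure K)

/-- Uniform limits of simple functions: the integral of simple functions is a contraction for the
uniform norm. -/
theorem exists_op {f : ℝ → ℂ} (hf : IsBdd f) : ∃ A : K →L[ℂ] K, ∀ (s : SimpleFunc ℝ ℂ) (ε : ℝ),
    (∀ l, ‖f l - s l‖ ≤ ε) → ‖A - E.simpleOp s‖ ≤ ε := by
  obtain ⟨s, hs⟩ := hf.exists_seq
  have key : ∀ (t : SimpleFunc ℝ ℂ) (ε : ℝ), (∀ l, ‖f l - t l‖ ≤ ε) → ∀ n,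
      ‖E.simpleOp (s n) - E.simpleOp t‖ ≤ 1 / ((n : ℝ) + 1) + ε := fun t ε ht n => by
    rw [← E.simpleOp_sub]
    refine E.norm_simpleOp_le (add_nonneg (Nat.one_div_pos_of_nat).le
      ((norm_nonneg _).trans (ht 0))) fun l => ?_
    have h1 : (s n - t) l = (f l - t l) - (f l - s n l) := by
      change s n l - t l = _
      ring
    rw [h1]
    refine (norm_sub_le _ _).trans ?_
    rw [add_comm]
    exact add_le_add (hs n l) (ht l)
  obtain ⟨A, hA⟩ : ∃ A, Tendsto (fun n => E.simpleOp (s n)) atTop (𝓝 A) := by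
    refine cauchySeq_tendsto_of_complete (cauchySeq_of_le_tendsto_0
      (fun n : ℕ => 2 * (1 / ((n : ℝ) + 1))) (fun n m N hn hm => ?_) ?_)
    · rw [dist_eq_norm]
      refine (key (s m) _ (hs m) n).trans ?_
      rw [two_mul]
      exact add_le_add (Nat.one_div_le_one_div hn) (Nat.one_div_le_one_div hm)
    · simpa using (tendsto_one_div_add_atTop_nhds_zero_nat (𝕜 := ℝ)).const_mul 2
  refine ⟨A, fun t ε ht => ?_⟩
  have h1 := (hA.sub_const (E.simpleOp t)).norm
  have h2 := (tendsto_one_div_add_atTop_nhds_zero_nat (𝕜 := ℝ)).add_const ε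
  rw [zero_add] at h2
  exact le_of_tendsto_of_tendsto' h1 h2 (key t ε ht)

open Classical in
/-- The operator `f(L) = ∫ f dE` for a bounded Borel function `f`; by convention `0` for other `f`. -/
def op (f : ℝ → ℂ) : K →L[ℂ] K := if hf : IsBdd f then (E.exists_op hf).choose else 0

theorem norm_op_sub_simpleOp_le {f : ℝ → ℂ} (hf : IsBdd f) {s : SimpleFunc ℝ ℂ} {ε : ℝ}
    (hs : ∀ l, ‖f l - s l‖ ≤ ε) : ‖E.op f - E.simpleOp s‖ ≤ ε := by
  rw [op, dif_pos hf]
  exact (E.exists_op hf).choose_spec s ε hs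

theorem tendsto_simpleOp {f : ℝ → ℂ} (hf : IsBdd f) {s : ℕ → SimpleFunc ℝ ℂ} {ε : ℕ → ℝ}
    (hs : ∀ n l, ‖f l - s n l‖ ≤ ε n) (hε : Tendsto ε atTop (𝓝 0)) :
    Tendsto (fun n => E.simpleOp (s n)) atTop (𝓝 (E.op f)) := by
  rw [tendsto_iff_norm_sub_tendsto_zero]
  refine squeeze_zero (fun _ => norm_nonneg _) (fun n => ?_) hε
  rw [norm_sub_rev]
  exact E.norm_op_sub_simpleOp_le hf (hs n)

theorem op_simpleFunc (s : SimpleFunc ℝ ℂ) : E.op s = E.simpleOp s := by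
  have := E.norm_op_sub_simpleOp_le (IsBdd.simpleFunc s) (s := s) (ε := 0) (by simp)
  rwa [norm_le_zero_iff, sub_eq_zero] at this

theorem op_sub {f g : ℝ → ℂ} (hf : IsBdd f) (hg : IsBdd g) :
    E.op (fun l => f l - g l) = E.op f - E.op g := by
  obtain ⟨s, hs⟩ := hf.exists_seq
  obtain ⟨t, ht⟩ := hg.exists_seq
  have h0 := tendsto_one_div_add_atTop_nhds_zero_nat (𝕜 := ℝ)
  have h1 := (E.tendsto_simpleOp hf hs h0).sub (E.tendsto_simpleOp hg ht h0)
  simp only [← E.simpleOp_sub] at h1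
  have h2 := h0.add h0
  rw [add_zero] at h2
  refine tendsto_nhds_unique (E.tendsto_simpleOp (hf.sub hg) (fun n l => ?_) h2) h1
  change ‖f l - g l - (s n l - t n l)‖ ≤ _
  rw [sub_sub_sub_comm]
  exact (norm_sub_le _ _).trans (add_le_add (hs n l) (ht n l))

/-- Multiplicativity passes from simple functions to their uniform limits. -/
theorem op_mul {f g : ℝ → ℂ} (hf : IsBdd f) (hg : IsBdd g) :
    E.op (fun l => f l * g l) = E.op f * E.op g := by
  obtain ⟨s, hs⟩ := hf.exists_seq
  obtain ⟨t, ht⟩ := hg.exists_seq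
  obtain ⟨C, hC⟩ := hf.bounded
  obtain ⟨D, hD⟩ := hg.bounded
  have h0 := tendsto_one_div_add_atTop_nhds_zero_nat (𝕜 := ℝ)
  have h1 := (E.tendsto_simpleOp hf hs h0).mul (E.tendsto_simpleOp hg ht h0)
  simp only [← E.simpleOp_mul] at h1
  have h2 := (h0.const_mul C).add (h0.mul_const (D + 1))
  rw [mul_zero, zero_mul, add_zero] at h2
  refine tendsto_nhds_unique (E.tendsto_simpleOp (hf.mul hg) (fun n l => ?_) h2) h1
  change ‖f l * g l - s n l * t n l‖ ≤ _
  have h3 : f l * g l - s n l * t n l = f l * (g l - t n l) + (f l - s n l) * t n l := by ring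
  have h4 : ‖t n l‖ ≤ D + 1 := by
    have h5 : t n l = g l - (g l - t n l) := by ring
    rw [h5]
    refine (norm_sub_le _ _).trans (add_le_add (hD l) ((ht n l).trans ?_))
    rw [div_le_one (by positivity)]
    linarith [Nat.cast_nonneg (α := ℝ) n]
  rw [h3]
  refine (norm_add_le _ _).trans ?_
  rw [norm_mul, norm_mul]
  have h6 := (norm_nonneg _).trans (hC l)
  have h7 : (0 : ℝ) ≤ 1 / ((n : ℝ) + 1) := (Nat.one_div_pos_of_nat).le
  exact add_le_add (mul_le_mul (hC l) (ht n l) (norm_nonneg _) h6)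
    (mul_le_mul (hs n l) h4 (norm_nonneg _) h7)

theorem op_const (c : ℂ) : E.op (fun _ => c) = c • 1 := by
  have h1 : (fun _ : ℝ => c) = (SimpleFunc.const ℝ c : ℝ → ℂ) := rfl
  rw [h1, E.op_simpleFunc, simpleOp]
  rw [SimpleFunc.range_const, Finset.sum_singleton]
  congr 1
  rw [← E.proj_univ]
  congr 1
  ext x
  simp

theorem op_const_mul {f : ℝ → ℂ} (hf : IsBdd f) (c : ℂ) :
    E.op (fun l => c * f l) = c • E.op f := by
  rw [E.op_mul (IsBdd.const c) hf, op_const, smul_mul_assoc, one_mul]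

theorem op_add {f g : ℝ → ℂ} (hf : IsBdd f) (hg : IsBdd g) :
    E.op (fun l => f l + g l) = E.op f + E.op g := by
  have h1 : (fun l => f l + g l) = fun l => f l - (-1) * g l := by ext l; ring
  rw [h1, E.op_sub hf ((IsBdd.const (-1)).mul hg), E.op_const_mul hg]
  simp

theorem inner_op_left {f : ℝ → ℂ} (hf : IsBdd f) (ξ η : K) :
    inner ℂ (E.op f ξ) η = inner ℂ ξ (E.op (fun l => (starRingEnd ℂ) (f l)) η) := by
  obtain ⟨s, hs⟩ := hf.exists_seq
  have h0 := tendsto_one_div_add_atTop_nhds_zero_nat (𝕜 := ℝ)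
  have h1 := (((ContinuousLinearMap.apply ℂ K ξ).continuous.tendsto _).comp
    (E.tendsto_simpleOp hf hs h0)).inner (tendsto_const_nhds (x := η)) (𝕜 := ℂ)
  have h2 := (tendsto_const_nhds (x := ξ)).inner (𝕜 := ℂ)
    (((ContinuousLinearMap.apply ℂ K η).continuous.tendsto _).comp
    (E.tendsto_simpleOp hf.conj (s := fun n => (s n).map (starRingEnd ℂ)) (fun n l => by
      change ‖(starRingEnd ℂ) (f l) - (starRingEnd ℂ) (s n l)‖ ≤ _
      rw [← map_sub, Complex.norm_conj]
      exact hs n l) h0))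
  refine tendsto_nhds_unique h1 (h2.congr fun n => ?_)
  exact (E.simpleOp_conj (s n) ξ η).symm

theorem inner_op {f : ℝ → ℂ} (hf : IsBdd f) (ξ : K) :
    inner ℂ ξ (E.op f ξ) = ∫ l, f l ∂(E.measure ξ) := by
  obtain ⟨s, hs⟩ := hf.exists_seq
  have h0 := tendsto_one_div_add_atTop_nhds_zero_nat (𝕜 := ℝ)
  have h2 := (tendsto_const_nhds (x := ξ)).inner (𝕜 := ℂ)
    (((ContinuousLinearMap.apply ℂ K ξ).continuous.tendsto _).comp
    (E.tendsto_simpleOp hf hs h0))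
  refine tendsto_nhds_unique h2 ?_
  have h3 : ∀ n, inner ℂ ξ (E.simpleOp (s n) ξ) = ∫ l, s n l ∂(E.measure ξ) :=
    fun n => E.inner_simpleOp _ _
  change Tendsto (fun n => inner ℂ ξ (E.simpleOp (s n) ξ)) _ _
  simp only [h3]
  rw [tendsto_iff_norm_sub_tendsto_zero]
  have h4 := h0.mul_const ((E.measure ξ).real univ)
  rw [zero_mul] at h4
  refine squeeze_zero (fun _ => norm_nonneg _) (fun n => ?_) h4
  rw [← integral_sub ((IsBdd.simpleFunc (s n)).integrable _) (hf.integrable _)]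
  refine norm_integral_le_of_norm_le_const (Eventually.of_forall fun l => ?_)
  rw [norm_sub_rev]
  exact hs n l

theorem norm_op_sq {f : ℝ → ℂ} (hf : IsBdd f) (ξ : K) :
    ‖E.op f ξ‖ ^ 2 = ∫ l, ‖f l‖ ^ 2 ∂(E.measure ξ) := by
  have h1 : inner ℂ (E.op f ξ) (E.op f ξ) = ((∫ l, ‖f l‖ ^ 2 ∂(E.measure ξ) : ℝ) : ℂ) := by
    rw [E.inner_op_left hf]
    change inner ℂ ξ ((E.op _ * E.op f) ξ) = _
    rw [← E.op_mul hf.conj hf, E.inner_op (hf.conj.mul hf), ← integral_complex_ofReal]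
    refine integral_congr_ae (Eventually.of_forall fun l => ?_)
    change (starRingEnd ℂ) (f l) * f l = ((‖f l‖ ^ 2 : ℝ) : ℂ)
    rw [Complex.conj_mul']
    norm_cast
  rw [← inner_self_eq_norm_sq (𝕜 := ℂ), h1]
  rfl

/-- Dominated convergence for the functional calculus. -/
theorem tendsto_op_apply {F : ℕ → ℝ → ℂ} {f : ℝ → ℂ} (hF : ∀ n, IsBdd (F n)) (hf : IsBdd f)
    {C : ℝ} {ξ : K} (hC : ∀ n, ∀ᵐ l ∂(E.measure ξ), ‖F n l‖ ≤ C)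
    (hlim : ∀ᵐ l ∂(E.measure ξ), Tendsto (fun n => F n l) atTop (𝓝 (f l))) :
    Tendsto (fun n => E.op (F n) ξ) atTop (𝓝 (E.op f ξ)) := by
  have h1 : Tendsto (fun n => ‖E.op (F n) ξ - E.op f ξ‖ ^ 2) atTop (𝓝 0) := by
    have h2 : ∀ n, ‖E.op (F n) ξ - E.op f ξ‖ ^ 2 = ∫ l, ‖F n l - f l‖ ^ 2 ∂(E.measure ξ) :=
      fun n => by
        rw [← sub_apply, ← E.op_sub (hF n) hf, E.norm_op_sq ((hF n).sub hf)]
    simp only [h2]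
    obtain ⟨D, hD⟩ := hf.bounded
    have h3 := tendsto_integral_of_dominated_convergence (μ := E.measure ξ)
      (F := fun n l => ‖F n l - f l‖ ^ 2) (f := fun _ => (0 : ℝ)) (fun _ => (C + D) ^ 2)
      (fun n => (((hF n).measurable.sub hf.measurable).norm.pow_const 2).aestronglyMeasurable)
      (integrable_const _) (fun n => by
        filter_upwards [hC n] with l hl
        rw [norm_pow, norm_norm]
        exact pow_le_pow_left₀ (norm_nonneg _)
          ((norm_sub_le _ _).trans (add_le_add hl (hD l))) 2)
      (by
        filter_upwards [hlim] with l hl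
        have := ((hl.sub_const (f l)).norm).pow 2
        simpa using this)
    simpa using h3
  have h2 := (Real.continuous_sqrt.tendsto 0).comp h1
  rw [tendsto_iff_norm_sub_tendsto_zero]
  simpa [Function.comp_def, Real.sqrt_sq] using h2

end SpectralMeasure

/-! ### The spectral resolution of a semigroup of self-adjoint contractions -/

namespace SpectralMeasure

variable {K : Type*} [NormedAddCommGroup K] [InnerProductSpace ℂ K] [CompleteSpace K]
variable (E : SpectralMeasure K)

theorem lintegral_sub_simpleFunc {g : ℝ → ℂ} (hg : IsBdd g) (s : SimpleFunc ℝ ℂ) (ξ : K) :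
    ∫⁻ l, ‖g l - s l‖ₑ ^ 2 ∂(E.measure ξ) = ENNReal.ofReal (‖E.op g ξ - E.simpleOp s ξ‖ ^ 2) := by
  have hb := hg.sub (IsBdd.simpleFunc s)
  rw [← E.op_simpleFunc, ← sub_apply, ← E.op_sub hg (IsBdd.simpleFunc s), E.norm_op_sq hb,
    ofReal_integral_eq_lintegral_ofReal (hb.integrable_norm_sq _)
      (Eventually.of_forall fun l => by positivity)]
  refine lintegral_congr fun l => ?_
  rw [ENNReal.ofReal_pow (norm_nonneg _), ofReal_norm]

theorem hasIntegral_op {f g : ℝ → ℂ} (hg : IsBdd g) {ξ : K} (hfg : f =ᵐ[E.measure ξ] g) :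
    E.HasIntegral f ξ (E.op g ξ) := by
  intro ε hε
  obtain ⟨s, hs⟩ := hg.exists_simpleFunc (ε := min ε √ε / (2 * (‖ξ‖ + 1))) (by positivity)
  have h1 : ‖E.op g ξ - E.simpleOp s ξ‖ < min ε √ε := by
    rw [← sub_apply]
    refine ((E.op g - E.simpleOp s).le_of_opNorm_le (E.norm_op_sub_simpleOp_le hg hs) ξ).trans_lt ?_
    rw [div_mul_eq_mul_div, div_lt_iff₀ (by positivity)]
    have : 0 < min ε √ε := by positivity
    nlinarith [norm_nonneg ξ]
  refine ⟨s, ?_, ?_⟩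
  · have h2 : ∫⁻ l, ‖f l - s l‖ₑ ^ 2 ∂(E.measure ξ) = ∫⁻ l, ‖g l - s l‖ₑ ^ 2 ∂(E.measure ξ) :=
      lintegral_congr_ae (by filter_upwards [hfg] with l hl; rw [hl])
    rw [h2, E.lintegral_sub_simpleFunc hg, ENNReal.ofReal_lt_ofReal_iff hε]
    calc _ < √ε ^ 2 := pow_lt_pow_left₀ (h1.trans_le (min_le_right _ _)) (norm_nonneg _) two_ne_zero
      _ = ε := Real.sq_sqrt hε.le
  · have h2 : ∑ c ∈ s.range, c • E.proj (s ⁻¹' {c}) ξ = E.simpleOp s ξ := by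
      rw [simpleOp, sum_apply]; rfl
    rw [h2]
    exact h1.trans_le (min_le_left _ _)

theorem HasIntegral.eq_op {E : SpectralMeasure K} {f g : ℝ → ℂ} (hg : IsBdd g) {ξ η : K}
    (hfg : f =ᵐ[E.measure ξ] g) (h : E.HasIntegral f ξ η) : η = E.op g ξ := by
  have key : ∀ ε : ℝ, 0 < ε → ‖η - E.op g ξ‖ ≤ ε := fun ε hε => by
    obtain ⟨s, hs1, hs2⟩ := h (min (ε / 2) ((ε / 2) ^ 2)) (by positivity)
    have h2 : ∑ c ∈ s.range, c • E.proj (s ⁻¹' {c}) ξ = E.simpleOp s ξ := by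
      rw [simpleOp, sum_apply]; rfl
    rw [h2] at hs2
    have h3 : ∫⁻ l, ‖f l - s l‖ₑ ^ 2 ∂(E.measure ξ) = ∫⁻ l, ‖g l - s l‖ₑ ^ 2 ∂(E.measure ξ) :=
      lintegral_congr_ae (by filter_upwards [hfg] with l hl; rw [hl])
    rw [h3, E.lintegral_sub_simpleFunc hg, ENNReal.ofReal_lt_ofReal_iff (by positivity)] at hs1
    have h4 : ‖E.op g ξ - E.simpleOp s ξ‖ < ε / 2 :=
      lt_of_pow_lt_pow_left₀ 2 (by positivity) (hs1.trans_le (min_le_right _ _))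
    have h5 := hs2.trans_le (min_le_left _ _)
    have h6 := norm_sub_le (η - E.simpleOp s ξ) (E.op g ξ - E.simpleOp s ξ)
    rw [sub_sub_sub_cancel_right] at h6
    linarith
  have : ‖η - E.op g ξ‖ ≤ 0 := le_of_forall_pos_le_add fun ε hε => by simpa using key ε hε
  rwa [norm_le_zero_iff, sub_eq_zero] at this

/-- Finitely additive projections, whose scalar functions are measures, are countably additive. -/
theorem hasSum_of_additive {K : Type*} [NormedAddCommGroup K] [InnerProductSpace ℂ K]
    {X : Type*} [MeasurableSpace X] {P : Set X → K →L[ℂ] K} {ν : K → Measure X} (hfin : ∀ ξ, IsFiniteMeasure (ν ξ))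
    (hnorm : ∀ B, MeasurableSet B → ∀ ξ, ‖P B ξ‖ ^ 2 = (ν ξ).real B)
    (hadd : ∀ B C, MeasurableSet B → MeasurableSet C → Disjoint B C → P (B ∪ C) = P B + P C)
    {B : ℕ → Set X} (hB : ∀ n, MeasurableSet (B n)) (hd : Pairwise (Function.onFun Disjoint B))
    (ξ : K) : HasSum (fun n => P (B n) ξ) (P (⋃ n, B n) ξ) := by
  have := hfin ξ
  have hempty : P ∅ = 0 := by
    ext ζ
    have h1 := hnorm ∅ MeasurableSet.empty ζ
    simpa using h1
  have hfin : ∀ F : Finset ℕ, P (⋃ n ∈ F, B n) = ∑ n ∈ F, P (B n) := fun F => by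
    classical
    induction F using Finset.induction_on with
    | empty => simp [hempty]
    | insert a F ha ih =>
      rw [Finset.set_biUnion_insert, hadd _ _ (hB a)
        (Finset.measurableSet_biUnion F fun n _ => hB n), ih, Finset.sum_insert ha]
      rw [Set.disjoint_iUnion₂_right]
      exact fun n hn => hd (fun h => ha (h ▸ hn))
  set U := ⋃ n, B n
  have hU : MeasurableSet U := MeasurableSet.iUnion hB
  -- the remainder of a partial sum is the projection of the complement, whose norm is given by the
  -- measure `ν ξ`
  have hdiff : ∀ F : Finset ℕ, ‖∑ n ∈ F, P (B n) ξ - P U ξ‖ ^ 2 =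
      (ν ξ).real U - ∑ n ∈ F, (ν ξ).real (B n) := fun F => by
    have hV : MeasurableSet (⋃ n ∈ F, B n) := Finset.measurableSet_biUnion F fun n _ => hB n
    have hVU : (⋃ n ∈ F, B n) ⊆ U := iUnion₂_subset fun n _ => subset_iUnion B n
    have h1 : P U = P (⋃ n ∈ F, B n) + P (U \ ⋃ n ∈ F, B n) := by
      rw [← hadd _ _ hV (hU.diff hV) disjoint_sdiff_right, union_sdiff_cancel hVU]
    have h2 : ∑ n ∈ F, P (B n) ξ - P U ξ = -(P (U \ ⋃ n ∈ F, B n) ξ) := by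
      rw [h1, add_apply, hfin, sum_apply]; abel
    rw [h2, norm_neg, hnorm _ (hU.diff hV), measureReal_sdiff hVU hV,
      measureReal_biUnion_finset (fun i _ j _ hij => hd hij) fun n _ => hB n]
  have hsum : HasSum (fun n => (ν ξ).real (B n)) ((ν ξ).real U) := by
    have h1 : (ν ξ) U = ∑' n, (ν ξ) (B n) := measure_iUnion hd hB
    have h2 := ENNReal.hasSum_toReal (f := fun n => (ν ξ) (B n)) (by
      rw [← h1]; exact measure_ne_top _ _)
    have h3 : (ν ξ).real U = ∑' n, ((ν ξ) (B n)).toReal := by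
      rw [measureReal_def, h1, ENNReal.tsum_toReal_eq fun _ => measure_ne_top _ _]
    rw [h3]
    exact h2
  rw [HasSum, tendsto_iff_norm_sub_tendsto_zero]
  have h1 : Tendsto (fun F : Finset ℕ => ‖∑ n ∈ F, P (B n) ξ - P U ξ‖ ^ 2) atTop (𝓝 0) := by
    simp only [hdiff]
    have := (hsum : Tendsto _ _ _).const_sub ((ν ξ).real U)
    rwa [sub_self] at this
  have h2 := (Real.continuous_sqrt.tendsto 0).comp h1
  simpa [Function.comp_def, Real.sqrt_sq] using h2

end SpectralMeasure

/-- The function `e^{-tλ}` on the half-line `λ ≥ 0`, extended by `0`. -/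
def heat (t l : ℝ) : ℂ := if 0 ≤ l then (Real.exp (-(t * l)) : ℂ) else 0

theorem isBdd_heat {t : ℝ} (ht : 0 < t) : IsBdd (heat t) := by
  refine ⟨Measurable.ite measurableSet_Ici (by fun_prop) measurable_const, 1, fun l => ?_⟩
  rw [heat]
  split_ifs with hl
  · rw [Complex.norm_real, Real.norm_of_nonneg (Real.exp_pos _).le, Real.exp_le_one_iff]
    nlinarith [mul_nonneg ht.le hl]
  · simp

/-- The scalar measures of the powers of a positive operator: `⟨ξ, S_t ξ⟩ = ∫ x^t dν_ξ(x)`. For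
rational `t` this follows from `S_{k/n} = (S_{1/n})^k`, for other `t` by monotonicity. -/
theorem inner_semigroup_eq {K : Type*} [NormedAddCommGroup K] [InnerProductSpace ℂ K]
    [CompleteSpace K] {S : ℝ → K →L[ℂ] K} (hsa : ∀ t, 0 < t → IsSelfAdjoint (S t))
    (hmul : ∀ s, 0 < s → ∀ t, 0 < t → S (s + t) = S s * S t) (hnorm : ∀ t, 0 < t → ‖S t‖ ≤ 1)
    (ξ : K) (ν : Measure (spectrum ℝ (S 1))) [IsFiniteMeasure ν]
    (hν : ∀ f : C(spectrum ℝ (S 1), ℝ),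
      ∫ x, f x ∂ν = (inner ℂ ξ (cfcHom (hsa 1 one_pos) f ξ)).re) {t : ℝ} (ht : 0 < t) :
    (inner ℂ ξ (S t ξ)).re = ∫ x, (x : ℝ) ^ t ∂ν := by
  have hhalf : ∀ t, 0 < t → ∀ ζ, inner ℂ ζ (S t ζ) = inner ℂ (S (t / 2) ζ) (S (t / 2) ζ) := by
    intro t ht ζ
    have h1 := hmul (t / 2) (by positivity) (t / 2) (by positivity)
    rw [add_halves] at h1
    rw [h1, ← ContinuousLinearMap.adjoint_inner_right, ← ContinuousLinearMap.star_eq_adjoint,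
      (hsa (t / 2) (by positivity)).star_eq]
    rfl
  have hpos : ∀ t, 0 < t → 0 ≤ S t := fun t ht => by
    have h1 := hmul (t / 2) (by positivity) (t / 2) (by positivity)
    rw [add_halves] at h1
    have h2 := star_mul_self_nonneg (S (t / 2))
    rwa [(hsa (t / 2) (by positivity)).star_eq, ← h1] at h2
  have hsp : ∀ x : spectrum ℝ (S 1), 0 ≤ (x : ℝ) ∧ (x : ℝ) ≤ 1 := fun x =>
    ⟨spectrum_nonneg_of_nonneg (hpos 1 one_pos) x.2,
      (le_abs_self _).trans ((spectrum.norm_le_norm_mul_of_mem x.2).trans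
        (mul_le_one₀ (hnorm 1 one_pos) (norm_nonneg _) ContinuousLinearMap.norm_id_le))⟩
  have hpow : ∀ u, 0 < u → ∀ k : ℕ, 0 < k → S (k * u) = S u ^ k := fun u hu k hk => by
    induction k, hk using Nat.le_induction with
    | base => simp
    | succ k hk ih =>
      have hk0 : (0 : ℝ) < k := by exact_mod_cast hk
      rw [pow_succ, ← ih, ← hmul _ (by positivity) _ hu]
      congr 1; push_cast; ring
  -- `S r` is the power `r` of `S 1` for rational `r`, by uniqueness of positive roots
  have hrat : ∀ r : ℚ, (0 : ℝ) < r → (inner ℂ ξ (S r ξ)).re = ∫ x, (x : ℝ) ^ (r : ℝ) ∂ν := by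
    intro r hr
    have hr' : 0 < r := by exact_mod_cast hr
    have hd : (0 : ℝ) < r.den := by exact_mod_cast r.den_pos
    have hn : 0 < r.num.toNat := by have := Rat.num_pos.mpr hr'; omega
    have hrq : (r : ℝ) = r.num.toNat * (1 / (r.den : ℝ)) := by
      rw [mul_one_div, Rat.cast_def]
      congr 1
      have : ((r.num.toNat : ℤ) : ℝ) = (r.num : ℝ) := by
        rw [Int.toNat_of_nonneg (Rat.num_pos.mpr hr').le]
      exact_mod_cast this.symm
    have h1 : S r = S 1 ^ (r : ℝ) := by
      have hA := hpos (1 / (r.den : ℝ)) (by positivity)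
      have h2 := hpow (1 / (r.den : ℝ)) (by positivity) r.den r.den_pos
      rw [mul_one_div_cancel hd.ne'] at h2
      rw [h2, ← CFC.rpow_natCast _ _ hA, CFC.rpow_rpow_of_exponent_nonneg _ _ _ (by positivity)
        hr.le hA]
      have h3 : (r.den : ℝ) * r = (r.num.toNat : ℕ) := by
        rw [hrq]; field_simp
      rw [h3, CFC.rpow_natCast _ _ hA, ← hpow _ (by positivity) _ hn, ← hrq]
    have hc : ContinuousOn (fun x : ℝ => x ^ (r : ℝ)) (spectrum ℝ (S 1)) :=
      (Real.continuous_rpow_const hr.le).continuousOn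
    rw [h1, CFC.rpow_eq_cfc_real (hpos 1 one_pos), cfc_apply _ _ (hsa 1 one_pos) hc, ← hν]
    rfl
  -- `S t = S (s/2) S (t - s) S (s/2)`, with a contraction in the middle
  have hanti : ∀ s, 0 < s → ∀ t, s < t → (inner ℂ ξ (S t ξ)).re ≤ (inner ℂ ξ (S s ξ)).re := by
    intro s hs t hst
    have h1 : S t = S (s / 2) * S (t - s) * S (s / 2) := by
      rw [← hmul _ (by positivity) _ (by linarith), ← hmul _ (by linarith) _ (by positivity)]
      congr 1; ring
    have h2 : inner ℂ ξ (S t ξ) = inner ℂ (S (s / 2) ξ) (S (t - s) (S (s / 2) ξ)) := by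
      rw [h1, ← ContinuousLinearMap.adjoint_inner_right, ← ContinuousLinearMap.star_eq_adjoint,
        (hsa (s / 2) (by positivity)).star_eq]
      rfl
    have h4 : (inner ℂ (S (s / 2) ξ) (S (s / 2) ξ)).re = ‖S (s / 2) ξ‖ ^ 2 :=
      inner_self_eq_norm_sq (𝕜 := ℂ) _
    rw [h2, hhalf s hs, h4]
    refine (Complex.re_le_norm _).trans ((norm_inner_le_norm _ _).trans ?_)
    have h3 := (S (t - s)).le_of_opNorm_le (hnorm _ (by linarith)) (S (s / 2) ξ)
    nlinarith [norm_nonneg (S (s / 2) ξ)]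
  have hcont : ContinuousAt (fun t : ℝ => ∫ x : spectrum ℝ (S 1), (x : ℝ) ^ t ∂ν) t := by
    refine continuousAt_of_dominated (bound := fun _ => 1) ?_ ?_ (integrable_const 1) ?_
    · exact Eventually.of_forall fun s =>
        (measurable_subtype_coe.pow_const s).aestronglyMeasurable
    · filter_upwards [lt_mem_nhds ht] with s hs
      refine Eventually.of_forall fun x => ?_
      rw [Real.norm_of_nonneg (Real.rpow_nonneg (hsp x).1 s)]
      exact Real.rpow_le_one (hsp x).1 (hsp x).2 hs.le
    · exact Eventually.of_forall fun x => Real.continuousAt_const_rpow' ht.ne'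
  -- both sides are compared at rational exponents close to `t`, on either side
  have hdense : Dense (Set.range ((↑) : ℚ → ℝ)) := Rat.denseRange_cast
  refine le_antisymm ?_ ?_
  · obtain ⟨u, -, hu, hut⟩ := hdense.exists_seq_strictMono_tendsto_of_lt ht
    refine ge_of_tendsto' (hcont.tendsto.comp hut) fun n => ?_
    obtain ⟨⟨h1, h2⟩, r, hr⟩ := hu n
    change _ ≤ ∫ x : spectrum ℝ (S 1), (x : ℝ) ^ (u n) ∂ν
    rw [← hr] at h1 h2 ⊢
    rw [← hrat r h1]
    exact hanti _ h1 _ h2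
  · obtain ⟨u, -, hu, hut⟩ := hdense.exists_seq_strictAnti_tendsto_of_lt (lt_add_one t)
    refine le_of_tendsto' (hcont.tendsto.comp hut) fun n => ?_
    obtain ⟨⟨h1, h2⟩, r, hr⟩ := hu n
    change ∫ x : spectrum ℝ (S 1), (x : ℝ) ^ (u n) ∂ν ≤ _
    rw [← hr] at h1 h2 ⊢
    rw [← hrat r (ht.trans h1)]
    exact hanti _ ht _ h1

theorem eq_of_inner_map_self_eq {K : Type*} [NormedAddCommGroup K] [InnerProductSpace ℂ K]
    {A B : K →L[ℂ] K} (h : ∀ ξ, inner ℂ ξ (A ξ) = inner ℂ ξ (B ξ)) : A = B := by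
  have h1 : (A : K →ₗ[ℂ] K) = B := (ext_inner_map _ _).mp fun ξ => by
    have := congrArg (starRingEnd ℂ) (h ξ)
    simpa using this
  exact ContinuousLinearMap.coe_injective h1

/-- **Spectral theorem for semigroups**: a semigroup of self-adjoint contractions with `S_1`
injective is `S_t = ∫ e^{-tλ} dE(λ)` for a resolution of the identity `E` on the half-line
`λ ≥ 0`: the image of the resolution of `S_1` under `x ↦ -log x`. -/
theorem exists_spectralMeasure_of_semigroup {K : Type*} [NormedAddCommGroup K]
    [InnerProductSpace ℂ K] [CompleteSpace K] {S : ℝ → K →L[ℂ] K}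
    (hsa : ∀ t, 0 < t → IsSelfAdjoint (S t))
    (hmul : ∀ s, 0 < s → ∀ t, 0 < t → S (s + t) = S s * S t) (hnorm : ∀ t, 0 < t → ‖S t‖ ≤ 1)
    (hker : ∀ ξ, S 1 ξ = 0 → ξ = 0) :
    ∃ E : SpectralMeasure K, E.proj (Iio 0) = 0 ∧ ∀ t, 0 < t → E.op (heat t) = S t := by
  have hsp : ∀ x : spectrum ℝ (S 1), 0 ≤ (x : ℝ) ∧ (x : ℝ) ≤ 1 := fun x => by
    refine ⟨spectrum_nonneg_of_nonneg ?_ x.2,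
      (le_abs_self _).trans ((spectrum.norm_le_norm_mul_of_mem x.2).trans
        (mul_le_one₀ (hnorm 1 one_pos) (norm_nonneg _) ContinuousLinearMap.norm_id_le))⟩
    have h1 := hmul (1 / 2) (by positivity) (1 / 2) (by positivity)
    rw [add_halves] at h1
    have h2 := star_mul_self_nonneg (S (1 / 2))
    rwa [(hsa (1 / 2) (by positivity)).star_eq, ← h1] at h2
  choose ν hfin hν using exists_scalar_measure (cfcHom (hsa 1 one_pos) (R := ℝ))
  have hΦ : ScalarMeasures (cfcHom (hsa 1 one_pos) (R := ℝ)) ν := ⟨hfin, hν⟩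
  obtain ⟨P, hP1, hP2, hP3, hP4⟩ := hΦ.exists_spectral_projections
  have hg : Measurable fun x : spectrum ℝ (S 1) => -Real.log x :=
    (Real.measurable_log.comp measurable_subtype_coe).neg
  set g : spectrum ℝ (S 1) → ℝ := fun x => -Real.log x
  let E : SpectralMeasure K :=
    { proj := fun B => P (g ⁻¹' B)
      isStarProjection := fun B hB => hP1 _ (hg hB)
      proj_univ := hP2
      hasSum_proj := fun B hB hd ξ => by
        rw [preimage_iUnion]
        exact SpectralMeasure.hasSum_of_additive hfin hP3 hP4 (fun n => hg (hB n))
          (fun i j hij => (hd hij).preimage g) ξ }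
  have hE : ∀ ξ, E.measure ξ = (ν ξ).map g := fun ξ => by
    have := hfin ξ
    refine Measure.ext fun B hB => ?_
    rw [E.measure_apply hB, Measure.map_apply hg hB]
    change ENNReal.ofReal (‖P (g ⁻¹' B) ξ‖ ^ 2) = _
    rw [hP3 _ (hg hB), ofReal_measureReal]
  -- the point `0`, where `-log x` takes a junk value, is a null set as `S_1` is injective
  have hzero : ∀ ξ, ∀ᵐ x : spectrum ℝ (S 1) ∂(ν ξ), 0 < (x : ℝ) := fun ξ => by
    have := hfin ξ
    set Z : Set (spectrum ℝ (S 1)) := {x | (x : ℝ) = 0}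
    have hZ : MeasurableSet Z := measurable_subtype_coe (measurableSet_singleton (0 : ℝ))
    have hidem : P Z (P Z ξ) = P Z ξ :=
      congrArg (fun A : K →L[ℂ] K => A ξ) (hP1 Z hZ).isIdempotentElem.eq
    have h1 : P Zᶜ (P Z ξ) = 0 := by
      have h2 := hP4 Z Zᶜ hZ hZ.compl disjoint_compl_right
      rw [union_compl_self, hP2] at h2
      have h3 := congrArg (fun A : K →L[ℂ] K => A (P Z ξ)) h2
      simp only [one_apply_eq_self, add_apply, hidem] at h3
      simpa using h3.symm
    have h4 : P Z ξ = 0 := by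
      have := hfin (P Z ξ)
      refine hker _ ?_
      have h5 := hΦ.norm_sq ((ContinuousMap.id ℝ).restrict (spectrum ℝ (S 1))) (P Z ξ)
      rw [cfcHom_id] at h5
      have h6 : ∀ᵐ x : spectrum ℝ (S 1) ∂(ν (P Z ξ)), (x : ℝ) = 0 := by
        have h7 := hP3 Zᶜ hZ.compl (P Z ξ)
        rw [h1] at h7
        rw [ae_iff]
        have h8 : (ν (P Z ξ)).real Zᶜ = 0 := by simpa using h7.symm
        exact (measureReal_eq_zero_iff).mp h8
      rw [integral_eq_zero_of_ae (by filter_upwards [h6] with x hx; simp [hx])] at h5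
      simpa using h5
    have h8 := hP3 Z hZ ξ
    rw [h4] at h8
    have h9 : ν ξ Z = 0 := (measureReal_eq_zero_iff).mp (by simpa using h8.symm)
    have h10 : ∀ᵐ x ∂(ν ξ), x ∉ Z := by rw [ae_iff]; simpa using h9
    filter_upwards [h10] with x hx
    exact lt_of_le_of_ne (hsp x).1 fun h => hx h.symm
  refine ⟨E, ?_, fun t ht => ?_⟩
  · have h1 : g ⁻¹' (Iio 0) = ∅ := by
      ext x
      simp only [g, mem_preimage, mem_Iio, mem_empty_iff_false, iff_false, not_lt,
        Left.nonneg_neg_iff]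
      exact Real.log_nonpos (hsp x).1 (hsp x).2
    change P (g ⁻¹' (Iio 0)) = 0
    rw [h1]
    ext ξ
    have h2 := hP3 ∅ MeasurableSet.empty ξ
    simpa using h2
  · refine eq_of_inner_map_self_eq fun ξ => ?_
    have := hfin ξ
    have hreal : ((inner ℂ ξ (S t ξ)).re : ℂ) = inner ℂ ξ (S t ξ) := by
      refine Complex.conj_eq_iff_re.mp ?_
      rw [inner_conj_symm, ← ContinuousLinearMap.adjoint_inner_right,
        ← ContinuousLinearMap.star_eq_adjoint, (hsa t ht).star_eq]
    rw [E.inner_op (isBdd_heat ht), hE,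
      integral_map hg.aemeasurable (isBdd_heat ht).measurable.aestronglyMeasurable, ← hreal,
      inner_semigroup_eq hsa hmul hnorm ξ (ν ξ) (hν ξ) ht, ← integral_complex_ofReal]
    refine integral_congr_ae ?_
    filter_upwards [hzero ξ] with x hx
    have h1 : 0 ≤ g x := by
      simp only [g, Left.nonneg_neg_iff]
      exact Real.log_nonpos (hsp x).1 (hsp x).2
    rw [heat, if_pos h1, Real.rpow_def_of_pos hx]
    congr 2
    simp only [g]; ring

/-! ### The semigroup on `L₂(M)` -/

/-- The embedding `M → L₂(M)` as a bounded operator. -/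
def toL2L (τ : Trace M) : Elt M →L[ℂ] L2 τ :=
  LinearMap.mkContinuous (toL2 τ) (√‖τ.toFunctional‖) (norm_toL2_le τ)

/-- A linear map on `M` that is bounded for the norm of `L₂(M)` extends to `L₂(M)`. -/
theorem exists_extension_toL2 (τ : Trace M) {F : Type*} [NormedAddCommGroup F] [NormedSpace ℂ F]
    [CompleteSpace F] (f : Elt M →ₗ[ℂ] F) {C : ℝ} (hf : ∀ x, ‖f x‖ ≤ C * ‖toL2 τ x‖) :
    ∃ g : L2 τ →L[ℂ] F, ∀ x, g (toL2 τ x) = f x := by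
  let f' : PreL2 τ →L[ℂ] F := LinearMap.mkContinuous (f ∘ₗ (toPreL2 τ).symm.toLinearMap) C
    fun x => by
      have h1 := hf ((toPreL2 τ).symm x)
      have h2 : toL2 τ ((toPreL2 τ).symm x) = (x : L2 τ) := rfl
      rwa [h2, UniformSpace.Completion.norm_coe] at h1
  refine ⟨f'.extend (UniformSpace.Completion.toComplL (𝕜 := ℂ) (E := PreL2 τ)), fun x => ?_⟩
  exact ContinuousLinearMap.extend_eq f' (UniformSpace.Completion.denseRange_coe)
    (UniformSpace.Completion.isUniformInducing_coe _) (toPreL2 τ x)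

/-- Two continuous maps on `L₂(M)` that agree on `M` are equal. -/
theorem eq_of_toL2 (τ : Trace M) {F : Type*} [TopologicalSpace F] [T2Space F] {f g : L2 τ → F}
    (hf : Continuous f) (hg : Continuous g) (h : ∀ x, f (toL2 τ x) = g (toL2 τ x)) (ξ : L2 τ) :
    f ξ = g ξ :=
  congrFun ((denseRange_toL2 τ).equalizer hf hg (funext h)) ξ

/-- `T_t` maps `L₂(M)` to `M`, since `L₂(M)` is continuously contained in `L₁(M)`. -/
theorem exists_norm_apply_le_toL2 {τ : Trace M} {T : ℝ → Elt M →ₗ[ℂ] Elt M} {ν : ℝ}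
    (hU : IsUltracontractive τ T ν) :
    ∃ D : ℝ≥0, ∀ t : ℝ, 0 < t → ∀ x, ‖T t x‖ ≤ D * t ^ (-ν) * ‖toL2 τ x‖ := by
  obtain ⟨A, hA⟩ := hU
  obtain ⟨C, hC⟩ := lpNorm_one_ofM_le τ
  refine ⟨A * C, fun t ht x => ?_⟩
  have h0 : 0 ≤ t ^ (-ν) := Real.rpow_nonneg ht.le _
  have h1 : ‖T t x‖ₑ ≤ ENNReal.ofReal (A * C * t ^ (-ν) * ‖toL2 τ x‖) := by
    refine (hA t ht x).trans ?_
    calc _ ≤ A * ENNReal.ofReal (t ^ (-ν)) * (C * ENNReal.ofReal ‖toL2 τ x‖) := by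
          gcongr; exact hC x
      _ = _ := by
          rw [ENNReal.ofReal_mul (by positivity), ENNReal.ofReal_mul (by positivity),
            ENNReal.ofReal_mul (by positivity), ENNReal.ofReal_coe_nnreal,
            ENNReal.ofReal_coe_nnreal]
          ring
  rw [← ofReal_norm] at h1
  exact (ENNReal.ofReal_le_ofReal_iff (by positivity)).mp h1

/-- The extension of an ultracontractive semigroup to `L₂(M)`: the maps `T_t : L₂(M) → M` and the
semigroup `S_t` on `L₂(M)`. -/
structure L2Semigroup (τ : Trace M) (T : ℝ → Elt M →ₗ[ℂ] Elt M) where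
  /-- the operator `T_t` from `L₂(M)` to `M` -/
  reg : ℝ → L2 τ →L[ℂ] Elt M
  /-- the operator `T_t` on `L₂(M)` -/
  op : ℝ → L2 τ →L[ℂ] L2 τ
  reg_toL2 : ∀ t, 0 < t → ∀ x, reg t (toL2 τ x) = T t x
  toL2_reg : ∀ t, 0 < t → ∀ ξ, toL2 τ (reg t ξ) = op t ξ
  isSelfAdjoint : ∀ t, 0 < t → IsSelfAdjoint (op t)
  op_add : ∀ s, 0 < s → ∀ t, 0 < t → op (s + t) = op s * op t
  norm_lt_one : ∀ t, 0 < t → ‖op t‖ < 1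
  eq_zero : ∀ ξ, op 1 ξ = 0 → ξ = 0

theorem L2Semigroup.op_toL2 {τ : Trace M} {T : ℝ → Elt M →ₗ[ℂ] Elt M} (S : L2Semigroup τ T) {t : ℝ}
    (ht : 0 < t) (x : Elt M) : S.op t (toL2 τ x) = toL2 τ (T t x) := by
  rw [← S.toL2_reg t ht, S.reg_toL2 t ht]

/-- `T_t x → x` weakly in `L₂(M)`, as `z ↦ τ(y* z)` is a normal functional. -/
theorem tendsto_trace_mul {τ : Trace M} {T : ℝ → Elt M →ₗ[ℂ] Elt M}
    (hT : IsSymmetricContractionSemigroup τ T) (x y : Elt M) :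
    Tendsto (fun t => τ (star y * T t x)) (𝓝[>] 0) (𝓝 (τ (star y * x))) := by
  obtain ⟨ξ, η, hξ, hη, h⟩ := τ.normal
  have h1 : Summable fun n => ‖(y : H →L[ℂ] H) (ξ n)‖ ^ 2 := by
    refine Summable.of_nonneg_of_le (fun n => by positivity) (fun n => ?_)
      (hξ.mul_left (‖(y : H →L[ℂ] H)‖ ^ 2))
    rw [← mul_pow]
    gcongr
    exact (y : H →L[ℂ] H).le_opNorm _
  have h2 := hT.weakStar_continuous x (fun n => (y : H →L[ℂ] H) (ξ n)) η h1 hη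
  have h3 : ∀ z : Elt M, ∑' n, inner ℂ ((y : H →L[ℂ] H) (ξ n)) ((z : H →L[ℂ] H) (η n)) =
      τ (star y * z) := fun z => by
    rw [← (h (star y * z)).tsum_eq]
    refine tsum_congr fun n => ?_
    rw [← ContinuousLinearMap.adjoint_inner_right, ← ContinuousLinearMap.star_eq_adjoint]
    rfl
  simpa only [h3] using h2

theorem norm_mul_self_of_isSelfAdjoint {K : Type*} [NormedAddCommGroup K] [InnerProductSpace ℂ K]
    [CompleteSpace K] {A : K →L[ℂ] K} (hA : IsSelfAdjoint A) : ‖A * A‖ = ‖A‖ * ‖A‖ := by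
  rw [← CStarRing.norm_star_mul_self (x := A), hA.star_eq]

/-- Ultracontractivity defines `T_t` on `L₂(M)`, with a norm that tends to `0` as `t → ∞`. As
`‖S_{2t}‖ = ‖S_t‖²` for self-adjoint operators, this forces `‖S_t‖ < 1` for every `t`. A vector in
the kernel of `S_1` is in the kernel of every `S_{2^{-n}}`, and vanishes as `T_t x → x` weakly for
`t → 0`. -/
theorem nonempty_L2Semigroup {τ : Trace M} {T : ℝ → Elt M →ₗ[ℂ] Elt M}
    (hT : IsSymmetricContractionSemigroup τ T) {ν : ℝ} (hν : 0 < ν)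
    (hU : IsUltracontractive τ T ν) : Nonempty (L2Semigroup τ T) := by
  obtain ⟨D, hD⟩ := exists_norm_apply_le_toL2 hU
  choose! R hR using fun (t : ℝ) (ht : 0 < t) => exists_extension_toL2 τ (T t) (hD t ht)
  let S : ℝ → L2 τ →L[ℂ] L2 τ := fun t => (toL2L τ).comp (R t)
  have hS : ∀ t, 0 < t → ∀ x, S t (toL2 τ x) = toL2 τ (T t x) := fun t ht x => by
    change toL2 τ (R t (toL2 τ x)) = _
    rw [hR t ht]
  have hsa : ∀ t, 0 < t → IsSelfAdjoint (S t) := fun t ht => by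
    rw [ContinuousLinearMap.isSelfAdjoint_iff_isSymmetric]
    intro ξ η
    change inner ℂ (S t ξ) η = inner ℂ ξ (S t η)
    refine eq_of_toL2 τ (f := fun ξ => inner ℂ (S t ξ) η) (g := fun ξ => inner ℂ ξ (S t η))
      (by fun_prop) (by fun_prop) (fun x => ?_) ξ
    refine eq_of_toL2 τ (f := fun η => inner ℂ (S t (toL2 τ x)) η)
      (g := fun η => inner ℂ (toL2 τ x) (S t η)) (by fun_prop) (by fun_prop) (fun y => ?_) η
    rw [hS t ht, hS t ht, inner_toL2, inner_toL2, hT.symmetric t ht]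
  have hadd : ∀ s, 0 < s → ∀ t, 0 < t → S (s + t) = S s * S t := fun s hs t ht => by
    ext1 ξ
    refine eq_of_toL2 τ (f := S (s + t)) (g := S s * S t) (by fun_prop) (by fun_prop)
      (fun x => ?_) ξ
    change _ = S s (S t (toL2 τ x))
    rw [hS _ (by positivity), hS t ht, hS s hs, hT.semigroup s hs t ht]
  have hnorm : ∀ t, 0 < t → ‖S t‖ < 1 := fun t ht => by
    by_contra! hge
    -- if `‖S_t‖ ≥ 1`, then `‖S_{2^n t}‖ ≥ 1` for all `n`
    have h1 : ∀ n : ℕ, 1 ≤ ‖S (2 ^ n * t)‖ := fun n => by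
      induction n with
      | zero => simpa using hge
      | succ n ih =>
        have h2 : S (2 ^ (n + 1) * t) = S (2 ^ n * t) * S (2 ^ n * t) := by
          rw [← hadd _ (by positivity) _ (by positivity)]
          congr 1; ring
        rw [h2, norm_mul_self_of_isSelfAdjoint (hsa _ (by positivity))]
        nlinarith
    have h3 : ∀ n : ℕ, ‖S (2 ^ n * t)‖ ≤ √‖τ.toFunctional‖ * (D * (2 ^ n * t) ^ (-ν)) := fun n => by
      have hpos : (0 : ℝ) < 2 ^ n * t := by positivity
      refine ContinuousLinearMap.opNorm_le_bound _ (by positivity) fun ξ => ?_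
      refine isClosed_property (denseRange_toL2 τ)
        (p := fun ξ => ‖S (2 ^ n * t) ξ‖ ≤ √‖τ.toFunctional‖ * (D * (2 ^ n * t) ^ (-ν)) * ‖ξ‖)
        (isClosed_le (by fun_prop) (by fun_prop)) (fun x => ?_) ξ
      rw [hS _ hpos]
      refine (norm_toL2_le τ _).trans ?_
      rw [mul_assoc]
      gcongr
      exact hD _ hpos x
    have h4 : Tendsto (fun n : ℕ => √‖τ.toFunctional‖ * (D * ((2 : ℝ) ^ n * t) ^ (-ν))) atTop
        (𝓝 (√‖τ.toFunctional‖ * (D * 0))) := by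
      refine ((((tendsto_rpow_neg_atTop hν).comp ?_).const_mul _).const_mul _)
      exact (tendsto_pow_atTop_atTop_of_one_lt one_lt_two).atTop_mul_const ht
    have h5 := ge_of_tendsto' h4 fun n => (h1 n).trans (h3 n)
    simp at h5
    linarith
  refine ⟨⟨R, S, hR, fun t _ ξ => rfl, hsa, hadd, hnorm, fun ξ hξ => ?_⟩⟩
  -- `‖S_{t/2} ξ‖² = ⟨ξ, S_t ξ⟩`, so that the kernels of `S_t` and `S_{t/2}` coincide
  have h1 : ∀ n : ℕ, S ((2 : ℝ)⁻¹ ^ n) ξ = 0 := fun n => by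
    induction n with
    | zero => simpa using hξ
    | succ n ih =>
      have hpos : (0 : ℝ) < 2⁻¹ ^ (n + 1) := by positivity
      have h2 : S ((2 : ℝ)⁻¹ ^ n) = S (2⁻¹ ^ (n + 1)) * S (2⁻¹ ^ (n + 1)) := by
        rw [← hadd _ hpos _ hpos]; congr 1; ring
      rw [h2] at ih
      have h3 : inner ℂ (S (2⁻¹ ^ (n + 1)) ξ) (S (2⁻¹ ^ (n + 1)) ξ) = 0 := by
        rw [← ContinuousLinearMap.adjoint_inner_right, ← ContinuousLinearMap.star_eq_adjoint,
          (hsa _ hpos).star_eq]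
        change inner ℂ ξ ((S (2⁻¹ ^ (n + 1)) * S (2⁻¹ ^ (n + 1))) ξ) = 0
        rw [ih, inner_zero_right]
      exact inner_self_eq_zero.mp h3
  have hlim : Tendsto (fun n : ℕ => (2 : ℝ)⁻¹ ^ n) atTop (𝓝[>] 0) :=
    tendsto_nhdsWithin_iff.mpr ⟨tendsto_pow_atTop_nhds_zero_of_lt_one (by norm_num) (by norm_num),
      Eventually.of_forall fun n => by simp⟩
  -- `ξ` is orthogonal to the vectors `S_{2^{-n}} x`, which converge weakly to `x`; as the
  -- convergence is known only against elements of `M`, pass through elements `y` close to `ξ`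
  have h2 : ∀ x y : Elt M, ‖inner ℂ (toL2 τ y) (toL2 τ x)‖ ≤ ‖toL2 τ y - ξ‖ * ‖toL2 τ x‖ :=
    fun x y => by
    rw [inner_toL2]
    refine le_of_tendsto' ((tendsto_trace_mul hT x y).comp hlim).norm fun n => ?_
    have hpos : (0 : ℝ) < 2⁻¹ ^ n := by positivity
    have h3 : inner ℂ ξ (S (2⁻¹ ^ n) (toL2 τ x)) = 0 := by
      have h4 := ContinuousLinearMap.adjoint_inner_right (S (2⁻¹ ^ n)) ξ (toL2 τ x)
      rw [← ContinuousLinearMap.star_eq_adjoint, (hsa _ hpos).star_eq] at h4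
      rw [h4, h1, inner_zero_left]
    have h5 : τ (star y * T (2⁻¹ ^ n) x) = inner ℂ (toL2 τ y - ξ) (S (2⁻¹ ^ n) (toL2 τ x)) := by
      rw [inner_sub_left, h3, sub_zero, hS _ hpos, inner_toL2]
    simp only [Function.comp_apply]
    rw [h5]
    refine (norm_inner_le_norm _ _).trans ?_
    gcongr
    have h6 := (S (2⁻¹ ^ n)).le_of_opNorm_le (hnorm _ hpos).le (toL2 τ x)
    simpa using h6
  obtain ⟨y, hy⟩ := exists_tendsto_toL2 τ ξ
  have h3 : ∀ x, inner ℂ ξ (toL2 τ x) = 0 := fun x => by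
    have h4 : Tendsto (fun n => ‖toL2 τ (y n) - ξ‖ * ‖toL2 τ x‖) atTop (𝓝 0) := by
      have := (tendsto_iff_norm_sub_tendsto_zero.mp hy).mul_const ‖toL2 τ x‖
      simpa using this
    have h5 := le_of_tendsto_of_tendsto' (hy.inner (tendsto_const_nhds (x := toL2 τ x))).norm h4
      fun n => h2 x (y n)
    exact norm_le_zero_iff.mp h5
  have h4 := eq_of_toL2 τ (f := fun η => inner ℂ ξ η) (g := fun _ => (0 : ℂ)) (by fun_prop)
    continuous_const h3 ξ
  exact inner_self_eq_zero.mp h4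

/-! ### Uniqueness of the spectral resolution, and the spectral gap -/

/-- A finite measure on `[0, 1]` is determined by its moments. -/
theorem ext_of_moments {μ μ' : Measure (Icc (0 : ℝ) 1)} [IsFiniteMeasure μ] [IsFiniteMeasure μ']
    (h : ∀ n : ℕ, ∫ x, (x : ℝ) ^ n ∂μ = ∫ x, (x : ℝ) ^ n ∂μ') : μ = μ' := by
  have hint : ∀ (κ : Measure (Icc (0 : ℝ) 1)) [IsFiniteMeasure κ] (f : C(Icc (0 : ℝ) 1, ℝ)),
      Integrable f κ := fun κ _ f => integrable_continuousMap κ f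
  have hp : ∀ p : Polynomial ℝ, ∫ x, p.toContinuousMapOn (Icc 0 1) x ∂μ =
      ∫ x, p.toContinuousMapOn (Icc 0 1) x ∂μ' := fun p => by
    induction p using Polynomial.induction_on' with
    | add p q hp hq =>
      have h1 : ∀ x : Icc (0 : ℝ) 1, (p + q).toContinuousMapOn (Icc 0 1) x =
          p.toContinuousMapOn (Icc 0 1) x + q.toContinuousMapOn (Icc 0 1) x := fun x => by simp
      simp only [h1]
      rw [integral_add (hint μ _) (hint μ _), integral_add (hint μ' _) (hint μ' _), hp, hq]
    | monomial n a =>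
      simp only [Polynomial.toContinuousMapOn_apply, Polynomial.toContinuousMap_apply,
        Polynomial.eval_monomial]
      rw [integral_const_mul, integral_const_mul, h]
  have hf : ∀ f : C(Icc (0 : ℝ) 1, ℝ), ∫ x, f x ∂μ = ∫ x, f x ∂μ' := fun f => by
    have key : ∀ ε : ℝ, 0 < ε → |∫ x, f x ∂μ - ∫ x, f x ∂μ'| ≤ ε * (μ.real univ + μ'.real univ) :=
      fun ε hε => by
      obtain ⟨p, hpf⟩ := exists_polynomial_near_continuousMap 0 1 f ε hε
      have h1 : ∀ (κ : Measure (Icc (0 : ℝ) 1)) [IsFiniteMeasure κ],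
          |∫ x, p.toContinuousMapOn (Icc 0 1) x ∂κ - ∫ x, f x ∂κ| ≤ ε * κ.real univ := fun κ _ => by
        rw [← integral_sub (hint κ _) (hint κ _), ← Real.norm_eq_abs]
        refine norm_integral_le_of_norm_le_const (Eventually.of_forall fun x => ?_)
        exact ((p.toContinuousMapOn (Icc 0 1) - f).norm_coe_le_norm x).trans hpf.le
      have h2 := h1 μ
      have h3 := h1 μ'
      rw [hp p] at h2
      rw [abs_le] at h2 h3 ⊢
      constructor <;> linarith [h2.1, h2.2, h3.1, h3.2]
    have h4 : Tendsto (fun ε : ℝ => ε * (μ.real univ + μ'.real univ)) (𝓝[>] 0)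
        (𝓝 (0 * (μ.real univ + μ'.real univ))) :=
      ((continuous_id.mul continuous_const).tendsto 0).mono_left nhdsWithin_le_nhds
    have h5 := ge_of_tendsto h4 (eventually_mem_nhdsWithin.mono fun ε hε => key ε hε)
    rw [zero_mul] at h5
    exact sub_eq_zero.mp (abs_nonpos_iff.mp h5)
  exact ext_of_forall_integral_eq_of_IsFiniteMeasure fun f => hf f.toContinuousMap

/-- A finite measure on the half-line is determined by its Laplace transform. -/
theorem ext_of_laplace {μ μ' : Measure ℝ} [IsFiniteMeasure μ] [IsFiniteMeasure μ']
    (h0 : ∀ᵐ l ∂μ, 0 ≤ l) (h0' : ∀ᵐ l ∂μ', 0 ≤ l) (hmass : μ.real univ = μ'.real univ)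
    (h : ∀ t, 0 < t → ∫ l, heat t l ∂μ = ∫ l, heat t l ∂μ') : μ = μ' := by
  let e : ℝ → Icc (0 : ℝ) 1 := fun l => ⟨Real.exp (-max l 0), (Real.exp_pos _).le, by
    rw [Real.exp_le_one_iff]; simp⟩
  have he : Measurable e := (by fun_prop : Measurable fun l : ℝ => Real.exp (-max l 0)).subtype_mk
  have hmom : ∀ (κ : Measure ℝ) [IsFiniteMeasure κ], (∀ᵐ l ∂κ, 0 ≤ l) → ∀ n : ℕ, 0 < n →
      ((∫ x, (x : ℝ) ^ n ∂(κ.map e) : ℝ) : ℂ) = ∫ l, heat n l ∂κ := fun κ _ hκ n hn => by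
    rw [integral_map he.aemeasurable (by fun_prop), ← integral_complex_ofReal]
    refine integral_congr_ae ?_
    filter_upwards [hκ] with l hl
    rw [heat, if_pos hl]
    simp only [e, max_eq_left hl]
    rw [← Real.exp_nat_mul]
    congr 2; ring
  have h1 : μ.map e = μ'.map e := by
    refine ext_of_moments fun n => ?_
    rcases Nat.eq_zero_or_pos n with rfl | hn
    · simp only [pow_zero, integral_const, smul_eq_mul, mul_one]
      rw [map_measureReal_apply he MeasurableSet.univ, map_measureReal_apply he MeasurableSet.univ]
      simpa using hmass
    · have h2 := hmom μ h0 n hn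
      rw [h n (by exact_mod_cast hn), ← hmom μ' h0' n hn] at h2
      exact_mod_cast h2
  have hg : Measurable fun x : Icc (0 : ℝ) 1 => -Real.log x :=
    (Real.measurable_log.comp measurable_subtype_coe).neg
  have hback : ∀ (κ : Measure ℝ), (∀ᵐ l ∂κ, 0 ≤ l) →
      (κ.map e).map (fun x : Icc (0 : ℝ) 1 => -Real.log x) = κ := fun κ hκ => by
    rw [Measure.map_map hg he]
    conv_rhs => rw [← Measure.map_id (μ := κ)]
    refine Measure.map_congr ?_
    filter_upwards [hκ] with l hl
    simp [e, max_eq_left hl]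
  rw [← hback μ h0, h1, hback μ' h0']

namespace SpectralMeasure

variable {K : Type*} [NormedAddCommGroup K] [InnerProductSpace ℂ K] [CompleteSpace K]

theorem ae_notMem_of_proj_eq_zero (E : SpectralMeasure K) {B : Set ℝ} (hB : MeasurableSet B) {ξ : K}
    (h : E.proj B ξ = 0) : ∀ᵐ l ∂(E.measure ξ), l ∉ B := by
  rw [ae_iff]
  simp only [not_not, Set.ofPred_mem_eq]
  rw [E.measure_apply hB, h]
  simp

theorem HasIntegral.of_measure_eq {E E' : SpectralMeasure K} (h : ∀ ξ, E.measure ξ = E'.measure ξ)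
    {f : ℝ → ℂ} {ξ η : K} (hE : E.HasIntegral f ξ η) : E'.HasIntegral f ξ η := by
  have hproj : ∀ B, MeasurableSet B → E.proj B = E'.proj B := fun B hB => by
    have hre : ∀ (F : SpectralMeasure K) (ζ : K),
        inner ℂ ζ (F.proj B ζ) = (((F.measure ζ).real B : ℝ) : ℂ) := fun F ζ => by
      rw [F.measureReal_apply hB, ← F.inner_proj hB]
      refine (Complex.conj_eq_iff_re.mp ?_).symm
      rw [inner_conj_symm, F.inner_proj_comm hB]
    refine eq_of_inner_map_self_eq fun ζ => ?_
    rw [hre E, hre E', h]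
  intro ε hε
  obtain ⟨s, hs1, hs2⟩ := hE ε hε
  refine ⟨s, by rwa [← h], ?_⟩
  rwa [Finset.sum_congr rfl fun c _ => by rw [← hproj _ (s.measurableSet_fiber c)]]

/-- If `‖e^{-L}‖ < 1`, the spectrum of `L` is bounded away from `0`. -/
theorem exists_gap (E : SpectralMeasure K) (h0 : E.proj (Iio 0) = 0) (h1 : ‖E.op (heat 1)‖ < 1) :
    ∃ δ : ℝ, 0 < δ ∧ E.proj (Iio δ) = 0 := by
  -- on the range of `E([0, -log ρ))` the operator `e^{-L}` is at least `ρ > ‖e^{-L}‖`, so this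
  -- range is trivial
  obtain ⟨ρ, hρ1, hρ2⟩ := exists_between h1
  have hρ0 : 0 < ρ := (norm_nonneg _).trans_lt hρ1
  refine ⟨-Real.log ρ, by linarith [Real.log_neg hρ0 hρ2], ?_⟩
  ext ξ
  set B := Iio (-Real.log ρ)
  set η := E.proj B ξ
  have hη1 : ∀ᵐ l ∂(E.measure η), l ∉ Bᶜ := by
    refine E.ae_notMem_of_proj_eq_zero measurableSet_Iio.compl ?_
    have h2 := E.proj_mul_of_disjoint (measurableSet_Iio (a := -Real.log ρ)).compl
      (measurableSet_Iio (a := -Real.log ρ)) disjoint_compl_left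
    exact congrArg (fun A : K →L[ℂ] K => A ξ) h2
  have hη2 : ∀ᵐ l ∂(E.measure η), l ∉ Iio 0 :=
    E.ae_notMem_of_proj_eq_zero measurableSet_Iio (by rw [h0]; rfl)
  have h2 : ρ ^ 2 * ‖η‖ ^ 2 ≤ ‖E.op (heat 1) η‖ ^ 2 := by
    rw [E.norm_op_sq (isBdd_heat one_pos), ← E.measureReal_univ]
    calc ρ ^ 2 * (E.measure η).real univ = ∫ _, ρ ^ 2 ∂(E.measure η) := by
          simp [mul_comm]
      _ ≤ _ := by
          refine integral_mono_ae (integrable_const _)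
            ((isBdd_heat one_pos).integrable_norm_sq _) ?_
          filter_upwards [hη1, hη2] with l hl1 hl2
          have h3 : l < -Real.log ρ := by simpa [B] using hl1
          have h4 : 0 ≤ l := by simpa using hl2
          simp only [heat, if_pos h4, Complex.norm_real, Real.norm_of_nonneg (Real.exp_pos _).le]
          gcongr
          rw [← Real.log_le_iff_le_exp hρ0]
          linarith
  have h3 := (E.op (heat 1)).le_opNorm η
  have h4 : ρ * ‖η‖ ≤ ‖E.op (heat 1)‖ * ‖η‖ := by
    refine le_trans ?_ h3
    rw [← mul_pow] at h2
    exact le_of_sq_le_sq h2 (norm_nonneg _)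
  have h5 : ‖η‖ = 0 := by
    by_contra hne
    have : 0 < ‖η‖ := lt_of_le_of_ne (norm_nonneg _) (Ne.symm hne)
    exact absurd (le_of_mul_le_mul_right h4 this) (not_le.mpr hρ1)
  simpa using h5

end SpectralMeasure

/-- The spectral resolution of the generator of an ultracontractive semigroup: it is unique, so
that the multipliers are the integrals with respect to it, and its support is bounded away
from `0`. -/
theorem exists_resolution {τ : Trace M} {T : ℝ → Elt M →ₗ[ℂ] Elt M} (S : L2Semigroup τ T) :
    ∃ (E : SpectralMeasure (L2 τ)) (δ : ℝ), 0 < δ ∧ E.proj (Iio δ) = 0 ∧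
      (∀ t, 0 < t → E.op (heat t) = S.op t) ∧
      ∀ (f : ℝ → ℂ) (ξ η : L2 τ), IsMultiplier τ T f ξ η ↔ E.HasIntegral f ξ η := by
  obtain ⟨E, hE0, hE⟩ := exists_spectralMeasure_of_semigroup S.isSelfAdjoint S.op_add
    (fun t ht => (S.norm_lt_one t ht).le) S.eq_zero
  obtain ⟨δ, hδ, hgap⟩ := E.exists_gap hE0 (by rw [hE 1 one_pos]; exact S.norm_lt_one 1 one_pos)
  have hnonneg : ∀ F : SpectralMeasure (L2 τ), F.proj (Iio 0) = 0 → ∀ ξ,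
      ∀ᵐ l ∂(F.measure ξ), 0 ≤ l := fun F hF ξ => by
    filter_upwards [F.ae_notMem_of_proj_eq_zero measurableSet_Iio (ξ := ξ) (by rw [hF]; rfl)]
      with l hl
    simpa using hl
  have hheat : ∀ F : SpectralMeasure (L2 τ), F.proj (Iio 0) = 0 → ∀ t ξ,
      (fun l => (Real.exp (-(t * l)) : ℂ)) =ᵐ[F.measure ξ] heat t := fun F hF t ξ => by
    filter_upwards [hnonneg F hF ξ] with l hl
    rw [heat, if_pos hl]
  have hres : IsSpectralResolution τ T E := ⟨hE0, fun t ht x => by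
    have h1 := E.hasIntegral_op (isBdd_heat ht) (hheat E hE0 t (toL2 τ x))
    rwa [hE t ht, S.op_toL2 ht] at h1⟩
  refine ⟨E, δ, hδ, hgap, hE, fun f ξ η => ⟨?_, fun h => ⟨E, hres, h⟩⟩⟩
  -- the scalar measures of another resolution have the same Laplace transforms
  rintro ⟨F, ⟨hF0, hF⟩, h⟩
  have hF' : ∀ t, 0 < t → F.op (heat t) = S.op t := fun t ht => by
    ext1 ζ
    refine eq_of_toL2 τ (f := F.op (heat t)) (g := S.op t) (by fun_prop) (by fun_prop)
      (fun x => ?_) ζ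
    rw [S.op_toL2 ht, (hF t ht x).eq_op (isBdd_heat ht) (hheat F hF0 t (toL2 τ x))]
  refine SpectralMeasure.HasIntegral.of_measure_eq (fun ζ => ?_) h
  refine ext_of_laplace (hnonneg F hF0 ζ) (hnonneg E hE0 ζ) ?_ fun t ht => ?_
  · rw [F.measureReal_univ, E.measureReal_univ]
  · rw [← F.inner_op (isBdd_heat ht), ← E.inner_op (isBdd_heat ht), hF' t ht, hE t ht]

/-! ### Multipliers of the generator -/

namespace SpectralMeasure

variable {K : Type*} [NormedAddCommGroup K] [InnerProductSpace ℂ K] [CompleteSpace K]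

theorem norm_op_apply_le (E : SpectralMeasure K) {f : ℝ → ℂ} (hf : IsBdd f) {C : ℝ} (hC : 0 ≤ C)
    (h : ∀ l, ‖f l‖ ≤ C) (ξ : K) : ‖E.op f ξ‖ ≤ C * ‖ξ‖ := by
  have h1 : ‖E.op f ξ‖ ^ 2 ≤ (C * ‖ξ‖) ^ 2 := by
    rw [E.norm_op_sq hf, mul_pow, ← E.measureReal_univ]
    calc ∫ l, ‖f l‖ ^ 2 ∂(E.measure ξ) ≤ ∫ _, C ^ 2 ∂(E.measure ξ) :=
          integral_mono (hf.integrable_norm_sq _) (integrable_const _)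
            fun l => pow_le_pow_left₀ (norm_nonneg _) (h l) 2
      _ = _ := by simp [mul_comm]
  exact le_of_sq_le_sq h1 (by positivity)

theorem isBdd_sum_and_op_sum (E : SpectralMeasure K) {ι : Type*} (F : Finset ι) (c : ι → ℂ)
    {f : ι → ℝ → ℂ} (hf : ∀ i, IsBdd (f i)) :
    IsBdd (fun l => ∑ i ∈ F, c i * f i l) ∧
      E.op (fun l => ∑ i ∈ F, c i * f i l) = ∑ i ∈ F, c i • E.op (f i) := by
  classical
  induction F using Finset.induction_on with
  | empty =>
    simp only [Finset.sum_empty]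
    exact ⟨IsBdd.const 0, by rw [E.op_const, zero_smul]⟩
  | insert a F ha ih =>
    simp only [Finset.sum_insert ha]
    have h1 : IsBdd fun l => c a * f a l := (IsBdd.const (c a)).mul (hf a)
    exact ⟨h1.add ih.1, by rw [E.op_add h1 ih.1, E.op_const_mul (hf a), ih.2]⟩

end SpectralMeasure

/-- The restriction of a function to the half-line `[δ, ∞)`, extended by `0`. -/
def cut (δ : ℝ) (f : ℝ → ℂ) : ℝ → ℂ := (Ici δ).indicator f

theorem cut_of_le {δ : ℝ} (f : ℝ → ℂ) {l : ℝ} (h : δ ≤ l) : cut δ f l = f l :=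
  Set.indicator_of_mem (mem_Ici.mpr h) f

theorem norm_cut_le {δ C : ℝ} {f : ℝ → ℂ} (hC : 0 ≤ C) (h : ∀ l, δ ≤ l → ‖f l‖ ≤ C) (l : ℝ) :
    ‖cut δ f l‖ ≤ C := by
  by_cases hl : δ ≤ l
  · rw [cut_of_le f hl]; exact h l hl
  · rw [cut, Set.indicator_of_notMem (by simpa using hl), norm_zero]; exact hC

theorem isBdd_cut {δ C : ℝ} {f : ℝ → ℂ} (hf : ContinuousOn f (Ici δ))
    (h : ∀ l, δ ≤ l → ‖f l‖ ≤ C) : IsBdd (cut δ f) := by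
  classical
  refine ⟨?_, C, norm_cut_le ((norm_nonneg _).trans (h δ le_rfl)) h⟩
  rw [cut, ← Set.piecewise_eq_indicator]
  exact hf.measurable_piecewise continuousOn_const measurableSet_Ici

/-- The spectral resolution of the generator of a semigroup on `L₂(M)`, carried by `[δ, ∞)`. -/
structure Resolution {τ : Trace M} {T : ℝ → Elt M →ₗ[ℂ] Elt M} (S : L2Semigroup τ T) where
  /-- the resolution of the identity -/
  E : SpectralMeasure (L2 τ)
  /-- a lower bound for the spectrum -/
  δ : ℝ
  δ_pos : 0 < δ
  proj_Iio : E.proj (Iio δ) = 0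
  op_heat : ∀ t, 0 < t → E.op (heat t) = S.op t
  isMultiplier_iff_hasIntegral : ∀ (f : ℝ → ℂ) (ξ η : L2 τ),
    IsMultiplier τ T f ξ η ↔ E.HasIntegral f ξ η

namespace Resolution

variable {τ : Trace M} {T : ℝ → Elt M →ₗ[ℂ] Elt M} {S : L2Semigroup τ T} (R : Resolution S)

theorem ae_le (ξ : L2 τ) : ∀ᵐ l ∂(R.E.measure ξ), R.δ ≤ l := by
  filter_upwards [R.E.ae_notMem_of_proj_eq_zero measurableSet_Iio (ξ := ξ)
    (by rw [R.proj_Iio]; rfl)] with l hl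
  simpa using hl

theorem isMultiplier_iff {f : ℝ → ℂ} (hf : IsBdd (cut R.δ f)) {ξ η : L2 τ} :
    IsMultiplier τ T f ξ η ↔ η = R.E.op (cut R.δ f) ξ := by
  have h : f =ᵐ[R.E.measure ξ] cut R.δ f := by
    filter_upwards [R.ae_le ξ] with l hl
    rw [cut_of_le f hl]
  rw [R.isMultiplier_iff_hasIntegral]
  exact ⟨fun h1 => h1.eq_op hf h, fun h1 => h1 ▸ R.E.hasIntegral_op hf h⟩

/-- The function `λ^{iu-α}` on `[δ, ∞)`. -/
def pow (α u : ℝ) : ℝ → ℂ := cut R.δ fun l => (l : ℂ) ^ (Complex.I * u - α)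

theorem norm_cpow_eq {l : ℝ} (hl : 0 < l) (α u : ℝ) :
    ‖(l : ℂ) ^ (Complex.I * u - α)‖ = l ^ (-α) := by
  rw [Complex.norm_cpow_eq_rpow_re_of_pos hl]
  simp

theorem norm_cpow_le {α : ℝ} (hα : 0 < α) (u : ℝ) {l : ℝ} (hl : R.δ ≤ l) :
    ‖(l : ℂ) ^ (Complex.I * u - α)‖ ≤ R.δ ^ (-α) := by
  rw [norm_cpow_eq (R.δ_pos.trans_le hl)]
  exact Real.rpow_le_rpow_of_nonpos R.δ_pos hl (by linarith)

theorem isBdd_pow {α : ℝ} (hα : 0 < α) (u : ℝ) : IsBdd (R.pow α u) := by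
  refine isBdd_cut (fun l hl => ?_) fun l hl => R.norm_cpow_le hα u hl
  have hl0 : 0 < l := R.δ_pos.trans_le hl
  refine ContinuousAt.continuousWithinAt ?_
  exact (Complex.continuousAt_ofReal_cpow_const l _ (Or.inr hl0.ne'))

theorem norm_pow_le {α : ℝ} (hα : 0 < α) (u l : ℝ) : ‖R.pow α u l‖ ≤ R.δ ^ (-α) :=
  norm_cut_le (Real.rpow_nonneg R.δ_pos.le _) (fun _ hl => R.norm_cpow_le hα u hl) l

theorem isPower_iff {α : ℝ} (hα : 0 < α) {u : ℝ} {ξ η : L2 τ} :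
    IsPower τ T (Complex.I * u - α) ξ η ↔ η = R.E.op (R.pow α u) ξ :=
  R.isMultiplier_iff (R.isBdd_pow hα u)

/-- The norm in `L₁(M)` of `L^{iu-α} 1` is bounded below: pairing this element with its image under
`T_1`, which is bounded, gives `‖T_{1/2} L^{-α} 1‖₂²`. -/
theorem exists_le_norm_pow_one [Nontrivial (Elt M)] {α : ℝ} (hα : 0 < α) :
    ∃ c : ℝ, 0 < c ∧ ∀ u, c ≤ ‖ofL2 τ (R.E.op (R.pow α u) (toL2 τ 1))‖ := by
  set ξ := toL2 τ 1
  have hξ : ξ ≠ 0 := fun h => one_ne_zero (toL2_injective τ (h.trans (map_zero _).symm))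
  have hh : (0 : ℝ) < 1 / 2 := by norm_num
  -- `b u (L) = e^{-L/2} L^{iu-α}`, whose modulus does not depend on `u`
  set b : ℝ → ℝ → ℂ := fun u l => heat (1 / 2) l * R.pow α u l
  have hb : ∀ u, IsBdd (b u) := fun u => (isBdd_heat hh).mul (R.isBdd_pow hα u)
  have hnorm : ∀ u l, R.δ ≤ l → ‖b u l‖ = Real.exp (-(1 / 2 * l)) * l ^ (-α) := fun u l hl => by
    have hl0 : 0 < l := R.δ_pos.trans_le hl
    rw [norm_mul, heat, if_pos hl0.le, Complex.norm_real, Real.norm_of_nonneg (Real.exp_pos _).le,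
      pow, cut_of_le _ hl, norm_cpow_eq hl0]
  have heq : ∀ u, ‖R.E.op (b u) ξ‖ ^ 2 = ‖R.E.op (b 0) ξ‖ ^ 2 := fun u => by
    rw [R.E.norm_op_sq (hb u), R.E.norm_op_sq (hb 0)]
    refine integral_congr_ae ?_
    filter_upwards [R.ae_le ξ] with l hl
    rw [hnorm u l hl, hnorm 0 l hl]
  have hpos : 0 < ‖R.E.op (b 0) ξ‖ ^ 2 := by
    refine lt_of_le_of_ne (by positivity) fun h => hξ ?_
    rw [R.E.norm_op_sq (hb 0)] at h
    have h1 := (integral_eq_zero_iff_of_nonneg (fun l => by positivity)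
      ((hb 0).integrable_norm_sq (R.E.measure ξ))).mp h.symm
    have h2 : ∀ᵐ l ∂(R.E.measure ξ), False := by
      filter_upwards [h1, R.ae_le ξ] with l hl1 hl2
      have h3 := hnorm 0 l hl2
      have hl0 : 0 < l := R.δ_pos.trans_le hl2
      have h4 : 0 < Real.exp (-(1 / 2 * l)) * l ^ (-α) :=
        mul_pos (Real.exp_pos _) (Real.rpow_pos_of_pos hl0 _)
      have h5 : ‖b 0 l‖ ^ 2 = 0 := hl1
      rw [h3] at h5
      exact absurd h5 (by positivity)
    have h6 := R.E.measureReal_univ ξ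
    have h7 : R.E.measure ξ = 0 := by
      rw [← Measure.measure_univ_eq_zero]
      simpa [ae_iff] using h2
    rw [h7] at h6
    simpa using h6.symm
  -- the denominator bounds the norm in `M` of `T_1 ζ`, for `ζ = L^{iu-α} 1`
  refine ⟨‖R.E.op (b 0) ξ‖ ^ 2 / (‖S.reg 1‖ * (R.δ ^ (-α) * ‖ξ‖) + 1), by
    have := R.δ_pos
    positivity, fun u => ?_⟩
  have := R.δ_pos
  rw [div_le_iff₀ (by positivity), ← heq u]
  set ζ := R.E.op (R.pow α u) ξ
  have h1 : ofL2 τ ζ (star (S.reg 1 ζ)) = inner ℂ (R.E.op (b u) ξ) (R.E.op (b u) ξ) := by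
    have h2 : S.op 1 = S.op (1 / 2) * S.op (1 / 2) := by
      rw [← S.op_add _ hh _ hh]; norm_num
    have h3 : R.E.op (b u) = S.op (1 / 2) * R.E.op (R.pow α u) := by
      rw [← R.op_heat _ hh, ← R.E.op_mul (isBdd_heat hh) (R.isBdd_pow hα u)]
    rw [ofL2_apply, star_star, S.toL2_reg 1 one_pos, h2, h3]
    change inner ℂ (S.op (1 / 2) (S.op (1 / 2) ζ)) ζ = inner ℂ (S.op (1 / 2) ζ) (S.op (1 / 2) ζ)
    rw [← ContinuousLinearMap.adjoint_inner_right, ← ContinuousLinearMap.star_eq_adjoint,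
      (S.isSelfAdjoint _ hh).star_eq]
  have h2 : ‖ofL2 τ ζ (star (S.reg 1 ζ))‖ = ‖R.E.op (b u) ξ‖ ^ 2 := by
    rw [h1, inner_self_eq_norm_sq_to_K]
    simp
  rw [← h2]
  refine ((ofL2 τ ζ).le_opNorm _).trans ?_
  gcongr
  rw [norm_star]
  refine ((S.reg 1).le_opNorm _).trans ?_
  have h3 := R.E.norm_op_apply_le (R.isBdd_pow hα u) (Real.rpow_nonneg R.δ_pos.le _)
    (R.norm_pow_le hα u) ξ
  have h4 : ‖S.reg 1‖ * ‖ζ‖ ≤ ‖S.reg 1‖ * (R.δ ^ (-α) * ‖ξ‖) := by gcongr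
  linarith

end Resolution

theorem nonempty_resolution {τ : Trace M} {T : ℝ → Elt M →ₗ[ℂ] Elt M} (S : L2Semigroup τ T) :
    Nonempty (Resolution S) := by
  obtain ⟨E, δ, h1, h2, h3, h4⟩ := exists_resolution S
  exact ⟨⟨E, δ, h1, h2, h3, h4⟩⟩

/-! ### Mellin inversion and its quadrature -/

theorem continuous_mellin_line {m : ℝ → ℂ} {α : ℝ} (hm : ContinuousOn m (Ioi 0))
    (hmellin : MellinConvergent m (α : ℂ)) :
    Continuous fun u : ℝ => mellin m ((α : ℂ) - Complex.I * u) := by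
  have hne : ∀ t ∈ Ioi (0 : ℝ), (t : ℂ) ∈ Complex.slitPlane := fun t ht => Or.inl (by simpa using ht)
  refine continuous_of_dominated (bound := fun t => ‖(t : ℂ) ^ ((α : ℂ) - 1) • m t‖)
    (fun u => ?_) (fun u => ?_) hmellin.norm ?_
  · refine ContinuousOn.aestronglyMeasurable (fun t ht => ?_) measurableSet_Ioi
    refine ContinuousWithinAt.smul
      (f := fun t : ℝ => (t : ℂ) ^ ((α : ℂ) - Complex.I * u - 1)) ?_ (hm t ht)
    exact (Complex.continuousAt_ofReal_cpow_const t _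
      (Or.inr (ne_of_gt (mem_Ioi.mp ht)))).continuousWithinAt
  · filter_upwards [ae_restrict_mem measurableSet_Ioi] with t ht
    rw [norm_smul, norm_smul, Complex.norm_cpow_eq_rpow_re_of_pos ht,
      Complex.norm_cpow_eq_rpow_re_of_pos ht]
    simp
  · filter_upwards [ae_restrict_mem measurableSet_Ioi] with t ht
    have : (t : ℂ) ≠ 0 := Complex.slitPlane_ne_zero (hne t ht)
    refine Continuous.smul (f := fun u : ℝ => (t : ℂ) ^ ((α : ℂ) - Complex.I * u - 1)) ?_
      continuous_const
    exact Continuous.const_cpow (by fun_prop) (Or.inl this)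

/-- Mellin inversion: `m(x) = (2π)⁻¹ ∫ x^{iu-α} w(u) du` for `w(u) = [𝔐_α m](u)`. -/
theorem mellin_inversion {m : ℝ → ℂ} {α : ℝ} (hm : ContinuousOn m (Ioi 0))
    (hmellin : MellinConvergent m (α : ℂ))
    (hw : Integrable fun u : ℝ => mellin m ((α : ℂ) - Complex.I * u)) {x : ℝ} (hx : 0 < x) :
    m x = ((1 / (2 * Real.pi) : ℝ) : ℂ) *
      ∫ u : ℝ, mellin m ((α : ℂ) - Complex.I * u) * (x : ℂ) ^ (Complex.I * u - α) := by
  have h1 : Complex.VerticalIntegrable (mellin m) α := by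
    have h2 := hw.comp_neg
    refine h2.congr (Eventually.of_forall fun y => ?_)
    simp only [Complex.ofReal_neg]
    congr 1; ring
  rw [← mellinInv_mellin_eq α m hx hmellin h1 (hm.continuousAt (Ioi_mem_nhds hx)), mellinInv,
    Complex.real_smul]
  congr 1
  rw [← integral_neg_eq_self]
  refine integral_congr_ae (Eventually.of_forall fun u => ?_)
  simp only [Complex.ofReal_neg, smul_eq_mul]
  rw [mul_comm]
  congr 2 <;> ring

theorem norm_le_of_mellin_integrable {m : ℝ → ℂ} {α : ℝ} (hm : ContinuousOn m (Ioi 0))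
    (hmellin : MellinConvergent m (α : ℂ))
    (hw : Integrable fun u : ℝ => mellin m ((α : ℂ) - Complex.I * u)) {x : ℝ} (hx : 0 < x) :
    ‖m x‖ ≤ (∫ u : ℝ, ‖mellin m ((α : ℂ) - Complex.I * u)‖) * x ^ (-α) := by
  rw [mellin_inversion hm hmellin hw hx, norm_mul, Complex.norm_real]
  have hpi : ‖1 / (2 * Real.pi)‖ ≤ 1 := by
    rw [Real.norm_of_nonneg (by positivity), div_le_one (by positivity)]
    linarith [Real.pi_gt_three]
  have h1 : ‖∫ u : ℝ, mellin m ((α : ℂ) - Complex.I * u) * (x : ℂ) ^ (Complex.I * u - α)‖ ≤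
      (∫ u : ℝ, ‖mellin m ((α : ℂ) - Complex.I * u)‖) * x ^ (-α) := by
    rw [← integral_mul_const]
    refine norm_integral_le_of_norm_le (hw.norm.mul_const _) (Eventually.of_forall fun u => ?_)
    rw [norm_mul, Resolution.norm_cpow_eq hx]
  calc _ ≤ 1 * ((∫ u : ℝ, ‖mellin m ((α : ℂ) - Complex.I * u)‖) * x ^ (-α)) := by gcongr
    _ = _ := one_mul _

/-- A point of a set at which a nonnegative function, not assumed to be measurable, is at most
its average (for the lower integral), up to `ε`. -/
theorem exists_mul_le_setLIntegral_add {w : ℝ → ℝ≥0∞} (hw : Measurable w) (N : ℝ → ℝ≥0∞)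
    {I : Set ℝ} (hI : MeasurableSet I) (hne : I.Nonempty) (hfin : ∫⁻ u in I, w u * N u ≠ ∞)
    (hwfin : ∫⁻ u in I, w u ≠ ∞) {ε : ℝ≥0∞} (hε : ε ≠ 0) :
    ∃ u ∈ I, (∫⁻ v in I, w v) * N u ≤ (∫⁻ v in I, w v * N v) + ε := by
  by_contra! h
  set W := ∫⁻ v in I, w v
  set a := ∫⁻ v in I, w v * N v
  have hW : W ≠ 0 := by
    obtain ⟨u, hu⟩ := hne
    intro h0
    have := h u hu
    rw [h0, zero_mul] at this
    exact not_lt_zero this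
  have h1 : (a + ε) / W * W ≤ a := by
    rw [← lintegral_const_mul _ hw]
    refine setLIntegral_mono' hI fun u hu => ?_
    rw [mul_comm]
    gcongr
    rw [ENNReal.div_le_iff hW hwfin, mul_comm]
    exact (h u hu).le
  rw [ENNReal.div_mul_cancel hW hwfin] at h1
  exact absurd h1 (not_le.mpr (ENNReal.lt_add_right hfin hε))

/-- Riemann sums of `∫ w(u) φ(u) du`, with sample points adapted to a weight `N`, which need not be
measurable. -/
theorem exists_quadrature {w : ℝ → ℂ} (hwm : Measurable w) (hw : Integrable w) (N : ℝ → ℝ≥0∞)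
    (hA : ∫⁻ u, ‖w u‖ₑ * N u ≠ ∞) :
    ∃ (F : ℕ → Finset ℤ) (c : ℕ → ℤ → ℂ) (u : ℕ → ℤ → ℝ),
      (∀ n, ∑ i ∈ F n, ‖c n i‖ₑ * N (u n i) ≤ (∫⁻ v, ‖w v‖ₑ * N v) + 1) ∧
      (∀ n, ∑ i ∈ F n, ‖c n i‖ ≤ ∫ v, ‖w v‖) ∧
      ∀ (φ : ℝ → ℂ) (C : ℝ), Continuous φ → (∀ v, ‖φ v‖ ≤ C) →
        Tendsto (fun n => ∑ i ∈ F n, c n i * φ (u n i)) atTop (𝓝 (∫ v, w v * φ v)) := by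
  -- `I n i` is the interval of length `1 / (n + 1)` starting at `i / (n + 1)`, and `c n i` the
  -- integral of `w` over it; the intervals with index in `F n` cover `[-(n + 1), n + 1)`
  set I : ℕ → ℤ → Set ℝ := fun n i => {v | ⌊((n : ℝ) + 1) * v⌋ = i}
  have hI : ∀ n i, MeasurableSet (I n i) := fun n i =>
    (Int.measurable_floor.comp (measurable_const_mul ((n : ℝ) + 1))) (measurableSet_singleton i)
  have hn : ∀ n : ℕ, (0 : ℝ) < n + 1 := fun n => by positivity
  have hne : ∀ n i, (I n i).Nonempty := fun n i => ⟨i / ((n : ℝ) + 1), by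
    simp only [I, Set.mem_ofPred_eq]
    rw [mul_div_cancel₀ _ (hn n).ne', Int.floor_intCast]⟩
  have hdisj : ∀ n, Pairwise (Function.onFun Disjoint (I n)) := fun n i j hij =>
    Set.disjoint_left.mpr fun v hv hv' => hij (hv.symm.trans hv')
  set F : ℕ → Finset ℤ := fun n => Finset.Ico (-((n : ℤ) + 1) ^ 2) (((n : ℤ) + 1) ^ 2)
  have hF : ∀ n, (F n).card ≠ 0 := fun n => by
    rw [Finset.card_ne_zero]
    refine Finset.nonempty_Ico.mpr ?_
    have : (0 : ℤ) < ((n : ℤ) + 1) ^ 2 := by positivity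
    linarith
  -- the sample points are nearly optimal for `N` in their intervals; the errors add up to at most
  -- `1`
  have hpt : ∀ n i, ∃ v ∈ I n i, (∫⁻ v in I n i, ‖w v‖ₑ) * N v ≤
      (∫⁻ v in I n i, ‖w v‖ₑ * N v) + ((F n).card : ℝ≥0∞)⁻¹ := fun n i => by
    refine exists_mul_le_setLIntegral_add hwm.enorm N (hI n i) (hne n i) ?_ ?_ ?_
    · exact ((setLIntegral_le_lintegral _ _).trans_lt hA.lt_top).ne
    · exact ((setLIntegral_le_lintegral _ _).trans_lt hw.2).ne
    · simp
  choose u hu1 hu2 using hpt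
  set c : ℕ → ℤ → ℂ := fun n i => ∫ v in I n i, w v
  refine ⟨F, c, u, fun n => ?_, fun n => ?_, fun φ C hφ hC => ?_⟩
  · calc ∑ i ∈ F n, ‖c n i‖ₑ * N (u n i)
        ≤ ∑ i ∈ F n, ((∫⁻ v in I n i, ‖w v‖ₑ * N v) + ((F n).card : ℝ≥0∞)⁻¹) := by
          refine Finset.sum_le_sum fun i _ => le_trans ?_ (hu2 n i)
          gcongr
          exact enorm_integral_le_lintegral_enorm _
      _ = (∫⁻ v in ⋃ i ∈ F n, I n i, ‖w v‖ₑ * N v) + 1 := by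
          rw [Finset.sum_add_distrib, lintegral_biUnion_finset
            (fun i _ j _ hij => hdisj n hij) fun i _ => hI n i, Finset.sum_const, nsmul_eq_mul,
            ENNReal.mul_inv_cancel (by exact_mod_cast hF n) (ENNReal.natCast_ne_top _)]
      _ ≤ _ := by gcongr; exact Measure.restrict_le_self
  · calc ∑ i ∈ F n, ‖c n i‖ ≤ ∑ i ∈ F n, ∫ v in I n i, ‖w v‖ :=
          Finset.sum_le_sum fun i _ => norm_integral_le_integral_norm _
      _ = ∫ v in ⋃ i ∈ F n, I n i, ‖w v‖ := by
          rw [integral_biUnion_finset _ (fun i _ => hI n i) (fun i _ j _ hij => hdisj n hij)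
            fun i _ => hw.norm.integrableOn]
      _ ≤ _ := setIntegral_le_integral hw.norm (Eventually.of_forall fun v => norm_nonneg _)
  · set G : ℕ → ℝ → ℂ := fun n v => ∑ i ∈ F n, (I n i).indicator (fun v => w v * φ (u n i)) v
    have hG1 : ∀ n v, (G n v = w v * φ (u n ⌊((n : ℝ) + 1) * v⌋) ∧
        ⌊((n : ℝ) + 1) * v⌋ ∈ F n) ∨ (G n v = 0 ∧ ⌊((n : ℝ) + 1) * v⌋ ∉ F n) := fun n v => by
      have hz : ∀ i, i ≠ ⌊((n : ℝ) + 1) * v⌋ →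
          (I n i).indicator (fun v => w v * φ (u n i)) v = 0 := fun i hi =>
        Set.indicator_of_notMem (s := I n i) (fun h => hi (Eq.symm h)) _
      by_cases hv : ⌊((n : ℝ) + 1) * v⌋ ∈ F n
      · refine Or.inl ⟨?_, hv⟩
        simp only [G]
        rw [Finset.sum_eq_single_of_mem _ hv fun i _ hi => hz i hi]
        exact Set.indicator_of_mem (s := I n _) rfl _
      · refine Or.inr ⟨Finset.sum_eq_zero fun i hi => hz i ?_, hv⟩
        rintro rfl
        exact hv hi
    have hG2 : ∀ n, ∑ i ∈ F n, c n i * φ (u n i) = ∫ v, G n v := fun n => by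
      simp only [G]
      rw [integral_finsetSum]
      · refine Finset.sum_congr rfl fun i _ => ?_
        rw [integral_indicator (hI n i), integral_mul_const]
      · exact fun i _ => (hw.mul_const _).indicator (hI n i)
    simp only [hG2]
    refine tendsto_integral_of_dominated_convergence (fun v => ‖w v‖ * C) (fun n => ?_)
      (hw.norm.mul_const C) (fun n => Eventually.of_forall fun v => ?_)
      (Eventually.of_forall fun v => ?_)
    · refine (integrable_finsetSum _ fun i _ => ?_).aestronglyMeasurable
      exact (hw.mul_const _).indicator (hI n i)
    · have hC0 : 0 ≤ C := (norm_nonneg _).trans (hC 0)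
      rcases hG1 n v with ⟨h, -⟩ | ⟨h, -⟩
      · rw [h, norm_mul]
        gcongr
        exact hC _
      · rw [h, norm_zero]; positivity
    · have hcast : Tendsto (fun n : ℕ => (n : ℝ) + 1) atTop atTop :=
        tendsto_natCast_atTop_atTop.atTop_add tendsto_const_nhds
      have hclose : ∀ n : ℕ, |u n ⌊((n : ℝ) + 1) * v⌋ - v| ≤ 1 / ((n : ℝ) + 1) := fun n => by
        have h1 : ⌊((n : ℝ) + 1) * u n ⌊((n : ℝ) + 1) * v⌋⌋ = ⌊((n : ℝ) + 1) * v⌋ := hu1 n _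
        have h2 := Int.abs_sub_lt_one_of_floor_eq_floor h1
        rw [← mul_sub, abs_mul, abs_of_pos (hn n)] at h2
        rw [le_div_iff₀ (hn n), mul_comm]
        exact h2.le
      have hlim : Tendsto (fun n : ℕ => u n ⌊((n : ℝ) + 1) * v⌋) atTop (𝓝 v) := by
        rw [tendsto_iff_norm_sub_tendsto_zero]
        exact squeeze_zero (fun n => norm_nonneg _) hclose tendsto_one_div_add_atTop_nhds_zero_nat
      have hlim2 : Tendsto (fun n : ℕ => w v * φ (u n ⌊((n : ℝ) + 1) * v⌋)) atTop
          (𝓝 (w v * φ v)) := ((hφ.tendsto v).comp hlim).const_mul _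
      refine hlim2.congr' ?_
      filter_upwards [hcast.eventually_gt_atTop |v|] with n hnv
      have hmem : ⌊((n : ℝ) + 1) * v⌋ ∈ F n := by
        have h1 := abs_lt.mp hnv
        have h2 := hn n
        simp only [F, Finset.mem_Ico]
        constructor
        · rw [Int.le_floor]
          push_cast
          nlinarith [h1.1]
        · rw [Int.floor_lt]
          push_cast
          nlinarith [h1.2]
      rcases hG1 n v with ⟨h, -⟩ | ⟨-, h⟩
      · exact h.symm
      · exact absurd hmem h

/-! ### Extension of multipliers to `L_p(M)` -/

/-- Every element of `L_p(M)` is a sum of elements of `M` with geometrically decreasing norms. -/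
theorem exists_decomposition (τ : Trace M) {p : ℝ} (hp : 0 < p) {x : Fn M} (hx : x ∈ Lp τ p) :
    ∃ y : ℕ → Elt M, (∀ j, lpNorm τ p (ofM τ (y j)) ≤ 2⁻¹ ^ j * lpNorm τ p x) ∧
      ∀ z, Tendsto (fun n => ∑ j ∈ Finset.range n, ofM τ (y j) z) atTop (𝓝 (x z)) := by
  obtain ⟨hx1, hxp⟩ := hx
  -- cut off repeatedly: `X (n + 1) = X n (1 - e_n)` is the remainder of the step `n`, the part
  -- `y_n = X n e_n` is bounded, and `X n = x c_n` for the product `c_n` of the projections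
  -- `1 - e_j`, `j < n`
  choose! e y he hey hτ hlp using fun (x' : Fn M) (hx' : lpNorm τ p x' < ∞) (n : ℕ) =>
    exists_cutoff τ hp hx' (δ := 2⁻¹ ^ n) (by positivity)
  let Z : ℕ → Fn M × Elt M := fun n => Nat.rec (x, 1)
    (fun n Y => (rightMul Y.1 (1 - e Y.1 n), Y.2 * (1 - e Y.1 n))) n
  let X : ℕ → Fn M := fun n => (Z n).1
  let c : ℕ → Elt M := fun n => (Z n).2
  have hX : ∀ n, X (n + 1) = rightMul (X n) (1 - e (X n) n) := fun n => rfl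
  have hc : ∀ n, c (n + 1) = c n * (1 - e (X n) n) := fun n => rfl
  have hXlp : ∀ n, lpNorm τ p (X n) ≤ 2⁻¹ ^ n * lpNorm τ p x ∧ lpNorm τ p (X n) < ∞ := fun n => by
    induction n with
    | zero => exact ⟨by simp [X, Z], hxp⟩
    | succ n ih =>
      have h1 := hlp (X n) ih.2 n
      rw [← hX] at h1
      refine ⟨?_, h1.trans_lt (ENNReal.mul_lt_top (by simp) ih.2)⟩
      calc _ ≤ 2⁻¹ * (2⁻¹ ^ n * lpNorm τ p x) := by
            refine h1.trans ?_
            gcongr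
            exact ih.1
        _ = _ := by rw [pow_succ]; ring
  have hproj : ∀ n, IsStarProjection (1 - e (X n) n) := fun n => (he (X n) (hXlp n).2 n).one_sub
  have hcn : ∀ n, ‖c n‖ ≤ 1 ∧ ∀ z, X n z = x (c n * z) := fun n => by
    induction n with
    | zero =>
      refine ⟨IsStarProjection.norm_le_one (IsStarProjection.one (Elt M)), fun z => ?_⟩
      change x z = x (1 * z)
      rw [one_mul]
    | succ n ih =>
      refine ⟨?_, fun z => ?_⟩
      · rw [hc]
        exact (norm_mul_le _ _).trans (mul_le_one₀ ih.1 (norm_nonneg _) (IsStarProjection.norm_le_one (hproj n)))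
      · rw [hX, rightMul_apply, ih.2, hc, mul_assoc]
  have hsplit : ∀ n z, X n z = ofM τ (y (X n) n) z + X (n + 1) z := fun n z => by
    rw [← hey (X n) (hXlp n).2 n, hX, rightMul_apply, rightMul_apply, ← map_add, ← add_mul,
      add_sub_cancel, one_mul]
  have hsum : ∀ n z, ∑ j ∈ Finset.range n, ofM τ (y (X j) j) z = x z - X n z := fun n z => by
    induction n with
    | zero => simp [X, Z]
    | succ n ih => rw [Finset.sum_range_succ, ih, hsplit n z]; ring
  -- the last factor of `c (n + 1)` has trace at most `2⁻ⁿ`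
  have hcz : Tendsto (fun n => ‖ofM τ (c n)‖) atTop (𝓝 0) := by
    rw [← tendsto_add_atTop_iff_nat 1]
    refine squeeze_zero (fun n => norm_nonneg _) (fun n => ?_)
      (tendsto_pow_atTop_nhds_zero_of_lt_one (r := (2 : ℝ)⁻¹) (by norm_num) (by norm_num))
    rw [hc]
    have h1 := norm_ofM_mul_le τ (c n) (1 - e (X n) n)
    have h2 := norm_ofM_of_nonneg_le τ (hproj n).nonneg
    have h3 := hτ (X n) (hXlp n).2 n
    have h4 := norm_nonneg (ofM τ (1 - e (X n) n))
    nlinarith [(hcn n).1]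
  refine ⟨fun j => y (X j) j, fun j => ?_, fun z => ?_⟩
  · rw [← hey (X j) (hXlp j).2 j]
    exact (lpNorm_rightMul_le τ hp _ (IsStarProjection.norm_le_one (he (X j) (hXlp j).2 j))).trans (hXlp j).1
  · simp only [hsum]
    -- `x` is a limit of elements `a` of `M` in `L₁(M)`, and `τ(a c_n z)` tends to `0`
    have h1 : Tendsto (fun n => X n z) atTop (𝓝 0) := by
      rw [Metric.tendsto_atTop]
      intro ε hε
      obtain ⟨_, ⟨a, rfl⟩, ha⟩ := Metric.mem_closure_iff.mp hx1 (ε / (2 * (‖z‖ + 1)))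
        (by positivity)
      rw [dist_eq_norm] at ha
      have h2 : Tendsto (fun n => ‖a‖ * ‖ofM τ (c n)‖ * ‖z‖) atTop (𝓝 (‖a‖ * 0 * ‖z‖)) :=
        (hcz.const_mul _).mul_const _
      rw [mul_zero, zero_mul] at h2
      obtain ⟨n₀, hn₀⟩ := (h2.eventually_lt_const (half_pos hε)).exists_forall_of_atTop
      refine ⟨n₀, fun n hn => ?_⟩
      rw [dist_zero_right, (hcn n).2]
      have h3 : x (c n * z) = (x - ofM τ a) (c n * z) + τ (a * c n * z) := by
        rw [sub_apply, ofM_apply, mul_assoc]; ring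
      have h4 : ‖(x - ofM τ a) (c n * z)‖ ≤ ‖x - ofM τ a‖ * ‖z‖ := by
        refine ((x - ofM τ a).le_opNorm _).trans ?_
        gcongr
        refine (norm_mul_le _ _).trans ?_
        have := (hcn n).1
        nlinarith [norm_nonneg z]
      have h5 : ‖x - ofM τ a‖ * ‖z‖ ≤ ε / 2 := by
        have h6 : ‖x - ofM τ a‖ * (2 * (‖z‖ + 1)) < ε := (lt_div_iff₀ (by positivity)).mp ha
        nlinarith [norm_nonneg (x - ofM τ a)]
      have h7 : ‖τ (a * c n * z)‖ ≤ ‖a‖ * ‖ofM τ (c n)‖ * ‖z‖ := by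
        refine (norm_trace_mul_le_ofM τ _ _).trans ?_
        gcongr
        exact norm_ofM_mul_le τ _ _
      rw [h3]
      refine (norm_add_le _ _).trans_lt ?_
      linarith [hn₀ n hn]
    simpa using h1.const_sub (x z)

namespace Resolution

variable {τ : Trace M} {T : ℝ → Elt M →ₗ[ℂ] Elt M} {S : L2Semigroup τ T} (R : Resolution S)

/-- `R_n z = ((T_{1/n} g(L)^*)(z^*))^*`, a regularization of the action of the transpose of `g(L)`,
with values in `M`. -/
def regTranspose (g : ℝ → ℂ) (n : ℕ) (z : Elt M) : Elt M :=
  star (S.reg (1 / ((n : ℝ) + 1)) (R.E.op (fun l => (starRingEnd ℂ) (g l)) (toL2 τ (star z))))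

theorem op_comm {f g : ℝ → ℂ} (hf : IsBdd f) (hg : IsBdd g) (ξ : L2 τ) :
    R.E.op f (R.E.op g ξ) = R.E.op g (R.E.op f ξ) := by
  have h1 : R.E.op f * R.E.op g = R.E.op g * R.E.op f := by
    rw [← R.E.op_mul hf hg, ← R.E.op_mul hg hf]
    simp only [mul_comm]
  exact congrArg (fun A : L2 τ →L[ℂ] L2 τ => A ξ) h1

theorem ofL2_regTranspose {g : ℝ → ℂ} (hg : IsBdd g) (n : ℕ) (ξ : L2 τ) (z : Elt M) :
    ofL2 τ ξ (R.regTranspose g n z) = ofL2 τ (R.E.op (heat (1 / ((n : ℝ) + 1))) (R.E.op g ξ)) z := by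
  have hn : (0 : ℝ) < 1 / ((n : ℝ) + 1) := by positivity
  rw [ofL2_apply, regTranspose, star_star, S.toL2_reg _ hn, ofL2_apply,
    R.op_comm (isBdd_heat hn) hg, ← R.op_heat _ hn]
  rw [← ContinuousLinearMap.adjoint_inner_right, ← ContinuousLinearMap.star_eq_adjoint]
  have h1 : IsSelfAdjoint (R.E.op (heat (1 / ((n : ℝ) + 1)))) := by
    rw [R.op_heat _ hn]; exact S.isSelfAdjoint _ hn
  rw [h1.star_eq, R.E.inner_op_left hg.conj]
  simp

/-- The transpose of `T_{1/n}` is a contraction of `M`. -/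
theorem norm_ofL2_regTranspose_le (hT : IsSymmetricContractionSemigroup τ T) {g : ℝ → ℂ}
    (hg : IsBdd g) (n : ℕ) (ξ : L2 τ) (z : Elt M) :
    ‖ofL2 τ ξ (R.regTranspose g n z)‖ ≤ ‖ofL2 τ (R.E.op g ξ)‖ * ‖z‖ := by
  have hn : (0 : ℝ) < 1 / ((n : ℝ) + 1) := by positivity
  have h1 : ofL2 τ ξ (R.regTranspose g n z) =
      ofL2 τ (R.E.op g ξ) (star (T (1 / ((n : ℝ) + 1)) (star z))) := by
    rw [R.ofL2_regTranspose hg, ofL2_apply, ofL2_apply, star_star, ← S.op_toL2 hn,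
      R.op_heat _ hn, ← ContinuousLinearMap.adjoint_inner_right,
      ← ContinuousLinearMap.star_eq_adjoint, (S.isSelfAdjoint _ hn).star_eq]
  rw [h1]
  refine ((ofL2 τ (R.E.op g ξ)).le_opNorm _).trans ?_
  gcongr
  rw [norm_star]
  exact (hT.contraction _ hn _).trans_eq (norm_star z)

/-- `T_{1/n}` tends strongly to the identity on `L₂(M)`. -/
theorem tendsto_ofL2_regTranspose {g : ℝ → ℂ} (hg : IsBdd g) (ξ : L2 τ) (z : Elt M) :
    Tendsto (fun n => ofL2 τ ξ (R.regTranspose g n z)) atTop (𝓝 (ofL2 τ (R.E.op g ξ) z)) := by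
  simp only [R.ofL2_regTranspose hg]
  have h1 : Tendsto (fun n : ℕ => R.E.op (heat (1 / ((n : ℝ) + 1))) (R.E.op g ξ)) atTop
      (𝓝 (R.E.op (fun _ => 1) (R.E.op g ξ))) := by
    refine R.E.tendsto_op_apply (fun n => isBdd_heat (by positivity)) (IsBdd.const 1) (C := 1)
      (fun n => ?_) ?_
    · filter_upwards [R.ae_le (R.E.op g ξ)] with l hl
      have hl0 : 0 ≤ l := R.δ_pos.le.trans hl
      rw [heat, if_pos hl0, Complex.norm_real, Real.norm_of_nonneg (Real.exp_pos _).le,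
        Real.exp_le_one_iff, Left.neg_nonpos_iff]
      positivity
    · filter_upwards [R.ae_le (R.E.op g ξ)] with l hl
      have hl0 : 0 ≤ l := R.δ_pos.le.trans hl
      simp only [heat, if_pos hl0]
      have h2 : Tendsto (fun n : ℕ => Real.exp (-(1 / ((n : ℝ) + 1) * l))) atTop
          (𝓝 (Real.exp (-(0 * l)))) :=
        (Real.continuous_exp.tendsto _).comp
          ((tendsto_one_div_add_atTop_nhds_zero_nat.mul_const l).neg)
      rw [zero_mul, neg_zero, Real.exp_zero] at h2
      exact_mod_cast (Complex.continuous_ofReal.tendsto 1).comp h2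
  rw [R.E.op_const, one_smul] at h1
  have h2 := (ofL2L τ).continuous.tendsto (R.E.op g ξ) |>.comp h1
  have h3 := ((ContinuousLinearMap.apply ℂ ℂ z).continuous.tendsto _).comp h2
  exact h3

open Classical in
/-- The extension of the multiplier `g(L)` from `L₂(M)` to functionals `x` on `M`: the weak limit of
`z ↦ x(R_n z)`, and `0` if there is none. -/
def extend (g : ℝ → ℂ) (x : Fn M) : Fn M :=
  if h : ∃ φ : Fn M, ∀ z, Tendsto (fun n => x (R.regTranspose g n z)) atTop (𝓝 (φ z))
  then h.choose else 0

theorem extend_eq {g : ℝ → ℂ} {x φ : Fn M}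
    (h : ∀ z, Tendsto (fun n => x (R.regTranspose g n z)) atTop (𝓝 (φ z))) :
    R.extend g x = φ := by
  have hex : ∃ φ : Fn M, ∀ z, Tendsto (fun n => x (R.regTranspose g n z)) atTop (𝓝 (φ z)) := ⟨φ, h⟩
  rw [extend, dif_pos hex]
  ext z
  exact tendsto_nhds_unique (hex.choose_spec z) (h z)

theorem extend_ofL2 {g : ℝ → ℂ} (hg : IsBdd g) (ξ : L2 τ) :
    R.extend g (ofL2 τ ξ) = ofL2 τ (R.E.op g ξ) :=
  R.extend_eq fun z => R.tendsto_ofL2_regTranspose hg ξ z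

/-- The extension of `g(L)` along a series in `M`, when `g(L)` is bounded in `L₁(M)` on its terms. -/
theorem exists_extend (hT : IsSymmetricContractionSemigroup τ T) {g : ℝ → ℂ} (hg : IsBdd g)
    {x : Fn M} {y : ℕ → Elt M} {b : ℕ → ℝ} (hb : Summable b)
    (hyb : ∀ j, ‖ofL2 τ (R.E.op g (toL2 τ (y j)))‖ ≤ b j)
    (hx : ∀ z, Tendsto (fun n => ∑ j ∈ Finset.range n, ofM τ (y j) z) atTop (𝓝 (x z))) :
    ∃ φ : Fn M, (∀ z, Tendsto (fun n => x (R.regTranspose g n z)) atTop (𝓝 (φ z))) ∧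
      ∀ z, Tendsto (fun n => ∑ j ∈ Finset.range n, ofL2 τ (R.E.op g (toL2 τ (y j))) z) atTop
        (𝓝 (φ z)) := by
  have hs : Summable fun j => ofL2 τ (R.E.op g (toL2 τ (y j))) := Summable.of_norm_bounded hb hyb
  have happ : ∀ z, HasSum (fun j => ofL2 τ (R.E.op g (toL2 τ (y j))) z)
      ((∑' j, ofL2 τ (R.E.op g (toL2 τ (y j)))) z) := fun z =>
    hs.hasSum.mapL (ContinuousLinearMap.apply ℂ ℂ z)
  have hbd : ∀ n j z, ‖ofM τ (y j) (R.regTranspose g n z)‖ ≤ b j * ‖z‖ := fun n j z => by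
    rw [← ofL2_toL2]
    exact (R.norm_ofL2_regTranspose_le hT hg n _ z).trans
      (mul_le_mul_of_nonneg_right (hyb j) (norm_nonneg _))
  -- the terms `x_j(R_n z)` are dominated uniformly in `n`, so that the limit in `n` may be taken
  -- termwise
  refine ⟨∑' j, ofL2 τ (R.E.op g (toL2 τ (y j))), fun z => ?_, fun z => ?_⟩
  · have h1 : ∀ n, x (R.regTranspose g n z) = ∑' j, ofM τ (y j) (R.regTranspose g n z) := fun n => by
      have h2 : Summable fun j => ofM τ (y j) (R.regTranspose g n z) :=
        Summable.of_norm_bounded (hb.mul_right ‖z‖) fun j => hbd n j z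
      exact tendsto_nhds_unique (hx _) h2.hasSum.tendsto_sum_nat
    simp only [h1]
    rw [← (happ z).tsum_eq]
    refine tendsto_tsum_of_dominated_convergence (hb.mul_right ‖z‖) (fun j => ?_)
      (Eventually.of_forall fun n j => hbd n j z)
    rw [← ofL2_toL2]
    exact R.tendsto_ofL2_regTranspose hg _ z
  · exact (happ z).tendsto_sum_nat

end Resolution

/-! ### The maximal inequality -/

theorem ofL2_smul (τ : Trace M) (c : ℂ) (ξ : L2 τ) : ofL2 τ (c • ξ) = c • ofL2 τ ξ :=
  (ofL2L τ).map_smul c ξ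

/-- The quasi-norm `𝒩` of a constant family controls its domination. -/
def ControlsSingularNumbers (τ : Trace M) (N : SeqNorm) (q : ℝ) (𝒩 : Fn M → ℝ≥0∞) : Prop :=
  ∀ x, N (fun k : ℤ => (2 : ℝ≥0∞) ^ ((k : ℝ) / q) * singularNumber τ x (2 ^ k)) ≤ 2 * 𝒩 x

namespace Resolution

variable {τ : Trace M} {T : ℝ → Elt M →ₗ[ℂ] Elt M} {S : L2Semigroup τ T} (R : Resolution S)
variable {N : SeqNorm} {p q α : ℝ} {𝒩 : Fn M → ℝ≥0∞}

/-- The constant family `L^{iu-α} ξ` is dominated by a multiple of the operator norm times the norm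
of `ξ`. Strict upper bounds `a` and `ℓ` take the place of these quantities, as the operator norm is
an infimum and the bound in `exists_dominated_const` has to be positive. -/
theorem exists_dominated_pow (hq : 1 < q) (hα : 0 < α) (h𝒩 : ControlsSingularNumbers τ N q 𝒩) :
    ∃ K : ℝ≥0, ∀ (J : Type) (u : ℝ) (ξ : L2 τ) (ℓ a : ℝ≥0), ofL2 τ ξ ∈ Lp τ p → 0 < ℓ →
      lpNorm τ p (ofL2 τ ξ) ≤ ℓ → opNorm τ p 𝒩 (IsPower τ T (Complex.I * u - α)) < a →
      Dominated τ N q (K * a * ℓ : ℝ≥0) (fun _ : J => ofL2 τ (R.E.op (R.pow α u) ξ)) := by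
  obtain ⟨C, hC⟩ := exists_dominated_const τ N hq
  refine ⟨C * 2, fun J u ξ ℓ a hξ hℓ hle ha => ?_⟩
  obtain ⟨c, hc⟩ := iInf_lt_iff.mp ha
  obtain ⟨hc1, hc2⟩ := iInf_lt_iff.mp hc
  have hca : c < a := by exact_mod_cast hc2
  obtain ⟨η, hη, hη2⟩ := hc1 ξ hξ
  rw [R.isPower_iff hα] at hη
  subst hη
  have h1 := hC J (R.E.op (R.pow α u) ξ) (2 * a * ℓ)
    (mul_pos (mul_pos two_pos (pos_of_gt hca)) hℓ) (by
      refine (h𝒩 _).trans ?_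
      push_cast
      rw [mul_assoc]
      gcongr
      refine hη2.trans ?_
      gcongr)
  convert h1 using 2
  ring

/-- The operator norms of `L^{iu-α}` are bounded below, by testing on the unit of `M`. -/
theorem exists_le_opNorm_pow (R : Resolution S) [Nontrivial (Elt M)] (hp : 0 < p)
    (hq : 1 < q) (hα : 0 < α)
    (h𝒩 : ControlsSingularNumbers τ N q 𝒩) :
    ∃ c : ℝ≥0∞, c ≠ 0 ∧ c ≠ ∞ ∧
      ∀ u : ℝ, c ≤ opNorm τ p 𝒩 (IsPower τ T (Complex.I * u - α)) := by
  obtain ⟨K, hK⟩ := R.exists_dominated_pow (p := p) hq hα h𝒩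
  obtain ⟨D, hD⟩ := exists_norm_le_of_dominated τ N q
  obtain ⟨c, hc, hcu⟩ := R.exists_le_norm_pow_one hα
  have h1 : ofL2 τ (toL2 τ 1) ∈ Lp τ p := by rw [ofL2_toL2]; exact ofM_mem_Lp τ hp 1
  have h2 : lpNorm τ p (ofL2 τ (toL2 τ 1)) ≠ ∞ := h1.2.ne
  set ℓ : ℝ≥0 := (lpNorm τ p (ofL2 τ (toL2 τ 1))).toNNReal + 1
  have hℓ : lpNorm τ p (ofL2 τ (toL2 τ 1)) ≤ ℓ := by
    rw [← ENNReal.coe_toNNReal h2, ENNReal.coe_le_coe]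
    exact le_self_add
  set B : ℝ := D * (K * ℓ)
  have hB : 0 ≤ B := by positivity
  refine ⟨ENNReal.ofReal (c / (B + 1)), by rw [ENNReal.ofReal_ne_zero_iff]; positivity,
    ENNReal.ofReal_ne_top, fun u => ?_⟩
  by_contra! hlt
  obtain ⟨a, ha1, ha2⟩ := ENNReal.lt_iff_exists_nnreal_btwn.mp hlt
  have h3 := hD _ Unit _ (hK Unit u (toL2 τ 1) ℓ a h1 (by positivity) hℓ ha1) ()
  have h4 : (a : ℝ) < c / (B + 1) := by
    rw [← ENNReal.ofReal_coe_nnreal] at ha2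
    exact (ENNReal.ofReal_lt_ofReal_iff (by positivity)).mp ha2
  rw [lt_div_iff₀ (by positivity)] at h4
  have h5 : c ≤ D * (K * a * ℓ) := by
    refine (hcu u).trans ?_
    exact_mod_cast h3
  have h6 : (D : ℝ) * (K * a * ℓ) = B * a := by simp only [B]; ring
  nlinarith [a.2]

/-- Since the operator norms are bounded below, finiteness of the weighted integral makes the Mellin
transform integrable, which is what Mellin inversion requires. -/
theorem integrable_mellin (R : Resolution S) [Nontrivial (Elt M)] (hp : 0 < p)
    (hq : 1 < q) (hα : 0 < α)
    (h𝒩 : ControlsSingularNumbers τ N q 𝒩) {w : ℝ → ℂ} (hw : Continuous w)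
    (hfin : ∫⁻ u : ℝ, ‖w u‖ₑ * opNorm τ p 𝒩 (IsPower τ T (Complex.I * u - α)) < ∞) :
    Integrable w := by
  obtain ⟨c, hc0, hc1, hc⟩ := R.exists_le_opNorm_pow (p := p) hp hq hα h𝒩
  refine ⟨hw.aestronglyMeasurable, ?_⟩
  have h1 : (∫⁻ u, ‖w u‖ₑ) * c < ∞ := by
    rw [← lintegral_mul_const _ hw.measurable.enorm]
    refine (lintegral_mono fun u => ?_).trans_lt hfin
    gcongr
    exact hc u
  by_contra h
  have h2 : ∫⁻ u, ‖w u‖ₑ = ∞ := not_lt_top_iff.mp h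
  rw [h2, ENNReal.top_mul hc0] at h1
  exact lt_irrefl _ h1

/-- The function `m(tλ)` on `[δ, ∞)`. -/
def dilate (m : ℝ → ℂ) (t : ℝ) : ℝ → ℂ := cut R.δ fun l => m (t * l)

theorem isBdd_dilate {m : ℝ → ℂ} (hm : ContinuousOn m (Ioi 0))
    (hmellin : MellinConvergent m (α : ℂ)) (hα : 0 < α)
    (hw : Integrable fun u : ℝ => mellin m ((α : ℂ) - Complex.I * u)) {t : ℝ} (ht : 0 < t) :
    IsBdd (R.dilate m t) := by
  have hpos : ∀ l, R.δ ≤ l → 0 < t * l := fun l hl => mul_pos ht (R.δ_pos.trans_le hl)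
  refine isBdd_cut (hm.comp (by fun_prop) fun l hl => hpos l hl) (fun l hl =>
    (norm_le_of_mellin_integrable hm hmellin hw (hpos l hl)).trans
      (mul_le_mul_of_nonneg_left (b := (t * l) ^ (-α)) (c := (t * R.δ) ^ (-α)) ?_ ?_))
  · exact Real.rpow_le_rpow_of_nonpos (mul_pos ht R.δ_pos) (by gcongr) (by linarith)
  · exact integral_nonneg fun u => norm_nonneg _

theorem norm_ofReal_cpow_I {t : ℝ} (ht : 0 < t) (u : ℝ) : ‖(t : ℂ) ^ (Complex.I * u)‖ = 1 := by
  rw [Complex.norm_cpow_eq_rpow_re_of_pos ht]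
  simp

/-- The quadrature of Mellin inversion: `t^α m(tL) ξ` is a limit of linear combinations of the
elements `t^{iu} L^{iu-α} ξ`. -/
theorem tendsto_quadrature {m : ℝ → ℂ} (hm : ContinuousOn m (Ioi 0))
    (hmellin : MellinConvergent m (α : ℂ)) (hα : 0 < α)
    (hw : Integrable fun u : ℝ => mellin m ((α : ℂ) - Complex.I * u))
    {F : ℕ → Finset ℤ} {c : ℕ → ℤ → ℂ} {u : ℕ → ℤ → ℝ} {W : ℝ}
    (hc : ∀ n, ∑ i ∈ F n, ‖c n i‖ ≤ W)
    (hlim : ∀ (φ : ℝ → ℂ) (C : ℝ), Continuous φ → (∀ v, ‖φ v‖ ≤ C) →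
      Tendsto (fun n => ∑ i ∈ F n, c n i * φ (u n i)) atTop
        (𝓝 (∫ v : ℝ, mellin m ((α : ℂ) - Complex.I * v) * φ v)))
    {t : ℝ} (ht : 0 < t) (ξ : L2 τ) :
    Tendsto (fun n => ∑ i ∈ F n, (((1 / (2 * Real.pi) : ℝ) : ℂ) * (c n i *
        (t : ℂ) ^ (Complex.I * u n i))) • R.E.op (R.pow α (u n i)) ξ) atTop
      (𝓝 (((t ^ α : ℝ) : ℂ) • R.E.op (R.dilate m t) ξ)) := by
  have hpi : ‖((1 / (2 * Real.pi) : ℝ) : ℂ)‖ ≤ 1 := by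
    rw [Complex.norm_real, Real.norm_of_nonneg (by positivity), div_le_one (by positivity)]
    linarith [Real.pi_gt_three]
  set κ : ℂ := ((1 / (2 * Real.pi) : ℝ) : ℂ)
  have hδ := R.δ_pos
  have hb := R.isBdd_dilate hm hmellin hα hw ht
  have h1 := fun n => R.E.isBdd_sum_and_op_sum (F n)
    (fun i => κ * (c n i * (t : ℂ) ^ (Complex.I * u n i)))
    (fun i => R.isBdd_pow hα (u n i))
  have h2 : ∀ n, ∑ i ∈ F n, (κ * (c n i * (t : ℂ) ^ (Complex.I * u n i))) •
      R.E.op (R.pow α (u n i)) ξ = R.E.op (fun l => ∑ i ∈ F n,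
        (κ * (c n i * (t : ℂ) ^ (Complex.I * u n i))) * R.pow α (u n i) l) ξ := fun n => by
    rw [(h1 n).2, sum_apply]
    rfl
  simp only [h2]
  have h3 : ((t ^ α : ℝ) : ℂ) • R.E.op (R.dilate m t) ξ =
      R.E.op (fun l => ((t ^ α : ℝ) : ℂ) * R.dilate m t l) ξ := by
    rw [R.E.op_const_mul hb]; rfl
  rw [h3]
  refine R.E.tendsto_op_apply (fun n => (h1 n).1) ((IsBdd.const _).mul hb) (C := W * R.δ ^ (-α))
    (fun n => Eventually.of_forall fun l => ?_) ?_
  · refine (norm_sum_le _ _).trans ?_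
    refine le_trans ?_ (mul_le_mul_of_nonneg_right (hc n) (Real.rpow_nonneg hδ.le _))
    rw [Finset.sum_mul]
    refine Finset.sum_le_sum fun i _ => ?_
    rw [norm_mul, norm_mul, norm_mul, norm_ofReal_cpow_I ht, mul_one]
    gcongr
    · exact mul_le_of_le_one_left (norm_nonneg _) hpi
    · exact R.norm_pow_le hα _ l
  · filter_upwards [R.ae_le ξ] with l hl
    have hl0 : 0 < l := hδ.trans_le hl
    have htC : (t : ℂ) ≠ 0 := by exact_mod_cast ht.ne'
    have hlC : (l : ℂ) ≠ 0 := by exact_mod_cast hl0.ne'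
    have h4 := (hlim (fun v => (t : ℂ) ^ (Complex.I * v) * (l : ℂ) ^ (Complex.I * v - α))
      (l ^ (-α)) ((Continuous.const_cpow (by fun_prop) (Or.inl htC)).mul
        (Continuous.const_cpow (by fun_prop) (Or.inl hlC))) (fun v => by
          rw [norm_mul, norm_ofReal_cpow_I ht, one_mul, norm_cpow_eq hl0])).const_mul κ
    -- Mellin inversion at `x = t l`, with `t^{iv} = t^α t^{iv-α}`
    have h5 : κ * ∫ v : ℝ, mellin m ((α : ℂ) - Complex.I * v) *
        ((t : ℂ) ^ (Complex.I * v) * (l : ℂ) ^ (Complex.I * v - α)) =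
        ((t ^ α : ℝ) : ℂ) * R.dilate m t l := by
      rw [dilate, cut_of_le _ hl, mellin_inversion hm hmellin hw (mul_pos ht hl0)]
      rw [mul_left_comm, ← integral_const_mul (((t ^ α : ℝ) : ℂ))]
      congr 1
      refine integral_congr_ae (Eventually.of_forall fun v => ?_)
      simp only
      rw [Complex.ofReal_mul, Complex.mul_cpow_ofReal_nonneg ht.le hl0.le,
        Complex.ofReal_cpow ht.le]
      have h6 : (t : ℂ) ^ (Complex.I * v) = (t : ℂ) ^ (α : ℂ) * (t : ℂ) ^ (Complex.I * v - α) := by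
        rw [← Complex.cpow_add _ _ htC]; congr 1; ring
      rw [h6]; ring
    rw [h5] at h4
    refine h4.congr fun n => ?_
    rw [Finset.mul_sum]
    refine Finset.sum_congr rfl fun i _ => ?_
    rw [pow, cut_of_le _ hl]
    ring

/-- The maximal inequality on `L₂(M) ∩ L_p(M)`. -/
theorem exists_dominated_dilate (R : Resolution S) [Nontrivial (Elt M)] (hp : 0 < p)
    (hq : 1 < q) (hα : 0 < α)
    (h𝒩 : ControlsSingularNumbers τ N q 𝒩) {m : ℝ → ℂ} (hm : ContinuousOn m (Ioi 0))
    (hmellin : MellinConvergent m (α : ℂ))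
    (hw : Integrable fun u : ℝ => mellin m ((α : ℂ) - Complex.I * u))
    (hfin : ∫⁻ u : ℝ, ‖mellin m ((α : ℂ) - Complex.I * u)‖ₑ *
      opNorm τ p 𝒩 (IsPower τ T (Complex.I * u - α)) < ∞) :
    ∃ B : ℝ≥0, 0 < B ∧ ∀ ξ : L2 τ, ofL2 τ ξ ∈ Lp τ p → ∀ ℓ : ℝ≥0, 0 < ℓ →
      lpNorm τ p (ofL2 τ ξ) ≤ ℓ → Dominated τ N q (B * ℓ : ℝ≥0)
        (fun t : Ioi (0 : ℝ) => ofL2 τ ((((t : ℝ) ^ α : ℝ) : ℂ) • R.E.op (R.dilate m t) ξ)) := by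
  obtain ⟨K, hK⟩ := R.exists_dominated_pow (p := p) hq hα h𝒩
  obtain ⟨c₀, hc0, -, hc0u⟩ := R.exists_le_opNorm_pow (p := p) hp hq hα h𝒩
  have hwm : Measurable fun u : ℝ => mellin m ((α : ℂ) - Complex.I * u) :=
    (continuous_mellin_line hm hmellin).measurable
  obtain ⟨F, c, u, hF1, hF2, hF3⟩ := exists_quadrature hwm hw _ hfin.ne
  set P : ℝ → ℝ≥0∞ := fun u => opNorm τ p 𝒩 (IsPower τ T (Complex.I * u - α))
  set A : ℝ≥0∞ := ∫⁻ u : ℝ, ‖mellin m ((α : ℂ) - Complex.I * u)‖ₑ * P u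
  have hpi : ‖((1 / (2 * Real.pi) : ℝ) : ℂ)‖ ≤ 1 := by
    rw [Complex.norm_real, Real.norm_of_nonneg (by positivity), div_le_one (by positivity)]
    linarith [Real.pi_gt_three]
  refine ⟨2 * K * (A.toNNReal + 1) + 1, by positivity, fun ξ hξ ℓ hℓ hle => ?_⟩
  -- each term is a constant family times scalars of modulus at most `|c n i|`: the modulus of
  -- `t^{iu}` is `1`, so that the dependence on `t` costs nothing
  have hterm : ∀ n, ∀ i ∈ F n, Dominated τ N q (2 * K * ℓ * (‖c n i‖ₑ * P (u n i)))
      (fun t : Ioi (0 : ℝ) => (((1 / (2 * Real.pi) : ℝ) : ℂ) * (c n i *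
        ((t : ℝ) : ℂ) ^ (Complex.I * u n i))) • ofL2 τ (R.E.op (R.pow α (u n i)) ξ)) :=
    fun n i hi => by
    by_cases hci : c n i = 0
    · have h0 := (Dominated.zero (τ := τ) (N := N) (q := q) (J := Ioi (0 : ℝ))).mono
        (B' := 2 * K * ℓ * (‖c n i‖ₑ * P (u n i))) zero_le
      convert h0 using 2 with t
      rw [hci, zero_mul, mul_zero]
      exact zero_smul ℂ (ofL2 τ (R.E.op (R.pow α (u n i)) ξ))
    have hPtop : P (u n i) ≠ ∞ := fun h => by
      have h1 := (Finset.single_le_sum (f := fun i => ‖c n i‖ₑ * P (u n i))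
        (fun _ _ => zero_le) hi).trans (hF1 n)
      simp only [h] at h1
      rw [ENNReal.mul_top (by simpa using hci)] at h1
      exact absurd (lt_of_le_of_lt h1 (ENNReal.add_lt_top.mpr ⟨hfin, ENNReal.one_lt_top⟩))
        (lt_irrefl _)
    have hP0 : P (u n i) ≠ 0 := fun h => hc0 (le_zero_iff.mp (h ▸ hc0u (u n i)))
    -- `P < 2 P`, as `P` is positive and finite
    have hlt : P (u n i) < (2 * (P (u n i)).toNNReal : ℝ≥0) := by
      rw [ENNReal.coe_mul, ENNReal.coe_toNNReal hPtop, ENNReal.coe_ofNat, two_mul]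
      exact ENNReal.lt_add_right hPtop hP0
    refine ((hK (Ioi (0 : ℝ)) (u n i) ξ ℓ _ hξ hℓ hle hlt).smul (norm_nonneg (c n i)) _
      fun t => ?_).mono ?_
    · rw [norm_mul, norm_mul, norm_ofReal_cpow_I t.2, mul_one]
      exact mul_le_of_le_one_left (norm_nonneg _) hpi
    · rw [ofReal_norm]
      push_cast
      rw [ENNReal.coe_toNNReal hPtop]
      exact le_of_eq (by ring)
  refine Dominated.of_tendsto (ψ := fun n (t : Ioi (0 : ℝ)) => ∑ i ∈ F n, (((1 / (2 * Real.pi) : ℝ) : ℂ) *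
    (c n i * ((t : ℝ) : ℂ) ^ (Complex.I * u n i))) • ofL2 τ (R.E.op (R.pow α (u n i)) ξ))
    (fun n => (Dominated.sum (F n) (hterm n)).mono ?_) fun t z => ?_
  · rw [← Finset.mul_sum]
    calc _ ≤ 2 * K * ℓ * (A + 1) := by gcongr; exact hF1 n
      _ = (2 * K * (A.toNNReal + 1) * ℓ : ℝ≥0) := by
        push_cast
        rw [ENNReal.coe_toNNReal hfin.ne]; ring
      _ ≤ _ := by
        rw [ENNReal.coe_le_coe]
        gcongr
        exact le_self_add
  · have h1 := R.tendsto_quadrature hm hmellin hα hw hF2 hF3 t.2 ξ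
    have h2 := (ofL2L τ).continuous.tendsto _ |>.comp h1
    have h3 := ((ContinuousLinearMap.apply ℂ ℂ z).continuous.tendsto _).comp h2
    refine h3.congr fun n => ?_
    simp only [Function.comp_apply, map_sum, map_smul, ofL2L_apply]
    rw [sum_apply]
    simp

end Resolution

namespace Resolution

variable {τ : Trace M} {T : ℝ → Elt M →ₗ[ℂ] Elt M} {S : L2Semigroup τ T} (R : Resolution S)
variable {N : SeqNorm} {p q : ℝ}

theorem extend_add_smul {g : ℝ → ℂ} {x y : Fn M} (c : ℂ)
    (hx : ∃ φ : Fn M, ∀ z, Tendsto (fun n => x (R.regTranspose g n z)) atTop (𝓝 (φ z)))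
    (hy : ∃ φ : Fn M, ∀ z, Tendsto (fun n => y (R.regTranspose g n z)) atTop (𝓝 (φ z))) :
    R.extend g (c • x + y) = c • R.extend g x + R.extend g y := by
  obtain ⟨φ, hφ⟩ := hx
  obtain ⟨ψ, hψ⟩ := hy
  rw [R.extend_eq hφ, R.extend_eq hψ]
  exact R.extend_eq fun z => ((hφ z).const_mul c).add (hψ z)

/-- A maximal inequality on `L₂(M) ∩ L_p(M)` extends to `L_p(M)`. -/
theorem dominated_extend (hT : IsSymmetricContractionSemigroup τ T) (hp : 0 < p)
    {g : ℝ → ℝ → ℂ} {a : ℝ → ℂ} (hg : ∀ t, 0 < t → IsBdd (g t)) (ha : ∀ t, 0 < t → a t ≠ 0)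
    {B : ℝ≥0}
    (hB : ∀ ξ : L2 τ, ofL2 τ ξ ∈ Lp τ p → ∀ ℓ : ℝ≥0, 0 < ℓ → lpNorm τ p (ofL2 τ ξ) ≤ ℓ →
      Dominated τ N q (B * ℓ : ℝ≥0) (fun t : Ioi (0 : ℝ) => ofL2 τ (a t • R.E.op (g t) ξ)))
    {x : Fn M} (hx : x ∈ Lp τ p) {ℓ : ℝ≥0} (hℓ : 0 < ℓ) (hle : lpNorm τ p x ≤ ℓ) :
    (∀ t, 0 < t →
      ∃ φ : Fn M, ∀ z, Tendsto (fun n => x (R.regTranspose (g t) n z)) atTop (𝓝 (φ z))) ∧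
      Dominated τ N q (2 * B * ℓ : ℝ≥0) (fun t : Ioi (0 : ℝ) => a t • R.extend (g t) x) := by
  obtain ⟨y, hy1, hy2⟩ := exists_decomposition τ hp hx
  obtain ⟨D, hD⟩ := exists_norm_le_of_dominated τ N q
  -- the terms of a decomposition of `x` are dominated with geometrically decreasing bounds, whose
  -- sum is `2 B ℓ`
  have hdom : ∀ j, Dominated τ N q (B * (2⁻¹ ^ j * ℓ) : ℝ≥0)
      (fun t : Ioi (0 : ℝ) => ofL2 τ (a t • R.E.op (g t) (toL2 τ (y j)))) := fun j => by
    refine hB _ ?_ _ (by positivity) ?_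
    · rw [ofL2_toL2]; exact ofM_mem_Lp τ hp _
    · rw [ofL2_toL2]
      refine (hy1 j).trans ?_
      push_cast
      gcongr
  have hgeom : Summable fun j : ℕ => (2 : ℝ)⁻¹ ^ j :=
    summable_geometric_of_lt_one (by norm_num) (by norm_num)
  have hex : ∀ t, 0 < t → ∃ φ : Fn M,
      (∀ z, Tendsto (fun n => x (R.regTranspose (g t) n z)) atTop (𝓝 (φ z))) ∧
      ∀ z, Tendsto (fun n => ∑ j ∈ Finset.range n, ofL2 τ (R.E.op (g t) (toL2 τ (y j))) z) atTop
        (𝓝 (φ z)) := fun t ht => by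
    refine R.exists_extend hT (hg t ht) (b := fun j => ‖a t‖⁻¹ * (D * (B * (2⁻¹ ^ j * ℓ))))
      ((((hgeom.mul_right _).mul_left _).mul_left _).mul_left _) (fun j => ?_) hy2
    have h1 := hD _ _ _ (hdom j) ⟨t, ht⟩
    simp only [ofL2_smul, norm_smul] at h1
    rw [le_inv_mul_iff₀ (norm_pos_iff.mpr (ha t ht))]
    exact_mod_cast h1
  refine ⟨fun t ht => (hex t ht).imp fun φ h => h.1, ?_⟩
  refine Dominated.of_tendsto (ψ := fun n (t : Ioi (0 : ℝ)) => ∑ j ∈ Finset.range n,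
    ofL2 τ (a t • R.E.op (g t) (toL2 τ (y j))))
    (fun n => (Dominated.sum (Finset.range n) fun j _ => hdom j).mono ?_) fun t z => ?_
  · rw [← ENNReal.ofNNReal_finsetSum, ENNReal.coe_le_coe, ← Finset.mul_sum, ← Finset.sum_mul,
      mul_comm (2 : ℝ≥0), mul_assoc]
    gcongr
    have h1 : ∑ i ∈ Finset.range n, (2 : ℝ)⁻¹ ^ i ≤ 2 := by
      have := hgeom.sum_le_tsum (Finset.range n) fun i _ => by positivity
      rwa [tsum_geometric_inv_two] at this
    exact NNReal.coe_le_coe.mp (by push_cast; exact h1)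
  · obtain ⟨φ, hφ1, hφ2⟩ := hex t t.2
    rw [R.extend_eq hφ1]
    refine ((hφ2 z).const_mul (a t)).congr fun n => ?_
    rw [sum_apply, Finset.mul_sum]
    exact Finset.sum_congr rfl fun j _ => by rw [ofL2_smul]; rfl

end Resolution

theorem supNorm_zero (τ : Trace M) (N : Fn M → ℝ≥0∞) {J : Type*} {φ : J → Fn M}
    (hφ : ∀ j, φ j = 0) : supNorm τ N φ = 0 := by
  refine le_zero_iff.mp ?_
  refine (iInf₂_le (0 : L2 τ) (0 : L2 τ)).trans ((iInf₂_le (fun _ => 0) 0).trans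
    ((iInf₂_le (fun _ => by simp) fun j => ⟨fun _ => 0, fun _ => 0, ?_, ?_, fun z => ?_⟩).trans ?_))
  · simp
  · simp
  · simp
  · rw [hφ j]
    simp

/-- The maximal theorem, for the norm `𝒩₂` on the 2-convexification and the quasi-norm `𝒩`. -/
theorem maximalBounded_of_lintegral_lt_top {τ : Trace M} {T : ℝ → Elt M →ₗ[ℂ] Elt M}
    (hT : IsSymmetricContractionSemigroup τ T) {ν : ℝ} (hν : 0 < ν) (hU : IsUltracontractive τ T ν)
    {N : SeqNorm} {p q α : ℝ} (hp : 0 < p) (hq : 1 < q) (hα : 0 < α) {𝒩 𝒩₂ : Fn M → ℝ≥0∞}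
    (h𝒩 : ControlsSingularNumbers τ N q 𝒩)
    (h𝒩₂ : ∀ (a : L2 τ) (G : Fn M) (κ : ℤ → ℝ≥0∞), SqControlled τ a G →
      (∀ k : ℤ, kFun τ (2 ^ k) G ≤ κ k) → 𝒩₂ (ofL2 τ a) ≤ (2 * lorentz N q κ) ^ (1 / 2 : ℝ))
    {m : ℝ → ℂ} (hm : ContinuousOn m (Ioi 0)) (hmellin : MellinConvergent m (α : ℂ))
    (hfin : ∫⁻ u : ℝ, ‖mellin m ((α : ℂ) - Complex.I * u)‖ₑ *
      opNorm τ p 𝒩 (IsPower τ T (Complex.I * u - α)) < ∞) :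
    MaximalBounded τ T m α p (supNorm τ 𝒩₂) := by
  obtain ⟨S⟩ := nonempty_L2Semigroup hT hν hU
  obtain ⟨R⟩ := nonempty_resolution S
  rcases subsingleton_or_nontrivial (Elt M) with hM | hM
  -- for the trivial algebra, all functionals vanish
  · have hz : ∀ x : Fn M, x = 0 := fun x => by
      ext z
      rw [Subsingleton.elim z 0, map_zero, map_zero]
    have hz2 : ∀ ξ : L2 τ, ξ = 0 := fun ξ => ofL2_injective τ ((hz _).trans (hz _).symm)
    refine ⟨fun _ _ => 0, 0, fun t ξ _ => ⟨0, ?_, ((hz _).symm)⟩, fun t c x _ y _ => (hz _).symm,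
      fun x _ => ?_⟩
    · rw [R.isMultiplier_iff_hasIntegral]
      have h1 := R.E.hasIntegral_op (IsBdd.const 0) (f := fun l => m (t * l)) (ξ := ξ) (by
        have h2 : R.E.measure ξ = 0 := by
          rw [← Measure.measure_univ_eq_zero, R.E.measure_apply MeasurableSet.univ,
            hz2 (R.E.proj univ ξ)]
          simp
        rw [h2]
        simp [EventuallyEq])
      rwa [hz2 (R.E.op _ ξ)] at h1
    · rw [supNorm_zero τ 𝒩₂ fun _ => rfl]
      exact zero_le
  · have hw := R.integrable_mellin hp hq hα h𝒩 (continuous_mellin_line hm hmellin) hfin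
    obtain ⟨B, hB0, hB⟩ := R.exists_dominated_dilate hp hq hα h𝒩 hm hmellin hw hfin
    have hg : ∀ t : ℝ, 0 < t → IsBdd (R.dilate m t) := fun t ht =>
      R.isBdd_dilate hm hmellin hα hw ht
    have ha : ∀ t : ℝ, 0 < t → ((t ^ α : ℝ) : ℂ) ≠ 0 := fun t ht => by
      exact_mod_cast (Real.rpow_pos_of_pos ht α).ne'
    have hext : ∀ x ∈ Lp τ p, ∀ t : ℝ, 0 < t → ∃ φ : Fn M,
        ∀ z, Tendsto (fun n => x (R.regTranspose (R.dilate m t) n z)) atTop (𝓝 (φ z)) :=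
      fun x hx => by
      refine (R.dominated_extend hT hp hg ha hB hx (ℓ := (lpNorm τ p x).toNNReal + 1)
        (by positivity) ?_).1
      rw [ENNReal.coe_add, ENNReal.coe_toNNReal hx.2.ne]
      exact le_self_add
    refine ⟨fun t x => (((t : ℝ) ^ α : ℝ) : ℂ) • R.extend (R.dilate m t) x, 8 * B,
      fun t ξ hξ => ?_, fun t c x hx y hy => ?_, fun x hx => ?_⟩
    · refine ⟨R.E.op (R.dilate m t) ξ, (R.isMultiplier_iff (hg t t.2)).mpr rfl, ?_⟩
      change _ • R.extend _ _ = _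
      rw [R.extend_ofL2 (hg t t.2), ofL2_smul]
    · change _ • R.extend _ _ = c • (_ • R.extend _ x) + _ • R.extend _ y
      rw [R.extend_add_smul c (hext x hx t t.2) (hext y hy t t.2), smul_add, smul_comm]
    -- the domination is stated for positive bounds `ℓ ≥ ‖x‖_p`; let `ℓ` decrease to `‖x‖_p`
    · refine ENNReal.le_of_forall_pos_le_add fun ε hε _ => ?_
      have hε' : 0 < ε / (8 * B) := by positivity
      set ℓ : ℝ≥0 := (lpNorm τ p x).toNNReal + ε / (8 * B)
      have hℓ : (ℓ : ℝ≥0∞) = lpNorm τ p x + (ε / (8 * B) : ℝ≥0) := by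
        rw [ENNReal.coe_add, ENNReal.coe_toNNReal hx.2.ne]
      have h1 := (R.dominated_extend hT hp hg ha hB hx (ℓ := ℓ) (by positivity)
        (by rw [hℓ]; exact le_self_add)).2
      refine (h1.supNorm_le hq h𝒩₂ (by positivity)).trans (le_of_eq ?_)
      have h2 : (4 : ℝ≥0∞) * (2 * B * ℓ : ℝ≥0) = (8 * B : ℝ≥0) * ℓ := by
        push_cast; ring
      rw [h2, hℓ, mul_add, ← ENNReal.coe_mul, mul_div_cancel₀ _ (by positivity)]

end

end NCUltra

theorem theorem3p6 {H : Type*} [NormedAddCommGroup H] [InnerProductSpace ℂ H] [CompleteSpace H]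
    (M : VonNeumannAlgebra H) (τ : NCUltra.Trace M)
    (T : ℝ → NCUltra.Elt M →ₗ[ℂ] NCUltra.Elt M)
    (hT : NCUltra.IsSymmetricContractionSemigroup τ T)
    (ν : ℝ) (hν : 0 < ν) (hU : NCUltra.IsUltracontractive τ T ν)
    (p q r α : ℝ) (hp : 1 < p) (hpq : p < q) (hr : 1 < r)
    (hαr : 1 - 1 / r = α / ν) (hαpq : 1 / p - 1 / q = α / ν)
    (m : ℝ → ℂ) (hm : ContinuousOn m (Set.Ioi 0)) (hmellin : MellinConvergent m (α : ℂ)) :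
    ((∫⁻ u : ℝ, ‖mellin m ((α : ℂ) - Complex.I * u)‖ₑ *
        NCUltra.strongPowerNorm τ T (Complex.I * u - α) p q) < ⊤ →
      NCUltra.MaximalBounded τ T m α p (NCUltra.strongSupNorm τ q)) ∧
    ((∫⁻ u : ℝ, ‖mellin m ((α : ℂ) - Complex.I * u)‖ₑ *
        NCUltra.weakPowerNorm τ T (Complex.I * u - α) 1 r) < ⊤ →
      NCUltra.MaximalBounded τ T m α 1 (NCUltra.weakSupNorm τ r)) := by
  have hα : 0 < α := by
    have h1 : 0 < α / ν := by
      rw [← hαr, sub_pos, div_lt_one (zero_lt_one.trans hr)]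
      exact hr
    exact (div_pos_iff_of_pos_right hν).mp h1
  have hq : 1 < q := hp.trans hpq
  exact ⟨fun h => NCUltra.maximalBounded_of_lintegral_lt_top hT hν hU (zero_lt_one.trans hp) hq hα
      (NCUltra.lq_singularNumber_le τ hq.le)
      (fun _ _ _ ha hκ => NCUltra.lpNorm_le_of_sqControlled hq.le ha hκ) hm hmellin h,
    fun h => NCUltra.maximalBounded_of_lintegral_lt_top hT hν hU one_pos hr hα
      (NCUltra.sup_singularNumber_le τ hr.le)
      (fun _ _ _ ha hκ => NCUltra.weakNorm_le_of_sqControlled hr.le ha hκ) hm hmellin h⟩
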